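/- Let $\ell\ge 1$ and let $\alpha_1,\dots,\alpha_\ell,\beta_1,\dots,\beta_\ell>0$ satisfy $\prod_m\alpha_m=\prod_m\beta_m$. Put $$\Phi(z)=\prod_{i=1}^{\ell}\begin{pmatrix}1&\alpha_i^{-1}z^{-1}\\ \alpha_i&1\end{pmatrix}\frac1{1-z^{-1}}\begin{pmatrix}1&\beta_i^{-1}z^{-1}\\ \beta_i&1\end{pmatrix}$$ (ordered product), let $\mathcal R^\circ=\{(z,w)\in(\mathbb C^*)^2:(1-z^{-1})^\ell\det(\Phi(z)-wI)=0\}$ be the spectral curve of the $(2\times\ell)$-periodic Aztec diamond, and $\mathcal R$ its compactification, obtained by adding a point $p_0$ over $z=0$ and the points $p_\infty=(\infty,1)$, $q_0=(1,0)$, $q_\infty=(1,\infty)$. Assume that $\mathcal R$ has the maximal genus $\ell-1$. Let $\sigma(z,w)=(\bar z,\bar w)$. The real part of $\mathcal R$ consists of an oval $A_0$ containing $p_0,p_\infty,q_0,q_\infty$ and of compact ovals $A_1,\dots,A_{\ell-1}\subset(\mathbb R^*)^2$. Let $A_{0,1}=\{(z,w)\in\mathcal R^\circ: z>1,\ w>1\}$,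 the arc of $A_0$ between $p_\infty$ and $q_\infty$, and let $\mathcal R_0$ be the connected component of the set of non-real points of $\mathcal R$ that contains the points with $\operatorname{Im}z<0$, $|w|>1$. Let $a=\sqrt{\alpha_1/\beta_\ell}$, and, with principal square roots, $$f(z)=\frac{\sqrt{a+\mathrm i}\,(\mathrm i-a)}{z-1}\begin{pmatrix}\mathrm i\sqrt{\alpha_1\beta_\ell}&1\end{pmatrix},\quad g(z)=\sqrt{a-\mathrm i}\begin{pmatrix}\frac{\mathrm i}{\sqrt{\alpha_1\beta_\ell}}\frac1z\\ 1\end{pmatrix},\quad \bar g(z)=\overline{g(\bar z)},\quad Q(z,w)=\frac{\operatorname{adj}(wI-\Phi(z))}{\partial_w\det(wI-\Phi(z))}.$$ For $q\in\mathcal R_0$ let $\gamma_q$ be a simple curve in $\mathcal R^\circ$ from $q$ to $\sigma(q)$, symmetric under $\sigma$, that meets the real points only in $A_{0,1}$, and define $$\mathcal Z(q)=2a\sqrt{a^2+1}+\frac1{2\pi\mathrm i}\int_{\gamma_q}f(z)Q(z,w)g(z)\,dz,\qquad \vartheta(q)=\frac1{2\pi\mathrm i}\int_{\gamma_q}f(z)Q(z,w)\bar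 g(z)\,dz$$ (the integrals do not depend on the choice of $\gamma_q$). Let $S_{\mathrm{Romb}}=\{(\mathcal Z(q),\vartheta(q)):q\in\mathcal R_0\}\subset\mathbb R^{2,2}=\mathbb C\times\mathbb C$, with quadratic form $|Z|^2-|\theta|^2$. Write $Q=uv^T$ on $\mathcal R^\circ$, where $u$ is the first column of $Q$ and $v^T$ is its first row divided by the product of the first row and the first column, and set $G=v^Tg$ and $\overline G(q)=\overline{G(\sigma(q))}$, meromorphic functions on $\mathcal R$. Then $\mathcal Z$ is injective on $\mathcal R_0$, and for every compact oval $A_i$ the following holds. (1) The limit $P_i=(\mathcal Z_i,\vartheta_i)=\lim_{\mathcal R_0\ni q\to A_i}(\mathcal Z(q),\vartheta(q))$ exists, and $\mathcal Z(\mathcal R_0)$ contains a punctured neighbourhood of $\mathcal Z_i$. (2) The cusp of $S_{\mathrm{Romb}}$ with apex $P_i$ is light-like: $P_i\in\overline{S_{\mathrm{Romb}}}\setminus S_{\mathrm{Romb}}$, and every tangent vector $(Z,\theta)$ of $S_{\mathrm{Romb}}$ at $P_i$ (every limit of rescaled secants from $P_i$) satisfies $|Z|^2=|\theta|^2$. (3)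 For every $q'\in A_i$ the direction $e=\lim_{\mathcal R_0\ni q\to q'}\frac{\mathcal Z(q)-\mathcal Z_i}{|\mathcal Z(q)-\mathcal Z_i|}$ exists. Let $r_{i,q'}=\{\mathcal Z_i+te:t>0\}$. The function $\overline G/G$ has a finite value at $q'$ (its limit there), this value satisfies $\left|\frac{\overline G(q')}{G(q')}\right|=1$, and $$\vartheta\circ\mathcal Z^{-1}(z)-\vartheta_i=\frac{\overline G(q')}{G(q')}(z-\mathcal Z_i)+O\big((z-\mathcal Z_i)^2\big)\qquad\text{as } r_{i,q'}\ni z\to\mathcal Z_i .$$ -/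

import Mathlib

open Filter Topology Complex

noncomputable section

namespace AztecGas

/-! ### The spectral curve

Throughout, `ℓ = n + 1`, and the weights `α₁, …, α_ℓ` and `β₁, …, β_ℓ` are
`α 0, …, α n` and `β 0, …, β n`. Hence `α₁` is `α 0` and `β_ℓ` is `β (Fin.last n)`. -/

/-- The symbol `φ_{2i-1}`. -/
def phiOdd (a : ℝ) (z : ℂ) : Matrix (Fin 2) (Fin 2) ℂ :=
  !![1, (a : ℂ)⁻¹ * z⁻¹; (a : ℂ), 1]

/-- The symbol `φ_{2i}`. -/
def phiEven (b : ℝ) (z : ℂ) : Matrix (Fin 2) (Fin 2) ℂ :=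
  (1 - z⁻¹)⁻¹ • !![1, (b : ℂ)⁻¹ * z⁻¹; (b : ℂ), 1]

variable {n : ℕ} (α β : Fin (n + 1) → ℝ)

/-- `Φ = φ₁ φ₂ ⋯ φ_{2ℓ}`, an ordered product. -/
def Phi (z : ℂ) : Matrix (Fin 2) (Fin 2) ℂ :=
  (List.ofFn fun i => phiOdd (α i) z * phiEven (β i) z).prod

/-- `det (w I - Φ(z))`. -/
def charDet (z w : ℂ) : ℂ :=
  (w • (1 : Matrix (Fin 2) (Fin 2) ℂ) - Phi α β z).det

/-- The spectral curve in `(ℂ*)²`. The Laurent polynomial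
`P(z, w) = (1 - z⁻¹)^ℓ det(Φ(z) - w I)` equals `-d w` with a constant `d > 0` at `z = 1`, so the
curve has no point with `z = 1`, `w ≠ 0`; away from `z = 1` it is the vanishing locus of the
determinant. The compact curve is obtained by adding the four real points
`p₀` (over `z = 0`), `p_∞ = (∞, 1)`, `q₀ = (1, 0)`, `q_∞ = (1, ∞)`. -/
def curve : Set (ℂ × ℂ) :=
  {q | q.1 ≠ 0 ∧ q.2 ≠ 0 ∧ q.1 ≠ 1 ∧ charDet α β q.1 q.2 = 0}

/-- The discriminant `(tr Φ)² - 4` of `det (w I - Φ(z)) = w² - (tr Φ(z)) w + 1`. -/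
def spectralDiscr (z : ℂ) : ℂ := (Phi α β z).trace ^ 2 - 4

/-- The meromorphic function `D` has a zero or a pole of odd order at `z`. -/
def HasOddOrderAt (D : ℂ → ℂ) (z : ℂ) : Prop :=
  ∃ k : ℤ, Odd k ∧ meromorphicOrderAt D z = (k : WithTop ℤ)

open Classical in
/-- The number of branch points, on the Riemann sphere, of the two-sheeted covering
`(z, w) ↦ z`: the points, including `z = ∞`, where the discriminant has odd order. -/
def numBranchPoints : ℕ :=
  {z : ℂ | HasOddOrderAt (spectralDiscr α β) z}.ncard +
    if HasOddOrderAt (fun x => spectralDiscr α β x⁻¹) 0 then 1 else 0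

/-- The genus of the (compact) spectral curve, a two-sheeted covering of the sphere with
`2 * genus + 2` branch points (Riemann–Hurwitz). -/
def spectralGenus : ℕ := numBranchPoints α β / 2 - 1

/-- The conjugation `σ(z, w) = (z̄, w̄)`. -/
def conjPt (q : ℂ × ℂ) : ℂ × ℂ :=
  ((starRingEnd ℂ) q.1, (starRingEnd ℂ) q.2)

/-- The real points of the spectral curve. -/
def realLocus : Set (ℂ × ℂ) := {q | q ∈ curve α β ∧ conjPt q = q}

/-- The non-real points of the spectral curve. -/
def nonrealLocus : Set (ℂ × ℂ) := {q | q ∈ curve α β ∧ conjPt q ≠ q}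

/-- A compact oval: a connected component of the real points in `(ℝ*)²` that is compact.
(The remaining oval contains the four points at infinity, which cut it into four
non-compact arcs.) -/
def IsCompactOval (A : Set (ℂ × ℂ)) : Prop :=
  IsCompact A ∧ ∃ p ∈ realLocus α β, A = connectedComponentIn (realLocus α β) p

/-- The arc `A_{0,1}` of the non-compact oval, joining `p_∞ = (∞, 1)` and `q_∞ = (1, ∞)`:
the real points with `z > 1` on the sheet `w > 1`. -/
def arcZeroOne : Set (ℂ × ℂ) :=
  {q | q ∈ realLocus α β ∧ 1 < q.1.re ∧ 1 < q.2.re}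

/-- The component `R₀` of the non-real points of the curve that lies to the left of the
non-compact oval, oriented from `q_∞` through `p₀`, `q₀`, `p_∞` back to `q_∞`. Along
`A_{0,1}` (where `z` decreases) its left side is the part of the sheet `|w| > 1` over the lower
half-plane, so `R₀` is the component containing that part of the sheet. -/
def regionZero : Set (ℂ × ℂ) :=
  {q | ∃ p ∈ nonrealLocus α β, p.1.im < 0 ∧ 1 < ‖p.2‖ ∧
    q ∈ connectedComponentIn (nonrealLocus α β) p}

/-! ### The limiting surface -/

/-- The parameter `a = √(α₁ / β_ℓ)`. -/
def aPar : ℝ := √(α 0 / β (Fin.last n))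

/-- `√(α₁ β_ℓ)`. -/
def sPar : ℝ := √(α 0 * β (Fin.last n))

/-- The row vector `f(z)`; the square root is the principal one. -/
def fVec (z : ℂ) : Fin 2 → ℂ :=
  (((aPar α β : ℂ) + I) ^ (1 / 2 : ℂ) * (I - (aPar α β : ℂ)) / (z - 1)) •
    ![I * (sPar α β : ℂ), 1]

/-- The column vector `g(z)`; the square root is the principal one. -/
def gVec (z : ℂ) : Fin 2 → ℂ :=
  (((aPar α β : ℂ) - I) ^ (1 / 2 : ℂ)) • ![I / (sPar α β : ℂ) * (1 / z), 1]

/-- `ḡ(z) = conj (g (conj z))`. -/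
def gBarVec (z : ℂ) : Fin 2 → ℂ :=
  fun j => (starRingEnd ℂ) (gVec α β ((starRingEnd ℂ) z) j)

/-- `Q(z, w) = adj(w I - Φ(z)) / ∂_w det(w I - Φ(z))`. -/
def Qmat (q : ℂ × ℂ) : Matrix (Fin 2) (Fin 2) ℂ :=
  (deriv (fun w => charDet α β q.1 w) q.2)⁻¹ •
    (q.2 • (1 : Matrix (Fin 2) (Fin 2) ℂ) - Phi α β q.1).adjugate

/-- A contour `γ_q` on the spectral curve for `q` in `R₀`: a simple curve from `q` to `σ q`,
symmetric under conjugation, that meets the real points only at `A_{0,1}`. It is `C¹` on its first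
half, hence by symmetry also on its second half. -/
structure IsContour {q : ℂ × ℂ} (γ : Path q (conjPt q)) : Prop where
  mem_curve : ∀ t, γ t ∈ curve α β
  simple : Function.Injective γ
  symmetric : ∀ t, γ (unitInterval.symm t) = conjPt (γ t)
  meets_real : ∀ t, γ t ∈ realLocus α β → γ t ∈ arcZeroOne α β
  contDiffOn : ContDiffOn ℝ 1 γ.extend (Set.Icc 0 (1 / 2))

open Classical in
/-- The integral of the `1`-form `ω dz` over a contour `γ_q`. -/
def contourIntegral (ω : ℂ × ℂ → ℂ) (q : ℂ × ℂ) : ℂ :=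
  if h : ∃ γ : Path q (conjPt q), IsContour α β γ then
    curveIntegral (fun p => ω p • ContinuousLinearMap.fst ℂ ℂ ℂ) h.choose
  else 0

/-- `𝒵(q) = 2 a √(a² + 1) + (2πi)⁻¹ ∫_{γ_q} f(z) Q(z, w) g(z) dz`. -/
def Zmap (q : ℂ × ℂ) : ℂ :=
  ((2 * aPar α β * √(aPar α β ^ 2 + 1) : ℝ) : ℂ) +
    (2 * (Real.pi : ℂ) * I)⁻¹ *
      contourIntegral α β
        (fun p => fVec α β p.1 ⬝ᵥ (Qmat α β p).mulVec (gVec α β p.1)) q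

/-- `ϑ(q) = (2πi)⁻¹ ∫_{γ_q} f(z) Q(z, w) ḡ(z) dz`. -/
def thetaMap (q : ℂ × ℂ) : ℂ :=
  (2 * (Real.pi : ℂ) * I)⁻¹ *
    contourIntegral α β
      (fun p => fVec α β p.1 ⬝ᵥ (Qmat α β p).mulVec (gBarVec α β p.1)) q

/-- The surface `S_Romb = {(𝒵(q), ϑ(q)) : q ∈ R₀}` in `ℝ^{2,2} = ℂ × ℂ`. -/
def surface : Set (ℂ × ℂ) :=
  (fun q => (Zmap α β q, thetaMap α β q)) '' regionZero α β

/-- The inverse `𝒵⁻¹ : 𝒵(R₀) → R₀`. -/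
def Zinv : ℂ → ℂ × ℂ := Function.invFunOn (Zmap α β) (regionZero α β)

/-! ### The factorization `f Q g = F G` -/

/-- The column `u`, the first column of `Q`. -/
def uVec (q : ℂ × ℂ) : Fin 2 → ℂ := fun i => Qmat α β q i 0

/-- The row `vᵀ`: the first row of `Q` divided by its product with the first column, so that
`u vᵀ = Q` on the spectral curve. -/
def vVec (q : ℂ × ℂ) : Fin 2 → ℂ :=
  (Qmat α β q 0 ⬝ᵥ uVec α β q)⁻¹ • Qmat α β q 0

/-- `G = vᵀ g`; together with `F = f u` it satisfies `F G = f Q g`. -/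
def Gfun (q : ℂ × ℂ) : ℂ := vVec α β q ⬝ᵥ gVec α β q.1

/-- `Ḡ(q) = conj (G (σ q))`. -/
def GBar (q : ℂ × ℂ) : ℂ := (starRingEnd ℂ) (Gfun α β (conjPt q))

/-- `c` is the value at `q'` of the meromorphic function `Ḡ / G` on the spectral curve. The value
is the limit at `q'`, as `Q` may have a pole, and `u` or `v` a zero or a pole, at `q'`. -/
def IsGRatioAt (q' : ℂ × ℂ) (c : ℂ) : Prop :=
  Tendsto (fun q => GBar α β q / Gfun α β q) (𝓝[curve α β \ {q'}] q') (𝓝 c)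

/-! ### Cusps in Minkowski space -/

/-- The quadratic form of `ℝ^{2,2} = ℂ × ℂ`. -/
def minkowskiSq (v : ℂ × ℂ) : ℝ := ‖v.1‖ ^ 2 - ‖v.2‖ ^ 2

/-- `S` has a light-like cusp with apex `P`: `P` is a limit point of `S` outside `S`, and every
tangent vector of `S` at `P` (limit of rescaled secants from `P`) is light-like. -/
def IsLightlikeCusp (S : Set (ℂ × ℂ)) (P : ℂ × ℂ) : Prop :=
  P ∈ closure S ∧ P ∉ S ∧ ∀ v ∈ tangentConeAt ℝ S P, minkowskiSq v = 0

/-- The open ray from `c` in direction `e`. -/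
def openRay (c e : ℂ) : Set ℂ := {z | ∃ t : ℝ, 0 < t ∧ z = c + t * e}

/-- `e` is the unit direction of the ray `r_{i,q'}` at `c = 𝒵_i`, along which `𝒵(q)` approaches
`c` as `q ∈ R₀` tends to the boundary point `q'`. -/
def IsRayDirection (q' : ℂ × ℂ) (c e : ℂ) : Prop :=
  ‖e‖ = 1 ∧
    Tendsto (fun q => (Zmap α β q - c) / (‖Zmap α β q - c‖ : ℂ))
      (𝓝[regionZero α β] q') (𝓝 e)

end AztecGas

end

open AztecGas

noncomputable section

namespace AztecGas

/-! ### The polynomial symbol -/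

open Polynomial in
/-- `z` times the product of two consecutive symbols, without the factor `(1 - z⁻¹)⁻¹`. -/
def polyFactor (p : ℝ × ℝ) : Matrix (Fin 2) (Fin 2) (Polynomial ℝ) :=
  !![X + C (p.2 / p.1), C (p.2⁻¹ + p.1⁻¹); C (p.1 + p.2) * X, X + C (p.1 / p.2)]

/-- The polynomial matrix `(z - 1)^ℓ Φ(z)`. -/
def polySymbol (L : List (ℝ × ℝ)) : Matrix (Fin 2) (Fin 2) (Polynomial ℝ) :=
  (L.map polyFactor).prod

theorem polySymbol_cons (p : ℝ × ℝ) (L : List (ℝ × ℝ)) :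
    polySymbol (p :: L) = polyFactor p * polySymbol L := by simp [polySymbol]

section PolySymbol

open Polynomial

theorem polySymbol_cons_entries (p : ℝ × ℝ) (L : List (ℝ × ℝ)) :
    polySymbol (p :: L) 0 0 = (X + C (p.2 / p.1)) * polySymbol L 0 0
      + C (p.2⁻¹ + p.1⁻¹) * polySymbol L 1 0 ∧
    polySymbol (p :: L) 0 1 = (X + C (p.2 / p.1)) * polySymbol L 0 1
      + C (p.2⁻¹ + p.1⁻¹) * polySymbol L 1 1 ∧
    polySymbol (p :: L) 1 0 = C (p.1 + p.2) * X * polySymbol L 0 0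
      + (X + C (p.1 / p.2)) * polySymbol L 1 0 ∧
    polySymbol (p :: L) 1 1 = C (p.1 + p.2) * X * polySymbol L 0 1
      + (X + C (p.1 / p.2)) * polySymbol L 1 1 := by
  simp only [polySymbol_cons, Matrix.mul_apply, Fin.sum_univ_two]
  simp [polyFactor]

theorem det_polySymbol (L : List (ℝ × ℝ)) (hL : ∀ p ∈ L, 0 < p.1 ∧ 0 < p.2) :
    (polySymbol L).det = (X - 1) ^ (2 * L.length) := by
  induction L with
  | nil => simp [polySymbol]
  | cons p L ih =>
    rw [polySymbol_cons, Matrix.det_mul, ih fun q hq => hL q (by simp [hq])]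
    have h := hL p (by simp)
    have h1 := h.1.ne'
    have h2 := h.2.ne'
    have : (polyFactor p).det = (X - 1) ^ 2 := by
      rw [polyFactor, Matrix.det_fin_two_of]
      have e1 : (X + C (p.2 / p.1)) * (X + C (p.1 / p.2)) = X ^ 2 +
          C (p.2 / p.1 + p.1 / p.2) * X + 1 := by
        have : C (p.2 / p.1) * C (p.1 / p.2) = (1 : ℝ[X]) := by
          rw [← C_mul, ← C_1]; congr 1; field_simp
        rw [C_add]; linear_combination this
      have e2 : C (p.2⁻¹ + p.1⁻¹) * (C (p.1 + p.2) * X) =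
          C (p.2 / p.1 + p.1 / p.2) * X + 2 * X := by
        rw [← mul_assoc, ← C_mul]
        have : (p.2⁻¹ + p.1⁻¹) * (p.1 + p.2) = p.2 / p.1 + p.1 / p.2 + 2 := by
          field_simp; ring
        rw [this, C_add, add_mul]; rfl
      rw [e1, e2]; ring
    rw [this, List.length_cons]; ring

theorem natDegree_polySymbol (L : List (ℝ × ℝ)) :
    (polySymbol L 0 0).natDegree ≤ L.length ∧ (polySymbol L 0 0).coeff L.length = 1 ∧
    (polySymbol L 0 1).natDegree ≤ L.length ∧ (polySymbol L 0 1).coeff L.length = 0 ∧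
    (polySymbol L 1 0).natDegree ≤ L.length ∧
    (polySymbol L 1 1).natDegree ≤ L.length ∧ (polySymbol L 1 1).coeff L.length = 1 := by
  induction L with
  | nil => simp [polySymbol]
  | cons p L ih =>
    obtain ⟨h1, h2, h3, h4, h5, h6, h7⟩ := ih
    obtain ⟨e1, e2, e3, e4⟩ := polySymbol_cons_entries p L
    rw [e1, e2, e3, e4, List.length_cons]
    have lin : ∀ (a : ℝ) (q : ℝ[X]), q.natDegree ≤ L.length →
        ((X + C a) * q).natDegree ≤ L.length + 1 := fun a q hq => by
      refine natDegree_mul_le.trans ?_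
      have := natDegree_X_add_C a
      omega
    have con : ∀ (a : ℝ) (q : ℝ[X]), q.natDegree ≤ L.length →
        (C a * q).natDegree ≤ L.length + 1 := fun a q hq => by
      refine (natDegree_C_mul_le a q).trans (by omega)
    have cX : ∀ (a : ℝ) (q : ℝ[X]), q.natDegree ≤ L.length →
        (C a * X * q).natDegree ≤ L.length + 1 := fun a q hq => by
      rw [mul_assoc]
      refine (natDegree_C_mul_le a _).trans (natDegree_mul_le.trans ?_)
      have := natDegree_X (R := ℝ)
      omega
    have z : ∀ q : ℝ[X], q.natDegree ≤ L.length → q.coeff (L.length + 1) = 0 := fun q hq =>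
      coeff_eq_zero_of_natDegree_lt (by omega)
    refine ⟨natDegree_add_le_of_degree_le (lin _ _ h1) (con _ _ h5), ?_,
      natDegree_add_le_of_degree_le (lin _ _ h3) (con _ _ h6), ?_,
      natDegree_add_le_of_degree_le (cX _ _ h1) (lin _ _ h5),
      natDegree_add_le_of_degree_le (cX _ _ h3) (lin _ _ h6), ?_⟩
    · simp [add_mul, coeff_X_mul, z _ h1, z _ h5, h2]
    · simp [add_mul, coeff_X_mul, z _ h3, z _ h6, h4]
    · simp [add_mul, mul_assoc, coeff_X_mul, z _ h6, h4, h7]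

theorem eval_zero_polySymbol (L : List (ℝ × ℝ)) :
    (polySymbol L 1 0).eval 0 = 0 ∧ (polySymbol L 0 0).eval 0 = (L.map fun p => p.2 / p.1).prod ∧
    (polySymbol L 1 1).eval 0 = (L.map fun p => p.1 / p.2).prod := by
  induction L with
  | nil => simp [polySymbol]
  | cons p L ih =>
    obtain ⟨h1, h2, h3⟩ := ih
    obtain ⟨e1, e2, e3, e4⟩ := polySymbol_cons_entries p L
    rw [e1, e3, e4]
    simp [h1, h2, h3]

theorem eval_polySymbol_pos (L : List (ℝ × ℝ)) (hL : ∀ p ∈ L, 0 < p.1 ∧ 0 < p.2) {x : ℝ}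
    (hx : 0 < x) :
    0 < (polySymbol L 0 0).eval x ∧ 0 ≤ (polySymbol L 0 1).eval x ∧
    0 ≤ (polySymbol L 1 0).eval x ∧ 0 < (polySymbol L 1 1).eval x ∧
    (L ≠ [] → 0 < (polySymbol L 0 1).eval x ∧ 0 < (polySymbol L 1 0).eval x) := by
  induction L with
  | nil => simp [polySymbol]
  | cons p L ih =>
    obtain ⟨h1, h2, h3, h4, -⟩ := ih fun q hq => hL q (by simp [hq])
    obtain ⟨e1, e2, e3, e4⟩ := polySymbol_cons_entries p L
    obtain ⟨hp, hq⟩ := hL p (by simp)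
    rw [e1, e2, e3, e4]
    simp only [eval_add, eval_mul, eval_X, eval_C, ne_eq, reduceCtorEq, not_false_eq_true,
      forall_true_left]
    refine ⟨by positivity, by positivity, by positivity, by positivity, by positivity,
      by positivity⟩

/-- The matrix `(1, κ/x; x, 1)`. -/
def coneFactor (κ : ℂ) (x : ℝ) : Matrix (Fin 2) (Fin 2) ℂ := !![1, κ / x; (x : ℂ), 1]

/-- The list `p₁, q₁, p₂, q₂, …` of a list of pairs `(pᵢ, qᵢ)`. -/
def flattenPairs (L : List (ℝ × ℝ)) : List ℝ := L.flatMap fun p => [p.1, p.2]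

theorem map_polySymbol (L : List (ℝ × ℝ)) (hL : ∀ p ∈ L, 0 < p.1 ∧ 0 < p.2) {z : ℂ}
    (hz : z ≠ 0) :
    (polySymbol L).map (aeval z) =
      z ^ L.length • ((flattenPairs L).map (coneFactor z⁻¹)).prod := by
  induction L with
  | nil => simp [polySymbol, flattenPairs, Matrix.map_one]
  | cons p L ih =>
    have ih' := ih fun q hq => hL q (by simp [hq])
    obtain ⟨hp, hq⟩ := hL p (by simp)
    have hp' : (p.1 : ℂ) ≠ 0 := by exact_mod_cast hp.ne'
    have hq' : (p.2 : ℂ) ≠ 0 := by exact_mod_cast hq.ne'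
    have key : (polyFactor p).map (aeval z) = z • (coneFactor z⁻¹ p.1 * coneFactor z⁻¹ p.2) := by
      ext i j
      fin_cases i <;> fin_cases j <;> simp [polyFactor, coneFactor] <;> field_simp <;> ring
    have hmul : (polySymbol (p :: L)).map (aeval z) =
        (polyFactor p).map (aeval z) * (polySymbol L).map (aeval z) := by
      rw [polySymbol_cons, ← AlgHom.coe_toRingHom, Matrix.map_mul]
    rw [hmul, key, ih']
    simp only [flattenPairs, List.flatMap_cons, List.map_append, List.map_cons, List.map_nil,
      List.prod_append, List.prod_cons, List.prod_nil, mul_one, List.length_cons,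
      Matrix.smul_mul, Matrix.mul_smul, smul_smul, Matrix.mul_assoc, pow_succ]

end PolySymbol

/-! ### The invariant cone -/

/-- The form `Im(u₁ ū₂)`. -/
def formA (u : Fin 2 → ℂ) : ℝ := (u 0 * (starRingEnd ℂ) (u 1)).im

/-- The form `Im(κ u₂ ū₁)`. -/
def formB (κ : ℂ) (u : Fin 2 → ℂ) : ℝ := (κ * u 1 * (starRingEnd ℂ) (u 0)).im

theorem forms_coneFactor (κ : ℂ) {x : ℝ} (hx : 0 < x) (u : Fin 2 → ℂ) :
    formA ((coneFactor κ x).mulVec u) = formA u + formB κ u + κ.im * normSq (u 1) / x ∧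
    formB κ ((coneFactor κ x).mulVec u) =
      normSq κ * formA u + formB κ u + x * κ.im * normSq (u 0) := by
  have hx' := hx.ne'
  constructor
  · simp [formA, formB, coneFactor, Matrix.mulVec, dotProduct, Fin.sum_univ_two,
      Complex.normSq_apply]
    field_simp; ring
  · simp [formA, formB, coneFactor, Matrix.mulVec, dotProduct, Fin.sum_univ_two,
      Complex.normSq_apply]
    field_simp; ring

/-- The product of the matrices `(1, κ/x; x, 1)` expands the two forms. -/
theorem forms_coneProd {κ : ℂ} (hκ : 0 < κ.im) (L : List ℝ) (hL : ∀ x ∈ L, 0 < x)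
    (hne : L ≠ []) :
    ∃ c d : ℝ, 0 < c ∧ 0 < d ∧ c + ‖κ‖ * d = (1 + ‖κ‖) ^ L.length ∧
      ∀ u : Fin 2 → ℂ, u ≠ 0 →
        0 ≤ formA ((L.map (coneFactor κ)).prod.mulVec u) - (c * formA u + d * formB κ u) ∧
        0 ≤ formB κ ((L.map (coneFactor κ)).prod.mulVec u) -
          (d * ‖κ‖ ^ 2 * formA u + c * formB κ u) ∧
        0 < (formA ((L.map (coneFactor κ)).prod.mulVec u) - (c * formA u + d * formB κ u)) +
          (formB κ ((L.map (coneFactor κ)).prod.mulVec u) -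
          (d * ‖κ‖ ^ 2 * formA u + c * formB κ u)) := by
  induction L with
  | nil => simp at hne
  | cons x L ih =>
    have hx := hL x (by simp)
    have hk : 0 < ‖κ‖ := norm_pos_iff.2 (by rintro rfl; simp at hκ)
    have hnsq : normSq κ = ‖κ‖ ^ 2 := normSq_eq_norm_sq κ
    rcases eq_or_ne L [] with rfl | hLne
    · refine ⟨1, 1, one_pos, one_pos, by simp, fun u hu => ?_⟩
      obtain ⟨hA, hB⟩ := forms_coneFactor κ hx u
      simp only [List.map_cons, List.map_nil, List.prod_cons, List.prod_nil, mul_one]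
      rw [hA, hB, hnsq]
      have h0 := normSq_nonneg (u 0)
      have h1 := normSq_nonneg (u 1)
      have p0 : 0 ≤ x * κ.im * normSq (u 0) := by positivity
      have p1 : 0 ≤ κ.im * normSq (u 1) / x := by positivity
      refine ⟨by linarith, by linarith, ?_⟩
      have : 0 < x * κ.im * normSq (u 0) + κ.im * normSq (u 1) / x := by
        by_cases h : u 0 = 0
        · have : u 1 ≠ 0 := fun h' => hu (by ext i; fin_cases i <;> simp [h, h'])
          have := normSq_pos.2 this
          positivity
        · have := normSq_pos.2 h
          positivity
      linarith
    · obtain ⟨c, d, hc, hd, hcd, H⟩ := ih (fun y hy => hL y (by simp [hy])) hLne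
      refine ⟨c + d * ‖κ‖ ^ 2, c + d, by positivity, by positivity, ?_, fun u hu => ?_⟩
      · rw [List.length_cons, pow_succ _ L.length, ← hcd]; ring
      · obtain ⟨h1, h2, h3⟩ := H u hu
        set v := (L.map (coneFactor κ)).prod.mulVec u with hv
        obtain ⟨hA, hB⟩ := forms_coneFactor κ hx v
        simp only [List.map_cons, List.prod_cons, ← Matrix.mulVec_mulVec, ← hv]
        rw [hA, hB, hnsq]
        have p0 : 0 ≤ x * κ.im * normSq (v 0) := by have := normSq_nonneg (v 0); positivity
        have p1 : 0 ≤ κ.im * normSq (v 1) / x := by have := normSq_nonneg (v 1); positivity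
        have q1 : 0 ≤ ‖κ‖ ^ 2 * (formA v - (c * formA u + d * formB κ u)) := by positivity
        refine ⟨by linarith, by linarith, ?_⟩
        linarith

/-- Sign dichotomy, first half, for eigenvectors. -/
theorem cone_eigen_aux {κ : ℂ} (hκ : 0 < κ.im) {L : List ℝ} (hL : ∀ x ∈ L, 0 < x)
    (hne : L ≠ []) {u : Fin 2 → ℂ} (hu : u ≠ 0) {ν : ℂ}
    (h : (L.map (coneFactor κ)).prod.mulVec u = ν • u) :
    (0 ≤ formA u → 0 ≤ formB κ u → 0 < formA u ∧ 0 < formB κ u ∧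
      (1 + ‖κ‖) ^ L.length < ‖ν‖ ^ 2) ∧
    (0 < formA u → formB κ u < 0 → ‖κ‖ * formA u + formB κ u < 0) ∧
    (formA u < 0 → 0 < formB κ u → ‖κ‖ * formA u + formB κ u < 0) := by
  obtain ⟨c, d, hc, hd, hcd, H⟩ := forms_coneProd hκ L hL hne
  obtain ⟨h1, h2, h3⟩ := H u hu
  have hk : 0 < ‖κ‖ := norm_pos_iff.2 (by rintro rfl; simp at hκ)
  have eA : formA (ν • u) = ‖ν‖ ^ 2 * formA u := by
    rw [← normSq_eq_norm_sq]; simp [formA, normSq_apply]; ring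
  have eB : formB κ (ν • u) = ‖ν‖ ^ 2 * formB κ u := by
    rw [← normSq_eq_norm_sq]; simp [formB, normSq_apply]; ring
  rw [h] at h1 h2 h3
  rw [eA] at h1 h3
  rw [eB] at h2 h3
  set A := formA u
  set B := formB κ u
  set N := ‖ν‖ ^ 2
  have hJ : 0 < (N - (c + ‖κ‖ * d)) * (‖κ‖ * A + B) := by
    rcases eq_or_lt_of_le h1 with h1' | h1'
    · nlinarith
    · have := mul_pos hk h1'
      nlinarith
  refine ⟨fun hA hB => ?_, fun hA hB => ?_, fun hA hB => ?_⟩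
  · have hN : 0 < N - (c + ‖κ‖ * d) :=
      pos_of_mul_pos_left hJ (by positivity)
    have hJ' : 0 < ‖κ‖ * A + B := pos_of_mul_pos_right hJ hN.le
    have hNc : 0 < N - c := by nlinarith
    have hApos : 0 < A := by
      rcases hA.eq_or_lt with h0 | h0
      · rw [← h0] at h1 hJ'
        nlinarith
      · exact h0
    refine ⟨hApos, ?_, by rw [← hcd]; linarith⟩
    rcases hB.eq_or_lt with h0 | h0
    · rw [← h0] at h2
      have : 0 < d * ‖κ‖ ^ 2 * A := by positivity
      nlinarith
    · exact h0
  · have hs : N - c < 0 := by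
      by_contra hs
      push Not at hs
      have : 0 < d * ‖κ‖ ^ 2 * A := by positivity
      nlinarith
    have : N - (c + ‖κ‖ * d) < 0 := by nlinarith
    by_contra hJ'
    push Not at hJ'
    nlinarith
  · have hs : N - c < 0 := by
      by_contra hs
      push Not at hs
      nlinarith [mul_pos hd hB]
    have : N - (c + ‖κ‖ * d) < 0 := by nlinarith
    by_contra hJ'
    push Not at hJ'
    nlinarith

theorem coneFactor_conj_mul (κ : ℂ) {x : ℝ} (hx : 0 < x) (u : Fin 2 → ℂ) :
    (coneFactor κ x).mulVec ![((coneFactor κ x).mulVec u) 0, -((coneFactor κ x).mulVec u) 1] =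
      (1 - κ) • ![u 0, -u 1] := by
  have : (x : ℂ) ≠ 0 := by exact_mod_cast hx.ne'
  ext i
  fin_cases i <;> simp [coneFactor, Matrix.mulVec, dotProduct, Fin.sum_univ_two] <;>
    field_simp <;> ring

theorem coneProd_reverse (κ : ℂ) (L : List ℝ) (hL : ∀ x ∈ L, 0 < x) (u : Fin 2 → ℂ) :
    (L.reverse.map (coneFactor κ)).prod.mulVec
      ![((L.map (coneFactor κ)).prod.mulVec u) 0, -((L.map (coneFactor κ)).prod.mulVec u) 1] =
      (1 - κ) ^ L.length • ![u 0, -u 1] := by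
  induction L generalizing u with
  | nil => simp
  | cons x L ih =>
    have hx := hL x (by simp)
    simp only [List.map_cons, List.prod_cons, List.reverse_cons, List.map_append,
      List.prod_append, List.map_nil, List.prod_nil, mul_one, ← Matrix.mulVec_mulVec]
    rw [coneFactor_conj_mul κ hx, Matrix.mulVec_smul, ih (fun y hy => hL y (by simp [hy])),
      smul_smul, List.length_cons, pow_succ']

/-- Sign dichotomy for the eigenvectors of the symbol over the half-plane `Im κ > 0`. -/
theorem cone_eigen {κ : ℂ} (hκ : 0 < κ.im) {L : List ℝ} (hL : ∀ x ∈ L, 0 < x)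
    (hne : L ≠ []) {u : Fin 2 → ℂ} (hu : u ≠ 0) {ν : ℂ}
    (h : (L.map (coneFactor κ)).prod.mulVec u = ν • u) :
    (0 < formA u ∧ ‖1 - κ‖ ^ L.length < ‖ν‖ ^ 2) ∨
    (formA u < 0 ∧ ‖ν‖ ^ 2 < ‖1 - κ‖ ^ L.length) := by
  have hk : 0 < ‖κ‖ := norm_pos_iff.2 (by rintro rfl; simp at hκ)
  have h1κ : (1 - κ) ≠ 0 := by
    intro h0
    have := congrArg Complex.im h0
    simp at this
    exact hκ.ne' this
  have hle : ‖1 - κ‖ ^ L.length ≤ (1 + ‖κ‖) ^ L.length := by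
    gcongr
    simpa using norm_sub_le (1 : ℂ) κ
  have hν : ν ≠ 0 := by
    rintro rfl
    rw [zero_smul] at h
    have := coneProd_reverse κ L hL u
    rw [h] at this
    have h0 : (![(0 : Fin 2 → ℂ) 0, -(0 : Fin 2 → ℂ) 1]) = 0 := by
      ext i; fin_cases i <;> simp
    rw [h0, Matrix.mulVec_zero] at this
    have h2 := (smul_eq_zero.1 this.symm).resolve_left (pow_ne_zero _ h1κ)
    apply hu
    ext i
    fin_cases i
    · simpa using congrFun h2 0
    · simpa using congrFun h2 1
  set u' : Fin 2 → ℂ := ![u 0, -u 1] with hu'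
  have hu'0 : u' ≠ 0 := by
    intro h2
    apply hu
    ext i
    fin_cases i
    · simpa [hu'] using congrFun h2 0
    · simpa [hu'] using congrFun h2 1
  have hrev : (L.reverse.map (coneFactor κ)).prod.mulVec u' =
      ((1 - κ) ^ L.length / ν) • u' := by
    have := coneProd_reverse κ L hL u
    rw [h] at this
    have e : ![(ν • u) 0, -(ν • u) 1] = ν • u' := by
      ext i; fin_cases i <;> simp [hu']
    rw [e, Matrix.mulVec_smul] at this
    rw [div_eq_inv_mul, ← smul_smul, ← this, smul_smul, inv_mul_cancel₀ hν, one_smul]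
  have hL' : ∀ x ∈ L.reverse, 0 < x := fun x hx => hL x (by simpa using hx)
  have hne' : L.reverse ≠ [] := by simpa using hne
  obtain ⟨a1, a2, a3⟩ := cone_eigen_aux hκ hL hne hu h
  obtain ⟨b1, b2, b3⟩ := cone_eigen_aux hκ hL' hne' hu'0 hrev
  have fA : formA u' = -formA u := by simp [formA, hu']
  have fB : formB κ u' = -formB κ u := by simp [formB, hu']
  rw [fA, fB, List.length_reverse] at b1
  rw [fA, fB] at b2 b3
  rcases le_or_gt 0 (formA u) with hA | hA
  · rcases le_or_gt 0 (formB κ u) with hB | hB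
    · obtain ⟨p, -, q⟩ := a1 hA hB
      exact Or.inl ⟨p, hle.trans_lt q⟩
    · rcases hA.eq_or_lt with h0 | h0
      · have := b1 (by linarith) (by linarith)
        linarith [this.1]
      · have := a2 h0 hB
        have := b3 (by linarith) (by linarith)
        linarith
  · rcases lt_or_ge 0 (formB κ u) with hB | hB
    · have := a3 hA hB
      have := b2 (by linarith) (by linarith)
      linarith
    · obtain ⟨p, -, q⟩ := b1 (by linarith) (by linarith)
      refine Or.inr ⟨hA, ?_⟩
      rw [norm_div, norm_pow, div_pow] at q
      have hpos : 0 < ‖ν‖ ^ 2 := by positivity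
      rw [lt_div_iff₀ hpos] at q
      have hp : 0 < ‖1 - κ‖ ^ L.length := by positivity
      nlinarith

/-- A left eigenvector `v` of the symbol gives the eigenvector `(κ v₁, v₂)` of the symbol with
reversed and inverted weights. -/
theorem coneProd_transpose (κ : ℂ) (L : List ℝ) (hL : ∀ x ∈ L, 0 < x) (v : Fin 2 → ℂ) :
    ((L.map (·⁻¹)).reverse.map (coneFactor κ)).prod.mulVec ![κ * v 0, v 1] =
      ![κ * (Matrix.vecMul v (L.map (coneFactor κ)).prod) 0,
        (Matrix.vecMul v (L.map (coneFactor κ)).prod) 1] := by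
  induction L generalizing v with
  | nil => simp
  | cons x L ih =>
    have hx : (x : ℂ) ≠ 0 := by exact_mod_cast (hL x (by simp)).ne'
    simp only [List.map_cons, List.prod_cons, List.reverse_cons, List.map_append,
      List.prod_append, List.map_nil, List.prod_nil, mul_one, ← Matrix.mulVec_mulVec,
      ← Matrix.vecMul_vecMul]
    rw [← ih (fun y hy => hL y (by simp [hy]))]
    congr 1
    ext i
    fin_cases i <;> simp [coneFactor, Matrix.mulVec, Matrix.vecMul, dotProduct,
      Fin.sum_univ_two] <;> field_simp

/-! ### The discriminant polynomial -/

/-- The list of pairs of weights. -/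
def weightList {n : ℕ} (α β : Fin (n + 1) → ℝ) : List (ℝ × ℝ) := List.ofFn fun i => (α i, β i)

theorem length_weightList {n : ℕ} (α β : Fin (n + 1) → ℝ) : (weightList α β).length = n + 1 := by
  simp [weightList]

theorem weightList_pos {n : ℕ} {α β : Fin (n + 1) → ℝ} (hα : ∀ i, 0 < α i) (hβ : ∀ i, 0 < β i) :
    ∀ p ∈ weightList α β, 0 < p.1 ∧ 0 < p.2 := by
  intro p hp
  obtain ⟨i, rfl⟩ := List.mem_ofFn.1 hp
  exact ⟨hα i, hβ i⟩

theorem weightList_ne_nil {n : ℕ} (α β : Fin (n + 1) → ℝ) : weightList α β ≠ [] := by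
  intro h
  have := length_weightList α β
  simp [h] at this

theorem Phi_eq_coneProd {n : ℕ} (α β : Fin (n + 1) → ℝ) (z : ℂ) :
    Phi α β z = ((1 - z⁻¹)⁻¹) ^ (n + 1) •
      ((flattenPairs (weightList α β)).map (coneFactor z⁻¹)).prod := by
  have aux : ∀ L : List (ℝ × ℝ),
      (L.map fun p => phiOdd p.1 z * phiEven p.2 z).prod =
      ((1 - z⁻¹)⁻¹) ^ L.length • ((flattenPairs L).map (coneFactor z⁻¹)).prod := by
    intro L
    induction L with
    | nil => simp [flattenPairs]
    | cons p L ih =>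
      have e1 : phiOdd p.1 z = coneFactor z⁻¹ p.1 := by
        simp only [phiOdd, coneFactor, div_eq_mul_inv, mul_comm]
      have e2 : phiEven p.2 z = (1 - z⁻¹)⁻¹ • coneFactor z⁻¹ p.2 := by
        simp only [phiEven, coneFactor, div_eq_mul_inv, mul_comm]
      rw [List.map_cons, List.prod_cons, ih, e1, e2]
      simp only [flattenPairs, List.flatMap_cons, List.map_append, List.map_cons, List.map_nil,
        List.prod_append, List.prod_cons, List.prod_nil, mul_one, List.length_cons,
        Matrix.smul_mul, Matrix.mul_smul, smul_smul, Matrix.mul_assoc, pow_succ]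
  have := aux (weightList α β)
  rw [length_weightList] at this
  rw [← this, Phi, weightList, List.map_ofFn]
  rfl

theorem Phi_eq_polySymbol {n : ℕ} {α β : Fin (n + 1) → ℝ} (hα : ∀ i, 0 < α i) (hβ : ∀ i, 0 < β i)
    {z : ℂ} (hz : z ≠ 0) :
    Phi α β z = ((z - 1) ^ (n + 1))⁻¹ •
      (polySymbol (weightList α β)).map (Polynomial.aeval z) := by
  rw [Phi_eq_coneProd, map_polySymbol _ (weightList_pos hα hβ) hz, smul_smul, length_weightList]
  congr 1
  have : (1 - z⁻¹) = (z - 1) * z⁻¹ := by field_simp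
  rw [this, ← inv_pow, ← mul_pow]
  congr 1
  rw [mul_inv, inv_inv]

open Polynomial in
/-- The polynomial `(z - 1)^{2ℓ} ((tr Φ)² - 4)`. -/
def discPoly (L : List (ℝ × ℝ)) : Polynomial ℝ :=
  (polySymbol L 0 0 - polySymbol L 1 1) ^ 2 + 4 * (polySymbol L 0 1 * polySymbol L 1 0)

section

open Polynomial

theorem discPoly_eq (L : List (ℝ × ℝ)) (hL : ∀ p ∈ L, 0 < p.1 ∧ 0 < p.2) :
    discPoly L = (polySymbol L 0 0 + polySymbol L 1 1) ^ 2 - 4 * (X - 1) ^ (2 * L.length) := by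
  rw [discPoly, ← det_polySymbol L hL, Matrix.det_fin_two]; ring

theorem natDegree_discPoly_le (L : List (ℝ × ℝ)) (hne : L ≠ []) :
    (discPoly L).natDegree ≤ 2 * L.length - 1 := by
  obtain ⟨h1, h2, h3, h4, h5, h6, h7⟩ := natDegree_polySymbol L
  have hpos : 0 < L.length := List.length_pos_of_ne_nil hne
  have low : ∀ q : ℝ[X], q.natDegree ≤ L.length → q.coeff L.length = 0 →
      q.natDegree ≤ L.length - 1 := by
    intro q hq h0
    refine natDegree_le_iff_coeff_eq_zero.2 fun N hN => ?_
    rcases (show L.length ≤ N by omega).eq_or_lt with rfl | h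
    · exact h0
    · exact coeff_eq_zero_of_natDegree_lt (by omega)
  have a1 := low (polySymbol L 0 0 - polySymbol L 1 1)
    ((natDegree_sub_le_of_le h1 h6).trans (max_self _).le) (by rw [coeff_sub, h2, h7]; simp)
  have a2 := low _ h3 h4
  rw [discPoly]
  refine natDegree_add_le_of_degree_le ?_ ?_
  · refine natDegree_pow_le.trans ?_; omega
  · have : (4 : ℝ[X]) = C 4 := rfl
    rw [this]
    refine (natDegree_C_mul_le _ _).trans (natDegree_mul_le.trans ?_)
    omega

theorem discPoly_pos (L : List (ℝ × ℝ)) (hL : ∀ p ∈ L, 0 < p.1 ∧ 0 < p.2) (hne : L ≠ [])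
    {x : ℝ} (hx : 0 < x) : 0 < (discPoly L).eval x := by
  obtain ⟨-, -, -, -, h⟩ := eval_polySymbol_pos L hL hx
  obtain ⟨h1, h2⟩ := h hne
  simp only [discPoly, eval_add, eval_pow, eval_sub, eval_mul]
  have : eval x (4 : ℝ[X]) = 4 := by simp
  rw [this]
  positivity

theorem discPoly_zero {n : ℕ} {α β : Fin (n + 1) → ℝ} (hβ : ∀ i, 0 < β i)
    (hprod : ∏ i, α i = ∏ i, β i) :
    (polySymbol (weightList α β) 0 0).eval 0 = 1 ∧ (polySymbol (weightList α β) 1 1).eval 0 = 1 ∧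
    (discPoly (weightList α β)).eval 0 = 0 := by
  obtain ⟨h1, h2, h3⟩ := eval_zero_polySymbol (weightList α β)
  have hb : ∏ i, β i ≠ 0 := Finset.prod_ne_zero_iff.2 fun i _ => (hβ i).ne'
  have e2 : ((weightList α β).map fun p => p.2 / p.1).prod = 1 := by
    rw [weightList, List.map_ofFn, List.prod_ofFn]
    simp [Finset.prod_div_distrib, hprod, hb]
  have e3 : ((weightList α β).map fun p => p.1 / p.2).prod = 1 := by
    rw [weightList, List.map_ofFn, List.prod_ofFn]
    simp [Finset.prod_div_distrib, hprod, hb]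
  refine ⟨by rw [h2, e2], by rw [h3, e3], ?_⟩
  simp [discPoly, h1, h2, h3, e2, e3]

theorem trace_Phi {n : ℕ} {α β : Fin (n + 1) → ℝ} (hα : ∀ i, 0 < α i) (hβ : ∀ i, 0 < β i)
    {z : ℂ} (hz : z ≠ 0) :
    (Phi α β z).trace = ((z - 1) ^ (n + 1))⁻¹ *
      aeval z (polySymbol (weightList α β) 0 0 + polySymbol (weightList α β) 1 1) := by
  rw [Phi_eq_polySymbol hα hβ hz, Matrix.trace_smul, Matrix.trace_fin_two]
  simp

theorem spectralDiscr_eq {n : ℕ} {α β : Fin (n + 1) → ℝ} (hα : ∀ i, 0 < α i) (hβ : ∀ i, 0 < β i)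
    {z : ℂ} (hz : z ≠ 0) (hz1 : z ≠ 1) :
    spectralDiscr α β z =
      aeval z (discPoly (weightList α β)) * (((z - 1) ^ (n + 1))⁻¹) ^ 2 := by
  have h1 : z - 1 ≠ 0 := sub_ne_zero.2 hz1
  rw [spectralDiscr, trace_Phi hα hβ hz, discPoly_eq _ (weightList_pos hα hβ), length_weightList]
  simp only [map_add, map_sub, map_mul, map_pow, aeval_X, map_one]
  have : aeval z (4 : ℝ[X]) = 4 := map_ofNat _ 4
  rw [this]
  field_simp
  ring

theorem hasOddOrderAt_imp {n : ℕ} {α β : Fin (n + 1) → ℝ} (hα : ∀ i, 0 < α i)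
    (hβ : ∀ i, 0 < β i) {z : ℂ} (h : HasOddOrderAt (spectralDiscr α β) z) :
    aeval z (discPoly (weightList α β)) = 0 := by
  by_contra hne
  obtain ⟨k, hk, hord⟩ := h
  set P := fun z : ℂ => aeval z (discPoly (weightList α β)) with hP
  have hPan : AnalyticAt ℂ P z := by
    have : P = fun z : ℂ => ((discPoly (weightList α β)).map (algebraMap ℝ ℂ)).eval z := by
      ext w; simp [hP, aeval_def, eval_map]
    rw [this]
    exact (Polynomial.differentiable _).analyticAt z
  set g := fun z : ℂ => ((z - 1) ^ (n + 1))⁻¹ with hg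
  have hgm : MeromorphicAt g z := by
    have : AnalyticAt ℂ (fun z : ℂ => (z - 1) ^ (n + 1)) z := by fun_prop
    exact this.meromorphicAt.inv
  have hev : spectralDiscr α β =ᶠ[𝓝[≠] z] P * g ^ 2 := by
    have h0 : ∀ᶠ y in 𝓝[≠] z, y ≠ 0 := by
      rcases eq_or_ne z 0 with rfl | hz
      · exact eventually_mem_nhdsWithin
      · exact eventually_nhdsWithin_of_eventually_nhds (isOpen_ne.mem_nhds hz)
    have h1 : ∀ᶠ y in 𝓝[≠] z, y ≠ 1 := by
      rcases eq_or_ne z 1 with rfl | hz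
      · exact eventually_mem_nhdsWithin
      · exact eventually_nhdsWithin_of_eventually_nhds (isOpen_ne.mem_nhds hz)
    filter_upwards [h0, h1] with y hy0 hy1
    exact spectralDiscr_eq hα hβ hy0 hy1
  rw [meromorphicOrderAt_congr hev, meromorphicOrderAt_mul hPan.meromorphicAt (hgm.pow 2),
    meromorphicOrderAt_pow hgm, hPan.meromorphicOrderAt_eq,
    (hPan.analyticOrderAt_eq_zero).2 hne] at hord
  obtain ⟨m, hm⟩ := hk
  by_cases hx : meromorphicOrderAt g z = ⊤
  · rw [hx] at hord
    revert hord
    simp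
  · lift meromorphicOrderAt g z to ℤ using hx with j
    have hord' : ((2 * j : ℤ) : WithTop ℤ) = ((k : ℤ) : WithTop ℤ) := by
      rw [← hord]
      simp
    have := WithTop.coe_injective hord'
    omega

/-- Maximal genus forces the discriminant polynomial to have full degree and simple roots. -/
theorem discPoly_of_genus {n : ℕ} {α β : Fin (n + 1) → ℝ} (hα : ∀ i, 0 < α i)
    (hβ : ∀ i, 0 < β i) (hprod : ∏ i, α i = ∏ i, β i) (hgenus : spectralGenus α β = n) :
    (discPoly (weightList α β)).natDegree = 2 * n + 1 ∧
    ∀ x : ℝ, (discPoly (weightList α β)).eval x = 0 →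
      (derivative (discPoly (weightList α β))).eval x ≠ 0 := by
  set P := discPoly (weightList α β) with hPdef
  have hpos : ∀ x : ℝ, 0 < x → 0 < P.eval x := fun x hx =>
    discPoly_pos _ (weightList_pos hα hβ) (weightList_ne_nil α β) hx
  have hP0 : P.eval 0 = 0 := (discPoly_zero hβ hprod).2.2
  have hPne : P ≠ 0 := by
    intro h
    have := hpos 1 one_pos
    simp [h] at this
  have hdeg : P.natDegree ≤ 2 * n + 1 := by
    have := natDegree_discPoly_le (weightList α β) (weightList_ne_nil α β)
    rw [length_weightList, ← hPdef] at this
    omega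
  have key : P.natDegree = 2 * n + 1 ∧ (P.map (algebraMap ℝ ℂ)).roots.Nodup := by
    set Q := P.map (algebraMap ℝ ℂ) with hQ
    have hQne : Q ≠ 0 := (Polynomial.map_ne_zero_iff (algebraMap ℝ ℂ).injective).2 hPne
    have hQdeg : Q.natDegree = P.natDegree := natDegree_map _
    have hcard : Q.roots.toFinset.card ≤ Multiset.card Q.roots := Multiset.toFinset_card_le _
    have hcard2 : Multiset.card Q.roots ≤ Q.natDegree := card_roots' _
    have hfull : 2 * n + 1 ≤ Q.roots.toFinset.card := by
      rcases Nat.eq_zero_or_pos n with hn | hn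
      · have : (0 : ℂ) ∈ Q.roots.toFinset := by
          rw [Multiset.mem_toFinset, mem_roots hQne, IsRoot.def, hQ, eval_map]
          have := congrArg (algebraMap ℝ ℂ) hP0
          rw [← eval₂_at_apply, map_zero] at this
          exact this
        have := Finset.card_pos.2 ⟨_, this⟩
        omega
      · have hsub : {z : ℂ | HasOddOrderAt (spectralDiscr α β) z} ⊆ (Q.roots.toFinset : Set ℂ) := by
          intro z hz
          have := hasOddOrderAt_imp hα hβ hz
          rw [Finset.mem_coe, Multiset.mem_toFinset, mem_roots hQne, IsRoot.def, hQ, eval_map]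
          exact this
        have h1 := Set.ncard_le_ncard hsub (Finset.finite_toSet _)
        rw [Set.ncard_coe_finset] at h1
        have h2 : numBranchPoints α β ≤ Q.roots.toFinset.card + 1 := by
          unfold numBranchPoints
          split_ifs <;> omega
        unfold spectralGenus at hgenus
        omega
    refine ⟨by omega, ?_⟩
    have : Q.roots.toFinset.card = Multiset.card Q.roots := by omega
    exact Multiset.toFinset_card_eq_card_iff_nodup.1 this
  refine ⟨key.1, fun x hx hx' => ?_⟩
  have hQne : P.map (algebraMap ℝ ℂ) ≠ 0 :=
    (Polynomial.map_ne_zero_iff (algebraMap ℝ ℂ).injective).2 hPne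
  have hr := (one_lt_rootMultiplicity_iff_isRoot (t := (x : ℂ)) hQne).2 ⟨by
      have := congrArg (algebraMap ℝ ℂ) hx
      simpa [IsRoot.def, eval_map, eval₂_at_apply] using
        (eval₂_at_apply (algebraMap ℝ ℂ) (p := P) x).trans this, by
      have := congrArg (algebraMap ℝ ℂ) hx'
      simpa [IsRoot.def, derivative_map, eval_map] using
        (eval₂_at_apply (algebraMap ℝ ℂ) (p := derivative P) x).trans this⟩
  rw [← count_roots] at hr
  have := Multiset.nodup_iff_count_le_one.1 key.2 (x : ℂ)
  omega

end

end AztecGas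

end

noncomputable section

namespace AztecGas

open Polynomial

/-! ### The sheet of the spectral curve over the slit plane -/

/-- The complex plane cut along the real points where `R ≥ 0`. -/
def slitDomain (R : ℝ[X]) : Set ℂ := {z | z.im ≠ 0 ∨ R.eval z.re < 0}

theorem isOpen_slitDomain (R : ℝ[X]) : IsOpen (slitDomain R) := by
  have h1 : IsOpen {z : ℂ | z.im ≠ 0} := isOpen_ne.preimage Complex.continuous_im
  have h2 : IsOpen {z : ℂ | R.eval z.re < 0} :=
    isOpen_lt (R.continuous.comp Complex.continuous_re) continuous_const
  exact h1.union h2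

theorem conj_mem_slitDomain {R : ℝ[X]} {z : ℂ} (hz : z ∈ slitDomain R) :
    (starRingEnd ℂ) z ∈ slitDomain R := by
  simpa [slitDomain] using hz

theorem aeval_conj_eq (p : ℝ[X]) (z : ℂ) :
    aeval ((starRingEnd ℂ) z) p = (starRingEnd ℂ) (aeval z p) := aeval_conj p z

theorem aeval_ofReal_eq (p : ℝ[X]) (x : ℝ) : aeval (x : ℂ) p = (p.eval x : ℝ) :=
  aeval_algebraMap_apply_eq_algebraMap_eval x p

theorem aeval_analyticAt (p : ℝ[X]) (z : ℂ) : AnalyticAt ℂ (fun z : ℂ => aeval z p) z := by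
  have : (fun z : ℂ => aeval z p) = fun z : ℂ => (p.map (algebraMap ℝ ℂ)).eval z := by
    ext w; simp [aeval_def, eval_map]
  rw [this]
  exact (Polynomial.differentiable _).analyticAt z

theorem aeval_differentiable (p : ℝ[X]) : Differentiable ℂ (fun z : ℂ => aeval z p) :=
  fun z => (aeval_analyticAt p z).differentiableAt

theorem aeval_continuous (p : ℝ[X]) : Continuous (fun z : ℂ => aeval z p) :=
  (aeval_differentiable p).continuous

/-- The polynomial `(p₂₂ - p₁₁) / (2z)`. -/
def diagPoly (L : List (ℝ × ℝ)) : ℝ[X] := divX (C (1 / 2) * (polySymbol L 1 1 - polySymbol L 0 0))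

/-- The polynomial `p₂₁ / z`. -/
def lowPoly (L : List (ℝ × ℝ)) : ℝ[X] := divX (polySymbol L 1 0)

section Polys

variable {n : ℕ} {α β : Fin (n + 1) → ℝ}

theorem lowPoly_mul_X (L : List (ℝ × ℝ)) : X * lowPoly L = polySymbol L 1 0 := by
  have h := X_mul_divX_add (polySymbol L 1 0)
  rw [coeff_zero_eq_eval_zero, (eval_zero_polySymbol L).1] at h
  simpa [lowPoly] using h

theorem diagPoly_mul_X (hβ : ∀ i, 0 < β i) (hprod : ∏ i, α i = ∏ i, β i) :
    X * diagPoly (weightList α β) =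
      C (1 / 2) * (polySymbol (weightList α β) 1 1 - polySymbol (weightList α β) 0 0) := by
  have h := X_mul_divX_add
    (C (1 / 2) * (polySymbol (weightList α β) 1 1 - polySymbol (weightList α β) 0 0))
  obtain ⟨h1, h2, -⟩ := discPoly_zero hβ hprod
  rw [coeff_zero_eq_eval_zero, eval_mul, eval_sub, h1, h2] at h
  simpa [diagPoly] using h

theorem discPoly_factor (hβ : ∀ i, 0 < β i) (hprod : ∏ i, α i = ∏ i, β i) :
    discPoly (weightList α β) = 4 * (X ^ 2 * diagPoly (weightList α β) ^ 2 +
      X * lowPoly (weightList α β) * polySymbol (weightList α β) 0 1) := by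
  have h1 := diagPoly_mul_X hβ hprod
  have h2 := lowPoly_mul_X (weightList α β)
  have h3 : (4 : ℝ[X]) * C (1 / 2) ^ 2 = 1 := by
    rw [← C_pow, show (4 : ℝ[X]) = C 4 from rfl, ← C_mul, ← C_1]; norm_num
  rw [discPoly, ← mul_pow, h1, h2, mul_pow]
  linear_combination (-(polySymbol (weightList α β) 1 1 - polySymbol (weightList α β) 0 0) ^ 2) * h3

theorem natDegree_symbolPolys (L : List (ℝ × ℝ)) (hL : L.length = n + 1) :
    (diagPoly L).natDegree ≤ n - 1 ∧ (n = 0 → diagPoly L = 0) ∧ (lowPoly L).natDegree ≤ n ∧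
    (polySymbol L 0 1).natDegree ≤ n := by
  obtain ⟨h1, h2, h3, h4, h5, h6, h7⟩ := natDegree_polySymbol L
  have low : ∀ q : ℝ[X], q.natDegree ≤ L.length → q.coeff L.length = 0 →
      q.natDegree ≤ n := by
    intro q hq h0
    refine natDegree_le_iff_coeff_eq_zero.2 fun N hN => ?_
    rcases (show L.length ≤ N by omega).eq_or_lt with rfl | h
    · exact h0
    · exact coeff_eq_zero_of_natDegree_lt (by omega)
  have hd : (C (1 / 2) * (polySymbol L 1 1 - polySymbol L 0 0)).natDegree ≤ n := by
    refine (natDegree_C_mul_le _ _).trans ?_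
    exact low _ ((natDegree_sub_le_of_le h6 h1).trans (max_self _).le)
      (by rw [coeff_sub, h2, h7]; simp)
  refine ⟨?_, ?_, ?_, low _ h3 h4⟩
  · rw [diagPoly, natDegree_divX_eq_natDegree_tsub_one]; omega
  · rintro rfl
    rw [diagPoly, eq_C_of_natDegree_le_zero hd, divX_C]
  · rw [lowPoly, natDegree_divX_eq_natDegree_tsub_one]; omega

/-- `r / 2 + z d`, the entry `μ - p₁₁` of the adjugate of `μ - (z - 1)^ℓ Φ`. -/
def adjEntry (L : List (ℝ × ℝ)) (z r : ℂ) : ℂ := r / 2 + z * aeval z (diagPoly L)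

/-- The eigenvalue `(τ + r) / 2` of `(z - 1)^ℓ Φ(z)`. -/
def eigenMu (L : List (ℝ × ℝ)) (z r : ℂ) : ℂ :=
  (aeval z (polySymbol L 0 0 + polySymbol L 1 1) + r) / 2

theorem adjEntry_eq (hβ : ∀ i, 0 < β i) (hprod : ∏ i, α i = ∏ i, β i) (z r : ℂ) :
    adjEntry (weightList α β) z r =
      eigenMu (weightList α β) z r - aeval z (polySymbol (weightList α β) 0 0) := by
  have h1 := congrArg (aeval z) (diagPoly_mul_X hβ hprod)
  simp only [map_mul, aeval_X, aeval_C, map_sub] at h1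
  rw [adjEntry, eigenMu, h1]
  simp
  ring

theorem entries_rel (hβ : ∀ i, 0 < β i) (hprod : ∏ i, α i = ∏ i, β i) {z r : ℂ}
    (hr : r ^ 2 = aeval z (discPoly (weightList α β))) :
    (r / 2 - z * aeval z (diagPoly (weightList α β))) * adjEntry (weightList α β) z r =
      z * aeval z (lowPoly (weightList α β)) * aeval z (polySymbol (weightList α β) 0 1) := by
  rw [discPoly_factor hβ hprod] at hr
  simp only [map_mul, map_add, map_pow, aeval_X, map_ofNat] at hr
  rw [adjEntry]
  linear_combination hr / 4

theorem eigenMu_mul (hα : ∀ i, 0 < α i) (hβ : ∀ i, 0 < β i) {z r : ℂ}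
    (hr : r ^ 2 = aeval z (discPoly (weightList α β))) :
    eigenMu (weightList α β) z r * eigenMu (weightList α β) z (-r) = (z - 1) ^ (2 * (n + 1)) := by
  rw [discPoly_eq _ (weightList_pos hα hβ), length_weightList] at hr
  simp only [map_mul, map_add, map_pow, map_sub, aeval_X, map_ofNat, map_one] at hr
  simp only [eigenMu, map_add]
  linear_combination -hr / 4

/-- Over the lower half-plane the signs of the eigenvector forms agree and are governed by the
modulus of the eigenvalue. -/
theorem lower_dichotomy (hα : ∀ i, 0 < α i) (hβ : ∀ i, 0 < β i)
    (hprod : ∏ i, α i = ∏ i, β i) {z r : ℂ} (hz : z.im < 0)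
    (hr : r ^ 2 = aeval z (discPoly (weightList α β))) :
    ((0 < (aeval z (polySymbol (weightList α β) 0 1) *
        (starRingEnd ℂ) (adjEntry (weightList α β) z r)).im ∧
      0 < (aeval z (lowPoly (weightList α β)) *
        (starRingEnd ℂ) (adjEntry (weightList α β) z r)).im) ∧
      ‖z - 1‖ ^ (n + 1) < ‖eigenMu (weightList α β) z r‖) ∨
    (((aeval z (polySymbol (weightList α β) 0 1) *
        (starRingEnd ℂ) (adjEntry (weightList α β) z r)).im < 0 ∧
      (aeval z (lowPoly (weightList α β)) *
        (starRingEnd ℂ) (adjEntry (weightList α β) z r)).im < 0) ∧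
      ‖eigenMu (weightList α β) z r‖ < ‖z - 1‖ ^ (n + 1)) := by
  set L := weightList α β with hLdef
  have hlen : L.length = n + 1 := length_weightList α β
  have hL := weightList_pos hα hβ
  have hz0 : z ≠ 0 := by rintro rfl; simp at hz
  set κ := z⁻¹ with hκdef
  have hκ : 0 < κ.im := by
    rw [hκdef, Complex.inv_im]
    exact div_pos (by linarith) (normSq_pos.2 hz0)
  set F := flattenPairs L with hF
  have hFlen : F.length = 2 * (n + 1) := by
    rw [← hlen, hF]
    simp [flattenPairs, List.length_flatMap, mul_comm]
  have hFpos : ∀ x ∈ F, 0 < x := by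
    intro x hx
    simp only [hF, flattenPairs, List.mem_flatMap] at hx
    obtain ⟨p, hp, hx⟩ := hx
    have := hL p hp
    simp at hx
    rcases hx with rfl | rfl
    · exact this.1
    · exact this.2
  have hFne : F ≠ [] := by intro h; rw [h] at hFlen; simp at hFlen
  have hmap := map_polySymbol L hL hz0
  rw [hlen, ← hκdef, ← hF] at hmap
  set N := (F.map (coneFactor κ)).prod with hN
  have hzp : z ^ (n + 1) ≠ 0 := pow_ne_zero _ hz0
  have entry : ∀ i j, aeval z (polySymbol L i j) = z ^ (n + 1) * N i j := fun i j => by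
    have := congrFun (congrFun hmap i) j
    simpa using this
  set μ := eigenMu L z r with hμ
  set P11 := aeval z (polySymbol L 0 0) with hP11
  set P12 := aeval z (polySymbol L 0 1) with hP12
  set P21 := aeval z (polySymbol L 1 0) with hP21
  set P22 := aeval z (polySymbol L 1 1) with hP22
  have hadj : adjEntry L z r = μ - P11 := adjEntry_eq hβ hprod z r
  have hμeq : (μ - P11) * (μ - P22) = P12 * P21 := by
    rw [discPoly] at hr
    simp only [map_mul, map_add, map_pow, map_sub, map_ofNat] at hr
    rw [hμ, eigenMu, map_add]
    linear_combination hr / 4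
  have hlow : κ * P21 = aeval z (lowPoly L) := by
    rw [hP21, ← lowPoly_mul_X, map_mul, aeval_X, hκdef, inv_mul_cancel_left₀ hz0]
  set ν := μ / z ^ (n + 1) with hν
  have hνμ : z ^ (n + 1) * ν = μ := by rw [hν]; field_simp
  have right : ∀ u : Fin 2 → ℂ, P11 * u 0 + P12 * u 1 = μ * u 0 →
      P21 * u 0 + P22 * u 1 = μ * u 1 → N.mulVec u = ν • u := by
    intro u h0 h1
    rw [hP11, hP12, entry, entry, ← hνμ] at h0
    rw [hP21, hP22, entry, entry, ← hνμ] at h1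
    ext i
    fin_cases i
    · simp [Matrix.mulVec, dotProduct, Fin.sum_univ_two]
      apply mul_left_cancel₀ hzp; linear_combination h0
    · simp [Matrix.mulVec, dotProduct, Fin.sum_univ_two]
      apply mul_left_cancel₀ hzp; linear_combination h1
  set F' := (F.map (·⁻¹)).reverse with hF'
  have hF'len : F'.length = 2 * (n + 1) := by simp [hF', hFlen]
  have hF'pos : ∀ x ∈ F', 0 < x := by
    intro x hx
    simp only [hF', List.mem_reverse, List.mem_map] at hx
    obtain ⟨y, hy, rfl⟩ := hx
    exact inv_pos.2 (hFpos y hy)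
  have hF'ne : F' ≠ [] := by intro h; rw [h] at hF'len; simp at hF'len
  have left : ∀ v : Fin 2 → ℂ, v 0 * P11 + v 1 * P21 = μ * v 0 →
      v 0 * P12 + v 1 * P22 = μ * v 1 →
      (F'.map (coneFactor κ)).prod.mulVec ![κ * v 0, v 1] = ν • ![κ * v 0, v 1] := by
    intro v h0 h1
    rw [hF', coneProd_transpose κ F hFpos]
    rw [hP11, hP21, entry, entry, ← hνμ] at h0
    rw [hP12, hP22, entry, entry, ← hνμ] at h1
    ext i
    fin_cases i
    · simp [Matrix.vecMul, dotProduct, Fin.sum_univ_two, ← hN]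
      apply mul_left_cancel₀ hzp; linear_combination κ * h0
    · simp [Matrix.vecMul, dotProduct, Fin.sum_univ_two, ← hN]
      apply mul_left_cancel₀ hzp; linear_combination h1
  have hP12ne : P12 ≠ 0 := by
    intro h0
    rw [h0, zero_mul] at hμeq
    have hu : (![0, 1] : Fin 2 → ℂ) ≠ 0 := fun h => by simpa using congrFun h 1
    have hev : N.mulVec ![0, 1] = (P22 / z ^ (n + 1)) • ![0, 1] := by
      have e01 := entry 0 1
      have e11 := entry 1 1
      rw [← hP12, h0] at e01
      have e01' : N 0 1 = 0 := (mul_eq_zero.1 e01.symm).resolve_left hzp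
      ext i
      fin_cases i
      · simp [Matrix.mulVec, dotProduct, Fin.sum_univ_two, e01']
      · simp [Matrix.mulVec, dotProduct, Fin.sum_univ_two]
        rw [hP22, e11]; field_simp
    rcases cone_eigen hκ hFpos hFne hu hev with h | h <;> simp [formA] at h
  have hP21ne : κ * P21 ≠ 0 := by
    intro h0
    have h0' : P21 = 0 := (mul_eq_zero.1 h0).resolve_left (inv_ne_zero hz0)
    have hu : (![0, 1] : Fin 2 → ℂ) ≠ 0 := fun h => by simpa using congrFun h 1
    have hev : (F'.map (coneFactor κ)).prod.mulVec ![0, 1] = (P22 / z ^ (n + 1)) • ![0, 1] := by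
      have := coneProd_transpose κ F hFpos ![0, 1]
      rw [← hF'] at this
      simp only [Matrix.cons_val_zero, Matrix.cons_val_one, mul_zero] at this
      rw [this]
      have e10 := entry 1 0
      have e11 := entry 1 1
      rw [← hP21, h0'] at e10
      have e10' : N 1 0 = 0 := (mul_eq_zero.1 e10.symm).resolve_left hzp
      ext i
      fin_cases i
      · simp [Matrix.vecMul, dotProduct, Fin.sum_univ_two, ← hN, e10']
      · simp [Matrix.vecMul, dotProduct, Fin.sum_univ_two, ← hN]
        rw [hP22, e11]; field_simp
    rcases cone_eigen hκ hF'pos hF'ne hu hev with h | h <;> simp [formA] at h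
  have hu : (![P12, μ - P11] : Fin 2 → ℂ) ≠ 0 := fun h => hP12ne (by simpa using congrFun h 0)
  have h1 := cone_eigen hκ hFpos hFne hu (right ![P12, μ - P11] (by simp; ring)
    (by simp; linear_combination -hμeq))
  have ht : (![κ * (![P21, μ - P11] : Fin 2 → ℂ) 0, (![P21, μ - P11] : Fin 2 → ℂ) 1]) ≠ 0 :=
    fun h => hP21ne (by simpa using congrFun h 0)
  have h2 := cone_eigen hκ hF'pos hF'ne ht (left ![P21, μ - P11] (by simp; ring)
    (by simp; linear_combination -hμeq))
  rw [hFlen] at h1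
  rw [hF'len] at h2
  have hnorm : ‖1 - κ‖ ^ (2 * (n + 1)) = (‖z - 1‖ ^ (n + 1) / ‖z‖ ^ (n + 1)) ^ 2 := by
    have : (1 - κ) = (z - 1) / z := by rw [hκdef]; field_simp
    rw [this, norm_div, div_pow, mul_comm 2, pow_mul, pow_mul, div_pow]
  have hnν : ‖ν‖ = ‖μ‖ / ‖z‖ ^ (n + 1) := by rw [hν, norm_div, norm_pow]
  have hzpos : 0 < ‖z‖ ^ (n + 1) := by positivity
  rw [hnorm, hnν] at h1 h2
  rw [hadj, ← hlow]
  have f1 : formA ![P12, μ - P11] = (P12 * (starRingEnd ℂ) (μ - P11)).im := by simp [formA]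
  have f2 : formA ![κ * (![P21, μ - P11] : Fin 2 → ℂ) 0, (![P21, μ - P11] : Fin 2 → ℂ) 1] =
      (κ * P21 * (starRingEnd ℂ) (μ - P11)).im := by simp [formA]
  rw [f1] at h1
  rw [f2] at h2
  have sq1 : (‖z - 1‖ ^ (n + 1) / ‖z‖ ^ (n + 1)) ^ 2 < (‖μ‖ / ‖z‖ ^ (n + 1)) ^ 2 ↔
      ‖z - 1‖ ^ (n + 1) < ‖μ‖ := by
    rw [sq_lt_sq₀ (by positivity) (by positivity), div_lt_div_iff_of_pos_right hzpos]
  have sq2 : (‖μ‖ / ‖z‖ ^ (n + 1)) ^ 2 < (‖z - 1‖ ^ (n + 1) / ‖z‖ ^ (n + 1)) ^ 2 ↔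
      ‖μ‖ < ‖z - 1‖ ^ (n + 1) := by
    rw [sq_lt_sq₀ (by positivity) (by positivity), div_lt_div_iff_of_pos_right hzpos]
  rw [sq1, sq2] at h1 h2
  rcases h1 with ⟨a1, b1⟩ | ⟨a1, b1⟩ <;> rcases h2 with ⟨a2, b2⟩ | ⟨a2, b2⟩
  · exact Or.inl ⟨⟨a1, a2⟩, b1⟩
  · linarith
  · linarith
  · exact Or.inr ⟨⟨a1, a2⟩, b1⟩

end Polys

section Sheet

variable {n : ℕ} {α β : Fin (n + 1) → ℝ}

/-- The imaginary part of `p₁₂ conj(μ - p₁₁)`; it is positive on `R₀`. -/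
def signForm (L : List (ℝ × ℝ)) (z r : ℂ) : ℝ :=
  (aeval z (polySymbol L 0 1) * (starRingEnd ℂ) (adjEntry L z r)).im

theorem adjEntry_conj (L : List (ℝ × ℝ)) (z r : ℂ) :
    adjEntry L ((starRingEnd ℂ) z) ((starRingEnd ℂ) r) = (starRingEnd ℂ) (adjEntry L z r) := by
  simp only [adjEntry, aeval_conj_eq, map_add, map_mul, map_div₀, map_ofNat]

theorem signForm_conj (L : List (ℝ × ℝ)) (z r : ℂ) :
    signForm L ((starRingEnd ℂ) z) ((starRingEnd ℂ) r) = -signForm L z r := by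
  rw [signForm, adjEntry_conj, aeval_conj_eq, ← map_mul, conj_im, signForm]

theorem aeval_of_im_eq_zero (p : ℝ[X]) {z : ℂ} (hz : z.im = 0) :
    aeval z p = (p.eval z.re : ℝ) := by
  conv_lhs => rw [show z = (z.re : ℂ) from Complex.ext rfl (by simp [hz])]
  exact aeval_ofReal_eq p z.re

theorem neg_of_discPoly_neg (hα : ∀ i, 0 < α i) (hβ : ∀ i, 0 < β i)
    (hprod : ∏ i, α i = ∏ i, β i) {x : ℝ} (hx : (discPoly (weightList α β)).eval x < 0) :
    x < 0 := by
  rcases lt_trichotomy x 0 with h | h | h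
  · exact h
  · rw [h, (discPoly_zero hβ hprod).2.2] at hx; exact absurd hx (lt_irrefl _)
  · have := discPoly_pos _ (weightList_pos hα hβ) (weightList_ne_nil α β) h
    linarith

/-- On the slit domain both square roots give opposite signs. -/
theorem signForm_dichotomy (hα : ∀ i, 0 < α i) (hβ : ∀ i, 0 < β i)
    (hprod : ∏ i, α i = ∏ i, β i) {z r : ℂ}
    (hz : z ∈ slitDomain (discPoly (weightList α β)))
    (hr : r ^ 2 = aeval z (discPoly (weightList α β))) :
    signForm (weightList α β) z r * signForm (weightList α β) z (-r) < 0 ∧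
    0 < signForm (weightList α β) z r * (aeval z (lowPoly (weightList α β)) *
        (starRingEnd ℂ) (adjEntry (weightList α β) z r)).im := by
  have hlow : ∀ {z r : ℂ}, z.im < 0 → r ^ 2 = aeval z (discPoly (weightList α β)) →
      signForm (weightList α β) z r * signForm (weightList α β) z (-r) < 0 ∧
    0 < signForm (weightList α β) z r * (aeval z (lowPoly (weightList α β)) *
        (starRingEnd ℂ) (adjEntry (weightList α β) z r)).im := by
    intro z r hz hr
    have h1 := lower_dichotomy hα hβ hprod hz hr
    have h2 := lower_dichotomy hα hβ hprod hz (r := -r) (by rw [neg_sq, hr])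
    have hmul := congrArg norm (eigenMu_mul hα hβ hr)
    rw [norm_mul, norm_pow, mul_comm 2, pow_mul] at hmul
    have hz1 : 0 < ‖z - 1‖ ^ (n + 1) := by
      have : z - 1 ≠ 0 := fun h => by
        have := congrArg Complex.im h
        simp at this
        exact hz.ne this
      positivity
    have hn1 := norm_nonneg (eigenMu (weightList α β) z r)
    have hn2 := norm_nonneg (eigenMu (weightList α β) z (-r))
    simp only [signForm]
    rcases h1 with ⟨⟨a1, b1⟩, c1⟩ | ⟨⟨a1, b1⟩, c1⟩ <;>
      rcases h2 with ⟨⟨a2, b2⟩, c2⟩ | ⟨⟨a2, b2⟩, c2⟩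
    · nlinarith
    · exact ⟨mul_neg_of_pos_of_neg a1 a2, mul_pos a1 b1⟩
    · exact ⟨mul_neg_of_neg_of_pos a1 a2, mul_pos_of_neg_of_neg a1 b1⟩
    · nlinarith
  rcases lt_trichotomy z.im 0 with h | h | h
  · exact hlow h hr
  · have hneg : (discPoly (weightList α β)).eval z.re < 0 := hz.resolve_left (not_not.2 h)
    have hx := neg_of_discPoly_neg hα hβ hprod hneg
    have hzx : z = (z.re : ℂ) := Complex.ext rfl (by simp [h])
    set x := z.re with hxdef
    have hdisc := congrArg (eval x) (discPoly_factor (α := α) (β := β) hβ hprod)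
    simp only [eval_mul, eval_add, eval_pow, eval_X] at hdisc
    have h4 : eval x (4 : ℝ[X]) = 4 := by simp
    rw [h4] at hdisc
    set D := eval x (diagPoly (weightList α β))
    set c := eval x (lowPoly (weightList α β)) with hc
    set b := eval x (polySymbol (weightList α β) 0 1) with hb
    rw [hdisc] at hneg
    have hcb : 0 < c * b := by
      have : 0 ≤ x ^ 2 * D ^ 2 := by positivity
      by_contra hcon
      push Not at hcon
      nlinarith [mul_nonneg_of_nonpos_of_nonpos hx.le hcon]
    have hrsq : r ^ 2 = ((discPoly (weightList α β)).eval x : ℝ) := by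
      rw [hr, hzx, aeval_ofReal_eq]
    have hre : (r ^ 2).re < 0 := by rw [hrsq, ofReal_re, hdisc]; exact hneg
    have him : r.im ≠ 0 := by
      intro h0
      simp [pow_two, h0] at hre
      nlinarith [mul_self_nonneg r.re]
    have f : ∀ s : ℂ, signForm (weightList α β) z s = -(b * s.im) / 2 := by
      intro s
      rw [signForm, adjEntry, hzx, aeval_ofReal_eq, aeval_ofReal_eq, ← hb]
      simp [map_ofNat]
      ring
    have g : (aeval z (lowPoly (weightList α β)) *
        (starRingEnd ℂ) (adjEntry (weightList α β) z r)).im = -(c * r.im) / 2 := by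
      rw [adjEntry, hzx, aeval_ofReal_eq, aeval_ofReal_eq, ← hc]
      simp [map_ofNat]
      ring
    rw [f, f, g]
    have hb0 : b ≠ 0 := by rintro h0; simp [h0] at hcb
    constructor
    · have : 0 < (b * r.im) ^ 2 := by positivity
      simp only [neg_im]
      nlinarith
    · have : 0 < (c * b) * r.im ^ 2 := by positivity
      nlinarith
  · have h' : ((starRingEnd ℂ) z).im < 0 := by simpa using h
    have hr' : ((starRingEnd ℂ) r) ^ 2 =
        aeval ((starRingEnd ℂ) z) (discPoly (weightList α β)) := by
      rw [aeval_conj_eq, ← hr, map_pow]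
    have := hlow h' hr'
    rw [← map_neg, signForm_conj, signForm_conj] at this
    have e : (aeval ((starRingEnd ℂ) z) (lowPoly (weightList α β)) *
        (starRingEnd ℂ) (adjEntry (weightList α β) ((starRingEnd ℂ) z) ((starRingEnd ℂ) r))).im =
        -(aeval z (lowPoly (weightList α β)) *
        (starRingEnd ℂ) (adjEntry (weightList α β) z r)).im := by
      rw [adjEntry_conj, aeval_conj_eq, ← map_mul, conj_im]
    rw [e, neg_mul_neg, neg_mul_neg] at this
    exact this

/-- The square root of the discriminant on the slit domain that belongs to `R₀`. -/
def sheet (L : List (ℝ × ℝ)) (z : ℂ) : ℂ :=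
  if 0 < signForm L z ((aeval z (discPoly L)) ^ (1 / 2 : ℂ)) then
    (aeval z (discPoly L)) ^ (1 / 2 : ℂ)
  else -(aeval z (discPoly L)) ^ (1 / 2 : ℂ)

theorem half_cpow_sq (w : ℂ) : (w ^ (1 / 2 : ℂ)) ^ 2 = w := by
  rw [one_div]
  exact_mod_cast Complex.cpow_nat_inv_pow w two_ne_zero

theorem sheet_sq (L : List (ℝ × ℝ)) (z : ℂ) : sheet L z ^ 2 = aeval z (discPoly L) := by
  rw [sheet]
  split_ifs
  · exact half_cpow_sq _
  · rw [neg_sq]; exact half_cpow_sq _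

theorem sheet_pos (hα : ∀ i, 0 < α i) (hβ : ∀ i, 0 < β i)
    (hprod : ∏ i, α i = ∏ i, β i) {z : ℂ}
    (hz : z ∈ slitDomain (discPoly (weightList α β))) :
    0 < signForm (weightList α β) z (sheet (weightList α β) z) := by
  have h := (signForm_dichotomy hα hβ hprod hz (half_cpow_sq _)).1
  rw [sheet]
  split_ifs with h0
  · exact h0
  · push Not at h0
    by_contra h1
    push Not at h1
    nlinarith

theorem eq_sheet (hα : ∀ i, 0 < α i) (hβ : ∀ i, 0 < β i)
    (hprod : ∏ i, α i = ∏ i, β i) {z r : ℂ}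
    (hz : z ∈ slitDomain (discPoly (weightList α β)))
    (hr : r ^ 2 = aeval z (discPoly (weightList α β)))
    (hpos : 0 < signForm (weightList α β) z r) : sheet (weightList α β) z = r := by
  rcases sq_eq_sq_iff_eq_or_eq_neg.1 ((sheet_sq (weightList α β) z).trans hr.symm) with h | h
  · exact h
  · have h1 := (signForm_dichotomy hα hβ hprod hz hr).1
    have h2 := sheet_pos hα hβ hprod hz
    rw [h] at h2
    nlinarith

theorem discPoly_ne_zero_of_mem (hα : ∀ i, 0 < α i) (hβ : ∀ i, 0 < β i)
    (hprod : ∏ i, α i = ∏ i, β i) {z : ℂ}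
    (hz : z ∈ slitDomain (discPoly (weightList α β))) :
    aeval z (discPoly (weightList α β)) ≠ 0 := by
  intro h0
  have := (signForm_dichotomy hα hβ hprod (r := 0) hz (by simpa using h0.symm)).1
  rw [neg_zero] at this
  nlinarith [mul_self_nonneg (signForm (weightList α β) z 0)]

theorem sheet_conj (hα : ∀ i, 0 < α i) (hβ : ∀ i, 0 < β i)
    (hprod : ∏ i, α i = ∏ i, β i) {z : ℂ}
    (hz : z ∈ slitDomain (discPoly (weightList α β))) :
    sheet (weightList α β) ((starRingEnd ℂ) z) =
      -(starRingEnd ℂ) (sheet (weightList α β) z) := by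
  refine eq_sheet hα hβ hprod (conj_mem_slitDomain hz) ?_ ?_
  · rw [neg_sq, ← map_pow, sheet_sq, aeval_conj_eq]
  · rw [← map_neg, signForm_conj]
    have h1 := (signForm_dichotomy hα hβ hprod hz (sheet_sq _ _)).1
    have h2 := sheet_pos hα hβ hprod hz
    nlinarith

theorem continuous_signForm (L : List (ℝ × ℝ)) {f : ℂ → ℂ} {z : ℂ} (hf : ContinuousAt f z) :
    ContinuousAt (fun w => signForm L w (f w)) z := by
  have h1 := (aeval_continuous (polySymbol L 0 1)).continuousAt (x := z)
  have h2 := (aeval_continuous (diagPoly L)).continuousAt (x := z)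
  unfold signForm adjEntry
  refine Complex.continuous_im.continuousAt.comp (h1.mul ?_)
  refine Complex.continuous_conj.continuousAt.comp ?_
  exact (hf.div_const 2).add (continuousAt_id.mul h2)

/-- A local holomorphic square root of a nonvanishing function. -/
theorem local_sqrt {R : ℝ[X]} {z₀ r₀ : ℂ} (h : r₀ ^ 2 = aeval z₀ R) (hne : r₀ ≠ 0) :
    ∃ f : ℂ → ℂ, AnalyticAt ℂ f z₀ ∧ f z₀ = r₀ ∧ (∀ z, f z ^ 2 = aeval z R) := by
  have hR : aeval z₀ R ≠ 0 := by rw [← h]; exact pow_ne_zero _ hne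
  refine ⟨fun z => r₀ * (aeval z R / aeval z₀ R) ^ (1 / 2 : ℂ), ?_, ?_, fun z => ?_⟩
  · refine analyticAt_const.mul (AnalyticAt.cpow ?_ analyticAt_const ?_)
    · exact (aeval_analyticAt R z₀).div analyticAt_const hR
    · rw [div_self hR]; exact one_mem_slitPlane
  · simp [div_self hR]
  · rw [mul_pow, half_cpow_sq, h]; field_simp

theorem sheet_differentiableAt (hα : ∀ i, 0 < α i) (hβ : ∀ i, 0 < β i)
    (hprod : ∏ i, α i = ∏ i, β i) {z : ℂ}
    (hz : z ∈ slitDomain (discPoly (weightList α β))) :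
    DifferentiableAt ℂ (sheet (weightList α β)) z := by
  have hne : sheet (weightList α β) z ≠ 0 := fun h0 =>
    discPoly_ne_zero_of_mem hα hβ hprod hz (by rw [← sheet_sq, h0]; simp)
  obtain ⟨f, hf, hf0, hfs⟩ := local_sqrt (sheet_sq (weightList α β) z) hne
  have hc : ∀ᶠ w in 𝓝 z, 0 < signForm (weightList α β) w (f w) := by
    refine (continuous_signForm _ hf.continuousAt).eventually (lt_mem_nhds ?_)
    simp only [hf0]; exact sheet_pos hα hβ hprod hz
  refine hf.differentiableAt.congr_of_eventuallyEq ?_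
  filter_upwards [hc, (isOpen_slitDomain _).mem_nhds hz] with w hw hw'
  exact eq_sheet hα hβ hprod hw' (hfs w) hw

theorem sheet_lower (hα : ∀ i, 0 < α i) (hβ : ∀ i, 0 < β i)
    (hprod : ∏ i, α i = ∏ i, β i) {z r : ℂ} (hz : z.im < 0)
    (hr : r ^ 2 = aeval z (discPoly (weightList α β))) :
    r = sheet (weightList α β) z ↔ ‖z - 1‖ ^ (n + 1) < ‖eigenMu (weightList α β) z r‖ := by
  have h1 := lower_dichotomy hα hβ hprod hz hr
  constructor
  · intro h
    have h2 := sheet_pos hα hβ hprod (z := z) (Or.inl hz.ne)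
    rw [← h] at h2
    rcases h1 with h1 | h1
    · exact h1.2
    · exact absurd h2 (not_lt.2 h1.1.1.le)
  · intro h
    rcases h1 with h1 | h1
    · exact (eq_sheet hα hβ hprod (Or.inl hz.ne) hr h1.1.1).symm
    · linarith [h1.2]

theorem sheet_re_pos (hα : ∀ i, 0 < α i) (hβ : ∀ i, 0 < β i)
    (hprod : ∏ i, α i = ∏ i, β i) {x : ℝ} (hx : 0 < x) :
    ∀ᶠ z in 𝓝[{z : ℂ | z.im < 0}] (x : ℂ), 0 < (sheet (weightList α β) z).re := by
  set L := weightList α β with hL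
  set τ : ℂ → ℂ := fun z => aeval z (polySymbol L 0 0 + polySymbol L 1 1) with hτ
  have key : ∀ z : ℂ, z.im < 0 → 0 < (τ z * (starRingEnd ℂ) (sheet L z)).re := by
    intro z hz
    have h1 := (sheet_lower hα hβ hprod hz (sheet_sq L z)).1 rfl
    have hmul := congrArg norm (eigenMu_mul hα hβ (sheet_sq L z))
    rw [norm_mul, norm_pow, mul_comm 2, pow_mul] at hmul
    have hlt : ‖eigenMu L z (-sheet L z)‖ < ‖eigenMu L z (sheet L z)‖ := by
      have hz1 : 0 ≤ ‖z - 1‖ ^ (n + 1) := by positivity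
      have hn2 := norm_nonneg (eigenMu L z (-sheet L z))
      by_contra hcon
      push Not at hcon
      nlinarith
    have hlt2 := (sq_lt_sq₀ (norm_nonneg _) (norm_nonneg _)).2 hlt
    rw [← normSq_eq_norm_sq, ← normSq_eq_norm_sq] at hlt2
    simp only [eigenMu, normSq_div] at hlt2
    have h4 : 0 < normSq 2 := normSq_pos.2 two_ne_zero
    rw [div_lt_div_iff_of_pos_right h4, normSq_add, normSq_add, normSq_neg, map_neg,
      mul_neg, neg_re] at hlt2
    simp only [hτ]
    linarith
  have hR : 0 < (discPoly L).eval x :=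
    discPoly_pos _ (weightList_pos hα hβ) (weightList_ne_nil α β) hx
  have hτx : τ x = ((polySymbol L 0 0 + polySymbol L 1 1).eval x : ℝ) := aeval_ofReal_eq _ _
  obtain ⟨p1, -, -, p2, -⟩ := eval_polySymbol_pos L (weightList_pos hα hβ) hx
  set T := (polySymbol L 0 0 + polySymbol L 1 1).eval x with hT
  have hTpos : 0 < T := by rw [hT, eval_add]; linarith
  set ρ := √((discPoly L).eval x) with hρ
  have hρpos : 0 < ρ := Real.sqrt_pos.2 hR
  obtain ⟨f, hf, hf0, hfs⟩ := local_sqrt (R := discPoly L) (z₀ := x) (r₀ := (ρ : ℂ)) (by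
    rw [aeval_ofReal_eq, ← ofReal_pow, hρ, Real.sq_sqrt hR.le]) (by exact_mod_cast hρpos.ne')
  have hτc : ContinuousAt τ x := (aeval_continuous _).continuousAt
  have hc : ∀ᶠ z in 𝓝 (x : ℂ), 0 < (τ z * (starRingEnd ℂ) (f z)).re ∧ 0 < (f z).re := by
    refine Filter.Eventually.and ?_ ?_
    · have : ContinuousAt (fun z => (τ z * (starRingEnd ℂ) (f z)).re) x :=
        Complex.continuous_re.continuousAt.comp
          (hτc.mul (Complex.continuous_conj.continuousAt.comp hf.continuousAt))
      refine this.eventually (lt_mem_nhds ?_)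
      simp only [hτx, hf0]; rw [conj_ofReal, ← ofReal_mul, ofReal_re]
      positivity
    · have : ContinuousAt (fun z => (f z).re) x :=
        Complex.continuous_re.continuousAt.comp hf.continuousAt
      refine this.eventually (lt_mem_nhds ?_)
      simp only [hf0]; rw [ofReal_re]; exact hρpos
  filter_upwards [eventually_nhdsWithin_of_eventually_nhds hc, eventually_mem_nhdsWithin]
    with z hz hzim
  have := key z hzim
  rcases sq_eq_sq_iff_eq_or_eq_neg.1 ((sheet_sq L z).trans (hfs z).symm) with h | h
  · rw [h]; exact hz.2
  · rw [h, map_neg, mul_neg, neg_re] at this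
    linarith [hz.1]

end Sheet

/-! ### Abstract slit curves -/

/-- A hyperelliptic curve `r² = R(z)` with real branch points, together with the branch of `r` on
the slit domain that describes one half of the curve. -/
structure SlitCurve where
  /-- The genus of the curve. -/
  genus : ℕ
  /-- The polynomial under the square root. -/
  R : ℝ[X]
  /-- The branch of the square root on the slit domain. -/
  r : ℂ → ℂ
  natDegree_R : R.natDegree = 2 * genus + 1
  R_zero : R.eval 0 = 0
  R_pos : ∀ x : ℝ, 0 < x → 0 < R.eval x
  simple : ∀ x : ℝ, R.eval x = 0 → (derivative R).eval x ≠ 0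
  ne_zero : ∀ z ∈ slitDomain R, aeval z R ≠ 0
  r_sq : ∀ z, r z ^ 2 = aeval z R
  r_diff : ∀ z ∈ slitDomain R, DifferentiableAt ℂ r z
  r_conj : ∀ z ∈ slitDomain R, r ((starRingEnd ℂ) z) = -(starRingEnd ℂ) (r z)
  r_re_pos : ∀ x : ℝ, 0 < x → ∀ᶠ z in 𝓝[{z : ℂ | z.im < 0}] (x : ℂ), 0 < (r z).re

/-- The spectral curve as a slit curve. -/
def spectralSlitCurve {n : ℕ} {α β : Fin (n + 1) → ℝ} (hα : ∀ i, 0 < α i) (hβ : ∀ i, 0 < β i)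
    (hprod : ∏ i, α i = ∏ i, β i) (hgenus : spectralGenus α β = n) : SlitCurve where
  genus := n
  R := discPoly (weightList α β)
  r := sheet (weightList α β)
  natDegree_R := (discPoly_of_genus hα hβ hprod hgenus).1
  R_zero := (discPoly_zero hβ hprod).2.2
  R_pos := fun _ hx => discPoly_pos _ (weightList_pos hα hβ) (weightList_ne_nil α β) hx
  simple := (discPoly_of_genus hα hβ hprod hgenus).2
  ne_zero := fun _ hz => discPoly_ne_zero_of_mem hα hβ hprod hz
  r_sq := sheet_sq _
  r_diff := fun _ hz => sheet_differentiableAt hα hβ hprod hz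
  r_conj := fun _ hz => sheet_conj hα hβ hprod hz
  r_re_pos := fun _ hx => sheet_re_pos hα hβ hprod hx

/-! ### Imaginary parts of primitives -/

/-- The real linear form `v ↦ Im (c v)`. -/
def imForm (c : ℂ) : ℂ →L[ℝ] ℝ :=
  imCLM.comp ((ContinuousLinearMap.mul ℂ ℂ c).restrictScalars ℝ)

@[simp] theorem imForm_apply (c v : ℂ) : imForm c v = (c * v).im := rfl

theorem hasFDerivAt_im {K : ℂ → ℂ} {c z : ℂ} (h : HasDerivAt K c z) :
    HasFDerivAt (fun z => (K z).im) (imForm c) z := by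
  have h1 := imCLM.hasFDerivAt.comp z (h.hasFDerivAt.restrictScalars ℝ)
  refine h1.congr_fderiv ?_
  ext v
  simp
  ring

theorem convex_lower : Convex ℝ {z : ℂ | z.im < 0} := convex_halfSpace_im_lt 0

theorem isOpen_lower : IsOpen {z : ℂ | z.im < 0} :=
  isOpen_lt Complex.continuous_im continuous_const

theorem exists_primitive {f : ℂ → ℂ} {s : Set ℂ} (hs : Convex ℝ s) (ho : IsOpen s)
    (hf : DifferentiableOn ℂ f s) : ∃ K : ℂ → ℂ, ∀ z ∈ s, HasDerivAt K (f z) z := by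
  obtain ⟨K, hK⟩ := hs.exists_forall_hasDerivWithinAt hf
  exact ⟨K, fun z hz => (hK z hz).hasDerivAt (ho.mem_nhds hz)⟩

theorem eq_const_of_hasDerivAt_zero {f : ℂ → ℂ} {s : Set ℂ} (hs : Convex ℝ s) (ho : IsOpen s)
    (hf : ∀ z ∈ s, HasDerivAt f 0 z) : ∃ c, ∀ z ∈ s, f z = c :=
  ho.exists_is_const_of_deriv_eq_zero hs.isPreconnected
    (fun z hz => (hf z hz).differentiableAt.differentiableWithinAt) (fun z hz => (hf z hz).deriv)

theorem tendsto_of_bounded_deriv {G G' : ℂ → ℂ} {s : Set ℂ} (hs : Convex ℝ s) {C : ℝ}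
    (hG : ∀ z ∈ s, HasDerivAt G (G' z) z) (hb : ∀ z ∈ s, ‖G' z‖ ≤ C) {x : ℂ}
    (hx : x ∈ closure s) : ∃ c, Tendsto G (𝓝[s] x) (𝓝 c) := by
  have hne : (𝓝[s] x).NeBot := mem_closure_iff_nhdsWithin_neBot.1 hx
  have hlip : LipschitzOnWith C.toNNReal G s :=
    hs.lipschitzOnWith_of_nnnorm_hasDerivWithin_le (fun z hz => (hG z hz).hasDerivWithinAt)
      fun z hz => by
        rw [← NNReal.coe_le_coe, coe_nnnorm]
        exact (hb z hz).trans (Real.le_coe_toNNReal C)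
  rw [← cauchy_map_iff_exists_tendsto]
  have hcau : Cauchy (𝓝[s] x) := cauchy_nhds.mono inf_le_left
  exact hcau.map_of_le hlip.uniformContinuousOn (le_principal_iff.2 self_mem_nhdsWithin)

theorem half_cpow_quadrant {w : ℂ} (hw : w.im < 0) :
    0 < (w ^ (1 / 2 : ℂ)).re ∧ (w ^ (1 / 2 : ℂ)).im < 0 := by
  have hw0 : w ≠ 0 := by rintro rfl; simp at hw
  rw [cpow_def_of_ne_zero hw0, exp_re, exp_im]
  have e1 : (log w * (1 / 2)).im = w.arg / 2 := by
    rw [mul_im, log_im]; simp; ring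
  rw [e1]
  have h1 := Complex.arg_neg_iff.2 hw
  have h2 := neg_pi_lt_arg w
  exact ⟨mul_pos (Real.exp_pos _) (Real.cos_pos_of_mem_Ioo ⟨by linarith, by linarith⟩),
    mul_neg_of_pos_of_neg (Real.exp_pos _) (Real.sin_neg_of_neg_of_neg_pi_lt (by linarith)
      (by linarith [Real.pi_pos]))⟩

theorem tendsto_half_cpow {α : Type*} {l : Filter α} {f : α → ℂ} (h : Tendsto f l (𝓝 0)) :
    Tendsto (fun a => f a ^ (1 / 2 : ℂ)) l (𝓝 0) := by
  rw [tendsto_zero_iff_norm_tendsto_zero] at h ⊢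
  have : ∀ a, ‖f a ^ (1 / 2 : ℂ)‖ = √‖f a‖ := fun a => by
    rw [eq_comm, Real.sqrt_eq_iff_mul_self_eq (norm_nonneg _) (norm_nonneg _), ← norm_mul,
      ← pow_two, half_cpow_sq]
  simp only [this]
  have h2 := (Real.continuous_sqrt.tendsto 0).comp h
  rw [Real.sqrt_zero] at h2
  exact h2

theorem convex_quadrant (δ : ℝ) :
    Convex ℝ {χ : ℂ | 0 < χ.re ∧ χ.im < 0 ∧ χ ∈ Metric.ball (0 : ℂ) δ} :=
  (convex_halfSpace_re_gt 0).inter ((convex_halfSpace_im_lt 0).inter (convex_ball _ _))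

theorem zero_mem_closure_quadrant {δ : ℝ} (hδ : 0 < δ) :
    (0 : ℂ) ∈ closure {χ : ℂ | 0 < χ.re ∧ χ.im < 0 ∧ χ ∈ Metric.ball (0 : ℂ) δ} := by
  have ht : Tendsto (fun t : ℝ => (t : ℂ) * (1 - I)) (𝓝[>] 0) (𝓝 0) := by
    have : Continuous (fun t : ℝ => (t : ℂ) * (1 - I)) := by fun_prop
    have := this.tendsto 0
    simp only [ofReal_zero, zero_mul] at this
    exact this.mono_left inf_le_left
  refine mem_closure_of_tendsto ht ?_
  filter_upwards [self_mem_nhdsWithin, ht.eventually (Metric.ball_mem_nhds 0 hδ)] with t ht1 ht2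
  have : (0 : ℝ) < t := ht1
  refine ⟨by simpa using this, by simpa using this, ht2⟩

/-- A holomorphic function on the lower half-plane whose derivative grows at most like
`|z - x₀|^{-1/2}` has a boundary value at `x₀`. -/
theorem exists_trace {K X : ℂ → ℂ} {x₀ : ℝ} {C : ℝ}
    (hK : ∀ z : ℂ, z.im < 0 → HasDerivAt K (X z) z)
    (hb : ∀ᶠ z in 𝓝 (x₀ : ℂ), z.im < 0 → ‖X z‖ ^ 2 * ‖z - x₀‖ ≤ C) :
    ∃ c, Tendsto K (𝓝[{z : ℂ | z.im < 0}] (x₀ : ℂ)) (𝓝 c) := by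
  have hsq : Tendsto (fun χ : ℂ => (x₀ : ℂ) + χ ^ 2) (𝓝 0) (𝓝 (x₀ : ℂ)) := by
    have : Continuous (fun χ : ℂ => (x₀ : ℂ) + χ ^ 2) := by fun_prop
    simpa using this.tendsto 0
  obtain ⟨δ, hδ, hball⟩ := Metric.eventually_nhds_iff_ball.1 (hsq.eventually hb)
  have him : ∀ χ : ℂ, 0 < χ.re → χ.im < 0 → ((x₀ : ℂ) + χ ^ 2).im < 0 := by
    intro χ h1 h2
    simp [pow_two]
    nlinarith
  obtain ⟨c, hc⟩ := tendsto_of_bounded_deriv (C := √(4 * C)) (convex_quadrant δ)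
    (G := fun χ => K (x₀ + χ ^ 2)) (G' := fun χ => X (x₀ + χ ^ 2) * (2 * χ))
    (fun χ hχ => by
      have h1 := hK _ (him χ hχ.1 hχ.2.1)
      have h2 : HasDerivAt (fun χ : ℂ => (x₀ : ℂ) + χ ^ 2) (2 * χ) χ := by
        simpa using (hasDerivAt_pow 2 χ).const_add (x₀ : ℂ)
      exact h1.comp χ h2)
    (fun χ hχ => by
      have h1 := hball χ hχ.2.2 (him χ hχ.1 hχ.2.1)
      refine Real.le_sqrt_of_sq_le ?_
      rw [norm_mul, norm_mul, mul_pow, mul_pow]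
      simp only [add_sub_cancel_left, norm_pow] at h1
      have : ‖(2 : ℂ)‖ = 2 := by simp
      rw [this]
      nlinarith)
    (zero_mem_closure_quadrant hδ)
  refine ⟨c, ?_⟩
  have hsub : Tendsto (fun z : ℂ => z - x₀) (𝓝[{z : ℂ | z.im < 0}] (x₀ : ℂ)) (𝓝 0) := by
    have : Continuous (fun z : ℂ => z - x₀) := by fun_prop
    have := this.tendsto (x₀ : ℂ)
    rw [sub_self] at this
    exact this.mono_left inf_le_left
  have ht := tendsto_half_cpow hsub
  have hin : Tendsto (fun z : ℂ => (z - x₀) ^ (1 / 2 : ℂ)) (𝓝[{z : ℂ | z.im < 0}] (x₀ : ℂ))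
      (𝓝[{χ : ℂ | 0 < χ.re ∧ χ.im < 0 ∧ χ ∈ Metric.ball (0 : ℂ) δ}] 0) := by
    refine tendsto_nhdsWithin_iff.2 ⟨ht, ?_⟩
    filter_upwards [self_mem_nhdsWithin, ht.eventually (Metric.ball_mem_nhds 0 hδ)] with z h1 h2
    have h1' : (z - x₀).im < 0 := by simpa using h1
    obtain ⟨a, b⟩ := half_cpow_quadrant h1'
    exact ⟨a, b, h2⟩
  refine (hc.comp hin).congr fun z => ?_
  simp only [Function.comp]
  rw [half_cpow_sq, add_sub_cancel]

/-- The analogue of `exists_trace` at infinity. -/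
theorem exists_trace_infty {K X : ℂ → ℂ} {C : ℝ}
    (hK : ∀ z : ℂ, z.im < 0 → HasDerivAt K (X z) z)
    (hb : ∀ᶠ z in Bornology.cobounded ℂ, z.im < 0 → ‖X z‖ ^ 2 * ‖z‖ ^ 3 ≤ C) :
    ∃ c, Tendsto K (Bornology.cobounded ℂ ⊓ 𝓟 {z : ℂ | z.im < 0}) (𝓝 c) := by
  have hb' : ∀ᶠ χ in 𝓝 (0 : ℂ), χ ≠ 0 → ((χ ^ 2)⁻¹).im < 0 →
      ‖X (χ ^ 2)⁻¹‖ ^ 2 * ‖(χ ^ 2)⁻¹‖ ^ 3 ≤ C := by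
    have : Tendsto (fun χ : ℂ => (χ ^ 2)⁻¹) (𝓝[≠] 0) (Bornology.cobounded ℂ) := by
      refine Filter.tendsto_inv₀_nhdsNE_zero.comp ?_
      refine tendsto_nhdsWithin_iff.2 ⟨?_, ?_⟩
      · have : Continuous (fun χ : ℂ => χ ^ 2) := by fun_prop
        exact (by simpa using this.tendsto 0 : Tendsto (fun χ : ℂ => χ ^ 2) (𝓝 0) (𝓝 0)).mono_left
          inf_le_left
      · filter_upwards [self_mem_nhdsWithin] with χ hχ
        exact pow_ne_zero 2 hχ
    exact eventually_nhdsWithin_iff.1 (this.eventually hb)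
  obtain ⟨δ, hδ, hball⟩ := Metric.eventually_nhds_iff_ball.1 hb'
  have hconj : Convex ℝ {χ : ℂ | 0 < χ.re ∧ 0 < χ.im ∧ χ ∈ Metric.ball (0 : ℂ) δ} :=
    (convex_halfSpace_re_gt 0).inter ((convex_halfSpace_im_gt 0).inter (convex_ball _ _))
  have hne : ∀ χ : ℂ, 0 < χ.re → χ ≠ 0 := by rintro χ h rfl; simp at h
  have him : ∀ χ : ℂ, 0 < χ.re → 0 < χ.im → ((χ ^ 2)⁻¹).im < 0 := by
    intro χ h1 h2
    rw [Complex.inv_im]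
    refine div_neg_of_neg_of_pos ?_ (normSq_pos.2 (pow_ne_zero 2 (hne χ h1)))
    simp [pow_two]
    nlinarith
  have hcl : (0 : ℂ) ∈ closure {χ : ℂ | 0 < χ.re ∧ 0 < χ.im ∧ χ ∈ Metric.ball (0 : ℂ) δ} := by
    have ht : Tendsto (fun t : ℝ => (t : ℂ) * (1 + I)) (𝓝[>] 0) (𝓝 0) := by
      have : Continuous (fun t : ℝ => (t : ℂ) * (1 + I)) := by fun_prop
      have := this.tendsto 0
      simp only [ofReal_zero, zero_mul] at this
      exact this.mono_left inf_le_left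
    refine mem_closure_of_tendsto ht ?_
    filter_upwards [self_mem_nhdsWithin, ht.eventually (Metric.ball_mem_nhds 0 hδ)] with t ht1 ht2
    have : (0 : ℝ) < t := ht1
    refine ⟨by simpa using this, by simpa using this, ht2⟩
  obtain ⟨c, hc⟩ := tendsto_of_bounded_deriv (C := √(4 * C)) hconj
    (G := fun χ => K (χ ^ 2)⁻¹) (G' := fun χ => X (χ ^ 2)⁻¹ * (-(2 * χ) / (χ ^ 2) ^ 2))
    (fun χ hχ => by
      have h1 := hK _ (him χ hχ.1 hχ.2.1)
      have h2 : HasDerivAt (fun χ : ℂ => (χ ^ 2)⁻¹) (-(2 * χ) / (χ ^ 2) ^ 2) χ := by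
        have := (hasDerivAt_pow 2 χ).fun_inv (pow_ne_zero 2 (hne χ hχ.1))
        simpa using this
      exact h1.comp χ h2)
    (fun χ hχ => by
      have h1 := hball χ hχ.2.2 (hne χ hχ.1) (him χ hχ.1 hχ.2.1)
      refine Real.le_sqrt_of_sq_le ?_
      have hχ0 : 0 < ‖χ‖ := norm_pos_iff.2 (hne χ hχ.1)
      rw [norm_mul, norm_div, norm_neg, norm_mul, norm_pow, norm_pow]
      rw [norm_inv, norm_pow] at h1
      have : ‖(2 : ℂ)‖ = 2 := by simp
      rw [this]
      have e : (‖X (χ ^ 2)⁻¹‖ * (2 * ‖χ‖ / (‖χ‖ ^ 2) ^ 2)) ^ 2 =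
          4 * (‖X (χ ^ 2)⁻¹‖ ^ 2 * ((‖χ‖ ^ 2)⁻¹) ^ 3) := by field_simp; ring
      rw [e]
      linarith)
    hcl
  refine ⟨c, ?_⟩
  have hinv : Tendsto (fun z : ℂ => (starRingEnd ℂ) z⁻¹)
      (Bornology.cobounded ℂ ⊓ 𝓟 {z : ℂ | z.im < 0}) (𝓝 0) := by
    have h1 : Tendsto (fun z : ℂ => z⁻¹) (Bornology.cobounded ℂ) (𝓝 0) :=
      tendsto_inv₀_cobounded
    have h2 := (Complex.continuous_conj.tendsto 0).comp h1
    rw [map_zero] at h2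
    exact h2.mono_left inf_le_left
  have ht := tendsto_half_cpow hinv
  have hmem : ∀ z : ℂ, z.im < 0 → 0 < (((starRingEnd ℂ) z⁻¹) ^ (1 / 2 : ℂ)).re ∧
      (((starRingEnd ℂ) z⁻¹) ^ (1 / 2 : ℂ)).im < 0 := by
    intro z hz
    apply half_cpow_quadrant
    have hz0 : z ≠ 0 := by rintro rfl; simp at hz
    rw [conj_im, inv_im, neg_lt_zero]
    exact div_pos (by linarith) (normSq_pos.2 hz0)
  have ht' := (Complex.continuous_conj.tendsto 0).comp ht
  rw [map_zero] at ht'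
  have hin : Tendsto (fun z : ℂ => (starRingEnd ℂ) (((starRingEnd ℂ) z⁻¹) ^ (1 / 2 : ℂ)))
      (Bornology.cobounded ℂ ⊓ 𝓟 {z : ℂ | z.im < 0})
      (𝓝[{χ : ℂ | 0 < χ.re ∧ 0 < χ.im ∧ χ ∈ Metric.ball (0 : ℂ) δ}] 0) := by
    refine tendsto_nhdsWithin_iff.2 ⟨ht', ?_⟩
    filter_upwards [mem_inf_of_right (mem_principal_self _),
      ht'.eventually (Metric.ball_mem_nhds 0 hδ)] with z h1 h2
    obtain ⟨a, b⟩ := hmem z h1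
    exact ⟨by simpa using a, by simpa using b, h2⟩
  refine (hc.comp hin).congr fun z => ?_
  simp only [Function.comp]
  rw [← map_pow, half_cpow_sq, conj_conj, inv_inv]

namespace SlitCurve

variable (S : SlitCurve)

/-- The slit domain of a slit curve. -/
def dom : Set ℂ := slitDomain S.R

theorem isOpen_dom : IsOpen S.dom := isOpen_slitDomain S.R

/-- The differential `q dz / ((z - 1) r)`, as a function on the slit domain. -/
def form (q : ℝ[X]) (z : ℂ) : ℂ := aeval z q / ((z - 1) * S.r z)

variable {S}

theorem lower_mem_dom {z : ℂ} (hz : z.im < 0) : z ∈ S.dom := Or.inl hz.ne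

theorem neg_of_R_neg {x : ℝ} (hx : S.R.eval x < 0) : x < 0 := by
  rcases lt_trichotomy x 0 with h | h | h
  · exact h
  · rw [h, S.R_zero] at hx; exact absurd hx (lt_irrefl _)
  · linarith [S.R_pos x h]

theorem mem_dom_imp {z : ℂ} (hz : z ∈ S.dom) : z.im ≠ 0 ∨ z.re < 0 :=
  hz.imp id neg_of_R_neg

theorem ne_one_of_mem {z : ℂ} (hz : z ∈ S.dom) : z ≠ 1 := by
  rintro rfl
  rcases mem_dom_imp hz with h | h
  · simp at h
  · norm_num at h

theorem ne_zero_of_mem {z : ℂ} (hz : z ∈ S.dom) : z ≠ 0 := by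
  rintro rfl
  rcases mem_dom_imp hz with h | h
  · simp at h
  · norm_num at h

theorem r_ne_zero {z : ℂ} (hz : z ∈ S.dom) : S.r z ≠ 0 := fun h =>
  S.ne_zero z hz (by rw [← S.r_sq, h]; simp)

theorem norm_r_sq (z : ℂ) : ‖S.r z‖ ^ 2 = ‖aeval z S.R‖ := by rw [← norm_pow, S.r_sq]

theorem form_differentiableOn (q : ℝ[X]) : DifferentiableOn ℂ (S.form q) S.dom := by
  intro z hz
  refine DifferentiableAt.differentiableWithinAt ?_
  have h1 := S.r_diff z hz
  have h2 := (aeval_differentiable q) z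
  refine h2.div ((differentiableAt_id.sub_const 1).mul h1) ?_
  exact mul_ne_zero (sub_ne_zero.2 (ne_one_of_mem hz)) (r_ne_zero hz)

theorem form_conj (q : ℝ[X]) {z : ℂ} (hz : z ∈ S.dom) :
    S.form q ((starRingEnd ℂ) z) = -(starRingEnd ℂ) (S.form q z) := by
  simp only [form, aeval_conj_eq, S.r_conj z hz, map_div₀, map_mul, map_sub, map_one]
  rw [mul_neg, div_neg]

theorem norm_form_sq (q : ℝ[X]) (z : ℂ) :
    ‖S.form q z‖ ^ 2 = ‖aeval z q‖ ^ 2 / (‖z - 1‖ ^ 2 * ‖aeval z S.R‖) := by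
  rw [form, norm_div, norm_mul, div_pow, mul_pow, norm_r_sq]

theorem exists_factor (x₀ : ℝ) : ∃ R₁ : ℝ[X], R₁.eval x₀ ≠ 0 ∧
    ((S.R.eval x₀ ≠ 0 ∧ S.R = R₁) ∨ (S.R.eval x₀ = 0 ∧ S.R = (X - C x₀) * R₁)) := by
  by_cases h : S.R.eval x₀ = 0
  · obtain ⟨R₁, hR₁⟩ := dvd_iff_isRoot.2 h
    refine ⟨R₁, fun h0 => S.simple x₀ h ?_, Or.inr ⟨h, hR₁⟩⟩
    rw [hR₁, derivative_mul]
    simp [h0]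
  · exact ⟨S.R, h, Or.inl ⟨h, rfl⟩⟩

theorem form_bound (q : ℝ[X]) {x₀ : ℝ} (hx₀ : x₀ ≠ 1) :
    ∃ C, ∀ᶠ z in 𝓝 (x₀ : ℂ), z ∈ S.dom → ‖S.form q z‖ ^ 2 * ‖z - x₀‖ ≤ C := by
  obtain ⟨R₁, hR₁, hR⟩ := S.exists_factor x₀
  have hR₁' : ‖aeval (x₀ : ℂ) R₁‖ ≠ 0 := by
    rw [aeval_ofReal_eq]; simpa using hR₁
  have h1 : ‖(x₀ : ℂ) - 1‖ ≠ 0 := by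
    rw [norm_ne_zero_iff, sub_ne_zero]; exact_mod_cast hx₀
  have cq := fun p : ℝ[X] => (aeval_continuous p).norm.continuousAt (x := (x₀ : ℂ))
  have c1 : ContinuousAt (fun z : ℂ => ‖z - 1‖ ^ 2) (x₀ : ℂ) := by fun_prop
  have cz : ContinuousAt (fun z : ℂ => ‖z - x₀‖) (x₀ : ℂ) := by fun_prop
  have hF : ContinuousAt (fun z : ℂ => ‖aeval z q‖ ^ 2 / (‖z - 1‖ ^ 2 * ‖aeval z R₁‖))
      (x₀ : ℂ) := ((cq q).pow 2).div (c1.mul (cq R₁)) (mul_ne_zero (pow_ne_zero 2 h1) hR₁')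
  rcases hR with ⟨-, hR⟩ | ⟨-, hR⟩
  · have := (hF.mul cz).eventually (gt_mem_nhds (lt_add_one _))
    refine ⟨‖aeval (x₀ : ℂ) q‖ ^ 2 / (‖(x₀ : ℂ) - 1‖ ^ 2 * ‖aeval (x₀ : ℂ) R₁‖) *
      ‖(x₀ : ℂ) - x₀‖ + 1, this.mono fun z hz _ => ?_⟩
    rw [norm_form_sq, hR]
    exact hz.le
  · have := hF.eventually (gt_mem_nhds (lt_add_one _))
    refine ⟨‖aeval (x₀ : ℂ) q‖ ^ 2 / (‖(x₀ : ℂ) - 1‖ ^ 2 * ‖aeval (x₀ : ℂ) R₁‖) + 1,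
      this.mono fun z hz hzd => ?_⟩
    have hne := S.ne_zero z hzd
    rw [hR, map_mul, map_sub, aeval_X, aeval_C] at hne
    have hzx : ‖z - x₀‖ ≠ 0 := norm_ne_zero_iff.2 (left_ne_zero_of_mul hne)
    refine le_trans (le_of_eq ?_) hz.le
    rw [norm_form_sq, hR, map_mul, map_sub, aeval_X, aeval_C, norm_mul]
    simp only [coe_algebraMap]
    have : ‖aeval z R₁‖ ≠ 0 := norm_ne_zero_iff.2 (right_ne_zero_of_mul hne)
    have : ‖z - 1‖ ≠ 0 := norm_ne_zero_iff.2 (sub_ne_zero.2 (ne_one_of_mem hzd))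
    field_simp

theorem aeval_reflect (p : ℝ[X]) {N : ℕ} (hN : p.natDegree ≤ N) {z : ℂ} (hz : z ≠ 0) :
    aeval z p = aeval z⁻¹ (reflect N p) * z ^ N := by
  let _ := invertibleOfNonzero hz
  have := eval₂_reflect_mul_pow (algebraMap ℝ ℂ) z N p hN
  rw [invOf_eq_inv] at this
  exact this.symm

theorem form_bound_infty {q : ℝ[X]} (hq : q.natDegree ≤ S.genus) :
    ∃ C, ∀ᶠ z in Bornology.cobounded ℂ, z ∈ S.dom → ‖S.form q z‖ ^ 2 * ‖z‖ ^ 3 ≤ C := by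
  set P := reflect (2 * S.genus + 1) S.R with hP
  set Q := reflect S.genus q with hQ
  have hP0 : ‖aeval (0 : ℂ) P‖ ≠ 0 := by
    rw [← ofReal_zero, aeval_ofReal_eq, ← coeff_zero_eq_eval_zero, hP, coeff_reflect]
    have hR0 : S.R ≠ 0 := by
      intro h
      have := S.R_pos 1 one_pos
      simp [h] at this
    rw [revAt_le (Nat.zero_le _), Nat.sub_zero, ← S.natDegree_R]
    simpa using hR0
  have hF : ContinuousAt (fun w : ℂ => ‖aeval w Q‖ ^ 2 / (‖1 - w‖ ^ 2 * ‖aeval w P‖)) 0 := by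
    have cq := fun p : ℝ[X] => (aeval_continuous p).norm.continuousAt (x := (0 : ℂ))
    have c1 : ContinuousAt (fun z : ℂ => ‖1 - z‖ ^ 2) 0 := by fun_prop
    exact ((cq Q).pow 2).div (c1.mul (cq P)) (mul_ne_zero (by simp) hP0)
  have h1 : Tendsto (fun z : ℂ => z⁻¹) (Bornology.cobounded ℂ) (𝓝 0) := tendsto_inv₀_cobounded
  have := h1.eventually (hF.eventually (gt_mem_nhds (lt_add_one _)))
  refine ⟨‖aeval (0 : ℂ) Q‖ ^ 2 / (‖1 - (0 : ℂ)‖ ^ 2 * ‖aeval (0 : ℂ) P‖) + 1,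
    this.mono fun z hz hzd => ?_⟩
  refine le_trans (le_of_eq ?_) hz.le
  have hz0 := ne_zero_of_mem hzd
  have hzn : ‖z‖ ≠ 0 := norm_ne_zero_iff.2 hz0
  have hR := S.ne_zero z hzd
  rw [norm_form_sq, aeval_reflect q hq hz0, aeval_reflect S.R S.natDegree_R.le hz0]
  rw [aeval_reflect S.R S.natDegree_R.le hz0] at hR
  have hPz : ‖aeval z⁻¹ P‖ ≠ 0 := norm_ne_zero_iff.2 (left_ne_zero_of_mul hR)
  have hz1 : z - 1 = z * (1 - z⁻¹) := by field_simp
  have hz1' : ‖1 - z⁻¹‖ ≠ 0 := by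
    rw [norm_ne_zero_iff]
    intro h0
    rw [h0, mul_zero] at hz1
    exact ne_one_of_mem hzd (sub_eq_zero.1 hz1)
  rw [hz1]
  simp only [norm_mul, norm_pow, ← hP, ← hQ]
  field_simp
  ring

end SlitCurve

/-- The folding of the plane onto the closed lower half-plane. -/
def fold (z : ℂ) : ℂ := ⟨z.re, -|z.im|⟩

theorem continuous_fold : Continuous fold := by
  have : fold = fun z => (z.re : ℂ) + ((-|z.im| : ℝ) : ℂ) * I := by
    ext z; apply Complex.ext <;> simp [fold]
  rw [this]
  exact (continuous_ofReal.comp continuous_re).add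
    ((continuous_ofReal.comp continuous_im.abs.neg).mul continuous_const)

theorem fold_im_nonpos (z : ℂ) : (fold z).im ≤ 0 := by simp [fold]

theorem fold_of_im_nonpos {z : ℂ} (hz : z.im ≤ 0) : fold z = z :=
  Complex.ext rfl (by simp [fold, abs_of_nonpos hz])

theorem fold_of_im_nonneg {z : ℂ} (hz : 0 ≤ z.im) : fold z = (starRingEnd ℂ) z :=
  Complex.ext rfl (by simp [fold, abs_of_nonneg hz])

theorem fold_conj (z : ℂ) : fold ((starRingEnd ℂ) z) = fold z :=
  Complex.ext rfl (by simp [fold])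

theorem norm_fold (z : ℂ) : ‖fold z‖ = ‖z‖ := by
  rcases le_total z.im 0 with h | h
  · rw [fold_of_im_nonpos h]
  · rw [fold_of_im_nonneg h, norm_conj]

theorem fold_ne_one {z : ℂ} (hz : z ≠ 1) : fold z ≠ 1 := by
  rcases le_total z.im 0 with h | h
  · rwa [fold_of_im_nonpos h]
  · rw [fold_of_im_nonneg h]
    intro h1
    exact hz (by rw [← conj_conj z, h1, map_one])

theorem mem_closure_lower {z : ℂ} (hz : z.im ≤ 0) : z ∈ closure {z : ℂ | z.im < 0} := by
  rw [Complex.closure_setOfPred_im_lt]; exact hz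

namespace SlitCurve

variable {S : SlitCurve}

theorem exists_boundary_value {q : ℝ[X]} {K : ℂ → ℂ}
    (hK : ∀ z ∈ {z : ℂ | z.im < 0}, HasDerivAt K (S.form q z) z) {z : ℂ} (hz : z.im ≤ 0)
    (hz1 : z ≠ 1) : ∃ c, Tendsto (fun z => (K z).im) (𝓝[{z : ℂ | z.im < 0}] z) (𝓝 c) := by
  rcases hz.lt_or_eq with h | h
  · exact ⟨_, (continuous_im.continuousAt.comp (hK z h).continuousAt).tendsto.mono_left inf_le_left⟩
  · have hzr : z = (z.re : ℂ) := Complex.ext rfl (by simp [h])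
    have hx : z.re ≠ 1 := by
      intro h1
      rw [h1] at hzr
      exact hz1 (by simpa using hzr)
    obtain ⟨C, hC⟩ := form_bound (S := S) q hx
    obtain ⟨c, hc⟩ := exists_trace (x₀ := z.re) hK
      (hC.mono fun w hw hwi => hw (lower_mem_dom hwi))
    rw [← hzr] at hc
    exact ⟨_, (continuous_im.tendsto c).comp hc⟩

theorem local_primitive {q : ℝ[X]} {K : ℂ → ℂ}
    (hK : ∀ z ∈ {z : ℂ | z.im < 0}, HasDerivAt K (S.form q z) z) {x : ℂ} (hx : x ∈ S.dom)
    (hxi : x.im = 0) : ∃ δ > 0, ∃ (T : ℂ → ℂ) (c : ℝ),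
      (∀ z ∈ Metric.ball x δ, HasDerivAt T (S.form q z) z) ∧
      (∀ z ∈ Metric.ball x δ, z.im < 0 → (K z).im = (T z).im + c) ∧
      (∀ z ∈ Metric.ball x δ, (starRingEnd ℂ) z ∈ Metric.ball x δ ∧
        (T ((starRingEnd ℂ) z)).im = (T z).im) := by
  obtain ⟨δ, hδ, hb⟩ := Metric.isOpen_iff.1 S.isOpen_dom x hx
  obtain ⟨T, hT⟩ := exists_primitive (convex_ball x δ) Metric.isOpen_ball
    ((form_differentiableOn q).mono hb)
  obtain ⟨c, hc⟩ := eq_const_of_hasDerivAt_zero (f := fun z => K z - T z)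
    ((convex_ball x δ).inter convex_lower) (Metric.isOpen_ball.inter isOpen_lower)
    (fun z hz => by simpa using (hK z hz.2).fun_sub (hT z hz.1))
  have hxc : (starRingEnd ℂ) x = x := Complex.ext rfl (by simp [hxi])
  have hcb : ∀ z ∈ Metric.ball x δ, (starRingEnd ℂ) z ∈ Metric.ball x δ := by
    intro z hz
    rw [mem_ball_iff_norm] at hz ⊢
    rw [← norm_conj, map_sub, conj_conj, hxc]
    exact hz
  obtain ⟨d, hd⟩ := eq_const_of_hasDerivAt_zero
    (f := fun z => T z + (starRingEnd ℂ) (T ((starRingEnd ℂ) z)))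
    (convex_ball x δ) Metric.isOpen_ball
    (fun z hz => by
      have h1 := (hT _ (hcb z hz)).conj_conj
      rw [conj_conj, form_conj q (hb hz), map_neg, conj_conj] at h1
      have := (hT z hz).add h1
      rwa [add_neg_cancel] at this)
  have hdi : d.im = 0 := by
    rw [← hd x (Metric.mem_ball_self hδ), hxc]; simp
  refine ⟨δ, hδ, T, c.im, hT, fun z hz hzi => ?_, fun z hz => ⟨hcb z hz, ?_⟩⟩
  · rw [← hc z ⟨hz, hzi⟩]; simp
  · have := congrArg Complex.im (hd z hz)
    rw [hdi] at this
    simp at this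
    linarith

/-- For a polynomial `q` of degree at most the genus, the imaginary part of the primitive of
`q dz / ((z - 1) r)`, normalised at infinity, as a function on the punctured plane. -/
theorem exists_harmonic {q : ℝ[X]} (hq : q.natDegree ≤ S.genus) :
    ∃ y : ℂ → ℝ, ContinuousOn y {1}ᶜ ∧ (∀ z, y ((starRingEnd ℂ) z) = y z) ∧
      (∀ z ∈ S.dom, HasFDerivAt y (imForm (S.form q z)) z) ∧
      Tendsto y (Bornology.cobounded ℂ) (𝓝 0) := by
  obtain ⟨K, hK⟩ := exists_primitive convex_lower isOpen_lower
    ((form_differentiableOn (S := S) q).mono fun z hz => lower_mem_dom hz)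
  obtain ⟨C, hC⟩ := form_bound_infty (S := S) hq
  obtain ⟨kinf, hkinf⟩ := exists_trace_infty hK (hC.mono fun z hz hzi => hz (lower_mem_dom hzi))
  set Lo : Set ℂ := {z : ℂ | z.im < 0} with hLo
  set y₀ : ℂ → ℝ := extendFrom Lo fun z => (K z).im with hy₀
  have htr : ∀ z : ℂ, z.im ≤ 0 → z ≠ 1 → Tendsto (fun z => (K z).im) (𝓝[Lo] z) (𝓝 (y₀ z)) :=
    fun z hz hz1 => tendsto_extendFrom (exists_boundary_value hK hz hz1)
  have hcont : ContinuousOn y₀ {z : ℂ | z.im ≤ 0 ∧ z ≠ 1} :=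
    continuousOn_extendFrom (fun z hz => mem_closure_lower hz.1)
      fun z hz => exists_boundary_value hK hz.1 hz.2
  have hlow : ∀ z : ℂ, z.im < 0 → y₀ z = (K z).im := fun z hz =>
    extendFrom_eq (mem_closure_lower hz.le)
      ((continuous_im.continuousAt.comp (hK z hz).continuousAt).tendsto.mono_left inf_le_left)
  refine ⟨fun z => y₀ (fold z) - kinf.im, ?_, fun z => by simp only [fold_conj], ?_, ?_⟩
  · refine ContinuousOn.sub (hcont.comp continuous_fold.continuousOn fun z hz => ?_)
      continuousOn_const
    exact ⟨fold_im_nonpos z, fold_ne_one hz⟩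
  · intro z hz
    rcases lt_trichotomy z.im 0 with h | h | h
    · refine ((hasFDerivAt_im (hK z h)).sub_const kinf.im).congr_of_eventuallyEq ?_
      filter_upwards [isOpen_lower.mem_nhds h] with w hw
      rw [fold_of_im_nonpos (le_of_lt hw), hlow w hw]
    · obtain ⟨δ, hδ, T, c, hT, hTK, hTc⟩ := local_primitive hK hz h
      refine ((hasFDerivAt_im (hT z (Metric.mem_ball_self hδ))).add_const
        (c - kinf.im)).congr_of_eventuallyEq ?_
      have key : ∀ w ∈ Metric.ball z δ, w.im ≤ 0 → y₀ w = (T w).im + c := by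
        intro w hw hwi
        rcases hwi.lt_or_eq with h1 | h1
        · rw [hlow w h1, hTK w hw h1]
        · refine extendFrom_eq (mem_closure_lower hwi) ?_
          have hc := (continuous_im.continuousAt.comp (hT w hw).continuousAt).add
            (continuousAt_const (y := c))
          refine (hc.tendsto.mono_left inf_le_left).congr' ?_
          filter_upwards [self_mem_nhdsWithin,
            mem_nhdsWithin_of_mem_nhds (Metric.isOpen_ball.mem_nhds hw)] with v hv1 hv2
          exact (hTK v hv2 hv1).symm
      filter_upwards [Metric.ball_mem_nhds z hδ] with w hw
      rcases le_total w.im 0 with h1 | h1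
      · rw [fold_of_im_nonpos h1, key w hw h1]; ring
      · rw [fold_of_im_nonneg h1, key _ (hTc w hw).1 (by simpa using h1), (hTc w hw).2]; ring
    · have hzc : ((starRingEnd ℂ) z).im < 0 := by simpa using h
      have h1 := (hK _ hzc).conj_conj.neg
      rw [conj_conj, form_conj q hz, map_neg, conj_conj, neg_neg] at h1
      refine ((hasFDerivAt_im h1).sub_const kinf.im).congr_of_eventuallyEq ?_
      have ho : IsOpen {z : ℂ | 0 < z.im} := isOpen_lt continuous_const continuous_im
      filter_upwards [ho.mem_nhds h] with w hw
      have hw' : 0 < w.im := hw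
      rw [fold_of_im_nonneg hw'.le, hlow _ (by simpa using hw')]
      simp
  · rw [Metric.tendsto_nhds]
    intro e he
    have h1 := ((continuous_im.tendsto kinf).comp hkinf).eventually
      (Metric.ball_mem_nhds kinf.im (half_pos he))
    rw [eventually_inf_principal] at h1
    obtain ⟨M, -, hM⟩ := hasBasis_cobounded_norm.mem_iff.1 h1
    refine hasBasis_cobounded_norm.mem_iff.2 ⟨max M 1 + 1, trivial, fun z hz => ?_⟩
    have hz' : max M 1 + 1 ≤ ‖fold z‖ := by rw [norm_fold]; exact hz
    have hne : fold z ≠ 1 := by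
      intro h
      rw [h, norm_one] at hz'
      linarith [le_max_right M 1]
    have h2 := htr (fold z) (fold_im_nonpos z) hne
    have hnb : (𝓝[Lo] (fold z)).NeBot :=
      mem_closure_iff_nhdsWithin_neBot.1 (mem_closure_lower (fold_im_nonpos z))
    have h3 : |y₀ (fold z) - kinf.im| ≤ e / 2 := by
      refine le_of_tendsto ((h2.sub_const kinf.im).abs) ?_
      have hlt : M < ‖fold z‖ := by linarith [le_max_left M 1]
      filter_upwards [self_mem_nhdsWithin,
        mem_nhdsWithin_of_mem_nhds (continuous_norm.continuousAt.eventually (lt_mem_nhds hlt))]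
        with w hw1 hw2
      have := hM (le_of_lt hw2) hw1
      exact le_of_lt (by simpa [Real.dist_eq] using this)
    show dist (y₀ (fold z) - kinf.im) 0 < e
    rw [Real.dist_eq, sub_zero]
    linarith

end SlitCurve

theorem conj_mem_ball_real {z : ℂ} {x δ : ℝ} (hz : z ∈ Metric.ball (x : ℂ) δ) :
    (starRingEnd ℂ) z ∈ Metric.ball (x : ℂ) δ := by
  rw [mem_ball_iff_norm] at hz ⊢
  rw [← norm_conj, map_sub, conj_conj, conj_ofReal]
  exact hz

theorem conj_mem_ball_zero {z : ℂ} {δ : ℝ} (hz : z ∈ Metric.ball (0 : ℂ) δ) :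
    (starRingEnd ℂ) z ∈ Metric.ball (0 : ℂ) δ := by
  rw [mem_ball_zero_iff] at hz ⊢
  rwa [norm_conj]

/-- The upper half of a disc around `0`. -/
def halfDisc (ε : ℝ) : Set ℂ := {χ : ℂ | 0 < χ.im} ∩ Metric.ball 0 ε

theorem convex_halfDisc (ε : ℝ) : Convex ℝ (halfDisc ε) :=
  (convex_halfSpace_im_gt 0).inter (convex_ball _ _)

theorem isOpen_halfDisc (ε : ℝ) : IsOpen (halfDisc ε) :=
  (isOpen_lt continuous_const continuous_im).inter Metric.isOpen_ball

/-- The principal square root of a real polynomial near a real point where it is positive. -/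
theorem sqrt_poly (u : ℝ[X]) {x₀ : ℝ} (hu : 0 < u.eval x₀) :
    ∃ δ > 0, ∃ h : ℂ → ℂ, DifferentiableOn ℂ h (Metric.ball (x₀ : ℂ) δ) ∧
      (∀ z ∈ Metric.ball (x₀ : ℂ) δ, h ((starRingEnd ℂ) z) = (starRingEnd ℂ) (h z)) ∧
      (∀ z ∈ Metric.ball (x₀ : ℂ) δ, 0 < (h z).re) ∧ (∀ z, h z ^ 2 = aeval z u) ∧
      h x₀ = (√(u.eval x₀) : ℝ) := by
  have hc : ContinuousAt (fun z : ℂ => (aeval z u).re) (x₀ : ℂ) :=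
    (continuous_re.comp (aeval_continuous u)).continuousAt
  have h0 : (aeval (x₀ : ℂ) u).re = u.eval x₀ := by rw [aeval_ofReal_eq, ofReal_re]
  obtain ⟨δ, hδ, hb⟩ := Metric.eventually_nhds_iff_ball.1
    (hc.eventually (lt_mem_nhds (show 0 < (aeval (x₀ : ℂ) u).re by rwa [h0])))
  have hs : ∀ z ∈ Metric.ball (x₀ : ℂ) δ, aeval z u ∈ slitPlane := fun z hz => Or.inl (hb z hz)
  refine ⟨δ, hδ, fun z => aeval z u ^ (1 / 2 : ℂ), fun z hz => ?_, fun z hz => ?_,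
    fun z hz => ?_, fun z => half_cpow_sq _, ?_⟩
  · exact ((aeval_differentiable u z).cpow_const (hs z hz)).differentiableWithinAt
  · have h1 := cpow_conj (aeval ((starRingEnd ℂ) z) u) (1 / 2)
      (mem_slitPlane_iff_arg.1 (hs _ (conj_mem_ball_real hz))).1
    have h2 : (starRingEnd ℂ) (1 / 2 : ℂ) = 1 / 2 := by
      rw [map_div₀, map_one, map_ofNat]
    rw [h2] at h1
    show aeval ((starRingEnd ℂ) z) u ^ (1 / 2 : ℂ) = _
    rw [h1, aeval_conj_eq, conj_conj]
  · have hne : aeval z u ≠ 0 := slitPlane_ne_zero (hs z hz)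
    show 0 < (aeval z u ^ (1 / 2 : ℂ)).re
    rw [cpow_def_of_ne_zero hne, exp_re]
    have e1 : (log (aeval z u) * (1 / 2)).im = (aeval z u).arg / 2 := by
      rw [mul_im, log_im]; simp; ring
    rw [e1]
    have h1 := neg_pi_lt_arg (aeval z u)
    have h2 := (arg_le_pi (aeval z u))
    have h3 := (mem_slitPlane_iff_arg.1 (hs z hz)).1
    exact mul_pos (Real.exp_pos _) (Real.cos_pos_of_mem_Ioo ⟨by linarith, by
      have := lt_of_le_of_ne h2 h3; linarith⟩)
  · show aeval (x₀ : ℂ) u ^ (1 / 2 : ℂ) = _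
    rw [aeval_ofReal_eq, Real.sqrt_eq_rpow, ofReal_cpow hu.le]
    simp

/-- A local coordinate of the curve `r² = R(z)` at a real point, in which the slit domain is the
upper half-plane. -/
structure Chart (S : SlitCurve) (x₀ r₀ : ℝ) where
  /-- The radius. -/
  ε : ℝ
  ε_pos : 0 < ε
  /-- The coordinate `z`. -/
  Z : ℂ → ℂ
  /-- The coordinate `r`. -/
  ρ : ℂ → ℂ
  /-- The quotient of `dz` by `r`. -/
  j : ℂ → ℂ
  /-- The inverse. -/
  inv : ℂ × ℂ → ℂ
  Z_zero : Z 0 = x₀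
  ρ_zero : ρ 0 = r₀
  Z_conj : ∀ χ ∈ Metric.ball 0 ε, Z ((starRingEnd ℂ) χ) = (starRingEnd ℂ) (Z χ)
  ρ_conj : ∀ χ ∈ Metric.ball 0 ε, ρ ((starRingEnd ℂ) χ) = (starRingEnd ℂ) (ρ χ)
  j_conj : ∀ χ ∈ Metric.ball 0 ε, j ((starRingEnd ℂ) χ) = (starRingEnd ℂ) (j χ)
  ρ_sq : ∀ χ ∈ Metric.ball 0 ε, ρ χ ^ 2 = aeval (Z χ) S.R
  hasDerivAt : ∀ χ ∈ Metric.ball 0 ε, HasDerivAt Z (j χ * ρ χ) χ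
  ρ_diff : DifferentiableOn ℂ ρ (Metric.ball 0 ε)
  j_diff : DifferentiableOn ℂ j (Metric.ball 0 ε)
  j_ne : ∀ χ ∈ Metric.ball 0 ε, j χ ≠ 0
  mem_dom : ∀ χ ∈ halfDisc ε, Z χ ∈ S.dom ∧ S.r (Z χ) = ρ χ
  inv_cont : ContinuousAt inv ((x₀ : ℂ), (r₀ : ℂ))
  inv_left : ∀ χ ∈ Metric.ball 0 ε, inv (Z χ, ρ χ) = χ
  inv_right : ∀ᶠ p in 𝓝 ((x₀ : ℂ), (r₀ : ℂ)), p.2 ^ 2 = aeval p.1 S.R →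
    Z (inv p) = p.1 ∧ ρ (inv p) = p.2

theorem exists_chart_of_ne (S : SlitCurve) {x₀ r₀ : ℝ} (h : r₀ ^ 2 = S.R.eval x₀) (hr : r₀ ≠ 0) :
    ∃ (c : Chart S x₀ r₀) (σ : ℝ), (σ = 1 ∨ σ = -1) ∧ (∀ χ, c.Z χ = x₀ + σ * χ) ∧
      (∀ χ ∈ Metric.ball 0 c.ε, c.j χ = σ / c.ρ χ) ∧ (0 < x₀ → 0 < r₀ → σ = -1) := by
  have hpos : 0 < S.R.eval x₀ := h ▸ by positivity
  obtain ⟨δ, hδ, f, hfd, hfc, hfp, hfs, hf0⟩ := sqrt_poly S.R hpos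
  obtain ⟨s, hs, hsr⟩ : ∃ s : ℝ, (s = 1 ∨ s = -1) ∧ s * √(S.R.eval x₀) = r₀ := by
    rw [← h, Real.sqrt_sq_eq_abs]
    rcases abs_cases r₀ with ⟨h1, -⟩ | ⟨h1, -⟩
    · exact ⟨1, Or.inl rfl, by rw [h1, one_mul]⟩
    · exact ⟨-1, Or.inr rfl, by rw [h1]; ring⟩
  have hs2 : (s : ℂ) ^ 2 = 1 := by rcases hs with rfl | rfl <;> norm_num
  set B := Metric.ball (x₀ : ℂ) δ with hB
  set Lo := {z : ℂ | z.im < 0} ∩ B with hLo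
  have hfne : ∀ z ∈ B, (s : ℂ) * f z ≠ 0 := by
    intro z hz h0
    have : f z ≠ 0 := fun h1 => by have := hfp z hz; rw [h1] at this; simp at this
    rcases mul_eq_zero.1 h0 with h2 | h2
    · rw [h2] at hs2; norm_num at hs2
    · exact this h2
  have hdich := IsPreconnected.eq_or_eq_neg_of_sq_eq (S := Lo) (f := S.r) (g := fun z => s * f z)
    (convex_lower.inter (convex_ball _ _)).isPreconnected
    (fun z hz => (S.r_diff z (SlitCurve.lower_mem_dom hz.1)).continuousAt.continuousWithinAt)
    (continuousOn_const.mul (hfd.continuousOn.mono fun z hz => hz.2))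
    (fun z hz => by
      simp only [Pi.pow_apply]
      rw [S.r_sq, mul_pow, hfs, hs2, one_mul])
    (fun {z} hz => hfne z hz.2)
  have hup : ∀ z, 0 < z.im → z ∈ B → (starRingEnd ℂ) z ∈ Lo := fun z hz hzB =>
    ⟨by simpa using hz, conj_mem_ball_real hzB⟩
  obtain ⟨σ, hσ, hσ1, hσ2⟩ : ∃ σ : ℝ, (σ = 1 ∨ σ = -1) ∧
      (∀ z ∈ B, 0 < σ * z.im → S.r z = s * f z) ∧ (0 < x₀ → 0 < r₀ → σ = -1) := by
    rcases hdich with hd | hd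
    · refine ⟨-1, Or.inr rfl, fun z hz hzi => hd ⟨?_, hz⟩, fun _ _ => rfl⟩
      show z.im < 0
      linarith
    · refine ⟨1, Or.inl rfl, fun z hz hzi => ?_, fun hx hr0 => ?_⟩
      · have hzi' : 0 < z.im := by linarith
        have h1 := hd (hup z hzi' hz)
        have h2 := S.r_conj _ (SlitCurve.lower_mem_dom (hup z hzi' hz).1)
        rw [conj_conj, h1] at h2
        rw [h2]
        simp [hfc z hz]
      · exfalso
        have h1 := S.r_re_pos x₀ hx
        have hs1 : s = 1 := by
          rcases hs with h3 | h3
          · exact h3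
          · rw [h3] at hsr
            have := Real.sqrt_nonneg (S.R.eval x₀)
            linarith
        have hne : (𝓝[{z : ℂ | z.im < 0}] (x₀ : ℂ)).NeBot :=
          mem_closure_iff_nhdsWithin_neBot.1 (mem_closure_lower (by simp))
        obtain ⟨z, hz1, hz2, hz3⟩ := (h1.and (eventually_mem_nhdsWithin.and
          (eventually_nhdsWithin_of_eventually_nhds
            (show ∀ᶠ z in 𝓝 (x₀ : ℂ), z ∈ B from Metric.ball_mem_nhds _ hδ)))).exists
        have h4 := hd ⟨hz2, hz3⟩
        have h5 := hfp z hz3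
        rw [h4, hs1] at hz1
        simp at hz1
        linarith
  have hσ2' : (σ : ℂ) * σ = 1 := by rcases hσ with rfl | rfl <;> norm_num
  have hσn : ‖(σ : ℂ)‖ = 1 := by rcases hσ with rfl | rfl <;> simp
  have hmap : ∀ χ ∈ Metric.ball (0 : ℂ) δ, (x₀ : ℂ) + σ * χ ∈ B := by
    intro χ hχ
    rw [hB, mem_ball_iff_norm, add_sub_cancel_left, norm_mul, hσn, one_mul]
    exact mem_ball_zero_iff.1 hχ
  have hlin : ∀ χ : ℂ, HasDerivAt (fun χ : ℂ => (x₀ : ℂ) + σ * χ) σ χ := fun χ => by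
    simpa using ((hasDerivAt_id χ).const_mul (σ : ℂ)).const_add (x₀ : ℂ)
  have hρd : DifferentiableOn ℂ (fun χ : ℂ => (s : ℂ) * f (x₀ + σ * χ)) (Metric.ball 0 δ) :=
    (hfd.comp (fun χ _ => (hlin χ).differentiableAt.differentiableWithinAt) hmap).const_mul _
  have hZc : ∀ χ : ℂ, (x₀ : ℂ) + σ * (starRingEnd ℂ) χ = (starRingEnd ℂ) ((x₀ : ℂ) + σ * χ) :=
    fun χ => by simp
  have hρc : ∀ χ ∈ Metric.ball (0 : ℂ) δ, (s : ℂ) * f (x₀ + σ * (starRingEnd ℂ) χ) =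
      (starRingEnd ℂ) ((s : ℂ) * f (x₀ + σ * χ)) := fun χ hχ => by
    rw [hZc, hfc _ (hmap χ hχ)]; simp
  have hρ0 : (s : ℂ) * f (x₀ + σ * 0) = r₀ := by
    rw [mul_zero, add_zero, hf0, ← hsr]; simp
  refine ⟨{ ε := δ, ε_pos := hδ, Z := fun χ => x₀ + σ * χ, ρ := fun χ => s * f (x₀ + σ * χ)
            j := fun χ => σ / (s * f (x₀ + σ * χ)), inv := fun p => σ * (p.1 - x₀)
            Z_zero := by simp
            ρ_zero := hρ0
            Z_conj := fun χ _ => hZc χ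
            ρ_conj := hρc
            j_conj := fun χ hχ => by simp only [hρc χ hχ, map_div₀, conj_ofReal]
            ρ_sq := fun χ _ => by rw [mul_pow, hfs, hs2, one_mul]
            hasDerivAt := fun χ hχ => by
              rw [div_mul_cancel₀ _ (hfne _ (hmap χ hχ))]; exact hlin χ
            ρ_diff := hρd
            j_diff := (differentiableOn_const _).div hρd fun χ hχ => hfne _ (hmap χ hχ)
            j_ne := fun χ hχ => div_ne_zero (fun h0 => by simp [h0] at hσn) (hfne _ (hmap χ hχ))
            mem_dom := fun χ hχ => ?_
            inv_cont := by fun_prop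
            inv_left := fun χ _ => by
              show (σ : ℂ) * (x₀ + σ * χ - x₀) = χ
              rw [add_sub_cancel_left, ← mul_assoc, hσ2', one_mul]
            inv_right := ?_ }, σ, hσ, fun χ => rfl, fun χ _ => rfl, hσ2⟩
  · have hi : ((x₀ : ℂ) + σ * χ).im = σ * χ.im := by simp
    have h0 : 0 < χ.im := hχ.1
    have hσσ : σ * σ = 1 := by exact_mod_cast hσ2'
    refine ⟨Or.inl ?_, hσ1 _ (hmap χ hχ.2) ?_⟩
    · rw [hi]
      exact mul_ne_zero (by rintro rfl; simp at hσn) h0.ne'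
    · rw [hi, ← mul_assoc, hσσ, one_mul]; exact h0
  · have hZinv : ∀ z : ℂ, (x₀ : ℂ) + σ * (σ * (z - x₀)) = z := fun z => by
      rw [← mul_assoc, hσ2', one_mul, add_sub_cancel]
    have hcont : ContinuousAt (fun p : ℂ × ℂ => p.2 + s * f p.1) ((x₀ : ℂ), (r₀ : ℂ)) := by
      have : ContinuousAt f (x₀ : ℂ) :=
        (hfd.differentiableAt (Metric.ball_mem_nhds _ hδ)).continuousAt
      exact continuousAt_snd.add (continuousAt_const.mul
        (ContinuousAt.comp (x := ((x₀ : ℂ), (r₀ : ℂ))) this continuousAt_fst))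
    have hne : (r₀ : ℂ) + s * f x₀ ≠ 0 := by
      have : (s : ℂ) * f x₀ = r₀ := by rw [hf0, ← hsr]; simp
      rw [this, ← two_mul]
      exact mul_ne_zero two_ne_zero (by exact_mod_cast hr)
    filter_upwards [hcont.eventually_ne hne] with p hp hpe
    simp only [hZinv]
    refine ⟨trivial, ?_⟩
    have : (p.2 - s * f p.1) * (p.2 + s * f p.1) = 0 := by
      linear_combination hpe - (s : ℂ) ^ 2 * hfs p.1 - aeval p.1 S.R * hs2
    rcases mul_eq_zero.1 this with h1 | h1
    · exact (sub_eq_zero.1 h1).symm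
    · exact absurd h1 hp

theorem exists_chart_of_eq (S : SlitCurve) {x₀ : ℝ} (h : S.R.eval x₀ = 0) :
    Nonempty (Chart S x₀ 0) := by
  obtain ⟨R₁, hR₁, hR⟩ := S.exists_factor x₀
  replace hR : S.R = (X - C x₀) * R₁ := by
    rcases hR with ⟨h1, -⟩ | ⟨-, h1⟩
    · exact absurd h h1
    · exact h1
  have hRe : ∀ z : ℂ, aeval z S.R = (z - x₀) * aeval z R₁ := fun z => by
    rw [hR, map_mul, map_sub, aeval_X, aeval_C]; rfl
  obtain ⟨σ, hσ, hσp⟩ : ∃ σ : ℝ, (σ = 1 ∨ σ = -1) ∧ 0 < (C σ * R₁).eval x₀ := by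
    rcases hR₁.lt_or_gt with h1 | h1
    · exact ⟨-1, Or.inr rfl, by simpa using h1⟩
    · exact ⟨1, Or.inl rfl, by simpa using h1⟩
  have hσσ : σ * σ = 1 := by rcases hσ with rfl | rfl <;> norm_num
  have hσ2' : (σ : ℂ) * σ = 1 := by exact_mod_cast hσσ
  obtain ⟨δ, hδ, f, hfd, hfc, hfp, hfs, hf0⟩ := sqrt_poly (C σ * R₁) hσp
  have hfs' : ∀ z, f z ^ 2 = σ * aeval z R₁ := fun z => by rw [hfs, map_mul, aeval_C]; rfl
  set B := Metric.ball (x₀ : ℂ) δ with hB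
  have hfne : ∀ z ∈ B, f z ≠ 0 := fun z hz h1 => by
    have := hfp z hz; rw [h1] at this; simp at this
  set ε := √δ with hε
  have hεp : 0 < ε := Real.sqrt_pos.2 hδ
  have hσn : ‖(σ : ℂ)‖ = 1 := by rcases hσ with rfl | rfl <;> simp
  have hmap : ∀ χ ∈ Metric.ball (0 : ℂ) ε, (x₀ : ℂ) + σ * χ ^ 2 ∈ B := by
    intro χ hχ
    rw [hB, mem_ball_iff_norm, add_sub_cancel_left, norm_mul, hσn, one_mul, norm_pow]
    have h1 := mem_ball_zero_iff.1 hχ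
    calc ‖χ‖ ^ 2 < ε ^ 2 := by gcongr
      _ = δ := Real.sq_sqrt hδ.le
  have hZd : ∀ χ : ℂ, HasDerivAt (fun χ : ℂ => (x₀ : ℂ) + σ * χ ^ 2) (σ * (2 * χ)) χ := fun χ => by
    simpa using ((hasDerivAt_pow 2 χ).const_mul (σ : ℂ)).const_add (x₀ : ℂ)
  have hfZ : DifferentiableOn ℂ (fun χ : ℂ => f (x₀ + σ * χ ^ 2)) (Metric.ball 0 ε) :=
    hfd.comp (fun χ _ => (hZd χ).differentiableAt.differentiableWithinAt) hmap
  have hZc : ∀ χ : ℂ, (x₀ : ℂ) + σ * ((starRingEnd ℂ) χ) ^ 2 =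
      (starRingEnd ℂ) ((x₀ : ℂ) + σ * χ ^ 2) := fun χ => by simp
  have hdom : ∀ χ ∈ halfDisc ε, (x₀ : ℂ) + σ * χ ^ 2 ∈ S.dom := by
    intro χ hχ
    have hχ0 : 0 < χ.im := hχ.1
    by_cases hi : ((x₀ : ℂ) + σ * χ ^ 2).im = 0
    · right
      have hσ0 : σ ≠ 0 := by rintro rfl; simp at hσn
      have hre : χ.re = 0 := by
        simp [pow_two] at hi
        rcases hi with h1 | h1
        · exact absurd h1 hσ0
        · nlinarith
      have hxr : ((x₀ : ℂ) + σ * χ ^ 2) = ((x₀ - σ * χ.im ^ 2 : ℝ) : ℂ) := by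
        have : χ = χ.im * I := Complex.ext (by simp [hre]) (by simp)
        rw [this, mul_pow, I_sq]; simp
        ring
      have h1 := hfp _ (hmap χ hχ.2)
      have h2 := hfs' ((x₀ : ℂ) + σ * χ ^ 2)
      have h3 := hfc _ (hmap χ hχ.2)
      rw [hxr] at h1 h2 h3 ⊢
      rw [conj_ofReal] at h3
      have h4 : (f ((x₀ - σ * χ.im ^ 2 : ℝ) : ℂ)).im = 0 := conj_eq_iff_im.1 h3.symm
      have h5 : 0 < σ * R₁.eval (x₀ - σ * χ.im ^ 2) := by
        have h6 := congrArg Complex.re h2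
        rw [aeval_ofReal_eq, ← ofReal_mul, ofReal_re, pow_two, mul_re, h4] at h6
        rw [← h6]; nlinarith
      rw [ofReal_re, hR]
      simp only [eval_mul, eval_sub, eval_X, eval_C]
      nlinarith [mul_pos h5 (pow_pos hχ0 2)]
    · exact Or.inl hi
  have hχne : ∀ χ ∈ halfDisc ε, χ ≠ 0 := by
    rintro χ hχ rfl
    have : (0 : ℝ) < (0 : ℂ).im := hχ.1
    simp at this
  have hdich := IsPreconnected.eq_or_eq_neg_of_sq_eq (S := halfDisc ε)
    (f := fun χ => S.r (x₀ + σ * χ ^ 2)) (g := fun χ => χ * f (x₀ + σ * χ ^ 2))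
    (convex_halfDisc ε).isPreconnected
    (fun χ hχ => (ContinuousAt.comp (f := fun χ : ℂ => (x₀ : ℂ) + σ * χ ^ 2)
      (S.r_diff _ (hdom χ hχ)).continuousAt (hZd χ).continuousAt).continuousWithinAt)
    (continuousOn_id.mul (hfZ.continuousOn.mono fun z hz => hz.2))
    (fun χ hχ => by
      simp only [Pi.pow_apply]
      rw [S.r_sq, mul_pow, hfs', hRe]; ring)
    (fun {χ} hχ => mul_ne_zero (hχne χ hχ) (hfne _ (hmap χ hχ.2)))
  obtain ⟨s, hs, hsr⟩ : ∃ s : ℝ, s * s = 1 ∧ ∀ χ ∈ halfDisc ε,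
      S.r (x₀ + σ * χ ^ 2) = s * χ * f (x₀ + σ * χ ^ 2) := by
    rcases hdich with hd | hd
    · exact ⟨1, by norm_num, fun χ hχ => by simpa using hd hχ⟩
    · exact ⟨-1, by norm_num, fun χ hχ => by simpa using hd hχ⟩
  have hs' : (s : ℂ) * s = 1 := by exact_mod_cast hs
  have hs0 : (s : ℂ) ≠ 0 := left_ne_zero_of_mul_eq_one hs'
  have hσ0 : (σ : ℂ) ≠ 0 := left_ne_zero_of_mul_eq_one hσ2'
  refine ⟨{ ε := ε, ε_pos := hεp, Z := fun χ => x₀ + σ * χ ^ 2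
            ρ := fun χ => s * χ * f (x₀ + σ * χ ^ 2)
            j := fun χ => 2 * σ / (s * f (x₀ + σ * χ ^ 2))
            inv := fun p => p.2 / (s * f p.1)
            Z_zero := by simp
            ρ_zero := by simp
            Z_conj := fun χ _ => hZc χ
            ρ_conj := fun χ hχ => by simp only [hZc, hfc _ (hmap χ hχ), map_mul, conj_ofReal]
            j_conj := fun χ hχ => by
              simp only [hZc, hfc _ (hmap χ hχ), map_mul, conj_ofReal, map_div₀, map_ofNat]
            ρ_sq := fun χ _ => by
              rw [mul_pow, mul_pow, hfs', hRe]
              linear_combination χ ^ 2 * σ * aeval ((x₀ : ℂ) + σ * χ ^ 2) R₁ * hs'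
            hasDerivAt := fun χ hχ => by
              have := hfne _ (hmap χ hχ)
              convert hZd χ using 1
              field_simp
            ρ_diff := (differentiableOn_id.const_mul _).mul hfZ
            j_diff := (differentiableOn_const _).div (hfZ.const_mul _) fun χ hχ =>
              mul_ne_zero hs0 (hfne _ (hmap χ hχ))
            j_ne := fun χ hχ => div_ne_zero (mul_ne_zero two_ne_zero hσ0)
              (mul_ne_zero hs0 (hfne _ (hmap χ hχ)))
            mem_dom := fun χ hχ => ⟨hdom χ hχ, hsr χ hχ⟩
            inv_cont := ?_
            inv_left := fun χ hχ => by
              show (s : ℂ) * χ * f (x₀ + σ * χ ^ 2) / (s * f (x₀ + σ * χ ^ 2)) = χ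
              rw [mul_right_comm, mul_div_cancel_left₀ _ (mul_ne_zero hs0 (hfne _ (hmap χ hχ)))]
            inv_right := ?_ }⟩
  · have : ContinuousAt f (x₀ : ℂ) :=
      (hfd.differentiableAt (Metric.ball_mem_nhds _ hδ)).continuousAt
    exact continuousAt_snd.div (continuousAt_const.mul
      (ContinuousAt.comp (x := ((x₀ : ℂ), ((0 : ℝ) : ℂ))) this continuousAt_fst))
      (mul_ne_zero hs0 (hfne _ (Metric.mem_ball_self hδ)))
  · have h1 : ∀ᶠ p : ℂ × ℂ in 𝓝 ((x₀ : ℂ), ((0 : ℝ) : ℂ)), p.1 ∈ B :=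
      continuousAt_fst.eventually (Metric.ball_mem_nhds _ hδ)
    filter_upwards [h1] with p hp hpe
    have hf := hfne _ hp
    have hZ : (x₀ : ℂ) + σ * (p.2 / (s * f p.1)) ^ 2 = p.1 := by
      have e1 : (s : ℂ) ^ 2 = 1 := by rw [pow_two, hs']
      rw [div_pow, mul_pow, hpe, hRe, hfs', e1]
      have : aeval p.1 R₁ ≠ 0 := by
        intro h0
        have := hfs' p.1
        rw [h0, mul_zero] at this
        exact hf (pow_eq_zero_iff two_ne_zero |>.1 this)
      field_simp
      ring
    refine ⟨hZ, ?_⟩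
    show (s : ℂ) * (p.2 / (s * f p.1)) * f ((x₀ : ℂ) + σ * (p.2 / (s * f p.1)) ^ 2) = p.2
    rw [hZ]
    field_simp

theorem exists_chart (S : SlitCurve) {x₀ r₀ : ℝ} (h : r₀ ^ 2 = S.R.eval x₀) :
    Nonempty (Chart S x₀ r₀) := by
  by_cases hr : r₀ = 0
  · subst hr
    exact exists_chart_of_eq S (by rw [← h]; norm_num)
  · obtain ⟨c, -⟩ := exists_chart_of_ne S h hr
    exact ⟨c⟩

theorem hasFDerivAt_imForm_comp {y : ℂ → ℝ} {Z : ℂ → ℂ} {c Z' χ : ℂ}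
    (hy : HasFDerivAt y (imForm c) (Z χ)) (hZ : HasDerivAt Z Z' χ) :
    HasFDerivAt (fun χ => y (Z χ)) (imForm (c * Z')) χ := by
  refine (hy.comp χ (hZ.hasFDerivAt.restrictScalars ℝ)).congr_fderiv ?_
  ext v
  simp
  ring

theorem eq_const_of_hasFDerivAt_zero {f : ℂ → ℝ} {s : Set ℂ} (hs : Convex ℝ s) (ho : IsOpen s)
    (hf : ∀ z ∈ s, HasFDerivAt f (0 : ℂ →L[ℝ] ℝ) z) : ∃ c, ∀ z ∈ s, f z = c :=
  ho.exists_is_const_of_fderiv_eq_zero hs.isPreconnected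
    (fun z hz => (hf z hz).differentiableAt.differentiableWithinAt) (fun z hz => (hf z hz).fderiv)

theorem imForm_sub_self (c : ℂ) : imForm c - imForm c = 0 := sub_self _

/-- A conjugation-symmetric primitive. -/
theorem exists_symm_primitive {k : ℂ → ℂ} {ε : ℝ} (hε : 0 < ε)
    (hk : DifferentiableOn ℂ k (Metric.ball 0 ε))
    (hkc : ∀ χ ∈ Metric.ball 0 ε, k ((starRingEnd ℂ) χ) = (starRingEnd ℂ) (k χ)) :
    ∃ K : ℂ → ℂ, K 0 = 0 ∧ (∀ χ ∈ Metric.ball 0 ε, HasDerivAt K (k χ) χ) ∧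
      (∀ χ ∈ Metric.ball 0 ε, K ((starRingEnd ℂ) χ) = (starRingEnd ℂ) (K χ)) := by
  obtain ⟨K, hK⟩ := exists_primitive (convex_ball (0 : ℂ) ε) Metric.isOpen_ball hk
  have hd : ∀ χ ∈ Metric.ball 0 ε, HasDerivAt (fun χ => K χ - K 0) (k χ) χ :=
    fun χ hχ => (hK χ hχ).sub_const _
  obtain ⟨d, hd'⟩ := eq_const_of_hasDerivAt_zero
    (f := fun χ => (K χ - K 0) - (starRingEnd ℂ) (K ((starRingEnd ℂ) χ) - K 0))
    (convex_ball (0 : ℂ) ε) Metric.isOpen_ball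
    (fun χ hχ => by
      have h1 := (hd _ (conj_mem_ball_zero hχ)).conj_conj
      rw [conj_conj, hkc χ hχ, conj_conj] at h1
      have := (hd χ hχ).sub h1
      rwa [sub_self] at this)
  have h0 : d = 0 := by rw [← hd' 0 (Metric.mem_ball_self hε)]; simp
  refine ⟨fun χ => K χ - K 0, sub_self _, hd, fun χ hχ => ?_⟩
  have := hd' _ (conj_mem_ball_zero hχ)
  rw [h0, conj_conj] at this
  exact sub_eq_zero.1 this

/-- A function harmonic on the slit domain, continuous on `D`, whose differential is the imaginary
part of `(a(z) + q(z) / ((z - 1) r)) dz`. -/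
structure Potential (S : SlitCurve) (D : Set ℂ) where
  /-- The function. -/
  y : ℂ → ℝ
  /-- The even part of the differential. -/
  a : ℂ → ℂ
  /-- The polynomial of the odd part of the differential. -/
  q : ℝ[X]
  isOpen_D : IsOpen D
  ne_one : ∀ z ∈ D, z ≠ 1
  a_diff : DifferentiableOn ℂ a D
  a_conj : ∀ z, a ((starRingEnd ℂ) z) = (starRingEnd ℂ) (a z)
  cont : ContinuousOn y D
  deriv : ∀ z ∈ S.dom, HasFDerivAt y (imForm (a z + S.form q z)) z

namespace Potential

variable {S : SlitCurve} {D : Set ℂ} (p : Potential S D) {x₀ r₀ : ℝ} (c : Chart S x₀ r₀)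

/-- The differential of a potential in a local coordinate. -/
def localForm (χ : ℂ) : ℂ :=
  c.j χ * (p.a (c.Z χ) * c.ρ χ + aeval (c.Z χ) p.q / (c.Z χ - 1))

/-- `K` is the local primitive of the differential of a potential, on the disc of radius `ε`. -/
structure IsLocalPrimitive (ε : ℝ) (K : ℂ → ℂ) : Prop where
  pos : 0 < ε
  le : ε ≤ c.ε
  zero : K 0 = 0
  deriv : ∀ χ ∈ Metric.ball 0 ε, HasDerivAt K (p.localForm c χ) χ
  diff : DifferentiableOn ℂ (p.localForm c) (Metric.ball 0 ε)
  conj : ∀ χ ∈ Metric.ball 0 ε, K ((starRingEnd ℂ) χ) = (starRingEnd ℂ) (K χ)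
  conj_form : ∀ χ ∈ Metric.ball 0 ε,
    p.localForm c ((starRingEnd ℂ) χ) = (starRingEnd ℂ) (p.localForm c χ)
  eq : ∀ χ ∈ Metric.ball 0 ε, 0 ≤ χ.im → p.y (c.Z χ) = p.y x₀ + (K χ).im

variable {p c} in
theorem IsLocalPrimitive.mono {ε δ : ℝ} {K : ℂ → ℂ} (h : p.IsLocalPrimitive c ε K) (hδ : 0 < δ)
    (hle : δ ≤ ε) : p.IsLocalPrimitive c δ K :=
  have hs := Metric.ball_subset_ball (x := (0 : ℂ)) hle
  ⟨hδ, hle.trans h.le, h.zero, fun χ hχ => h.deriv χ (hs hχ), h.diff.mono hs,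
    fun χ hχ => h.conj χ (hs hχ), fun χ hχ => h.conj_form χ (hs hχ), fun χ hχ => h.eq χ (hs hχ)⟩

theorem mem_closure_halfDisc {ε : ℝ} {χ : ℂ} (hχ : χ ∈ Metric.ball 0 ε) (hi : 0 ≤ χ.im) :
    χ ∈ closure (halfDisc ε) := by
  have h1 : χ ∈ closure {χ : ℂ | 0 < χ.im} := by
    rw [Complex.closure_setOfPred_lt_im]; exact hi
  rw [halfDisc, Set.inter_comm]
  exact Metric.isOpen_ball.inter_closure ⟨hχ, h1⟩

theorem exists_localPrimitive (hx : (x₀ : ℂ) ∈ D) : ∃ ε K, p.IsLocalPrimitive c ε K := by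
  have hZcont : ∀ χ ∈ Metric.ball 0 c.ε, ContinuousAt c.Z χ := fun χ hχ =>
    (c.hasDerivAt χ hχ).continuousAt
  have h0 : (0 : ℂ) ∈ Metric.ball (0 : ℂ) c.ε := Metric.mem_ball_self c.ε_pos
  obtain ⟨δ, hδ, hb⟩ := Metric.eventually_nhds_iff_ball.1
    ((hZcont 0 h0).eventually (p.isOpen_D.mem_nhds (by rw [c.Z_zero]; exact hx)))
  set ε := min δ c.ε with hε
  have hεp : 0 < ε := lt_min hδ c.ε_pos
  have hs : Metric.ball (0 : ℂ) ε ⊆ Metric.ball 0 c.ε := Metric.ball_subset_ball (min_le_right _ _)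
  have hD : ∀ χ ∈ Metric.ball (0 : ℂ) ε, c.Z χ ∈ D := fun χ hχ =>
    hb χ (Metric.ball_subset_ball (min_le_left _ _) hχ)
  have hZd : DifferentiableOn ℂ c.Z (Metric.ball 0 ε) := fun χ hχ =>
    (c.hasDerivAt χ (hs hχ)).differentiableAt.differentiableWithinAt
  have hZ1 : ∀ χ ∈ Metric.ball (0 : ℂ) ε, c.Z χ - 1 ≠ 0 := fun χ hχ =>
    sub_ne_zero.2 (p.ne_one _ (hD χ hχ))
  have hdiff : DifferentiableOn ℂ (p.localForm c) (Metric.ball 0 ε) := by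
    refine (c.j_diff.mono hs).mul (((p.a_diff.comp hZd hD).mul (c.ρ_diff.mono hs)).add ?_)
    exact ((aeval_differentiable p.q).comp_differentiableOn hZd).div (hZd.sub_const 1) hZ1
  have hconj : ∀ χ ∈ Metric.ball (0 : ℂ) ε,
      p.localForm c ((starRingEnd ℂ) χ) = (starRingEnd ℂ) (p.localForm c χ) := fun χ hχ => by
    simp only [localForm, c.j_conj χ (hs hχ), c.Z_conj χ (hs hχ), c.ρ_conj χ (hs hχ), p.a_conj,
      aeval_conj_eq, map_mul, map_add, map_div₀, map_sub, map_one]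
  obtain ⟨K, hK0, hK, hKc⟩ := exists_symm_primitive hεp hdiff hconj
  have hsub : halfDisc ε ⊆ Metric.ball 0 ε := fun χ hχ => hχ.2
  have hdom : ∀ χ ∈ halfDisc ε, c.Z χ ∈ S.dom ∧ S.r (c.Z χ) = c.ρ χ := fun χ hχ =>
    c.mem_dom χ ⟨hχ.1, hs hχ.2⟩
  obtain ⟨d, hd⟩ := eq_const_of_hasFDerivAt_zero (f := fun χ => p.y (c.Z χ) - (K χ).im)
    (convex_halfDisc ε) (isOpen_halfDisc ε) (fun χ hχ => by
      obtain ⟨h1, h2⟩ := hdom χ hχ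
      have h3 := hasFDerivAt_imForm_comp (p.deriv _ h1) (c.hasDerivAt χ (hs hχ.2))
      have h4 := hasFDerivAt_im (hK χ hχ.2)
      have hr : c.ρ χ ≠ 0 := h2 ▸ SlitCurve.r_ne_zero h1
      have he : (p.a (c.Z χ) + S.form p.q (c.Z χ)) * (c.j χ * c.ρ χ) = p.localForm c χ := by
        have := hZ1 χ hχ.2
        rw [SlitCurve.form, h2, localForm]
        field_simp
      rw [he] at h3
      have := h3.fun_sub h4
      rwa [imForm_sub_self] at this)
  have hlim : ∀ χ ∈ Metric.ball (0 : ℂ) ε, 0 ≤ χ.im → p.y (c.Z χ) - (K χ).im = d := by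
    intro χ hχ hi
    have hnb : (𝓝[halfDisc ε] χ).NeBot :=
      mem_closure_iff_nhdsWithin_neBot.1 (mem_closure_halfDisc hχ hi)
    have hcy : ContinuousAt (fun χ => p.y (c.Z χ)) χ :=
      ContinuousAt.comp (p.cont.continuousAt (p.isOpen_D.mem_nhds (hD χ hχ))) (hZcont χ (hs hχ))
    have hc := (hcy.sub (continuous_im.continuousAt.comp (hK χ hχ).continuousAt)).tendsto.mono_left
      (nhdsWithin_le_nhds (s := halfDisc ε))
    refine tendsto_nhds_unique (hc.congr' ?_) tendsto_const_nhds
    filter_upwards [self_mem_nhdsWithin] with w hw using hd w hw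
  have hd0 : p.y x₀ = d := by
    have := hlim 0 (Metric.mem_ball_self hεp) (by simp)
    rw [hK0, c.Z_zero] at this
    simpa using this
  exact ⟨ε, K, hεp, min_le_right _ _, hK0, hK, hdiff, hKc, hconj, fun χ hχ hi => by
    rw [hd0, ← hlim χ hχ hi]; ring⟩

end Potential

theorem Chart.tendsto_Z {S : SlitCurve} {x₀ r₀ : ℝ} (c : Chart S x₀ r₀) :
    Tendsto c.Z (𝓝 0) (𝓝 (x₀ : ℂ)) := by
  have := (c.hasDerivAt 0 (Metric.mem_ball_self c.ε_pos)).continuousAt.tendsto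
  rwa [c.Z_zero] at this

theorem Chart.inv_base {S : SlitCurve} {x₀ r₀ : ℝ} (c : Chart S x₀ r₀) :
    c.inv ((x₀ : ℂ), (r₀ : ℂ)) = 0 := by
  have := c.inv_left 0 (Metric.mem_ball_self c.ε_pos)
  rwa [c.Z_zero, c.ρ_zero] at this

theorem Chart.tendsto_inv {S : SlitCurve} {x₀ r₀ : ℝ} (c : Chart S x₀ r₀) :
    Tendsto c.inv (𝓝 ((x₀ : ℂ), (r₀ : ℂ))) (𝓝 0) := by
  have := c.inv_cont.tendsto
  rwa [c.inv_base] at this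

/-- Real points of the curve have real coordinate. -/
theorem Chart.inv_real {S : SlitCurve} {x₀ r₀ : ℝ} (c : Chart S x₀ r₀) :
    ∀ᶠ p : ℝ × ℝ in 𝓝 (x₀, r₀), p.2 ^ 2 = S.R.eval p.1 →
      (c.inv ((p.1 : ℂ), (p.2 : ℂ))).im = 0 ∧ c.inv ((p.1 : ℂ), (p.2 : ℂ)) ∈ Metric.ball 0 c.ε ∧
      c.Z (c.inv ((p.1 : ℂ), (p.2 : ℂ))) = p.1 ∧ c.ρ (c.inv ((p.1 : ℂ), (p.2 : ℂ))) = p.2 := by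
  have hcast : Tendsto (fun p : ℝ × ℝ => ((p.1 : ℂ), (p.2 : ℂ))) (𝓝 (x₀, r₀))
      (𝓝 ((x₀ : ℂ), (r₀ : ℂ))) := by
    have : Continuous (fun p : ℝ × ℝ => ((p.1 : ℂ), (p.2 : ℂ))) := by fun_prop
    exact this.tendsto (x₀, r₀)
  filter_upwards [hcast.eventually c.inv_right,
    (c.tendsto_inv.comp hcast).eventually (Metric.ball_mem_nhds 0 c.ε_pos)] with p h1 h2 h3
  have h4 := h1 (by
    show (p.2 : ℂ) ^ 2 = aeval (p.1 : ℂ) S.R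
    rw [aeval_ofReal_eq, ← h3]; simp)
  refine ⟨?_, h2, h4.1, h4.2⟩
  have h2' : c.inv ((p.1 : ℂ), (p.2 : ℂ)) ∈ Metric.ball 0 c.ε := h2
  have h5 := c.inv_left _ (conj_mem_ball_zero h2')
  rw [c.Z_conj _ h2', c.ρ_conj _ h2', h4.1, h4.2] at h5
  simp only [conj_ofReal] at h5
  exact conj_eq_iff_im.1 h5.symm

/-- Points of the slit domain have coordinate in the upper half-plane. -/
theorem Chart.inv_im_pos {S : SlitCurve} {x₀ r₀ : ℝ} (c : Chart S x₀ r₀) :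
    ∀ᶠ p : ℂ × ℂ in 𝓝 ((x₀ : ℂ), (r₀ : ℂ)), p.1 ∈ S.dom → p.2 = S.r p.1 →
      c.inv p ∈ halfDisc c.ε ∧ c.Z (c.inv p) = p.1 := by
  filter_upwards [c.inv_right, c.tendsto_inv.eventually (Metric.ball_mem_nhds 0 c.ε_pos)]
    with p h1 h2 h3 h4
  obtain ⟨h5, h6⟩ := h1 (by rw [h4, S.r_sq])
  have h2' : c.inv p ∈ Metric.ball 0 c.ε := h2
  refine ⟨⟨?_, h2⟩, h5⟩
  show 0 < (c.inv p).im
  by_contra hle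
  rcases (not_lt.1 hle).lt_or_eq with h7 | h7
  · have h8 := c.mem_dom ((starRingEnd ℂ) (c.inv p)) ⟨by simpa using h7, conj_mem_ball_zero h2'⟩
    rw [c.Z_conj _ h2', c.ρ_conj _ h2', h5, h6, S.r_conj _ h3, h4] at h8
    have h9 : (starRingEnd ℂ) (S.r p.1) = 0 := by linear_combination (-1 / 2 : ℂ) * h8.2
    exact SlitCurve.r_ne_zero h3 ((map_eq_zero _).1 h9)
  · have h8 : (starRingEnd ℂ) (c.inv p) = c.inv p := conj_eq_iff_im.2 h7
    have h9 := c.Z_conj _ h2'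
    have h10 := c.ρ_conj _ h2'
    rw [h8, h5] at h9
    rw [h8, h6] at h10
    have h11 := conj_eq_iff_im.1 h9.symm
    have h12 := conj_eq_iff_im.1 h10.symm
    rcases h3 with h13 | h13
    · exact h13 h11
    · have h14 := S.r_sq p.1
      rw [← h4, aeval_of_im_eq_zero _ h11] at h14
      have h15 := congrArg Complex.re h14
      rw [pow_two, mul_re, h12, ofReal_re] at h15
      nlinarith

namespace Potential

variable {S : SlitCurve} {D : Set ℂ} (p : Potential S D)

theorem eventually_eq_of_nonneg {x₀ : ℝ} (hx : (x₀ : ℂ) ∈ D) (hR : 0 ≤ S.R.eval x₀) :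
    ∀ᶠ x : ℝ in 𝓝 x₀, 0 ≤ S.R.eval x → p.y x = p.y x₀ := by
  obtain ⟨c⟩ := exists_chart S (Real.sq_sqrt hR)
  obtain ⟨ε, K, hK⟩ := p.exists_localPrimitive c hx
  have hcont : Tendsto (fun x : ℝ => (x, √(S.R.eval x))) (𝓝 x₀) (𝓝 (x₀, √(S.R.eval x₀))) := by
    have : Continuous (fun x : ℝ => (x, √(S.R.eval x))) :=
      continuous_id.prodMk (S.R.continuous.sqrt)
    exact this.tendsto x₀
  have hcast : Tendsto (fun p : ℝ × ℝ => ((p.1 : ℂ), (p.2 : ℂ))) (𝓝 (x₀, √(S.R.eval x₀)))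
      (𝓝 ((x₀ : ℂ), ((√(S.R.eval x₀) : ℝ) : ℂ))) := by
    have : Continuous (fun p : ℝ × ℝ => ((p.1 : ℂ), (p.2 : ℂ))) := by fun_prop
    exact this.tendsto (x₀, √(S.R.eval x₀))
  filter_upwards [hcont.eventually c.inv_real,
    ((c.tendsto_inv.comp hcast).comp hcont).eventually (Metric.ball_mem_nhds 0 hK.pos)]
    with x h1 h2 h3
  obtain ⟨h4, -, h5, -⟩ := h1 (Real.sq_sqrt h3)
  simp only [Function.comp] at h2
  have h6 := hK.eq _ h2 h4.ge
  have h7 := hK.conj _ h2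
  rw [conj_eq_iff_im.2 h4] at h7
  rw [h5, conj_eq_iff_im.1 h7.symm, add_zero] at h6
  exact h6

theorem eq_on_preconnected {s : Set ℝ} (hs : IsPreconnected s)
    (hsD : ∀ x ∈ s, (x : ℂ) ∈ D ∧ 0 ≤ S.R.eval x) {x x' : ℝ} (hx : x ∈ s) (hx' : x' ∈ s) :
    p.y x = p.y x' := by
  have : PreconnectedSpace s := isPreconnected_iff_preconnectedSpace.1 hs
  have hl : IsLocallyConstant (fun x : s => p.y (x : ℝ)) := by
    rw [IsLocallyConstant.iff_eventually_eq]
    intro x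
    have h1 := p.eventually_eq_of_nonneg (hsD x x.2).1 (hsD x x.2).2
    filter_upwards [continuous_subtype_val.continuousAt.eventually h1] with w hw
    exact hw (hsD w w.2).2
  exact hl.apply_eq_of_preconnectedSpace ⟨x, hx⟩ ⟨x', hx'⟩

end Potential

/-- The potential of `q dz / ((z - 1) r)`. -/
theorem exists_potential {S : SlitCurve} {q : ℝ[X]} (hq : q.natDegree ≤ S.genus) :
    ∃ p : Potential S {1}ᶜ, p.q = q ∧ (∀ z, p.a z = 0) ∧
      (∀ z, p.y ((starRingEnd ℂ) z) = p.y z) ∧ Tendsto p.y (Bornology.cobounded ℂ) (𝓝 0) := by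
  obtain ⟨y, h1, h2, h3, h4⟩ := SlitCurve.exists_harmonic hq
  exact ⟨{ y := y, a := fun _ => 0, q := q, isOpen_D := isOpen_compl_singleton
           ne_one := fun _ h => h, a_diff := differentiableOn_const _, a_conj := fun _ => by simp
           cont := h1, deriv := fun z hz => by rw [zero_add]; exact h3 z hz },
    rfl, fun _ => rfl, h2, h4⟩

theorem potential_eq_zero {S : SlitCurve} (p : Potential S {1}ᶜ)
    (h : Tendsto p.y (Bornology.cobounded ℂ) (𝓝 0)) {x : ℝ} (hx : 1 < x) : p.y x = 0 := by
  have hc : ∀ t : ℝ, 1 < t → p.y t = p.y x := fun t ht =>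
    p.eq_on_preconnected isPreconnected_Ioi (fun s hs => ⟨by
      have : (1 : ℝ) < s := hs
      simpa using this.ne', (S.R_pos s (one_pos.trans hs)).le⟩) ht hx
  have h1 : Tendsto (fun t : ℝ => p.y (t : ℂ)) atTop (𝓝 0) := by
    refine h.comp ?_
    rw [tendsto_norm_atTop_iff_cobounded.symm]
    simpa using tendsto_abs_atTop_atTop
  refine tendsto_nhds_unique (tendsto_const_nhds.congr' ?_) h1
  filter_upwards [eventually_gt_atTop 1] with t ht
  exact (hc t ht).symm

/-- The expansion of a potential at `z = 1`. -/
theorem potential_near_one {S : SlitCurve} (p : Potential S {1}ᶜ)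
    (h : Tendsto p.y (Bornology.cobounded ℂ) (𝓝 0)) (ha : ∀ z, p.a z = 0) :
    ∃ ε > 0, ∃ K : ℂ → ℂ, K 0 = 0 ∧ DifferentiableOn ℂ K (Metric.ball 0 ε) ∧
      (∀ χ ∈ Metric.ball 0 ε, K ((starRingEnd ℂ) χ) = (starRingEnd ℂ) (K χ)) ∧
      (∀ χ ∈ Metric.ball 0 ε, 0 ≤ χ.im → χ ≠ 0 →
        p.y (1 - χ) = p.q.eval 1 / √(S.R.eval 1) * (χ.arg - Real.pi) + (K χ).im) := by
  have hR1 := S.R_pos 1 one_pos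
  obtain ⟨c, σ, -, hZ, hj, hσ⟩ := exists_chart_of_ne S (Real.sq_sqrt hR1.le)
    (Real.sqrt_pos.2 hR1).ne'
  obtain rfl := hσ one_pos (Real.sqrt_pos.2 hR1)
  have hZ' : ∀ χ, c.Z χ = 1 - χ := fun χ => by rw [hZ]; simp; ring
  set b : ℝ := p.q.eval 1 / √(S.R.eval 1) with hb
  set B := Metric.ball (0 : ℂ) c.ε with hB
  have h0B : (0 : ℂ) ∈ B := Metric.mem_ball_self c.ε_pos
  set m : ℂ → ℂ := fun χ => -(aeval (c.Z χ) p.q * c.j χ) with hm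
  have hZd : DifferentiableOn ℂ c.Z B := fun χ hχ =>
    (c.hasDerivAt χ hχ).differentiableAt.differentiableWithinAt
  have hmd : DifferentiableOn ℂ m B :=
    (((aeval_differentiable p.q).comp_differentiableOn hZd).mul c.j_diff).neg
  have hm0 : m 0 = b := by
    simp only [hm, hj 0 h0B, c.ρ_zero, c.Z_zero]
    rw [show ((1 : ℝ) : ℂ) = ((1 : ℝ) : ℂ) from rfl, aeval_ofReal_eq, hb]
    push_cast
    ring
  have hmc : ∀ χ ∈ B, m ((starRingEnd ℂ) χ) = (starRingEnd ℂ) (m χ) := fun χ hχ => by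
    simp only [hm, c.Z_conj χ hχ, c.j_conj χ hχ, aeval_conj_eq, map_neg, map_mul]
  set g := dslope m 0 with hg
  have hgd : DifferentiableOn ℂ g B :=
    (Complex.differentiableOn_dslope (Metric.ball_mem_nhds 0 c.ε_pos)).2 hmd
  have hgm : ∀ χ, χ * g χ = m χ - b := fun χ => by
    have := sub_smul_dslope m 0 χ
    rw [sub_zero, smul_eq_mul, hm0] at this
    exact this
  have hgc' : ∀ χ ∈ B, χ ≠ 0 → g ((starRingEnd ℂ) χ) = (starRingEnd ℂ) (g χ) := fun χ hχ h0 => by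
    have h1 := hgm ((starRingEnd ℂ) χ)
    have h2 := congrArg (starRingEnd ℂ) (hgm χ)
    rw [map_mul, map_sub, conj_ofReal, ← hmc χ hχ, ← h1] at h2
    exact (mul_left_cancel₀ ((_root_.map_ne_zero _).2 h0) h2).symm
  have hgc : ∀ χ ∈ B, g ((starRingEnd ℂ) χ) = (starRingEnd ℂ) (g χ) := by
    intro χ hχ
    by_cases h0 : χ = 0
    · subst h0
      have hgc0 := (hgd.differentiableAt (Metric.ball_mem_nhds 0 c.ε_pos)).continuousAt
      have t1 : Tendsto g (𝓝[≠] 0) (𝓝 (g 0)) := hgc0.tendsto.mono_left inf_le_left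
      have t2 : Tendsto (fun χ => (starRingEnd ℂ) (g χ)) (𝓝[≠] 0) (𝓝 ((starRingEnd ℂ) (g 0))) :=
        (continuous_conj.tendsto _).comp t1
      have t3 : Tendsto (fun χ => g ((starRingEnd ℂ) χ)) (𝓝[≠] 0) (𝓝 (g 0)) := by
        have : Tendsto (starRingEnd ℂ) (𝓝 0) (𝓝 (0 : ℂ)) := by
          simpa using continuous_conj.tendsto (0 : ℂ)
        exact (hgc0.tendsto.comp this).mono_left inf_le_left
      rw [map_zero]
      refine tendsto_nhds_unique (t3.congr' ?_) t2
      filter_upwards [self_mem_nhdsWithin,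
        mem_nhdsWithin_of_mem_nhds (Metric.ball_mem_nhds (0 : ℂ) c.ε_pos)] with w h1 h2
      exact hgc' w h2 h1
    · exact hgc' χ hχ h0
  obtain ⟨K, hK0, hK, hKc⟩ := exists_symm_primitive c.ε_pos hgd hgc
  have hslit : ∀ χ : ℂ, 0 < χ.im → χ ∈ slitPlane := fun χ hχ => Or.inr hχ.ne'
  obtain ⟨d, hd⟩ := eq_const_of_hasFDerivAt_zero
    (f := fun χ => p.y (c.Z χ) - (b * (log χ) + K χ).im)
    (convex_halfDisc c.ε) (isOpen_halfDisc c.ε) (fun χ hχ => by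
      obtain ⟨h1, h2⟩ := c.mem_dom χ hχ
      have h3 := hasFDerivAt_imForm_comp (p.deriv _ h1) (c.hasDerivAt χ hχ.2)
      have h4 := hasFDerivAt_im (((hasDerivAt_log (hslit χ hχ.1)).const_mul (b : ℂ)).add
        (hK χ hχ.2))
      have hr : c.ρ χ ≠ 0 := h2 ▸ SlitCurve.r_ne_zero h1
      have hχ0 : χ ≠ 0 := slitPlane_ne_zero (hslit χ hχ.1)
      have he : (p.a (c.Z χ) + S.form p.q (c.Z χ)) * (c.j χ * c.ρ χ) = b * χ⁻¹ + g χ := by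
        rw [ha, zero_add, SlitCurve.form, h2]
        have h5 := hgm χ
        have h6 : c.Z χ - 1 = -χ := by rw [hZ']; ring
        rw [h6]
        simp only [hm] at h5
        field_simp
        linear_combination -h5
      rw [he] at h3
      have := h3.fun_sub h4
      rwa [imForm_sub_self] at this)
  have hlim : ∀ χ ∈ B, 0 ≤ χ.im → χ ≠ 0 →
      p.y (c.Z χ) - (b * χ.arg + (K χ).im) = d := by
    intro χ hχ hi h0
    have hnb : (𝓝[halfDisc c.ε] χ).NeBot :=
      mem_closure_iff_nhdsWithin_neBot.1 (Potential.mem_closure_halfDisc hχ hi)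
    have hcy : ContinuousAt (fun χ => p.y (c.Z χ)) χ :=
      ContinuousAt.comp (p.cont.continuousAt (p.isOpen_D.mem_nhds (by
        rw [hZ']; simpa using h0))) (c.hasDerivAt χ hχ).continuousAt
    have harg : Tendsto arg (𝓝[halfDisc c.ε] χ) (𝓝 χ.arg) := by
      by_cases hs : χ ∈ slitPlane
      · exact (continuousAt_arg hs).tendsto.mono_left inf_le_left
      · rw [mem_slitPlane_iff, not_or, not_not, not_lt] at hs
        have hre : χ.re < 0 := lt_of_le_of_ne hs.1 fun h1 => h0 (Complex.ext h1 hs.2)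
        refine (continuousWithinAt_arg_of_re_neg_of_im_zero hre hs.2).tendsto.mono_left
          (nhdsWithin_mono _ fun w hw => (le_of_lt hw.1 : (0 : ℝ) ≤ w.im))
    have hKim : Tendsto (fun χ => (K χ).im) (𝓝[halfDisc c.ε] χ) (𝓝 (K χ).im) :=
      (continuous_im.continuousAt.comp (hK χ hχ).continuousAt).tendsto.mono_left inf_le_left
    have hc := (hcy.tendsto.mono_left (nhdsWithin_le_nhds (s := halfDisc c.ε))).sub
      ((harg.const_mul b).add hKim)
    refine tendsto_nhds_unique (hc.congr' ?_) tendsto_const_nhds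
    filter_upwards [self_mem_nhdsWithin] with w hw
    rw [← hd w hw]
    simp [log_im]
  have hd0 : d = -(b * Real.pi) := by
    set t : ℝ := c.ε / 2 with ht
    have htp : 0 < t := half_pos c.ε_pos
    have htB : ((-t : ℝ) : ℂ) ∈ B := by
      rw [hB, mem_ball_zero_iff, Complex.norm_real, norm_neg, Real.norm_of_nonneg htp.le]
      exact half_lt_self c.ε_pos
    have h1 := hlim ((-t : ℝ) : ℂ) htB (by simp) (by simpa using htp.ne')
    have h2 := hKc _ htB
    rw [conj_ofReal] at h2
    have h3 : c.Z ((-t : ℝ) : ℂ) = ((1 + t : ℝ) : ℂ) := by rw [hZ']; simp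
    rw [h3, potential_eq_zero p h (by linarith), arg_ofReal_of_neg (by linarith),
      conj_eq_iff_im.1 h2.symm] at h1
    linarith
  refine ⟨c.ε, c.ε_pos, K, hK0, fun χ hχ => (hK χ hχ).differentiableAt.differentiableWithinAt,
    hKc, fun χ hχ hi h0 => ?_⟩
  have := hlim χ hχ hi h0
  rw [hZ', hd0] at this
  linarith

theorem potential_eq_on_Ioo {S : SlitCurve} (p : Potential S {1}ᶜ)
    (h : Tendsto p.y (Bornology.cobounded ℂ) (𝓝 0)) (ha : ∀ z, p.a z = 0) {x : ℝ} (h0 : 0 ≤ x)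
    (h1 : x < 1) : p.y x = -(p.q.eval 1 / √(S.R.eval 1) * Real.pi) := by
  obtain ⟨ε, hε, K, -, -, hKc, hK⟩ := potential_near_one p h ha
  set t : ℝ := min (ε / 2) (1 / 2) with ht
  have htp : 0 < t := lt_min (half_pos hε) (by norm_num)
  have ht1 : t ≤ 1 / 2 := min_le_right _ _
  have htε : t < ε := (min_le_left _ _).trans_lt (half_lt_self hε)
  have htB : (t : ℂ) ∈ Metric.ball (0 : ℂ) ε := by
    rw [mem_ball_zero_iff, Complex.norm_real, Real.norm_of_nonneg htp.le]
    exact htε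
  have h2 := hK _ htB (by simp) (by simpa using htp.ne')
  have h3 := hKc _ htB
  rw [conj_ofReal] at h3
  rw [arg_ofReal_of_nonneg htp.le, conj_eq_iff_im.1 h3.symm] at h2
  have h4 : p.y x = p.y ((1 - t : ℝ) : ℂ) :=
    p.eq_on_preconnected isPreconnected_Ico (s := Set.Ico 0 1) (fun s hs => ⟨by
      simpa using hs.2.ne, by
      rcases hs.1.eq_or_lt with h5 | h5
      · rw [← h5, S.R_zero]
      · exact (S.R_pos s h5).le⟩) ⟨h0, h1⟩ ⟨by linarith, by linarith⟩
  rw [h4]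
  push_cast
  rw [h2]
  ring

/-! ### Conjugation-symmetric functions -/

theorem im_le_of_deriv_le {H h : ℂ → ℂ} {ε C : ℝ} {m : ℕ} (hC : 0 ≤ C)
    (hH : ∀ χ ∈ Metric.ball 0 ε, HasDerivAt H (h χ) χ)
    (hc : ∀ χ ∈ Metric.ball 0 ε, H ((starRingEnd ℂ) χ) = (starRingEnd ℂ) (H χ))
    (hb : ∀ χ ∈ Metric.ball 0 ε, ‖h χ‖ ≤ C * ‖χ‖ ^ m) {χ : ℂ} (hχ : χ ∈ Metric.ball (0 : ℂ) ε) :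
    |(H χ).im| ≤ C * ‖χ‖ ^ m * |χ.im| := by
  have hsub : Metric.closedBall (0 : ℂ) ‖χ‖ ⊆ Metric.ball 0 ε :=
    Metric.closedBall_subset_ball (mem_ball_zero_iff.1 hχ)
  have h1 := (convex_closedBall (0 : ℂ) ‖χ‖).norm_image_sub_le_of_norm_hasDerivWithin_le
    (f := H) (f' := h) (C := C * ‖χ‖ ^ m) (fun w hw => (hH w (hsub hw)).hasDerivWithinAt)
    (fun w hw => (hb w (hsub hw)).trans (by
      have := mem_closedBall_zero_iff.1 hw
      gcongr))
    (x := (starRingEnd ℂ) χ) (y := χ) (by simp) (by simp)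
  rw [hc χ hχ, sub_conj, sub_conj, norm_mul, norm_mul, norm_I, mul_one, mul_one,
    Complex.norm_real, Complex.norm_real, Real.norm_eq_abs, Real.norm_eq_abs, abs_mul, abs_mul,
    abs_two] at h1
  linarith

/-- Second order expansion of the imaginary part of a conjugation-symmetric primitive. -/
theorem exists_im_expansion {K k : ℂ → ℂ} {ε : ℝ} (hε : 0 < ε)
    (hK : ∀ χ ∈ Metric.ball 0 ε, HasDerivAt K (k χ) χ)
    (hk : DifferentiableOn ℂ k (Metric.ball 0 ε))
    (hKc : ∀ χ ∈ Metric.ball 0 ε, K ((starRingEnd ℂ) χ) = (starRingEnd ℂ) (K χ))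
    {a b : ℝ} (ha : k 0 = a) (hb : deriv k 0 = b) :
    ∃ C ≥ 0, ∀ᶠ χ in 𝓝 (0 : ℂ),
      |(K χ).im - (a * χ.im + b * χ.re * χ.im)| ≤ C * ‖χ‖ ^ 2 * |χ.im| := by
  have h0 : (0 : ℂ) ∈ Metric.ball (0 : ℂ) ε := Metric.mem_ball_self hε
  set g := dslope k 0 with hg
  have hgd : DifferentiableOn ℂ g (Metric.ball 0 ε) :=
    (Complex.differentiableOn_dslope (Metric.ball_mem_nhds 0 hε)).2 hk
  have hg0 : g 0 = b := by rw [hg, dslope_same, hb]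
  have hgk : ∀ χ, χ * g χ = k χ - a := fun χ => by
    have := sub_smul_dslope k 0 χ
    rw [sub_zero, smul_eq_mul, ha] at this
    exact this
  obtain ⟨C, hC, hO⟩ := ((hgd.differentiableAt (Metric.ball_mem_nhds 0 hε)).isBigO_sub).exists_pos
  obtain ⟨δ, hδ, hball⟩ := Metric.eventually_nhds_iff_ball.1 hO.bound
  set η := min δ ε with hη
  have hη0 : 0 < η := lt_min hδ hε
  have hs : Metric.ball (0 : ℂ) η ⊆ Metric.ball 0 ε := Metric.ball_subset_ball (min_le_right _ _)
  refine ⟨C, hC.le, ?_⟩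
  filter_upwards [Metric.ball_mem_nhds (0 : ℂ) hη0] with χ hχ
  have key := im_le_of_deriv_le (H := fun χ => K χ - (a * χ + b * (χ ^ 2 / 2)))
    (h := fun χ => k χ - (a + b * χ)) (ε := η) (C := C) (m := 2) hC.le
    (fun χ hχ => by
      have h1 := (hasDerivAt_id χ).const_mul (a : ℂ)
      have h2 := (((hasDerivAt_pow 2 χ).div_const 2).const_mul (b : ℂ))
      have h3 := (hK χ (hs hχ)).fun_sub (h1.fun_add h2)
      refine h3.congr_deriv ?_
      norm_num)
    (fun χ hχ => by
      rw [hKc χ (hs hχ)]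
      simp [map_ofNat])
    (fun χ hχ => by
      have h1 := hball χ (Metric.ball_subset_ball (min_le_left _ _) hχ)
      rw [sub_zero, hg0] at h1
      have h2 : k χ - (a + b * χ) = χ * (g χ - b) := by rw [mul_sub, hgk]; ring
      rw [h2, norm_mul, pow_two]
      nlinarith [norm_nonneg χ])
    hχ
  have h3 : (K χ - (a * χ + b * (χ ^ 2 / 2))).im = (K χ).im - (a * χ.im + b * χ.re * χ.im) := by
    have : (χ ^ 2 / 2 : ℂ) = (1 / 2 : ℝ) * χ ^ 2 := by push_cast; ring
    rw [this]
    simp [pow_two]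
    ring
  rwa [h3] at key

/-- A conjugation-symmetric function mapping the upper half-disc to the upper half-plane has
non-vanishing derivative. -/
theorem deriv_ne_zero_of_im_pos {f : ℂ → ℂ} {ε : ℝ} (hε : 0 < ε)
    (hf : DifferentiableOn ℂ f (Metric.ball 0 ε))
    (hfc : ∀ χ ∈ Metric.ball 0 ε, f ((starRingEnd ℂ) χ) = (starRingEnd ℂ) (f χ))
    (hpos : ∀ χ ∈ halfDisc ε, 0 < (f χ).im) : deriv f 0 ≠ 0 := by
  intro hd
  have hB : Metric.ball (0 : ℂ) ε ∈ 𝓝 (0 : ℂ) := Metric.ball_mem_nhds 0 hε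
  have h0 : (0 : ℂ) ∈ Metric.ball (0 : ℂ) ε := Metric.mem_ball_self hε
  have hreal : ∀ t : ℝ, (t : ℂ) ∈ Metric.ball (0 : ℂ) ε → (f t).im = 0 := fun t ht => by
    have := hfc t ht
    rw [conj_ofReal] at this
    exact conj_eq_iff_im.1 this.symm
  have hf0 : (f 0).im = 0 := by simpa using hreal 0 (by simpa using hε)
  have han : AnalyticAt ℂ (fun χ => f χ - f 0) 0 := (hf.analyticAt hB).sub analyticAt_const
  have hnz : ¬ ∀ᶠ χ in 𝓝 (0 : ℂ), f χ - f 0 = 0 := by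
    intro h
    have hnb : (𝓝[halfDisc ε] (0 : ℂ)).NeBot :=
      mem_closure_iff_nhdsWithin_neBot.1 (Potential.mem_closure_halfDisc h0 (by simp))
    obtain ⟨χ, h1, h2⟩ := ((eventually_nhdsWithin_of_eventually_nhds h).and
      (eventually_mem_nhdsWithin (s := halfDisc ε))).exists
    have := hpos χ h2
    rw [sub_eq_zero.1 h1, hf0] at this
    exact lt_irrefl _ this
  obtain ⟨n, g, hg, hg0, hfg⟩ := han.exists_eventuallyEq_pow_smul_nonzero_iff.2 hnz
  simp only [sub_zero, smul_eq_mul] at hfg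
  have hn0 : n ≠ 0 := by
    rintro rfl
    have := hfg.self_of_nhds
    simp at this
    exact hg0 this.symm
  have hn1 : n ≠ 1 := by
    rintro rfl
    have h1 : HasDerivAt (fun χ => χ ^ 1 * g χ) (1 * g 0 + 0 * deriv g 0) 0 := by
      have := (hasDerivAt_id' (0 : ℂ)).fun_mul hg.differentiableAt.hasDerivAt
      simpa using this
    have h2 := (h1.congr_of_eventuallyEq hfg).deriv
    rw [deriv_sub_const, hd] at h2
    simp at h2
    exact hg0 h2.symm
  have hn2 : 2 ≤ n := by omega
  have hn2' : (2 : ℝ) ≤ n := by exact_mod_cast hn2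
  have hng : (𝓝[>] (0 : ℝ)).NeBot := inferInstance
  have hline : ∀ w : ℂ, Tendsto (fun t : ℝ => (t : ℂ) * w) (𝓝[>] 0) (𝓝 0) := fun w => by
    have : Continuous (fun t : ℝ => (t : ℂ) * w) := by fun_prop
    have := this.tendsto 0
    simp only [ofReal_zero, zero_mul] at this
    exact this.mono_left inf_le_left
  have hgre : (g 0).im = 0 := by
    have h1 : Tendsto (fun t : ℝ => (g ((t : ℂ) * 1)).im) (𝓝[>] 0) (𝓝 (g 0).im) :=
      (continuous_im.tendsto _).comp (hg.continuousAt.tendsto.comp (hline 1))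
    refine tendsto_nhds_unique (h1.congr' ?_) tendsto_const_nhds
    filter_upwards [(hline 1).eventually hfg, (hline 1).eventually hB, self_mem_nhdsWithin]
      with t h2 h3 h4
    have ht : (0 : ℝ) < t := h4
    rw [mul_one] at h2 h3 ⊢
    have h5 := congrArg Complex.im h2
    rw [sub_im, hreal t h3, hf0, ← ofReal_pow, im_ofReal_mul] at h5
    have h6 : t ^ n ≠ 0 := pow_ne_zero _ ht.ne'
    have h7 : t ^ n * (g t).im = 0 := by linarith
    exact (mul_eq_zero.1 h7).resolve_left h6
  obtain ⟨s, hs0, hs1, hs⟩ : ∃ s : ℝ, 0 < s ∧ s < 2 * Real.pi ∧ Real.sin s * (g 0).re < 0 := by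
    have hre : (g 0).re ≠ 0 := fun h => hg0 (Complex.ext h hgre)
    have hpi := Real.pi_pos
    rcases hre.lt_or_gt with h | h
    · exact ⟨Real.pi / 2, by linarith, by linarith, by rw [Real.sin_pi_div_two]; linarith⟩
    · refine ⟨Real.pi / 2 + Real.pi, by linarith, by linarith, ?_⟩
      rw [Real.sin_add_pi, Real.sin_pi_div_two]; linarith
  set w : ℂ := exp ((s / n : ℝ) * I) with hw
  have hwn : w ^ n = exp ((s : ℝ) * I) := by
    rw [hw, ← exp_nat_mul]
    congr 1
    have : (n : ℂ) ≠ 0 := by exact_mod_cast hn0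
    push_cast
    field_simp
  have hwi : 0 < w.im := by
    rw [hw, exp_ofReal_mul_I_im]
    refine Real.sin_pos_of_pos_of_lt_pi (by positivity) ?_
    rw [div_lt_iff₀ (by linarith)]
    nlinarith [Real.pi_pos]
  have hlim : Tendsto (fun t : ℝ => (w ^ n * g ((t : ℂ) * w)).im) (𝓝[>] 0)
      (𝓝 (w ^ n * g 0).im) :=
    (continuous_im.tendsto _).comp (tendsto_const_nhds.mul (hg.continuousAt.tendsto.comp (hline w)))
  have hneg : (w ^ n * g 0).im < 0 := by
    rw [hwn, mul_im, hgre, exp_ofReal_mul_I_im, mul_zero, zero_add]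
    exact hs
  obtain ⟨t, h1, h2, h3, h4⟩ := ((hlim.eventually (gt_mem_nhds hneg)).and
    (((hline w).eventually hfg).and (((hline w).eventually hB).and
      (eventually_mem_nhdsWithin (s := Set.Ioi (0 : ℝ)))))).exists
  have ht : (0 : ℝ) < t := h4
  have h5 := hpos ((t : ℂ) * w) ⟨by
    show 0 < ((t : ℂ) * w).im
    rw [im_ofReal_mul]; exact mul_pos ht hwi, h3⟩
  have h6 := congrArg Complex.im h2
  rw [mul_pow, mul_assoc, ← ofReal_pow, im_ofReal_mul, sub_im, hf0, sub_zero] at h6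
  rw [h6] at h5
  have := mul_neg_of_pos_of_neg (pow_pos ht n) h1
  linarith

/-! ### Points of the slit domain near a real point -/

namespace SlitCurve

variable {S : SlitCurve}

theorem eventually_r_near {x₀ r₀ : ℝ} (h : r₀ ^ 2 = S.R.eval x₀) {η : ℝ} (hη : 0 < η) :
    ∀ᶠ z in 𝓝 (x₀ : ℂ), ‖S.r z - r₀‖ < η ∨ ‖S.r z - (-r₀ : ℝ)‖ < η := by
  have h1 : Tendsto (fun z : ℂ => aeval z S.R) (𝓝 (x₀ : ℂ)) (𝓝 ((r₀ : ℂ) ^ 2)) := by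
    have := (aeval_continuous S.R).tendsto (x₀ : ℂ)
    rwa [aeval_ofReal_eq, ← h, ofReal_pow] at this
  filter_upwards [h1.eventually (Metric.ball_mem_nhds _ (pow_pos hη 2))] with z hz
  by_contra hcon
  rw [not_or, not_lt, not_lt] at hcon
  rw [dist_eq_norm, ← S.r_sq, show S.r z ^ 2 - (r₀ : ℂ) ^ 2 =
    (S.r z - r₀) * (S.r z - (-r₀ : ℝ)) by push_cast; ring, norm_mul] at hz
  have := mul_le_mul hcon.1 hcon.2 hη.le (norm_nonneg _)
  nlinarith

/-- A property of points of the slit domain near a real point may be checked in charts. -/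
theorem eventually_of_charts {x₀ : ℝ} (hR : 0 ≤ S.R.eval x₀) {P : ℂ → Prop}
    (h : ∀ r₀ : ℝ, r₀ ^ 2 = S.R.eval x₀ → ∃ c : Chart S x₀ r₀,
      ∀ᶠ χ in 𝓝 (0 : ℂ), χ ∈ halfDisc c.ε → P (c.Z χ)) :
    ∀ᶠ z in 𝓝 (x₀ : ℂ), z ∈ S.dom → P z := by
  have key : ∀ r₀ : ℝ, r₀ ^ 2 = S.R.eval x₀ → ∃ η > 0, ∀ᶠ z in 𝓝 (x₀ : ℂ),
      ‖S.r z - r₀‖ < η → z ∈ S.dom → P z := by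
    intro r₀ hr₀
    obtain ⟨c, hc⟩ := h r₀ hr₀
    obtain ⟨η, hη, hball⟩ := Metric.eventually_nhds_iff_ball.1
      ((c.tendsto_inv.eventually hc).and c.inv_im_pos)
    refine ⟨η, hη, ?_⟩
    filter_upwards [Metric.ball_mem_nhds _ hη] with z hz hr hzd
    obtain ⟨h1, h2⟩ := hball (z, S.r z) (by
      rw [← ball_prod_same]
      exact ⟨hz, by rw [mem_ball_iff_norm]; exact hr⟩)
    obtain ⟨h3, h4⟩ := h2 hzd rfl
    have := h1 h3
    rwa [h4] at this
  have hs := Real.sq_sqrt hR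
  obtain ⟨η₁, h1, h2⟩ := key _ hs
  obtain ⟨η₂, h3, h4⟩ := key (-√(S.R.eval x₀)) (by rw [neg_sq, hs])
  filter_upwards [h2, h4, eventually_r_near hs (lt_min h1 h3)] with z h5 h6 h7 h8
  rcases h7 with h7 | h7
  · exact h5 (h7.trans_le (min_le_left _ _)) h8
  · exact h6 (h7.trans_le (min_le_right _ _)) h8

/-- The complement of the slit domain on the negative axis. -/
def gaps (S : SlitCurve) : Set ℝ := {x | x < 0 ∧ 0 ≤ S.R.eval x}

theorem leadingCoeff_pos : 0 < S.R.leadingCoeff := by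
  by_contra h
  have hdeg : 0 < S.R.degree := by
    rw [← natDegree_pos_iff_degree_pos, S.natDegree_R]; omega
  have := tendsto_atBot_of_leadingCoeff_nonpos S.R hdeg (not_lt.1 h)
  obtain ⟨x, h1, h2⟩ := ((this.eventually (eventually_le_atBot 0)).and
    (eventually_gt_atTop 0)).exists
  linarith [S.R_pos x h2]

theorem exists_neg_bound : ∃ M > 0, ∀ x : ℝ, x < -M → S.R.eval x < 0 := by
  have hnd : (S.R.comp (-X)).natDegree = 2 * S.genus + 1 := by
    rw [natDegree_comp, natDegree_neg, natDegree_X, mul_one, S.natDegree_R]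
  have hdeg : 0 < (S.R.comp (-X)).degree := by
    rw [← natDegree_pos_iff_degree_pos, hnd]; omega
  have hlc : (S.R.comp (-X)).leadingCoeff ≤ 0 := by
    rw [leadingCoeff_comp (by simp), S.natDegree_R, leadingCoeff_neg, leadingCoeff_X,
      Odd.neg_one_pow ⟨S.genus, rfl⟩]
    linarith [S.leadingCoeff_pos]
  have := tendsto_atBot_of_leadingCoeff_nonpos _ hdeg hlc
  obtain ⟨M, hM⟩ := eventually_atTop.1 (this.eventually (eventually_lt_atBot 0))
  refine ⟨max M 1, by positivity, fun x hx => ?_⟩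
  have := hM (-x) (by linarith [le_max_left M 1])
  simpa using this

theorem exists_neg_near_zero : ∃ δ > 0, ∀ x : ℝ, -δ < x → x < 0 → S.R.eval x < 0 := by
  obtain ⟨R₁, hR₁⟩ := X_dvd_iff.2 (show S.R.coeff 0 = 0 by
    rw [coeff_zero_eq_eval_zero, S.R_zero])
  have h0 : R₁.eval 0 ≠ 0 := by
    intro h
    refine S.simple 0 S.R_zero ?_
    rw [hR₁]
    simp [h]
  have hge : 0 ≤ R₁.eval 0 := by
    have hc : Tendsto (fun x => R₁.eval x) (𝓝[>] 0) (𝓝 (R₁.eval 0)) :=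
      (R₁.continuous.tendsto 0).mono_left inf_le_left
    refine ge_of_tendsto hc ?_
    filter_upwards [self_mem_nhdsWithin] with x hx
    have hx0 : (0 : ℝ) < x := hx
    have := S.R_pos x hx0
    rw [hR₁, eval_mul, eval_X] at this
    exact (pos_of_mul_pos_right this hx0.le).le
  have hp := lt_of_le_of_ne hge h0.symm
  obtain ⟨δ, hδ, hb⟩ := Metric.eventually_nhds_iff_ball.1
    (R₁.continuous.continuousAt.eventually (lt_mem_nhds hp))
  refine ⟨δ, hδ, fun x h1 h2 => ?_⟩
  have := hb x (by rw [mem_ball_zero_iff, Real.norm_eq_abs, abs_lt]; constructor <;> linarith)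
  rw [hR₁, eval_mul, eval_X]
  exact mul_neg_of_neg_of_pos h2 this

theorem isCompact_gaps : IsCompact S.gaps := by
  obtain ⟨M, hM, h1⟩ := S.exists_neg_bound
  obtain ⟨δ, hδ, h2⟩ := S.exists_neg_near_zero
  have : S.gaps = Set.Icc (-M) (-δ) ∩ {x | 0 ≤ S.R.eval x} := by
    ext x
    constructor
    · rintro ⟨h3, h4⟩
      refine ⟨⟨?_, ?_⟩, h4⟩
      · by_contra h5
        linarith [h1 x (not_le.1 h5)]
      · by_contra h5
        linarith [h2 x (not_le.1 h5) h3]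
    · rintro ⟨⟨-, h3⟩, h4⟩
      exact ⟨by linarith, h4⟩
  rw [this]
  exact isCompact_Icc.inter_right (isClosed_le continuous_const S.R.continuous)

/-- The plane cut along the nonnegative axis. -/
def cutPlane : Set ℂ := {z | -z ∈ slitPlane}

theorem isOpen_cutPlane : IsOpen cutPlane := isOpen_slitPlane.preimage continuous_neg

theorem mem_cutPlane {z : ℂ} : z ∈ cutPlane ↔ z.im ≠ 0 ∨ z.re < 0 := by
  rw [cutPlane, Set.mem_ofPred_eq, mem_slitPlane_iff]
  simp [or_comm]

theorem dom_subset_cutPlane : S.dom ⊆ cutPlane := fun _ hz => mem_cutPlane.2 (mem_dom_imp hz)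

theorem cutPlane_cases {z : ℂ} (hz : z ∈ cutPlane) :
    z ∈ S.dom ∨ ∃ x ∈ S.gaps, z = (x : ℂ) := by
  by_cases h : z ∈ S.dom
  · exact Or.inl h
  · right
    have h' : ¬ (z.im ≠ 0 ∨ S.R.eval z.re < 0) := h
    rw [not_or, not_not, not_lt] at h'
    refine ⟨z.re, ⟨(mem_cutPlane.1 hz).resolve_left (not_not.2 h'.1), h'.2⟩, ?_⟩
    exact Complex.ext rfl (by simp [h'.1])

theorem not_mem_dom_of_gaps {x : ℝ} (hx : x ∈ S.gaps) : (x : ℂ) ∉ S.dom := by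
  rintro (h | h)
  · simp at h
  · rw [ofReal_re] at h; linarith [hx.2]

theorem gaps_mem_cutPlane {x : ℝ} (hx : x ∈ S.gaps) : (x : ℂ) ∈ cutPlane :=
  mem_cutPlane.2 (Or.inr (by simpa using hx.1))

end SlitCurve

theorem isPreconnected_punctured_ball (c : ℂ) {r : ℝ} (hr : 0 < r) :
    IsPreconnected (Metric.ball c r \ {c}) := by
  have h1 : IsPreconnected ({0}ᶜ : Set ℂ) :=
    (isConnected_compl_singleton_of_one_lt_rank (by simp) 0).isPreconnected
  set e := OpenPartialHomeomorph.univBall c r with he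
  have hc : ContinuousOn e Set.univ := by
    have := e.continuousOn
    rwa [OpenPartialHomeomorph.univBall_source] at this
  have hinj : Function.Injective e := by
    have := e.injOn
    rwa [OpenPartialHomeomorph.univBall_source, Set.injOn_univ] at this
  have h2 := h1.image e (hc.mono (Set.subset_univ _))
  rw [Set.image_compl_eq_range_sdiff_image hinj, Set.image_singleton,
    OpenPartialHomeomorph.univBall_apply_zero, ← Set.image_univ,
    ← OpenPartialHomeomorph.univBall_source c r, e.image_source_eq_target,
    OpenPartialHomeomorph.univBall_target c hr] at h2
  exact h2

theorem isPreconnected_diff_singleton {U : Set ℂ} (hU : IsOpen U) (hc : IsPreconnected U) (p : ℂ) :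
    IsPreconnected (U \ {p}) := by
  by_cases hp : p ∈ U
  swap
  · rwa [Set.sdiff_singleton_eq_self hp]
  obtain ⟨ε, hε, hb⟩ := Metric.isOpen_iff.1 hU p hp
  have hpb := isPreconnected_punctured_ball p hε
  have hbs : Metric.ball p ε \ {p} ⊆ U \ {p} := Set.sdiff_subset_sdiff_left hb
  have key : ∀ u v : Set ℂ, IsOpen u → IsOpen v → U \ {p} ⊆ u ∪ v → ((U \ {p}) ∩ v).Nonempty →
      Metric.ball p ε \ {p} ⊆ u → ((U \ {p}) ∩ (u ∩ v)).Nonempty := by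
    rintro u v hu hv huv ⟨y, hy1, hy2⟩ hbu
    obtain ⟨x, hx1, hx2, hx3⟩ := hc (u ∪ Metric.ball p ε) (v \ {p}) (hu.union Metric.isOpen_ball)
      (hv.sdiff isClosed_singleton)
      (fun x hx => by
        by_cases hxp : x = p
        · exact Or.inl (Or.inr (hxp ▸ Metric.mem_ball_self hε))
        · rcases huv ⟨hx, hxp⟩ with h | h
          · exact Or.inl (Or.inl h)
          · exact Or.inr ⟨h, hxp⟩)
      ⟨p, hp, Or.inr (Metric.mem_ball_self hε)⟩ ⟨y, hy1.1, hy2, hy1.2⟩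
    refine ⟨x, ⟨hx1, hx3.2⟩, ?_, hx3.1⟩
    rcases hx2 with h | h
    · exact h
    · exact hbu ⟨h, hx3.2⟩
  intro u v hu hv huv hnu hnv
  by_cases h1 : ((Metric.ball p ε \ {p}) ∩ u).Nonempty
  · by_cases h2 : ((Metric.ball p ε \ {p}) ∩ v).Nonempty
    · obtain ⟨x, hx⟩ := hpb u v hu hv (hbs.trans huv) h1 h2
      exact ⟨x, hbs hx.1, hx.2⟩
    · refine key u v hu hv huv hnv fun x hx => ?_
      rcases huv (hbs hx) with h | h
      · exact h
      · exact absurd ⟨x, hx, h⟩ h2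
  · rw [Set.inter_comm u v]
    refine key v u hv hu (by rwa [Set.union_comm]) hnu fun x hx => ?_
    rcases huv (hbs hx) with h | h
    · exact absurd ⟨x, hx, h⟩ h1
    · exact h

theorem isPreconnected_diff_finite {U F : Set ℂ} (hU : IsOpen U) (hc : IsPreconnected U)
    (hF : F.Finite) : IsPreconnected (U \ F) := by
  induction F, hF using Set.Finite.induction_on with
  | empty => simpa using hc
  | @insert a s _ hs ih =>
    have : U \ insert a s = (U \ s) \ {a} := by
      ext x; simp only [Set.mem_sdiff, Set.mem_insert_iff, Set.mem_singleton_iff]; tauto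
    rw [this]
    exact isPreconnected_diff_singleton (hU.sdiff hs.isClosed) ih a

/-! ### Filter lemmas -/

theorem exists_ultrafilter_of_mem_closure_image {X Y : Type*} [TopologicalSpace Y] {f : X → Y}
    {s : Set X} {c : Y} (h : c ∈ closure (f '' s)) :
    ∃ U : Ultrafilter X, s ∈ U ∧ Tendsto f U (𝓝 c) := by
  rw [mem_closure_iff_clusterPt, ClusterPt, ← Filter.map_principal, inf_comm,
    ← Filter.push_pull] at h
  have hnb : (𝓟 s ⊓ comap f (𝓝 c)).NeBot := h.of_map
  have hle : (Ultrafilter.of (𝓟 s ⊓ comap f (𝓝 c)) : Filter X) ≤ 𝓟 s ⊓ comap f (𝓝 c) :=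
    Ultrafilter.of_le _
  exact ⟨Ultrafilter.of _, le_principal_iff.1 (hle.trans inf_le_left),
    tendsto_iff_comap.2 (hle.trans inf_le_right)⟩

theorem ultrafilter_tendsto_of_mem_compact {X Y : Type*} [TopologicalSpace Y] {K : Set Y}
    (hK : IsCompact K) (U : Ultrafilter X) {f : X → Y} (h : ∀ᶠ x in (U : Filter X), f x ∈ K) :
    ∃ c ∈ K, Tendsto f U (𝓝 c) := by
  obtain ⟨c, hc, hle⟩ := isCompact_iff_ultrafilter_le_nhds.1 hK (U.map f)
    (le_principal_iff.2 h)
  exact ⟨c, hc, hle⟩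

theorem ultrafilter_cobounded_or (U : Ultrafilter ℂ) :
    (U : Filter ℂ) ≤ Bornology.cobounded ℂ ∨ ∃ z, (U : Filter ℂ) ≤ 𝓝 z := by
  by_cases h : (U : Filter ℂ) ≤ Bornology.cobounded ℂ
  · exact Or.inl h
  · right
    rw [Filter.not_le] at h
    obtain ⟨s, hs, hsU⟩ := h
    have h1 : sᶜ ∈ U := Ultrafilter.compl_mem_iff_notMem.2 hsU
    have h2 : Bornology.IsBounded sᶜ := by
      rw [← Bornology.isCobounded_compl_iff, compl_compl]; exact hs
    obtain ⟨r, hr⟩ := h2.subset_closedBall 0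
    obtain ⟨z, -, hz⟩ := isCompact_iff_ultrafilter_le_nhds.1 (isCompact_closedBall (0 : ℂ) r) U
      (le_principal_iff.2 (mem_of_superset h1 hr))
    exact ⟨z, hz⟩

theorem tendsto_mk {X : Type*} {l : Filter X} {f g : X → ℝ} {u v : ℝ} (hf : Tendsto f l (𝓝 u))
    (hg : Tendsto g l (𝓝 v)) : Tendsto (fun x => (⟨f x, g x⟩ : ℂ)) l (𝓝 ⟨u, v⟩) := by
  simp only [mk_eq_add_mul_I]
  exact ((continuous_ofReal.tendsto _).comp hf).add
    (((continuous_ofReal.tendsto _).comp hg).mul tendsto_const_nhds)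

theorem lower_mem_closure_dom {S : SlitCurve} {z : ℂ} (hz : z.im = 0) : z ∈ closure S.dom :=
  closure_mono (fun _ h => SlitCurve.lower_mem_dom h) (mem_closure_lower hz.le)

/-! ### Slopes of potentials -/

namespace Potential

variable {S : SlitCurve} {D : Set ℂ}

/-- Restriction of a potential. -/
def restrict (p : Potential S D) {D' : Set ℂ} (ho : IsOpen D') (h : D' ⊆ D) : Potential S D' where
  y := p.y
  a := p.a
  q := p.q
  isOpen_D := ho
  ne_one := fun z hz => p.ne_one z (h hz)
  a_diff := p.a_diff.mono h
  a_conj := p.a_conj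
  cont := p.cont.mono h
  deriv := p.deriv

variable (p : Potential S D) {x₀ r₀ : ℝ} (c : Chart S x₀ r₀)

/-- The value of the differential at the base point of a chart. -/
def slope : ℝ := (p.localForm c 0).re

/-- The derivative of the differential at the base point of a chart. -/
def slope₂ : ℝ := (_root_.deriv (p.localForm c) 0).re

variable {p c}

theorem deriv_real {k : ℂ → ℂ} {ε : ℝ} (hε : 0 < ε) (hk : DifferentiableOn ℂ k (Metric.ball 0 ε))
    (hc : ∀ χ ∈ Metric.ball 0 ε, k ((starRingEnd ℂ) χ) = (starRingEnd ℂ) (k χ)) :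
    (_root_.deriv k 0).im = 0 := by
  have h1 := (hk.differentiableAt (Metric.ball_mem_nhds 0 hε)).hasDerivAt
  have h2 := h1.conj_conj
  rw [map_zero] at h2
  have h3 : HasDerivAt k ((starRingEnd ℂ) (_root_.deriv k 0)) 0 := by
    refine h2.congr_of_eventuallyEq ?_
    filter_upwards [Metric.ball_mem_nhds (0 : ℂ) hε] with χ hχ
    simp [hc χ hχ]
  exact conj_eq_iff_im.1 (h3.unique h1)

theorem IsLocalPrimitive.localForm_zero {ε : ℝ} {K : ℂ → ℂ} (h : p.IsLocalPrimitive c ε K) :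
    p.localForm c 0 = p.slope c := by
  have := h.conj_form 0 (Metric.mem_ball_self h.pos)
  rw [map_zero] at this
  exact Complex.ext rfl (by simpa using conj_eq_iff_im.1 this.symm)

theorem IsLocalPrimitive.deriv_localForm {ε : ℝ} {K : ℂ → ℂ} (h : p.IsLocalPrimitive c ε K) :
    _root_.deriv (p.localForm c) 0 = p.slope₂ c :=
  Complex.ext rfl (by simpa using deriv_real h.pos h.diff h.conj_form)

theorem IsLocalPrimitive.expansion₂ {ε : ℝ} {K : ℂ → ℂ} (h : p.IsLocalPrimitive c ε K) :
    ∃ C ≥ 0, ∀ᶠ χ in 𝓝 (0 : ℂ), |(K χ).im - (p.slope c * χ.im + p.slope₂ c * χ.re * χ.im)| ≤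
      C * ‖χ‖ ^ 2 * |χ.im| :=
  exists_im_expansion h.pos h.deriv h.diff h.conj h.localForm_zero h.deriv_localForm

theorem IsLocalPrimitive.expansion₁ {ε : ℝ} {K : ℂ → ℂ} (h : p.IsLocalPrimitive c ε K) :
    ∃ C ≥ 0, ∀ᶠ χ in 𝓝 (0 : ℂ), |(K χ).im - p.slope c * χ.im| ≤ C * ‖χ‖ * |χ.im| := by
  obtain ⟨C, hC, h2⟩ := h.expansion₂
  refine ⟨C + |p.slope₂ c|, by positivity, ?_⟩
  filter_upwards [h2, Metric.ball_mem_nhds (0 : ℂ) one_pos] with χ h3 h4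
  rw [mem_ball_zero_iff] at h4
  have h5 := abs_re_le_norm χ
  have h6 : |p.slope₂ c * χ.re * χ.im| ≤ |p.slope₂ c| * ‖χ‖ * |χ.im| := by
    rw [abs_mul, abs_mul]; gcongr
  have h7 : C * ‖χ‖ ^ 2 * |χ.im| ≤ C * ‖χ‖ * |χ.im| := by
    have : ‖χ‖ ^ 2 ≤ ‖χ‖ := by nlinarith [norm_nonneg χ]
    gcongr
  have h8 : (K χ).im - p.slope c * χ.im =
      ((K χ).im - (p.slope c * χ.im + p.slope₂ c * χ.re * χ.im)) + p.slope₂ c * χ.re * χ.im := by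
    ring
  rw [h8]
  refine (abs_add_le _ _).trans ?_
  linarith

theorem IsLocalPrimitive.approx {ε : ℝ} {K : ℂ → ℂ} (h : p.IsLocalPrimitive c ε K) {η : ℝ}
    (hη : 0 < η) : ∀ᶠ χ in 𝓝 (0 : ℂ), |(K χ).im - p.slope c * χ.im| ≤ η * |χ.im| := by
  obtain ⟨C, hC, h2⟩ := h.expansion₁
  have h3 : Tendsto (fun χ : ℂ => C * ‖χ‖) (𝓝 0) (𝓝 0) := by
    have : Continuous (fun χ : ℂ => C * ‖χ‖) := by fun_prop
    simpa using this.tendsto 0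
  filter_upwards [h2, h3.eventually (gt_mem_nhds hη)] with χ h4 h5
  exact h4.trans (by gcongr)

end Potential

/-! ### The map into the plane -/

/-- The data defining the map of the slit domain into the plane. -/
structure CuspData where
  /-- The curve. -/
  S : SlitCurve
  /-- The polynomial of the first differential. -/
  qA : ℝ[X]
  /-- The polynomial of the second differential. -/
  qB : ℝ[X]
  degA : qA.natDegree ≤ S.genus
  degB : qB.natDegree ≤ S.genus
  jac : ∀ z ∈ S.dom, ((1 / (2 * z) + S.form qA z) * (starRingEnd ℂ) (S.form qB z)).im < 0
  bdry : ∀ x r : ℝ, x < 0 → r ^ 2 = S.R.eval x →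
    ¬ (r / (2 * x) + qA.eval x / (x - 1) = 0 ∧ qB.eval x = 0)
  qB_one : 0 < qB.eval 1

open SlitCurve in
/-- Adding `κ` times the argument to a potential. -/
def argPotential {S : SlitCurve} (p : Potential S {1}ᶜ) (ha : ∀ z, p.a z = 0) :
    Potential S cutPlane where
  y := fun z => ((-z).arg - Real.pi) / 2 + p.y z
  a := fun z => 1 / (2 * z)
  q := p.q
  isOpen_D := isOpen_cutPlane
  ne_one := by
    rintro z hz rfl
    have := mem_cutPlane.1 hz
    norm_num at this
  a_diff := fun z hz => by
    have hz0 : z ≠ 0 := fun h => by rw [h, mem_cutPlane] at hz; norm_num at hz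
    have : DifferentiableAt ℂ (fun z : ℂ => 1 / (2 * z)) z := by
      refine (differentiableAt_const _).div (differentiableAt_id.const_mul _) ?_
      simpa using hz0
    exact this.differentiableWithinAt
  a_conj := fun z => by simp [map_ofNat]
  cont := by
    refine ContinuousOn.add (ContinuousOn.div_const (ContinuousOn.sub (fun z hz => ?_)
      continuousOn_const) 2) (p.cont.mono ?_)
    · exact (ContinuousAt.comp (continuousAt_arg hz)
        continuous_neg.continuousAt).continuousWithinAt
    · rintro z hz rfl
      have := mem_cutPlane.1 hz
      norm_num at this
  deriv := fun z hz => by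
    have hc := dom_subset_cutPlane hz
    have h1 : HasDerivAt (fun z : ℂ => (log (-z) - Real.pi * I) / 2) (1 / (2 * z)) z := by
      have hz0 := ne_zero_of_mem hz
      have := ((((hasDerivAt_id' z).fun_neg).clog hc).sub_const (Real.pi * I : ℂ)).div_const 2
      refine this.congr_deriv ?_
      rw [neg_div_neg_eq, div_div, mul_comm]
    have h2 := (hasFDerivAt_im h1).add (p.deriv z hz)
    have h3 : imForm (1 / (2 * z)) + imForm (p.a z + S.form p.q z) =
        imForm (1 / (2 * z) + S.form p.q z) := by
      ext v; simp [ha]; ring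
    rw [h3] at h2
    refine h2.congr_of_eventuallyEq (Eventually.of_forall fun w => ?_)
    have : ((log (-w) - Real.pi * I) / 2).im = ((-w).arg - Real.pi) / 2 := by
      have e : (log (-w) - Real.pi * I) / 2 = ((1 / 2 : ℝ) : ℂ) * (log (-w) - Real.pi * I) := by
        push_cast; ring
      rw [e, im_ofReal_mul, sub_im, log_im]
      simp; ring
    simp only [Pi.add_apply]
    rw [this]

namespace CuspData

open SlitCurve

variable (D : CuspData)

/-- The potential of the odd part of the first differential. -/
def yA : Potential D.S {1}ᶜ := (exists_potential D.degA).choose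

/-- The potential of the second differential. -/
def yB : Potential D.S {1}ᶜ := (exists_potential D.degB).choose

theorem yA_spec : D.yA.q = D.qA ∧ (∀ z, D.yA.a z = 0) ∧
    (∀ z, D.yA.y ((starRingEnd ℂ) z) = D.yA.y z) ∧
    Tendsto D.yA.y (Bornology.cobounded ℂ) (𝓝 0) := (exists_potential D.degA).choose_spec

theorem yB_spec : D.yB.q = D.qB ∧ (∀ z, D.yB.a z = 0) ∧
    (∀ z, D.yB.y ((starRingEnd ℂ) z) = D.yB.y z) ∧
    Tendsto D.yB.y (Bornology.cobounded ℂ) (𝓝 0) := (exists_potential D.degB).choose_spec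

/-- The first coordinate. -/
def pA : Potential D.S cutPlane := argPotential D.yA D.yA_spec.2.1

/-- The second coordinate. -/
def pB : Potential D.S cutPlane := D.yB.restrict isOpen_cutPlane D.pA.ne_one

/-- The map into the plane. -/
def Y (z : ℂ) : ℂ := ⟨D.pA.y z, D.pB.y z⟩

/-- The first slope at `z = 1`. -/
def bA : ℝ := D.qA.eval 1 / √(D.S.R.eval 1)

/-- The second slope at `z = 1`. -/
def bB : ℝ := D.qB.eval 1 / √(D.S.R.eval 1)

theorem bB_pos : 0 < D.bB := div_pos D.qB_one (Real.sqrt_pos.2 (D.S.R_pos 1 one_pos))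

variable {D}

theorem continuousOn_Y : ContinuousOn D.Y cutPlane := fun z hz =>
  tendsto_mk (D.pA.cont z hz) (D.pB.cont z hz)

theorem continuousAt_Y {z : ℂ} (hz : z ∈ cutPlane) : ContinuousAt D.Y z :=
  continuousOn_Y.continuousAt (isOpen_cutPlane.mem_nhds hz)

theorem jac' {z : ℂ} (hz : z ∈ D.S.dom) : ((D.pA.a z + D.S.form D.pA.q z) *
    (starRingEnd ℂ) (D.pB.a z + D.S.form D.pB.q z)).im < 0 := by
  have h1 : D.pA.q = D.qA := D.yA_spec.1
  have h2 : D.pB.q = D.qB := D.yB_spec.1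
  have h3 : D.pB.a z = 0 := D.yB_spec.2.1 z
  rw [h1, h2, h3, zero_add]
  exact D.jac z hz

/-! #### Local behaviour in the slit domain -/

/-- `v ↦ (Im (a v), Im (b v))` -/
def pairForm (a b : ℂ) : ℂ →L[ℝ] ℂ :=
  ofRealCLM.comp (imForm a) + (I • ofRealCLM.comp (imForm b) : ℂ →L[ℝ] ℂ)

theorem pairForm_apply (a b v : ℂ) : pairForm a b v = ⟨(a * v).im, (b * v).im⟩ := by
  rw [mk_eq_add_mul_I]
  simp [pairForm]
  ring

theorem continuous_imForm : Continuous imForm := by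
  have h : imForm = (IsLinearMap.mk' imForm
      ⟨fun x y => by ext v; simp; ring, fun c x => by ext v; simp; ring⟩ :
      ℂ →ₗ[ℝ] (ℂ →L[ℝ] ℝ)) := rfl
  rw [h]
  exact LinearMap.continuous_of_finiteDimensional _

theorem exists_equiv_pairForm {a b : ℂ} (h : (a * (starRingEnd ℂ) b).im ≠ 0) :
    ∃ e : ℂ ≃L[ℝ] ℂ, (e : ℂ →L[ℝ] ℂ) = pairForm a b := by
  have hinj : Function.Injective (pairForm a b : ℂ →ₗ[ℝ] ℂ) := by
    rw [← LinearMap.ker_eq_bot, LinearMap.ker_eq_bot']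
    intro v hv
    have hv' : pairForm a b v = 0 := hv
    rw [pairForm_apply] at hv'
    have h1 : (a * v).im = 0 := congrArg Complex.re hv'
    have h2 : (b * v).im = 0 := congrArg Complex.im hv'
    by_contra hv0
    apply h
    have h3 : (a * (starRingEnd ℂ) b) * normSq v = (a * v) * (starRingEnd ℂ) (b * v) := by
      rw [← mul_conj, map_mul]; ring
    have h6 : (a * (starRingEnd ℂ) b).im * normSq v = 0 := by
      rw [← im_mul_ofReal, h3, mul_im, h1, conj_im, h2]; ring
    have h5 : normSq v ≠ 0 := normSq_eq_zero.not.2 hv0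
    exact (mul_eq_zero.1 h6).resolve_right h5
  refine ⟨(LinearEquiv.ofInjectiveEndo _ hinj).toContinuousLinearEquiv, ?_⟩
  ext v
  rfl

theorem exists_strict {z : ℂ} (hz : z ∈ D.S.dom) :
    ∃ e : ℂ ≃L[ℝ] ℂ, HasStrictFDerivAt D.Y (e : ℂ →L[ℝ] ℂ) z := by
  obtain ⟨e, he⟩ := exists_equiv_pairForm (D.jac' hz).ne
  refine ⟨e, ?_⟩
  rw [he]
  refine hasStrictFDerivAt_of_hasFDerivAt_of_continuousAt
    (f' := fun z => pairForm (D.pA.a z + D.S.form D.pA.q z) (D.pB.a z + D.S.form D.pB.q z)) ?_ ?_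
  · filter_upwards [D.S.isOpen_dom.mem_nhds hz] with w hw
    have h1 := ofRealCLM.hasFDerivAt.comp w (D.pA.deriv w hw)
    have h2 := (ofRealCLM.hasFDerivAt.comp w (D.pB.deriv w hw)).const_smul I
    refine (h1.add h2).congr_of_eventuallyEq (Eventually.of_forall fun v => ?_)
    rw [Y, mk_eq_add_mul_I]
    simp [mul_comm]
  · have hca : ∀ p : Potential D.S cutPlane,
        ContinuousAt (fun z => imForm (p.a z + D.S.form p.q z)) z := fun p => by
      refine ContinuousAt.comp (g := imForm) (f := fun z => p.a z + D.S.form p.q z)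
        continuous_imForm.continuousAt ?_
      exact (p.a_diff.continuousOn.continuousAt
        (isOpen_cutPlane.mem_nhds (dom_subset_cutPlane hz))).add
        ((form_differentiableOn p.q).continuousOn.continuousAt (D.S.isOpen_dom.mem_nhds hz))
    exact ((continuous_const.clm_comp continuous_id).continuousAt.comp (hca D.pA)).add
      (((continuous_const.clm_comp continuous_id).continuousAt.comp (hca D.pB)).const_smul I)

theorem map_nhds_Y {z : ℂ} (hz : z ∈ D.S.dom) : map D.Y (𝓝 z) = 𝓝 (D.Y z) := by
  obtain ⟨e, he⟩ := D.exists_strict hz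
  exact he.map_nhds_eq_of_equiv

theorem exists_injOn {z : ℂ} (hz : z ∈ D.S.dom) : ∃ V ∈ 𝓝 z, Set.InjOn D.Y V := by
  obtain ⟨e, he⟩ := D.exists_strict hz
  exact ⟨_, (he.toOpenPartialHomeomorph _).open_source.mem_nhds
    he.mem_toOpenPartialHomeomorph_source, (he.toOpenPartialHomeomorph _).injOn⟩

theorem isOpen_image_Y {O : Set ℂ} (hO : IsOpen O) (hd : O ⊆ D.S.dom) : IsOpen (D.Y '' O) := by
  rw [isOpen_iff_mem_nhds]
  rintro _ ⟨z, hz, rfl⟩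
  rw [← D.map_nhds_Y (hd hz)]
  exact image_mem_map (hO.mem_nhds hz)

/-! #### Behaviour at the gaps -/

theorem slope_ne {x₀ r₀ : ℝ} (c : Chart D.S x₀ r₀) (hx : x₀ ∈ D.S.gaps) :
    ¬ (D.pA.slope c = 0 ∧ D.pB.slope c = 0) := by
  rintro ⟨h1, h2⟩
  have h0 : (0 : ℂ) ∈ Metric.ball (0 : ℂ) c.ε := Metric.mem_ball_self c.ε_pos
  obtain ⟨ε, K, hK⟩ := D.pA.exists_localPrimitive c (gaps_mem_cutPlane hx)
  obtain ⟨ε', K', hK'⟩ := D.pB.exists_localPrimitive c (gaps_mem_cutPlane hx)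
  have hA := hK.localForm_zero
  have hB := hK'.localForm_zero
  rw [h1, ofReal_zero, Potential.localForm, mul_eq_zero, or_iff_right (c.j_ne 0 h0), c.Z_zero,
    c.ρ_zero] at hA
  rw [h2, ofReal_zero, Potential.localForm, mul_eq_zero, or_iff_right (c.j_ne 0 h0), c.Z_zero] at hB
  have hqA : D.pA.q = D.qA := D.yA_spec.1
  have hqB : D.pB.q = D.qB := D.yB_spec.1
  have h3 : D.pB.a x₀ = 0 := D.yB_spec.2.1 _
  have h4 : D.pA.a x₀ = 1 / (2 * (x₀ : ℂ)) := rfl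
  rw [hqA, h4, aeval_ofReal_eq] at hA
  rw [hqB, h3, zero_mul, zero_add, aeval_ofReal_eq] at hB
  have hr : r₀ ^ 2 = D.S.R.eval x₀ := by
    have := c.ρ_sq 0 h0
    rw [c.Z_zero, c.ρ_zero, aeval_ofReal_eq] at this
    exact_mod_cast this
  have hx1 : x₀ - 1 ≠ 0 := by have := hx.1; linarith
  refine D.bdry x₀ r₀ hx.1 hr ⟨?_, ?_⟩
  · have h5 : (1 / (2 * x₀) * r₀ + D.qA.eval x₀ / (x₀ - 1) : ℝ) = 0 := by exact_mod_cast hA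
    rw [← h5]; ring
  · have h5 : (D.qB.eval x₀ / (x₀ - 1) : ℝ) = 0 := by exact_mod_cast hB
    exact (div_eq_zero_iff.1 h5).resolve_right hx1

theorem ne_near_gap {x₀ : ℝ} (hx : x₀ ∈ D.S.gaps) :
    ∀ᶠ z in 𝓝 (x₀ : ℂ), z ∈ D.S.dom → D.Y z ≠ D.Y x₀ := by
  refine eventually_of_charts hx.2 fun r₀ hr₀ => ?_
  obtain ⟨c⟩ := exists_chart D.S hr₀
  refine ⟨c, ?_⟩
  have key : ∀ p : Potential D.S cutPlane, p.slope c ≠ 0 →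
      ∀ᶠ χ in 𝓝 (0 : ℂ), χ ∈ halfDisc c.ε → p.y (c.Z χ) ≠ p.y x₀ := by
    intro p hp
    obtain ⟨ε, K, hK⟩ := p.exists_localPrimitive c (gaps_mem_cutPlane hx)
    filter_upwards [hK.approx (half_pos (abs_pos.2 hp)), Metric.ball_mem_nhds _ hK.pos]
      with χ h1 h2 h3 h4
    have hi : 0 < χ.im := h3.1
    have h5 := hK.eq χ h2 hi.le
    rw [h4] at h5
    have h6 : (K χ).im = 0 := by linarith
    rw [h6, zero_sub, abs_neg, abs_mul, abs_of_pos hi] at h1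
    have := mul_pos (abs_pos.2 hp) hi
    linarith
  by_cases hA : D.pA.slope c = 0
  · have hB : D.pB.slope c ≠ 0 := fun hB => D.slope_ne c hx ⟨hA, hB⟩
    filter_upwards [key _ hB] with χ h1 h2 h3
    exact h1 h2 (congrArg Complex.im h3)
  · filter_upwards [key _ hA] with χ h1 h2 h3
    exact h1 h2 (congrArg Complex.re h3)

/-- The image of a neighbourhood of a union of gaps with the same value is a neighbourhood of that
value. -/
theorem image_mem_nhdsNE {G : Set ℝ} (hG : IsCompact G) (hGg : G ⊆ D.S.gaps) (hne : G.Nonempty)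
    {c : ℂ} (hc : ∀ x ∈ G, D.Y x = c) {O : Set ℂ} (hO : IsOpen O) (hGO : ∀ x ∈ G, (x : ℂ) ∈ O)
    (hOg : ∀ x ∈ D.S.gaps, (x : ℂ) ∈ O → x ∈ G) : D.Y '' (D.S.dom ∩ O) ∈ 𝓝[≠] c := by
  set G' : Set ℂ := (fun x : ℝ => (x : ℂ)) '' G with hG'
  have hG'c : IsCompact G' := hG.image continuous_ofReal
  set N : Set ℂ := O ∩ cutPlane ∩ {z | z ∈ D.S.dom → D.Y z ≠ c} with hN
  have hsub : G' ⊆ interior N := by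
    rintro _ ⟨x, hx, rfl⟩
    rw [mem_interior_iff_mem_nhds]
    refine inter_mem (inter_mem (hO.mem_nhds (hGO x hx))
      (isOpen_cutPlane.mem_nhds (gaps_mem_cutPlane (hGg hx)))) ?_
    have := D.ne_near_gap (hGg hx)
    rw [hc x hx] at this
    exact this
  obtain ⟨L, hL, hGL, hLN⟩ := exists_compact_between hG'c isOpen_interior hsub
  replace hLN := hLN.trans interior_subset
  have hbd : ∀ z ∈ L, z ∉ D.S.dom → z ∈ G' := by
    intro z hz hzd
    rcases D.S.cutPlane_cases (hLN hz).1.2 with h | ⟨x, hx, rfl⟩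
    · exact absurd h hzd
    · exact ⟨x, hOg x hx (hLN hz).1.1, rfl⟩
  have hfr : IsCompact (L \ interior L) := hL.diff isOpen_interior
  have hcl : IsClosed (D.Y '' (L \ interior L)) :=
    (hfr.image_of_continuousOn (continuousOn_Y.mono fun z hz => (hLN hz.1).1.2)).isClosed
  have hcn : c ∉ D.Y '' (L \ interior L) := by
    rintro ⟨z, hz, hzc⟩
    by_cases hzd : z ∈ D.S.dom
    · exact (hLN hz.1).2 hzd hzc
    · exact hz.2 (hGL (hbd z hz.1 hzd))
  obtain ⟨δ, hδ, hball⟩ := Metric.isOpen_iff.1 hcl.isOpen_compl c hcn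
  have hop : IsOpen (D.Y '' (D.S.dom ∩ interior L)) :=
    D.isOpen_image_Y (D.S.isOpen_dom.inter isOpen_interior) Set.inter_subset_left
  have hfin : Metric.ball c δ \ {c} ⊆ D.Y '' (D.S.dom ∩ interior L) := by
    refine (isPreconnected_punctured_ball c hδ).subset_of_closure_inter_subset hop ?_ ?_
    · obtain ⟨x, hx⟩ := hne
      have hnb : (𝓝[D.S.dom] (x : ℂ)).NeBot :=
        mem_closure_iff_nhdsWithin_neBot.1 (lower_mem_closure_dom (by simp))
      have hcY := D.continuousAt_Y (gaps_mem_cutPlane (hGg hx))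
      have h1 := hcY.eventually (Metric.ball_mem_nhds _ hδ)
      obtain ⟨z, ⟨h2, h3, h4⟩, h5⟩ := ((eventually_nhdsWithin_of_eventually_nhds
        (h1.and ((D.ne_near_gap (hGg hx)).and (show ∀ᶠ z in 𝓝 (x : ℂ), z ∈ interior L from
          isOpen_interior.mem_nhds (hGL ⟨x, hx, rfl⟩))))).and
        (eventually_mem_nhdsWithin (s := D.S.dom))).exists
      rw [hc x hx] at h2 h3
      exact ⟨D.Y z, ⟨h2, h3 h5⟩, z, ⟨h5, h4⟩, rfl⟩
    · rintro w ⟨hw1, hw2, hw3⟩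
      obtain ⟨U, hU1, hU2⟩ := exists_ultrafilter_of_mem_closure_image hw1
      obtain ⟨z, hzL, hz⟩ := isCompact_iff_ultrafilter_le_nhds.1 hL U
        (le_principal_iff.2 (mem_of_superset hU1 fun z hz => interior_subset hz.2))
      have hYz : D.Y z = w :=
        tendsto_nhds_unique ((D.continuousAt_Y (hLN hzL).1.2).tendsto.mono_left hz) hU2
      by_cases hzd : z ∈ D.S.dom
      · by_cases hzi : z ∈ interior L
        · exact ⟨z, ⟨hzd, hzi⟩, hYz⟩
        · exact absurd ⟨z, ⟨hzL, hzi⟩, hYz⟩ (hball hw2)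
      · obtain ⟨x, hx, rfl⟩ := hbd z hzL hzd
        exact absurd ((hc x hx).symm.trans hYz).symm hw3
  refine mem_nhdsWithin.2 ⟨Metric.ball c δ, Metric.isOpen_ball, Metric.mem_ball_self hδ, ?_⟩
  refine Set.Subset.trans hfin ?_
  rintro _ ⟨z, hz, rfl⟩
  have := hLN (interior_subset hz.2)
  exact ⟨z, ⟨hz.1, this.1.1⟩, rfl⟩

end CuspData

namespace CuspData

open SlitCurve

variable {D : CuspData}

/-- The sides of the limiting parallelogram that are not in the closure of the side at `z = 1`
approached from below. -/
def IsSide (D : CuspData) (c : ℂ) : Prop := ∃ t ∈ Set.Icc 0 Real.pi,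
  c = ⟨-t, 0⟩ ∨ c = ⟨-(Real.pi * D.bA) - t, -(Real.pi * D.bB)⟩ ∨
    c = ⟨-Real.pi - t * D.bA, -(t * D.bB)⟩

theorem arg_limit (U : Ultrafilter ℂ) :
    ∃ a ∈ Set.Icc (-Real.pi) Real.pi, Tendsto (fun z : ℂ => (-z).arg) U (𝓝 a) :=
  ultrafilter_tendsto_of_mem_compact isCompact_Icc U
    (Eventually.of_forall fun _ => ⟨(neg_pi_lt_arg _).le, arg_le_pi _⟩)

theorem tendsto_Y_of {U : Filter ℂ} {a u v : ℝ} (ha : Tendsto (fun z : ℂ => (-z).arg) U (𝓝 a))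
    (hu : Tendsto D.yA.y U (𝓝 u)) (hv : Tendsto D.yB.y U (𝓝 v)) :
    Tendsto D.Y U (𝓝 ⟨(a - Real.pi) / 2 + u, v⟩) :=
  tendsto_mk (((ha.sub_const _).div_const 2).add hu) hv

theorem yA_near_one : ∃ ε > 0, ∃ K : ℂ → ℂ, K 0 = 0 ∧ DifferentiableOn ℂ K (Metric.ball 0 ε) ∧
      (∀ χ ∈ Metric.ball 0 ε, K ((starRingEnd ℂ) χ) = (starRingEnd ℂ) (K χ)) ∧
      (∀ χ ∈ Metric.ball 0 ε, 0 ≤ χ.im → χ ≠ 0 →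
        D.yA.y (1 - χ) = D.bA * (χ.arg - Real.pi) + (K χ).im) := by
  have := potential_near_one D.yA D.yA_spec.2.2.2 D.yA_spec.2.1
  rwa [D.yA_spec.1] at this

theorem yB_near_one : ∃ ε > 0, ∃ K : ℂ → ℂ, K 0 = 0 ∧ DifferentiableOn ℂ K (Metric.ball 0 ε) ∧
      (∀ χ ∈ Metric.ball 0 ε, K ((starRingEnd ℂ) χ) = (starRingEnd ℂ) (K χ)) ∧
      (∀ χ ∈ Metric.ball 0 ε, 0 ≤ χ.im → χ ≠ 0 →
        D.yB.y (1 - χ) = D.bB * (χ.arg - Real.pi) + (K χ).im) := by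
  have := potential_near_one D.yB D.yB_spec.2.2.2 D.yB_spec.2.1
  rwa [D.yB_spec.1] at this

theorem tendsto_of_near_one {y : ℂ → ℝ} {b : ℝ} (h : ∃ ε > 0, ∃ K : ℂ → ℂ, K 0 = 0 ∧
      DifferentiableOn ℂ K (Metric.ball 0 ε) ∧
      (∀ χ ∈ Metric.ball 0 ε, K ((starRingEnd ℂ) χ) = (starRingEnd ℂ) (K χ)) ∧
      (∀ χ ∈ Metric.ball 0 ε, 0 ≤ χ.im → χ ≠ 0 →
        y (1 - χ) = b * (χ.arg - Real.pi) + (K χ).im)) {l : Filter ℂ} {g : ℂ → ℂ} {a : ℝ}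
    (hl : Tendsto g l (𝓝 0)) (hg : ∀ᶠ z in l, 0 < (g z).im)
    (ha : Tendsto (fun z => (g z).arg) l (𝓝 a)) :
    Tendsto (fun z => y (1 - g z)) l (𝓝 (b * (a - Real.pi))) := by
  obtain ⟨ε, hε, K, hK0, hKd, -, hK⟩ := h
  have hKc : Tendsto (fun z => (K (g z)).im) l (𝓝 0) := by
    have := (hKd.differentiableAt (Metric.ball_mem_nhds 0 hε)).continuousAt.tendsto
    rw [hK0] at this
    exact (continuous_im.tendsto' 0 0 (by simp)).comp (this.comp hl)
  have h2 := ((ha.sub_const Real.pi).const_mul b).add hKc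
  rw [add_zero] at h2
  refine h2.congr' ?_
  filter_upwards [hl.eventually (Metric.ball_mem_nhds 0 hε), hg] with z h3 h4
  exact (hK _ h3 h4.le (by rintro h; rw [h] at h4; simp at h4)).symm

/-- Limits of the map along ultrafilters. -/
theorem ultrafilter_cases (D : CuspData) (U : Ultrafilter ℂ) (hU : D.S.dom ∈ U) :
    ∃ c, Tendsto D.Y U (𝓝 c) ∧ ((∃ z ∈ D.S.dom, (U : Filter ℂ) ≤ 𝓝 z ∧ D.Y z = c) ∨
      (∃ x ∈ D.S.gaps, (U : Filter ℂ) ≤ 𝓝 (x : ℂ) ∧ D.Y x = c) ∨ D.IsSide c ∨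
      ((U : Filter ℂ) ≤ 𝓝 1 ∧ {z : ℂ | z.im < 0} ∈ U ∧
        ∃ t ∈ Set.Icc 0 Real.pi, c = ⟨-(t * D.bA), -(t * D.bB)⟩)) := by
  have hside : ∀ u v : ℝ, Tendsto D.yA.y U (𝓝 u) → Tendsto D.yB.y U (𝓝 v) →
      (u = 0 ∧ v = 0 ∨ u = -(D.bA * Real.pi) ∧ v = -(D.bB * Real.pi)) →
      ∃ c, Tendsto D.Y U (𝓝 c) ∧ D.IsSide c := by
    intro u v hu hv h
    obtain ⟨a, ⟨ha1, ha2⟩, ha⟩ := arg_limit U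
    refine ⟨_, D.tendsto_Y_of ha hu hv, (Real.pi - a) / 2, ⟨by linarith, by linarith⟩, ?_⟩
    rcases h with ⟨rfl, rfl⟩ | ⟨rfl, rfl⟩
    · left; congr 1; ring
    · right; left; congr 1 <;> ring
  rcases ultrafilter_cobounded_or U with hinf | ⟨z, hz⟩
  · obtain ⟨c, h1, h2⟩ := hside 0 0 (D.yA_spec.2.2.2.mono_left hinf)
      (D.yB_spec.2.2.2.mono_left hinf) (Or.inl ⟨rfl, rfl⟩)
    exact ⟨c, h1, Or.inr (Or.inr (Or.inl h2))⟩
  by_cases hzc : z ∈ cutPlane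
  · refine ⟨D.Y z, (D.continuousAt_Y hzc).tendsto.mono_left hz, ?_⟩
    rcases D.S.cutPlane_cases hzc with h | ⟨x, hx, rfl⟩
    · exact Or.inl ⟨z, h, hz, rfl⟩
    · exact Or.inr (Or.inl ⟨x, hx, hz, rfl⟩)
  rw [mem_cutPlane, not_or, not_not, not_lt] at hzc
  obtain ⟨x, rfl⟩ : ∃ x : ℝ, z = x := ⟨z.re, Complex.ext rfl (by simp [hzc.1])⟩
  have hx : 0 ≤ x := by simpa using hzc.2
  by_cases hx1 : x = 1
  · subst hx1
    rw [ofReal_one] at hz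
    have hdisj : {z : ℂ | z.im < 0} ∈ U ∨ {z : ℂ | 0 < z.im} ∈ U := by
      rw [← Ultrafilter.union_mem_iff]
      have hre : ∀ᶠ z in (U : Filter ℂ), 0 < z.re :=
        hz (continuous_re.continuousAt.eventually (lt_mem_nhds (by simp)))
      filter_upwards [hU, hre] with z h1 h2
      rcases mem_dom_imp h1 with h3 | h3
      · exact h3.lt_or_gt
      · linarith
    have hsub : Tendsto (fun z : ℂ => -z) U (𝓝 (-1)) := (continuous_neg.tendsto 1).mono_left hz
    rcases hdisj with hlo | hup
    · have harg : Tendsto (fun z : ℂ => (-z).arg) U (𝓝 Real.pi) := by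
        have h1 := continuousWithinAt_arg_of_re_neg_of_im_zero (z := -1) (by simp) (by simp)
        have h2 : Tendsto (fun z : ℂ => -z) U (𝓝[{z : ℂ | 0 ≤ z.im}] (-1)) := by
          refine tendsto_nhdsWithin_iff.2 ⟨hsub, ?_⟩
          filter_upwards [hlo] with z hz1
          have hz2 : z.im < 0 := hz1
          show 0 ≤ (-z).im
          rw [neg_im]; linarith
        have h3 := h1.tendsto.comp h2
        rwa [arg_neg_one] at h3
      have hg : Tendsto (fun z : ℂ => 1 - z) U (𝓝 0) :=
        (Continuous.tendsto' (by fun_prop) 1 0 (by simp)).mono_left hz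
      have hgi : ∀ᶠ z in (U : Filter ℂ), 0 < (1 - z).im := by
        filter_upwards [hlo] with z hz1
        have hz2 : z.im < 0 := hz1
        rw [sub_im, one_im]; linarith
      obtain ⟨a, ha1, ha⟩ := ultrafilter_tendsto_of_mem_compact
        (isCompact_Icc (a := (0 : ℝ)) (b := Real.pi)) U (f := fun z : ℂ => (1 - z).arg) (by
          filter_upwards [hgi] with z h1
          exact ⟨arg_nonneg_iff.2 h1.le, arg_le_pi _⟩)
      have hA := tendsto_of_near_one D.yA_near_one hg hgi ha
      have hB := tendsto_of_near_one D.yB_near_one hg hgi ha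
      simp only [sub_sub_cancel] at hA hB
      refine ⟨_, D.tendsto_Y_of harg hA hB, Or.inr (Or.inr (Or.inr ⟨hz, hlo, Real.pi - a,
        ⟨by linarith [ha1.2], by linarith [ha1.1]⟩, ?_⟩))⟩
      congr 1 <;> ring
    · have harg : Tendsto (fun z : ℂ => (-z).arg) U (𝓝 (-Real.pi)) := by
        have h1 := tendsto_arg_nhdsWithin_im_neg_of_re_neg_of_im_zero (z := -1) (by simp) (by simp)
        have h2 : Tendsto (fun z : ℂ => -z) U (𝓝[{z : ℂ | z.im < 0}] (-1)) := by
          refine tendsto_nhdsWithin_iff.2 ⟨hsub, ?_⟩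
          filter_upwards [hup] with z hz1
          have hz2 : 0 < z.im := hz1
          show (-z).im < 0
          rw [neg_im]; linarith
        exact h1.comp h2
      have hg : Tendsto (fun z : ℂ => 1 - (starRingEnd ℂ) z) U (𝓝 0) :=
        (Continuous.tendsto' (by fun_prop) 1 0 (by simp)).mono_left hz
      have hgi : ∀ᶠ z in (U : Filter ℂ), 0 < (1 - (starRingEnd ℂ) z).im := by
        filter_upwards [hup] with z hz1
        have hz2 : 0 < z.im := hz1
        rw [sub_im, one_im, conj_im]; linarith
      obtain ⟨a, ha1, ha⟩ := ultrafilter_tendsto_of_mem_compact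
        (isCompact_Icc (a := (0 : ℝ)) (b := Real.pi)) U
        (f := fun z : ℂ => (1 - (starRingEnd ℂ) z).arg) (by
          filter_upwards [hgi] with z h1
          exact ⟨arg_nonneg_iff.2 h1.le, arg_le_pi _⟩)
      have hA := tendsto_of_near_one D.yA_near_one hg hgi ha
      have hB := tendsto_of_near_one D.yB_near_one hg hgi ha
      simp only [sub_sub_cancel, D.yA_spec.2.2.1, D.yB_spec.2.2.1] at hA hB
      refine ⟨_, D.tendsto_Y_of harg hA hB, Or.inr (Or.inr (Or.inl ⟨Real.pi - a,
        ⟨by linarith [ha1.2], by linarith [ha1.1]⟩, Or.inr (Or.inr ?_)⟩))⟩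
      congr 1 <;> ring
  · have hne : (x : ℂ) ∈ ({1}ᶜ : Set ℂ) := by simpa using hx1
    have hA : Tendsto D.yA.y U (𝓝 (D.yA.y x)) :=
      (D.yA.cont.continuousAt (D.yA.isOpen_D.mem_nhds hne)).tendsto.mono_left hz
    have hB : Tendsto D.yB.y U (𝓝 (D.yB.y x)) :=
      (D.yB.cont.continuousAt (D.yB.isOpen_D.mem_nhds hne)).tendsto.mono_left hz
    obtain ⟨c, h1, h2⟩ := hside _ _ hA hB (by
      rcases lt_or_gt_of_ne hx1 with h | h
      · right
        rw [potential_eq_on_Ioo D.yA D.yA_spec.2.2.2 D.yA_spec.2.1 hx h,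
          potential_eq_on_Ioo D.yB D.yB_spec.2.2.2 D.yB_spec.2.1 hx h, D.yA_spec.1, D.yB_spec.1]
        exact ⟨rfl, rfl⟩
      · left
        exact ⟨potential_eq_zero D.yA D.yA_spec.2.2.2 h, potential_eq_zero D.yB D.yB_spec.2.2.2 h⟩)
    exact ⟨c, h1, Or.inr (Or.inr (Or.inl h2))⟩

/-! #### The image is contained in a parallelogram -/

theorem image_mem_nhdsNE_gap {x : ℝ} (hx : x ∈ D.S.gaps) : D.Y '' D.S.dom ∈ 𝓝[≠] (D.Y x) := by
  have hloc : ∀ x' ∈ D.S.gaps, ∀ᶠ t : ℝ in 𝓝 x', t ∈ D.S.gaps → D.Y t = D.Y x' := by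
    intro x' hx'
    filter_upwards [D.pA.eventually_eq_of_nonneg (gaps_mem_cutPlane hx') hx'.2,
      D.pB.eventually_eq_of_nonneg (gaps_mem_cutPlane hx') hx'.2] with t h1 h2 h3
    rw [Y, h1 h3.2, h2 h3.2]; rfl
  have hcl : IsClosed {t | t ∈ D.S.gaps ∧ D.Y t ≠ D.Y x} := by
    rw [← isOpen_compl_iff, isOpen_iff_mem_nhds]
    intro t ht
    by_cases htg : t ∈ D.S.gaps
    · have h1 : D.Y t = D.Y x := by
        by_contra h; exact ht ⟨htg, h⟩
      filter_upwards [hloc t htg] with s hs h2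
      exact h2.2 ((hs h2.1).trans h1)
    · filter_upwards [D.S.isCompact_gaps.isClosed.isOpen_compl.mem_nhds htg] with s hs h2
      exact hs h2.1
  have hcl2 : IsClosed {t | t ∈ D.S.gaps ∧ D.Y t = D.Y x} := by
    rw [← isOpen_compl_iff, isOpen_iff_mem_nhds]
    intro t ht
    by_cases htg : t ∈ D.S.gaps
    · have h1 : D.Y t ≠ D.Y x := fun h => ht ⟨htg, h⟩
      filter_upwards [hloc t htg] with s hs h2
      exact h1 ((hs h2.1).symm.trans h2.2)
    · filter_upwards [D.S.isCompact_gaps.isClosed.isOpen_compl.mem_nhds htg] with s hs h2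
      exact hs h2.1
  have hG : IsCompact {t | t ∈ D.S.gaps ∧ D.Y t = D.Y x} :=
    D.S.isCompact_gaps.of_isClosed_subset hcl2 fun t ht => ht.1
  have hG2 : IsCompact {t | t ∈ D.S.gaps ∧ D.Y t ≠ D.Y x} :=
    D.S.isCompact_gaps.of_isClosed_subset hcl fun t ht => ht.1
  have := D.image_mem_nhdsNE hG (fun t ht => ht.1) ⟨x, hx, rfl⟩ (fun t ht => ht.2)
    (O := ((fun t : ℝ => (t : ℂ)) '' {t | t ∈ D.S.gaps ∧ D.Y t ≠ D.Y x})ᶜ)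
    (hG2.image continuous_ofReal).isClosed.isOpen_compl
    (by
      rintro t ht ⟨s, hs, hst⟩
      rw [ofReal_inj.1 hst] at hs
      exact hs.2 ht.2)
    (fun t ht hO => ⟨ht, by
      by_contra h; exact hO ⟨t, ⟨ht, h⟩, rfl⟩⟩)
  exact mem_of_superset this (Set.image_mono Set.inter_subset_left)

theorem isBounded_image : Bornology.IsBounded (D.Y '' D.S.dom) := by
  by_contra h
  have hnb : (comap D.Y (Bornology.cobounded ℂ) ⊓ 𝓟 D.S.dom).NeBot := by
    rw [neBot_iff]
    intro h0
    apply h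
    have h1 : map D.Y (𝓟 D.S.dom ⊓ comap D.Y (Bornology.cobounded ℂ)) = ⊥ := by
      rw [inf_comm, h0, Filter.map_bot]
    rw [Filter.push_pull, Filter.map_principal] at h1
    rw [← Bornology.isCobounded_compl_iff]
    exact mem_iff_inf_principal_compl.2 (by rw [compl_compl, inf_comm]; exact h1)
  have hle := Ultrafilter.of_le (comap D.Y (Bornology.cobounded ℂ) ⊓ 𝓟 D.S.dom)
  obtain ⟨c, hc, -⟩ := D.ultrafilter_cases (Ultrafilter.of _)
    (le_principal_iff.1 (hle.trans inf_le_right))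
  have h1 : Tendsto D.Y (Ultrafilter.of (comap D.Y (Bornology.cobounded ℂ) ⊓ 𝓟 D.S.dom))
      (Bornology.cobounded ℂ) := tendsto_iff_comap.2 (hle.trans inf_le_left)
  exact hc.not_tendsto (Metric.disjoint_nhds_cobounded c) h1

theorem exists_gt_of_mem_nhdsNE {ℓ : ℂ →L[ℝ] ℝ} {v : ℂ} (hv : 0 < ℓ v) {s : Set ℂ} {c : ℂ}
    (hs : s ∈ 𝓝[≠] c) : ∃ w ∈ s, ℓ c < ℓ w := by
  have ht : Tendsto (fun t : ℝ => c + t * v) (𝓝[>] 0) (𝓝[≠] c) := by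
    refine tendsto_nhdsWithin_iff.2 ⟨?_, ?_⟩
    · have : Continuous (fun t : ℝ => c + t * v) := by fun_prop
      exact (this.tendsto' 0 c (by simp)).mono_left inf_le_left
    · filter_upwards [self_mem_nhdsWithin] with t ht
      have h0 : (0 : ℝ) < t := ht
      have hv0 : v ≠ 0 := by rintro rfl; simp at hv
      simpa using And.intro h0.ne' hv0
  obtain ⟨t, h1, h2⟩ := ((ht.eventually hs).and (eventually_mem_nhdsWithin
    (s := Set.Ioi (0 : ℝ)))).exists
  refine ⟨_, h1, ?_⟩
  have h3 : (t : ℂ) * v = t • v := rfl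
  rw [map_add, h3, map_smul, smul_eq_mul]
  have := mul_pos (show (0 : ℝ) < t from h2) hv
  linarith

theorem lt_of_sides {ℓ : ℂ →L[ℝ] ℝ} {v : ℂ} (hv : 0 < ℓ v) {M : ℝ} (hM : ∀ c, D.IsSide c → ℓ c ≤ M)
    (hM' : ∀ t ∈ Set.Icc 0 Real.pi, ℓ ⟨-(t * D.bA), -(t * D.bB)⟩ ≤ M) {c : ℂ}
    (hc : D.Y '' D.S.dom ∈ 𝓝[≠] c) : ℓ c < M := by
  by_contra hcon
  rw [not_lt] at hcon
  obtain ⟨w, hw, hwc⟩ := exists_gt_of_mem_nhdsNE hv hc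
  have hcpt : IsCompact (closure (D.Y '' D.S.dom)) := D.isBounded_image.isCompact_closure
  obtain ⟨m, hm, hmax⟩ := hcpt.exists_isMaxOn ⟨w, subset_closure hw⟩ ℓ.continuous.continuousOn
  have hMm : M < ℓ m := (hcon.trans_lt hwc).trans_le (hmax (subset_closure hw))
  have hno : D.Y '' D.S.dom ∉ 𝓝[≠] m := by
    intro h
    obtain ⟨w', hw', h1⟩ := exists_gt_of_mem_nhdsNE hv h
    exact absurd (hmax (subset_closure hw')) (not_le.2 h1)
  obtain ⟨U, hU1, hU2⟩ := exists_ultrafilter_of_mem_closure_image hm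
  obtain ⟨c', hc', hcases⟩ := D.ultrafilter_cases U hU1
  obtain rfl := tendsto_nhds_unique hc' hU2
  rcases hcases with ⟨z, hz, -, rfl⟩ | ⟨x, hx, -, rfl⟩ | h | ⟨-, -, t, ht, rfl⟩
  · apply hno
    refine mem_nhdsWithin_of_mem_nhds ?_
    rw [← D.map_nhds_Y hz]
    exact image_mem_map (D.S.isOpen_dom.mem_nhds hz)
  · exact hno (D.image_mem_nhdsNE_gap hx)
  · linarith [hM _ h]
  · linarith [hM' t ht]

/-- The open parallelogram bounding the image. -/
def par (D : CuspData) : Set ℂ := {c | c.im < 0 ∧ -(Real.pi * D.bB) < c.im ∧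
  c.re * D.bB - c.im * D.bA < 0 ∧ -(Real.pi * D.bB) < c.re * D.bB - c.im * D.bA}

theorem mem_par_of_mem_nhdsNE {c : ℂ} (hc : D.Y '' D.S.dom ∈ 𝓝[≠] c) : c ∈ D.par := by
  have hb := D.bB_pos
  have hpi := Real.pi_pos
  set L : ℂ →L[ℝ] ℝ := D.bB • reCLM - D.bA • imCLM with hL
  have hLa : ∀ z : ℂ, L z = D.bB * z.re - D.bA * z.im := fun z => by simp [hL]
  refine ⟨?_, ?_, ?_, ?_⟩
  · refine D.lt_of_sides (ℓ := imCLM) (v := I) (by simp) (M := 0) ?_ ?_ hc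
    · rintro c ⟨t, ⟨h0, h1⟩, rfl | rfl | rfl⟩
      · simp
      · simp; positivity
      · simp; positivity
    · rintro t ⟨h0, h1⟩
      simp; positivity
  · have := D.lt_of_sides (ℓ := -imCLM) (v := -I) (by simp) (M := Real.pi * D.bB) ?_ ?_ hc
    · simp at this; linarith
    · rintro c ⟨t, ⟨h0, h1⟩, rfl | rfl | rfl⟩
      · simp; positivity
      · simp
      · simp; gcongr
    · rintro t ⟨h0, h1⟩
      simp; gcongr
  · have := D.lt_of_sides (ℓ := L) (v := 1) (by simp [hLa, hb]) (M := 0) ?_ ?_ hc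
    · rw [hLa] at this; linarith
    · rintro c ⟨t, ⟨h0, h1⟩, rfl | rfl | rfl⟩
      · rw [hLa]; simp; positivity
      · rw [hLa]; simp only; nlinarith
      · rw [hLa]; simp only; nlinarith
    · rintro t ⟨h0, h1⟩
      rw [hLa]; simp only; nlinarith
  · have := D.lt_of_sides (ℓ := -L) (v := -1) (by simp [hLa, hb]) (M := Real.pi * D.bB) ?_ ?_ hc
    · rw [neg_apply, hLa] at this; linarith
    · rintro c ⟨t, ⟨h0, h1⟩, rfl | rfl | rfl⟩
      · rw [neg_apply, hLa]; simp only; nlinarith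
      · rw [neg_apply, hLa]; simp only; nlinarith
      · rw [neg_apply, hLa]; simp only; nlinarith
    · rintro t ⟨h0, h1⟩
      rw [neg_apply, hLa]; simp only; nlinarith

theorem Y_mem_par {z : ℂ} (hz : z ∈ D.S.dom) : D.Y z ∈ D.par := by
  apply mem_par_of_mem_nhdsNE
  refine mem_nhdsWithin_of_mem_nhds ?_
  rw [← D.map_nhds_Y hz]
  exact image_mem_map (D.S.isOpen_dom.mem_nhds hz)

theorem Y_gap_mem_par {x : ℝ} (hx : x ∈ D.S.gaps) : D.Y x ∈ D.par :=
  mem_par_of_mem_nhdsNE (D.image_mem_nhdsNE_gap hx)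

theorem isOpen_par : IsOpen D.par := by
  have h1 : Continuous fun c : ℂ => c.re * D.bB - c.im * D.bA := by fun_prop
  exact (isOpen_lt continuous_im continuous_const).inter
    ((isOpen_lt continuous_const continuous_im).inter
      ((isOpen_lt h1 continuous_const).inter (isOpen_lt continuous_const h1)))

theorem convex_par : Convex ℝ D.par := by
  intro x hx y hy a b ha hb hab
  obtain ⟨h1, h2, h3, h4⟩ := hx
  obtain ⟨k1, k2, k3, k4⟩ := hy
  have key : ∀ {u v w : ℝ}, u < w → v < w → a * u + b * v < w := by
    intro u v w hu hv
    rcases ha.eq_or_lt with h | h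
    · have : b = 1 := by linarith
      rw [← h, this]; linarith
    · have e : w = a * w + b * w := by rw [← add_mul, hab, one_mul]
      have := mul_lt_mul_of_pos_left hu h
      have := mul_le_mul_of_nonneg_left hv.le hb
      linarith
  have him : (a • x + b • y).im = a * x.im + b * y.im := by simp
  have hre : (a • x + b • y).re = a * x.re + b * y.re := by simp
  refine ⟨?_, ?_, ?_, ?_⟩
  · rw [him]; exact key h1 k1
  · have := key (neg_lt.1 h2) (neg_lt.1 k2)
    rw [him]; linarith
  · have := key h3 k3
    rw [him, hre]; linarith
  · have := key (neg_lt.1 h4) (neg_lt.1 k4)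
    rw [him, hre]; linarith

end CuspData

namespace CuspData

open SlitCurve

variable {D : CuspData}

/-- The midpoint of the side at `z = 1` approached from below. -/
def sideMid (D : CuspData) : ℂ := ⟨-(Real.pi / 2 * D.bA), -(Real.pi / 2 * D.bB)⟩

theorem normal_form_near_one (D : CuspData) : ∃ ε > 0, ∃ H K : ℂ → ℂ,
    DifferentiableOn ℂ H (Metric.ball 0 ε) ∧ DifferentiableOn ℂ K (Metric.ball 0 ε) ∧
    (∀ χ ∈ Metric.ball 0 ε, H ((starRingEnd ℂ) χ) = (starRingEnd ℂ) (H χ)) ∧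
    K 0 = 0 ∧
    ∀ χ ∈ halfDisc ε, (D.Y (1 - χ)).re * D.bB - (D.Y (1 - χ)).im * D.bA = (H χ).im ∧
      (D.Y (1 - χ)).im = D.bB * (χ.arg - Real.pi) + (K χ).im := by
  obtain ⟨εA, hεA, KA, hA0, hAd, hAc, hA⟩ := D.yA_near_one
  obtain ⟨εB, hεB, KB, hB0, hBd, hBc, hB⟩ := D.yB_near_one
  set ε := min (min εA εB) 1 with hε
  have hεp : 0 < ε := lt_min (lt_min hεA hεB) one_pos
  have hsA : Metric.ball (0 : ℂ) ε ⊆ Metric.ball 0 εA :=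
    Metric.ball_subset_ball ((min_le_left _ _).trans (min_le_left _ _))
  have hsB : Metric.ball (0 : ℂ) ε ⊆ Metric.ball 0 εB :=
    Metric.ball_subset_ball ((min_le_left _ _).trans (min_le_right _ _))
  have hs1 : ∀ χ ∈ Metric.ball (0 : ℂ) ε, 1 - χ ∈ slitPlane := by
    intro χ hχ
    left
    have h1 := mem_ball_zero_iff.1 hχ
    have h2 : ε ≤ 1 := min_le_right _ _
    have h3 := (abs_le.1 (abs_re_le_norm χ)).2
    rw [sub_re, one_re]; linarith
  refine ⟨ε, hεp, fun χ => D.bB * (KA χ + (1 / 2 : ℝ) * log (1 - χ)) - D.bA * KB χ, KB, ?_,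
    hBd.mono hsB, ?_, hB0, ?_⟩
  · refine (((hAd.mono hsA).add (DifferentiableOn.const_mul (fun χ hχ => ?_) _)).const_mul _).sub
      ((hBd.mono hsB).const_mul _)
    exact ((differentiableAt_id.const_sub 1).clog (hs1 χ hχ)).differentiableWithinAt
  · intro χ hχ
    have h1 := log_conj (1 - χ) (mem_slitPlane_iff_arg.1 (hs1 χ hχ)).1
    rw [map_sub, map_one] at h1
    simp only [map_sub, map_mul, map_add, conj_ofReal, hAc χ (hsA hχ), hBc χ (hsB hχ), h1]
  · intro χ hχ
    have hi : 0 < χ.im := hχ.1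
    have h0 : χ ≠ 0 := by rintro rfl; simp at hi
    have e1 : (D.Y (1 - χ)).im = D.bB * (χ.arg - Real.pi) + (KB χ).im :=
      hB χ (hsB hχ.2) hi.le h0
    refine ⟨?_, e1⟩
    have e2 : (D.Y (1 - χ)).re = ((-(1 - χ)).arg - Real.pi) / 2 + D.yA.y (1 - χ) := rfl
    rw [e1, e2, hA χ (hsA hχ.2) hi.le h0,
      arg_neg_eq_arg_add_pi_of_im_neg (by rw [sub_im, one_im]; linarith)]
    rw [sub_im, im_ofReal_mul, im_ofReal_mul, add_im, im_ofReal_mul, log_im]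
    ring

theorem strict_bound {g : ℂ → ℂ} {c : ℂ} (h : HasStrictDerivAt g c 0) {η : ℝ} (hη : 0 < η) :
    ∀ᶠ p : ℂ × ℂ in 𝓝 (0, 0), ‖g p.1 - g p.2 - c * (p.1 - p.2)‖ ≤ η * ‖p.1 - p.2‖ := by
  have := h.hasStrictFDerivAt.isLittleO.bound hη
  filter_upwards [this] with p hp
  simpa [mul_comm] using hp

/-- Near `z = 1`, approached from below, the map is injective on the points mapped near the middle
of the corresponding side. -/
theorem unique_near_one (D : CuspData) : ∃ δ > 0, ∀ z w : ℂ, z.im < 0 → w.im < 0 →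
    ‖z - 1‖ < δ → ‖w - 1‖ < δ → |(D.Y z).im + Real.pi / 2 * D.bB| < D.bB / 2 →
    D.Y z = D.Y w → z = w := by
  obtain ⟨ε, hε, H, K, hHd, hKd, hHc, hK0, hY⟩ := D.normal_form_near_one
  have hb := D.bB_pos
  have hbc : (D.bB : ℂ) ≠ 0 := by exact_mod_cast hb.ne'
  have hnb := Metric.ball_mem_nhds (0 : ℂ) hε
  have hreal : (deriv H 0).im = 0 := Potential.deriv_real hε hHd hHc
  have hne : deriv H 0 ≠ 0 := by
    have := deriv_ne_zero_of_im_pos hε hHd.neg (fun χ hχ => by simp [hHc χ hχ]) (fun χ hχ => by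
      have h1 : (1 - χ).im < 0 := by
        have : 0 < χ.im := hχ.1
        rw [sub_im, one_im]; linarith
      have h2 := (D.Y_mem_par (D.S.lower_mem_dom h1)).2.2.1
      rw [(hY χ hχ).1] at h2
      show 0 < (-(H χ)).im
      rw [neg_im]; linarith)
    rw [deriv.neg] at this
    exact fun h => this (by rw [h, neg_zero])
  set h₀ : ℝ := (deriv H 0).re with hh₀
  have hH0 : deriv H 0 = (h₀ : ℂ) := Complex.ext rfl (by simp [hreal])
  have hh₀' : h₀ ≠ 0 := fun h => hne (by rw [hH0, h, ofReal_zero])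
  set g : ℂ → ℂ := fun χ => χ * exp (K χ / D.bB) with hg
  have hHs : HasStrictDerivAt H h₀ 0 := by
    rw [← hH0]
    exact (hHd.analyticAt hnb).hasStrictDerivAt
  have hgs : HasStrictDerivAt g 1 0 := by
    have h1 : AnalyticAt ℂ (fun χ => exp (K χ / D.bB)) 0 :=
      ((hKd.analyticAt hnb).div analyticAt_const hbc).cexp
    have h2 := (hasStrictDerivAt_id (0 : ℂ)).mul h1.hasStrictDerivAt
    simp only [id, one_mul, zero_mul, add_zero, hK0, zero_div, exp_zero] at h2
    exact h2
  have hη : 0 < |h₀| / 16 := by positivity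
  obtain ⟨δ₁, hδ₁, hb₁⟩ := Metric.eventually_nhds_iff_ball.1
    ((strict_bound hHs hη).and ((strict_bound hgs (show 0 < 1 / 16 by norm_num)).and
      (strict_bound hgs (show 0 < (1 : ℝ) / 2 by norm_num))))
  refine ⟨min δ₁ ε, lt_min hδ₁ hε, fun z w hz hw hz1 hw1 hmid heq => ?_⟩
  set χ := 1 - z with hχ
  set ψ := 1 - w with hψ
  have hzχ : z = 1 - χ := by rw [hχ]; ring
  have hwψ : w = 1 - ψ := by rw [hψ]; ring
  have hχn : ‖χ‖ < min δ₁ ε := by rwa [hχ, norm_sub_rev]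
  have hψn : ‖ψ‖ < min δ₁ ε := by rwa [hψ, norm_sub_rev]
  have hχd : χ ∈ halfDisc ε := ⟨by show 0 < (1 - z).im; rw [sub_im, one_im]; linarith,
    mem_ball_zero_iff.2 (hχn.trans_le (min_le_right _ _))⟩
  have hψd : ψ ∈ halfDisc ε := ⟨by show 0 < (1 - w).im; rw [sub_im, one_im]; linarith,
    mem_ball_zero_iff.2 (hψn.trans_le (min_le_right _ _))⟩
  obtain ⟨k1, k2, k3⟩ := hb₁ (χ, ψ) (by
    rw [mem_ball_iff_norm, Prod.norm_def]
    simpa using ⟨hχn.trans_le (min_le_left _ _), hψn.trans_le (min_le_left _ _)⟩)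
  simp only at k1 k2 k3
  obtain ⟨a1, a2⟩ := hY χ hχd
  obtain ⟨b1, b2⟩ := hY ψ hψd
  rw [← hzχ] at a1 a2
  rw [← hwψ, ← heq] at b1 b2
  set θ : ℝ := χ.arg + (K χ).im / D.bB with hθ
  have e1 : (D.Y z).im = D.bB * (θ - Real.pi) := by rw [a2, hθ]; field_simp; ring
  have e2 : θ = ψ.arg + (K ψ).im / D.bB := by
    have : D.bB * (θ - Real.pi) = D.bB * (ψ.arg + (K ψ).im / D.bB - Real.pi) := by
      rw [← e1, b2]; field_simp; ring
    linarith [mul_left_cancel₀ hb.ne' this]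
  have polar : ∀ w : ℂ, g w = (‖g w‖ : ℝ) * exp ((w.arg + (K w).im / D.bB : ℝ) * I) := by
    intro w
    have h1 : (‖w‖ : ℂ) * exp (w.arg * I) = w := norm_mul_exp_arg_mul_I w
    have h2 : exp (K w / D.bB) = (‖exp (K w / D.bB)‖ : ℝ) * exp (((K w).im / D.bB : ℝ) * I) := by
      rw [norm_exp, ofReal_exp, ← exp_add]
      congr 1
      refine Complex.ext ?_ ?_ <;> simp
    calc g w = ((‖w‖ : ℂ) * exp (w.arg * I)) *
          ((‖exp (K w / D.bB)‖ : ℝ) * exp (((K w).im / D.bB : ℝ) * I)) := by rw [h1, ← h2]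
      _ = _ := by
        rw [hg]
        simp only [norm_mul]
        rw [ofReal_add, add_mul, exp_add]
        push_cast
        ring
  have hgχ := polar χ
  have hgψ := polar ψ
  rw [← hθ] at hgχ
  rw [← e2] at hgψ
  have hsin : 1 / 2 ≤ Real.sin θ := by
    rw [e1] at hmid
    have h1 : |θ - Real.pi / 2| < 1 / 2 := by
      have : D.bB * (θ - Real.pi) + Real.pi / 2 * D.bB = D.bB * (θ - Real.pi / 2) := by ring
      rw [this, abs_mul, abs_of_pos hb] at hmid
      by_contra hcon
      rw [not_lt] at hcon
      have := mul_le_mul_of_nonneg_left hcon hb.le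
      linarith
    have h2 : Real.sin θ = Real.cos (θ - Real.pi / 2) := by
      rw [Real.cos_sub_pi_div_two]
    rw [h2]
    have h3 := Real.one_sub_sq_div_two_le_cos (x := θ - Real.pi / 2)
    have h4 : (θ - Real.pi / 2) ^ 2 < (1 / 2) ^ 2 := sq_lt_sq' (by linarith [(abs_lt.1 h1).1])
      (abs_lt.1 h1).2
    linarith
  have hdiff : g χ - g ψ = ((‖g χ‖ - ‖g ψ‖ : ℝ) : ℂ) * exp ((θ : ℝ) * I) := by
    conv_lhs => rw [hgχ, hgψ]
    push_cast
    ring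
  have hdn : ‖g χ - g ψ‖ = |‖g χ‖ - ‖g ψ‖| := by
    rw [hdiff, norm_mul, norm_exp_ofReal_mul_I, mul_one, Complex.norm_real, Real.norm_eq_abs]
  have hdi : (g χ - g ψ).im = (‖g χ‖ - ‖g ψ‖) * Real.sin θ := by
    rw [hdiff, im_ofReal_mul, exp_ofReal_mul_I_im]
  have hχψ : ‖χ - ψ‖ ≤ 2 * ‖g χ - g ψ‖ := by
    have : ‖χ - ψ‖ ≤ ‖g χ - g ψ‖ + ‖g χ - g ψ - 1 * (χ - ψ)‖ := by
      have e : χ - ψ = (g χ - g ψ) - (g χ - g ψ - 1 * (χ - ψ)) := by ring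
      conv_lhs => rw [e]
      exact norm_sub_le _ _
    linarith
  have hHim : (H χ - H ψ).im = 0 := by rw [sub_im, ← a1, ← b1, sub_self]
  have hsplit : H χ - H ψ = h₀ * (g χ - g ψ) + ((H χ - H ψ - h₀ * (χ - ψ)) -
      h₀ * (g χ - g ψ - 1 * (χ - ψ))) := by ring
  have hrem : |((H χ - H ψ - h₀ * (χ - ψ)) - h₀ * (g χ - g ψ - 1 * (χ - ψ))).im| ≤
      |h₀| / 8 * ‖χ - ψ‖ := by
    refine (abs_im_le_norm _).trans ((norm_sub_le _ _).trans ?_)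
    rw [norm_mul, Complex.norm_real, Real.norm_eq_abs]
    have := mul_le_mul_of_nonneg_left k2 (abs_nonneg h₀)
    linarith
  rw [hsplit, add_im, im_ofReal_mul, hdi] at hHim
  have h5 : |h₀ * ((‖g χ‖ - ‖g ψ‖) * Real.sin θ)| ≤ |h₀| / 4 * |‖g χ‖ - ‖g ψ‖| := by
    have : h₀ * ((‖g χ‖ - ‖g ψ‖) * Real.sin θ) =
      -((H χ - H ψ - h₀ * (χ - ψ)) - h₀ * (g χ - g ψ - 1 * (χ - ψ))).im := by linarith
    rw [this, abs_neg]
    refine hrem.trans ?_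
    rw [← hdn]
    have := mul_le_mul_of_nonneg_left hχψ (show 0 ≤ |h₀| / 8 by positivity)
    linarith
  rw [abs_mul, abs_mul, abs_of_pos (show 0 < Real.sin θ by linarith)] at h5
  have h6 : |‖g χ‖ - ‖g ψ‖| = 0 := by
    have h7 : 0 < |h₀| := abs_pos.2 hh₀'
    have h8 := abs_nonneg (‖g χ‖ - ‖g ψ‖)
    have h9 : |h₀| * (|‖g χ‖ - ‖g ψ‖| * (1 / 2)) ≤ |h₀| * (|‖g χ‖ - ‖g ψ‖| * Real.sin θ) := by
      gcongr
    nlinarith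
  rw [← hdn] at h6
  rw [h6, mul_zero] at hχψ
  have h7 : χ - ψ = 0 := norm_le_zero_iff.1 hχψ
  rw [hzχ, hwψ, sub_eq_zero.1 h7]

/-- Pairs of distinct points with the same image. -/
def doublePairs (D : CuspData) : Set (ℂ × ℂ) :=
  {p | p.1 ∈ D.S.dom ∧ p.2 ∈ D.S.dom ∧ p.1 ≠ p.2 ∧ D.Y p.1 = D.Y p.2}

theorem doublePairs_swap {U : Ultrafilter (ℂ × ℂ)} (hU : D.doublePairs ∈ U) {c : ℂ}
    (h : Tendsto (fun p : ℂ × ℂ => D.Y p.1) U (𝓝 c)) :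
    (D.S.dom ∈ U.map Prod.fst ∧ Tendsto D.Y (U.map Prod.fst) (𝓝 c)) ∧
    (D.S.dom ∈ U.map Prod.snd ∧ Tendsto D.Y (U.map Prod.snd) (𝓝 c)) := by
  refine ⟨⟨?_, ?_⟩, ?_, ?_⟩
  · exact show Prod.fst ⁻¹' D.S.dom ∈ U from mem_of_superset hU fun p hp => hp.1
  · rw [Ultrafilter.coe_map, tendsto_map'_iff]; exact h
  · exact show Prod.snd ⁻¹' D.S.dom ∈ U from mem_of_superset hU fun p hp => hp.2.1
  · rw [Ultrafilter.coe_map, tendsto_map'_iff]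
    refine h.congr' ?_
    filter_upwards [hU] with p hp using hp.2.2.2

theorem isOpen_double : IsOpen ((fun p : ℂ × ℂ => D.Y p.1) '' D.doublePairs) := by
  rw [isOpen_iff_mem_nhds]
  rintro _ ⟨⟨z, w⟩, ⟨hz, hw, hne, heq⟩, rfl⟩
  simp only at hz hw hne heq ⊢
  obtain ⟨u, v, hu, hv, hzu, hwv, hd⟩ := t2_separation hne
  have h1 : D.Y '' (D.S.dom ∩ u) ∈ 𝓝 (D.Y z) :=
    (D.isOpen_image_Y (D.S.isOpen_dom.inter hu) Set.inter_subset_left).mem_nhds ⟨z, ⟨hz, hzu⟩, rfl⟩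
  have h2 : D.Y '' (D.S.dom ∩ v) ∈ 𝓝 (D.Y z) := by
    rw [heq]
    exact (D.isOpen_image_Y (D.S.isOpen_dom.inter hv) Set.inter_subset_left).mem_nhds
      ⟨w, ⟨hw, hwv⟩, rfl⟩
  filter_upwards [h1, h2]
  rintro c ⟨z', ⟨hz', hzu'⟩, rfl⟩ ⟨w', ⟨hw', hwv'⟩, heq'⟩
  exact ⟨(z', w'), ⟨hz', hw', fun h : z' = w' =>
    Set.disjoint_left.1 hd hzu' (by rw [h]; exact hwv'), heq'.symm⟩, rfl⟩

theorem sideMid_not_side : ¬ D.IsSide D.sideMid := by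
  have hb := D.bB_pos
  have hpi := Real.pi_pos
  rintro ⟨t, ⟨h0, h1⟩, h | h | h⟩
  · have := congrArg Complex.im h
    simp [sideMid] at this
    exact hb.ne' this
  · have := congrArg Complex.im h
    simp only [sideMid] at this
    nlinarith
  · have h2 := congrArg Complex.im h
    have h3 := congrArg Complex.re h
    simp only [sideMid] at h2 h3
    have h4 : t = Real.pi / 2 := by
      have : t * D.bB = Real.pi / 2 * D.bB := by linarith
      exact mul_right_cancel₀ hb.ne' this
    rw [h4] at h3
    linarith

theorem sideMid_not_mem_par : D.sideMid ∉ D.par := by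
  rintro ⟨-, -, h, -⟩
  simp only [sideMid] at h
  have : -(Real.pi / 2 * D.bA) * D.bB - -(Real.pi / 2 * D.bB) * D.bA = 0 := by ring
  rw [this] at h
  exact lt_irrefl _ h

theorem side_not_mem_par {c : ℂ} (hc : D.IsSide c) : c ∉ D.par := by
  rintro ⟨h1, h2, h3, h4⟩
  obtain ⟨t, -, rfl | rfl | rfl⟩ := hc
  · simp at h1
  · simp at h2
  · simp only at h4
    have : (-Real.pi - t * D.bA) * D.bB - -(t * D.bB) * D.bA = -(Real.pi * D.bB) := by ring
    rw [this] at h4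
    exact lt_irrefl _ h4

theorem side_one_not_mem_par {t : ℝ} : (⟨-(t * D.bA), -(t * D.bB)⟩ : ℂ) ∉ D.par := by
  rintro ⟨-, -, h, -⟩
  simp only at h
  have : -(t * D.bA) * D.bB - -(t * D.bB) * D.bA = 0 := by ring
  rw [this] at h
  exact lt_irrefl _ h

theorem eventually_not_double : ∀ᶠ c in 𝓝 D.sideMid,
    c ∉ (fun p : ℂ × ℂ => D.Y p.1) '' D.doublePairs := by
  by_contra hcon
  have hcl : D.sideMid ∈ closure ((fun p : ℂ × ℂ => D.Y p.1) '' D.doublePairs) := by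
    rw [mem_closure_iff_frequently]
    exact fun h => hcon h
  obtain ⟨U, hU1, hU2⟩ := exists_ultrafilter_of_mem_closure_image hcl
  obtain ⟨⟨d1, t1⟩, d2, t2⟩ := D.doublePairs_swap hU1 hU2
  have key : ∀ V : Ultrafilter ℂ, D.S.dom ∈ V → Tendsto D.Y V (𝓝 D.sideMid) →
      (V : Filter ℂ) ≤ 𝓝 1 ∧ {z : ℂ | z.im < 0} ∈ V := by
    intro V hV ht
    obtain ⟨c, hc, hcases⟩ := D.ultrafilter_cases V hV
    obtain rfl := tendsto_nhds_unique hc ht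
    rcases hcases with ⟨z, hz, -, h⟩ | ⟨x, hx, -, h⟩ | h | ⟨h1, h2, -⟩
    · exact absurd (h ▸ D.Y_mem_par hz) D.sideMid_not_mem_par
    · exact absurd (h ▸ D.Y_gap_mem_par hx) D.sideMid_not_mem_par
    · exact absurd h D.sideMid_not_side
    · exact ⟨h1, h2⟩
  obtain ⟨k1, k2⟩ := key _ d1 t1
  obtain ⟨k3, k4⟩ := key _ d2 t2
  obtain ⟨δ, hδ, huniq⟩ := D.unique_near_one
  have hb := D.bB_pos
  have e1 : ∀ᶠ p : ℂ × ℂ in (U : Filter (ℂ × ℂ)), ‖p.1 - 1‖ < δ := by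
    have := k1 (Metric.ball_mem_nhds (1 : ℂ) hδ)
    filter_upwards [show Prod.fst ⁻¹' Metric.ball (1 : ℂ) δ ∈ U from this] with p hp
    exact mem_ball_iff_norm.1 hp
  have e2 : ∀ᶠ p : ℂ × ℂ in (U : Filter (ℂ × ℂ)), ‖p.2 - 1‖ < δ := by
    have := k3 (Metric.ball_mem_nhds (1 : ℂ) hδ)
    filter_upwards [show Prod.snd ⁻¹' Metric.ball (1 : ℂ) δ ∈ U from this] with p hp
    exact mem_ball_iff_norm.1 hp
  have e3 : ∀ᶠ p : ℂ × ℂ in (U : Filter (ℂ × ℂ)), p.1.im < 0 := k2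
  have e4 : ∀ᶠ p : ℂ × ℂ in (U : Filter (ℂ × ℂ)), p.2.im < 0 := k4
  have e5 : ∀ᶠ p : ℂ × ℂ in (U : Filter (ℂ × ℂ)),
      |(D.Y p.1).im + Real.pi / 2 * D.bB| < D.bB / 2 := by
    have h1 : Tendsto (fun p : ℂ × ℂ => |(D.Y p.1).im + Real.pi / 2 * D.bB|) U (𝓝 0) := by
      have := (((continuous_im.tendsto _).comp hU2).add_const (Real.pi / 2 * D.bB)).abs
      have e : |D.sideMid.im + Real.pi / 2 * D.bB| = 0 := by simp [sideMid]
      rw [e] at this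
      exact this
    exact h1.eventually (gt_mem_nhds (half_pos hb))
  obtain ⟨p, h1, h2, h3, h4, h5, h6⟩ := (e1.and (e2.and (e3.and (e4.and (e5.and
    (show ∀ᶠ p in (U : Filter (ℂ × ℂ)), p ∈ D.doublePairs from hU1)))))).exists
  exact h6.2.2.1 (huniq _ _ h3 h4 h1 h2 h5 h6.2.2.2)

theorem sideMid_mem_closure_par : D.sideMid ∈ closure D.par := by
  have hb := D.bB_pos
  have hpi := Real.pi_pos
  have ht : Tendsto (fun t : ℝ => D.sideMid - t) (𝓝[>] 0) (𝓝 D.sideMid) := by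
    have : Continuous (fun t : ℝ => D.sideMid - t) := by fun_prop
    exact (this.tendsto' 0 _ (by simp)).mono_left inf_le_left
  refine mem_closure_of_tendsto ht ?_
  have h1 : ∀ᶠ t : ℝ in 𝓝[>] 0, t < Real.pi :=
    eventually_nhdsWithin_of_eventually_nhds (gt_mem_nhds hpi)
  filter_upwards [self_mem_nhdsWithin, h1] with t h2 h3
  have h0 : (0 : ℝ) < t := h2
  have e1 : (D.sideMid - t).im = -(Real.pi / 2 * D.bB) := by simp [sideMid]
  have e2 : (D.sideMid - t).re = -(Real.pi / 2 * D.bA) - t := by simp [sideMid]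
  refine ⟨?_, ?_, ?_, ?_⟩
  · rw [e1]; nlinarith
  · rw [e1]; nlinarith
  · rw [e1, e2]; nlinarith
  · rw [e1, e2]; nlinarith

theorem finite_gap_values : (D.Y '' ((fun x : ℝ => (x : ℂ)) '' D.S.gaps)).Finite := by
  have hloc : ∀ x ∈ D.S.gaps, {t : ℝ | t ∈ D.S.gaps → D.Y t = D.Y x} ∈ 𝓝 x := by
    intro x hx
    filter_upwards [D.pA.eventually_eq_of_nonneg (gaps_mem_cutPlane hx) hx.2,
      D.pB.eventually_eq_of_nonneg (gaps_mem_cutPlane hx) hx.2] with t h1 h2 h3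
    rw [Y, h1 h3.2, h2 h3.2]; rfl
  obtain ⟨t, -, ht⟩ := D.S.isCompact_gaps.elim_nhds_subcover _ hloc
  refine (t.finite_toSet.image fun x : ℝ => D.Y x).subset ?_
  rintro _ ⟨_, ⟨x, hx, rfl⟩, rfl⟩
  obtain ⟨i, hi, hxi⟩ := Set.mem_iUnion₂.1 (ht hx)
  exact ⟨i, hi, (hxi hx).symm⟩

theorem injOn_Y (D : CuspData) : Set.InjOn D.Y D.S.dom := by
  set F := D.Y '' ((fun x : ℝ => (x : ℂ)) '' D.S.gaps) with hF
  set W := (fun p : ℂ × ℂ => D.Y p.1) '' D.doublePairs with hW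
  have hFfin : F.Finite := D.finite_gap_values
  have hpre : IsPreconnected (D.par \ F) :=
    isPreconnected_diff_finite D.isOpen_par D.convex_par.isPreconnected hFfin
  have hcl : closure W ∩ (D.par \ F) ⊆ W := by
    rintro c ⟨hc, hcp, hcF⟩
    obtain ⟨U, hU1, hU2⟩ := exists_ultrafilter_of_mem_closure_image hc
    obtain ⟨⟨d1, t1⟩, d2, t2⟩ := D.doublePairs_swap hU1 hU2
    have key : ∀ V : Ultrafilter ℂ, D.S.dom ∈ V → Tendsto D.Y V (𝓝 c) →
        ∃ z ∈ D.S.dom, (V : Filter ℂ) ≤ 𝓝 z ∧ D.Y z = c := by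
      intro V hV ht
      obtain ⟨c, hc, hcases⟩ := D.ultrafilter_cases V hV
      obtain rfl := tendsto_nhds_unique hc ht
      rcases hcases with h | ⟨x, hx, -, h⟩ | h | ⟨-, -, t, -, rfl⟩
      · exact h
      · exact absurd ⟨_, ⟨x, hx, rfl⟩, h⟩ hcF
      · exact absurd hcp (D.side_not_mem_par h)
      · exact absurd hcp D.side_one_not_mem_par
    obtain ⟨z, hz, hUz, hzc⟩ := key _ d1 t1
    obtain ⟨w, hw, hUw, hwc⟩ := key _ d2 t2
    by_cases hzw : z = w
    · exfalso
      subst hzw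
      obtain ⟨V, hV, hinj⟩ := D.exists_injOn hz
      have e1 : ∀ᶠ p : ℂ × ℂ in (U : Filter (ℂ × ℂ)), p.1 ∈ V := hUz hV
      have e2 : ∀ᶠ p : ℂ × ℂ in (U : Filter (ℂ × ℂ)), p.2 ∈ V := hUw hV
      obtain ⟨p, h1, h2, h3⟩ := (e1.and (e2.and
        (show ∀ᶠ p in (U : Filter (ℂ × ℂ)), p ∈ D.doublePairs from hU1))).exists
      exact h3.2.2.1 (hinj h1 h2 h3.2.2.2)
    · exact ⟨(z, w), ⟨hz, hw, hzw, hzc.trans hwc.symm⟩, hzc⟩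
  have hempty : ¬ ((D.par \ F) ∩ W).Nonempty := by
    intro hne
    have hsub := hpre.subset_of_closure_inter_subset D.isOpen_double hne hcl
    have hFm : D.sideMid ∉ F := by
      rintro ⟨_, ⟨x, hx, rfl⟩, h⟩
      exact D.sideMid_not_mem_par (h ▸ D.Y_gap_mem_par hx)
    obtain ⟨c, h1, h2, h3⟩ := mem_closure_iff_nhds.1 D.sideMid_mem_closure_par _
      (inter_mem D.eventually_not_double (hFfin.isClosed.isOpen_compl.mem_nhds hFm)) |>.imp
      fun c hc => (⟨hc.1.1, hc.1.2, hc.2⟩ : _ ∧ _ ∧ _)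
    exact h1 (hsub ⟨h3, h2⟩)
  intro z hz w hw hzw
  by_contra hne
  have hcW : D.Y z ∈ W := ⟨(z, w), ⟨hz, hw, hne, hzw⟩, rfl⟩
  have hcp : D.Y z ∈ D.par := D.Y_mem_par hz
  apply hempty
  have h1 : W ∩ D.par ∈ 𝓝 (D.Y z) :=
    inter_mem (D.isOpen_double.mem_nhds hcW) (D.isOpen_par.mem_nhds hcp)
  have h2 : Fᶜ ∈ 𝓝[≠] (D.Y z) := by
    have := (hFfin.subset (Set.sdiff_subset (t := {D.Y z}))).isClosed.isOpen_compl.mem_nhds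
      (show D.Y z ∈ (F \ {D.Y z})ᶜ from fun h => h.2 rfl)
    filter_upwards [mem_nhdsWithin_of_mem_nhds this, self_mem_nhdsWithin] with c hc1 hc2 hc3
    exact hc1 ⟨hc3, hc2⟩
  obtain ⟨c, h3, h4⟩ := ((eventually_nhdsWithin_of_eventually_nhds
    (show ∀ᶠ c in 𝓝 (D.Y z), c ∈ W ∩ D.par from h1)).and
    (show ∀ᶠ c in 𝓝[≠] (D.Y z), c ∈ Fᶜ from h2)).exists
  exact ⟨c, ⟨h3.2, h4⟩, h3.1⟩

end CuspData

/-! ### Expansions at the gaps -/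

namespace Potential

open SlitCurve

variable {S : SlitCurve} {D : Set ℂ} (p : Potential S D) {x₀ r₀ : ℝ} (c : Chart S x₀ r₀)

theorem expansion₁ (hx : (x₀ : ℂ) ∈ D) : ∃ C ≥ 0, ∀ᶠ χ in 𝓝 (0 : ℂ), 0 < χ.im →
    |p.y (c.Z χ) - p.y x₀ - p.slope c * χ.im| ≤ C * ‖χ‖ * χ.im := by
  obtain ⟨ε, K, hK⟩ := p.exists_localPrimitive c hx
  obtain ⟨C, hC, h⟩ := hK.expansion₁
  refine ⟨C, hC, ?_⟩
  filter_upwards [h, Metric.ball_mem_nhds _ hK.pos] with χ h1 h2 h3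
  rw [hK.eq χ h2 h3.le, add_sub_cancel_left]
  rwa [abs_of_pos h3] at h1

theorem expansion₂ (hx : (x₀ : ℂ) ∈ D) : ∃ C ≥ 0, ∀ᶠ χ in 𝓝 (0 : ℂ), 0 < χ.im →
    |p.y (c.Z χ) - p.y x₀ - (p.slope c * χ.im + p.slope₂ c * χ.re * χ.im)| ≤
      C * ‖χ‖ ^ 2 * χ.im := by
  obtain ⟨ε, K, hK⟩ := p.exists_localPrimitive c hx
  obtain ⟨C, hC, h⟩ := hK.expansion₂
  refine ⟨C, hC, ?_⟩
  filter_upwards [h, Metric.ball_mem_nhds _ hK.pos] with χ h1 h2 h3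
  rw [hK.eq χ h2 h3.le, add_sub_cancel_left]
  rwa [abs_of_pos h3] at h1

theorem localForm_eq {χ : ℂ} (hχ : χ ∈ halfDisc c.ε) :
    p.localForm c χ = (p.a (c.Z χ) + S.form p.q (c.Z χ)) * (c.j χ * c.ρ χ) := by
  obtain ⟨h1, h2⟩ := c.mem_dom χ hχ
  have hr : c.ρ χ ≠ 0 := h2 ▸ r_ne_zero h1
  have h3 : c.Z χ - 1 ≠ 0 := sub_ne_zero.2 (ne_one_of_mem h1)
  rw [SlitCurve.form, h2, localForm]
  field_simp

/-- The value of a pair of potentials. -/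
def pair (p q : Potential S D) (z : ℂ) : ℂ := ⟨p.y z, q.y z⟩

/-- The slope of a pair of potentials. -/
def pairSlope (p q : Potential S D) : ℂ := ⟨p.slope c, q.slope c⟩

theorem pair_expansion (p q : Potential S D) (hx : (x₀ : ℂ) ∈ D) :
    ∃ C ≥ 0, ∀ᶠ χ in 𝓝 (0 : ℂ), 0 < χ.im →
      ‖pair p q (c.Z χ) - pair p q x₀ - χ.im * pairSlope c p q‖ ≤ C * ‖χ‖ * χ.im := by
  obtain ⟨C, hC, h⟩ := p.expansion₁ c hx
  obtain ⟨C', hC', h'⟩ := q.expansion₁ c hx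
  refine ⟨C + C', by positivity, ?_⟩
  filter_upwards [h, h'] with χ h1 h2 h3
  refine (norm_le_abs_re_add_abs_im _).trans ?_
  have e1 : (pair p q (c.Z χ) - pair p q x₀ - χ.im * pairSlope c p q).re =
      p.y (c.Z χ) - p.y x₀ - p.slope c * χ.im := by
    simp [pair, pairSlope]; ring
  have e2 : (pair p q (c.Z χ) - pair p q x₀ - χ.im * pairSlope c p q).im =
      q.y (c.Z χ) - q.y x₀ - q.slope c * χ.im := by
    simp [pair, pairSlope]; ring
  rw [e1, e2]
  have := h1 h3
  have := h2 h3
  linarith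

end Potential

open Potential

namespace CuspData

open SlitCurve

variable {D : CuspData} {x₀ r₀ : ℝ} (c : Chart D.S x₀ r₀)

theorem Y_eq_pair : D.Y = pair D.pA D.pB := rfl

/-- The slope of the map in a chart. -/
def nSlope (c : Chart D.S x₀ r₀) : ℂ := pairSlope c D.pA D.pB

variable {c}

theorem nSlope_ne (hx : x₀ ∈ D.S.gaps) : nSlope c ≠ 0 := fun h =>
  D.slope_ne c hx ⟨congrArg Complex.re h, congrArg Complex.im h⟩

/-- The coefficient of the second order expansion transversal to the slope. -/
def transverse (c : Chart D.S x₀ r₀) : ℝ :=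
  D.pA.slope c * D.pB.slope₂ c - D.pB.slope c * D.pA.slope₂ c

theorem transverse_ne (hx : x₀ ∈ D.S.gaps) : transverse c ≠ 0 := by
  obtain ⟨εA, KA, hA⟩ := D.pA.exists_localPrimitive c (gaps_mem_cutPlane hx)
  obtain ⟨εB, KB, hB⟩ := D.pB.exists_localPrimitive c (gaps_mem_cutPlane hx)
  have hjac : ∀ χ ∈ halfDisc c.ε,
      (D.pA.localForm c χ * (starRingEnd ℂ) (D.pB.localForm c χ)).im < 0 := by
    intro χ hχ
    obtain ⟨h1, h2⟩ := c.mem_dom χ hχ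
    have hr : c.ρ χ ≠ 0 := h2 ▸ r_ne_zero h1
    have hZ : c.j χ * c.ρ χ ≠ 0 := mul_ne_zero (c.j_ne χ hχ.2) hr
    rw [localForm_eq _ c hχ, localForm_eq _ c hχ, map_mul, mul_mul_mul_comm, mul_conj (c.j χ * _),
      im_mul_ofReal]
    exact mul_neg_of_neg_of_pos (D.jac' h1) (normSq_pos.2 hZ)
  have key : ∀ {f g : ℂ → ℂ} {ε : ℝ}, 0 < ε → DifferentiableOn ℂ f (Metric.ball 0 ε) →
      DifferentiableOn ℂ g (Metric.ball 0 ε) →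
      (∀ χ ∈ Metric.ball 0 ε, f ((starRingEnd ℂ) χ) = (starRingEnd ℂ) (f χ)) →
      (∀ χ ∈ Metric.ball 0 ε, g ((starRingEnd ℂ) χ) = (starRingEnd ℂ) (g χ)) →
      (∀ χ ∈ halfDisc ε, 0 < (f χ * (starRingEnd ℂ) (g χ)).im) → g 0 ≠ 0 →
      deriv f 0 * g 0 - f 0 * deriv g 0 ≠ 0 := by
    intro f g ε hε hf hg hfc hgc him hg0
    obtain ⟨δ, hδ, hb⟩ := Metric.eventually_nhds_iff_ball.1
      ((hg.differentiableAt (Metric.ball_mem_nhds 0 hε)).continuousAt.eventually_ne hg0)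
    have hs1 : Metric.ball (0 : ℂ) (min δ ε) ⊆ Metric.ball 0 δ :=
      Metric.ball_subset_ball (min_le_left _ _)
    have hs2 : Metric.ball (0 : ℂ) (min δ ε) ⊆ Metric.ball 0 ε :=
      Metric.ball_subset_ball (min_le_right _ _)
    have h1 := deriv_ne_zero_of_im_pos (f := fun χ => f χ / g χ) (lt_min hδ hε)
      ((hf.mono hs2).div (hg.mono hs2) fun χ hχ => hb χ (hs1 hχ))
      (fun χ hχ => by rw [hfc χ (hs2 hχ), hgc χ (hs2 hχ), map_div₀])
      (fun χ hχ => by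
        have h2 := him χ ⟨hχ.1, hs2 hχ.2⟩
        have h3 : f χ / g χ = (f χ * (starRingEnd ℂ) (g χ)) * ((normSq (g χ))⁻¹ : ℝ) := by
          rw [div_eq_mul_inv, Complex.inv_def]; ring
        rw [h3, im_mul_ofReal]
        exact mul_pos h2 (inv_pos.2 (normSq_pos.2 (hb χ (hs1 hχ.2)))))
    have h4 := deriv_fun_div (hf.differentiableAt (Metric.ball_mem_nhds 0 hε))
      (hg.differentiableAt (Metric.ball_mem_nhds 0 hε)) hg0
    rw [h4] at h1
    exact (div_ne_zero_iff.1 h1).1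
  set ε := min εA εB with hε
  have hεp : 0 < ε := lt_min hA.pos hB.pos
  have hA' := hA.mono hεp (min_le_left _ _)
  have hB' := hB.mono hεp (min_le_right _ _)
  have hsub : halfDisc ε ⊆ halfDisc c.ε := fun χ hχ =>
    ⟨hχ.1, Metric.ball_subset_ball hA'.le hχ.2⟩
  intro h0
  have h0' : D.pA.slope c * D.pB.slope₂ c - D.pB.slope c * D.pA.slope₂ c = 0 := h0
  by_cases hn : D.pB.slope c = 0
  · have hn' : D.pA.slope c ≠ 0 := fun h => D.slope_ne c hx ⟨h, hn⟩
    have := key hεp hB'.diff hA'.diff hB'.conj_form hA'.conj_form (fun χ hχ => by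
      have h1 := hjac χ (hsub hχ)
      have h2 : D.pB.localForm c χ * (starRingEnd ℂ) (D.pA.localForm c χ) =
        (starRingEnd ℂ) (D.pA.localForm c χ * (starRingEnd ℂ) (D.pB.localForm c χ)) := by
        rw [map_mul, conj_conj, mul_comm]
      rw [h2, conj_im]
      linarith) (by rw [hA'.localForm_zero]; exact_mod_cast hn')
    apply this
    rw [hA'.localForm_zero, hB'.localForm_zero, hA'.deriv_localForm, hB'.deriv_localForm]
    exact_mod_cast (by linarith : D.pB.slope₂ c * D.pA.slope c - D.pB.slope c * D.pA.slope₂ c = 0)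
  · have := key hεp hA'.diff.neg hB'.diff (fun χ hχ => by simp [hA'.conj_form χ hχ])
      hB'.conj_form (fun χ hχ => by
      have h1 := hjac χ (hsub hχ)
      simp only [Pi.neg_apply, neg_mul, neg_im]
      linarith) (by rw [hB'.localForm_zero]; exact_mod_cast hn)
    apply this
    rw [deriv.neg, Pi.neg_apply, hA'.localForm_zero, hB'.localForm_zero, hA'.deriv_localForm,
      hB'.deriv_localForm]
    exact_mod_cast (by linarith :
      -D.pA.slope₂ c * D.pB.slope c - -D.pA.slope c * D.pB.slope₂ c = 0)

theorem Y_expansion (c : Chart D.S x₀ r₀) (hx : x₀ ∈ D.S.gaps) :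
    ∃ C ≥ 0, ∀ᶠ χ in 𝓝 (0 : ℂ), 0 < χ.im →
      ‖D.Y (c.Z χ) - D.Y x₀ - χ.im * nSlope c‖ ≤ C * ‖χ‖ * χ.im :=
  pair_expansion c D.pA D.pB (gaps_mem_cutPlane hx)

theorem transverse_expansion (c : Chart D.S x₀ r₀) (hx : x₀ ∈ D.S.gaps) :
    ∃ C ≥ 0, ∀ᶠ χ in 𝓝 (0 : ℂ), 0 < χ.im →
      |((D.Y (c.Z χ) - D.Y x₀) * (starRingEnd ℂ) (nSlope c)).im -
        transverse c * χ.re * χ.im| ≤ C * ‖χ‖ ^ 2 * χ.im := by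
  obtain ⟨C, hC, h⟩ := D.pA.expansion₂ c (gaps_mem_cutPlane hx)
  obtain ⟨C', hC', h'⟩ := D.pB.expansion₂ c (gaps_mem_cutPlane hx)
  refine ⟨|D.pB.slope c| * C + |D.pA.slope c| * C', by positivity, ?_⟩
  filter_upwards [h, h'] with χ h1 h2 h3
  have e : ((D.Y (c.Z χ) - D.Y x₀) * (starRingEnd ℂ) (nSlope c)).im -
        transverse c * χ.re * χ.im =
      D.pA.slope c * (D.pB.y (c.Z χ) - D.pB.y x₀ -
        (D.pB.slope c * χ.im + D.pB.slope₂ c * χ.re * χ.im)) -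
      D.pB.slope c * (D.pA.y (c.Z χ) - D.pA.y x₀ -
        (D.pA.slope c * χ.im + D.pA.slope₂ c * χ.re * χ.im)) := by
    simp [Y, nSlope, pairSlope, transverse]; ring
  rw [e]
  refine (abs_sub _ _).trans ?_
  rw [abs_mul, abs_mul]
  have k1 := mul_le_mul_of_nonneg_left (h2 h3) (abs_nonneg (D.pA.slope c))
  have k2 := mul_le_mul_of_nonneg_left (h1 h3) (abs_nonneg (D.pB.slope c))
  linarith

theorem lower_bound (c : Chart D.S x₀ r₀) (hx : x₀ ∈ D.S.gaps) :
    ∀ᶠ χ in 𝓝 (0 : ℂ), 0 < χ.im → ‖nSlope c‖ / 2 * χ.im ≤ ‖D.Y (c.Z χ) - D.Y x₀‖ := by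
  obtain ⟨C, hC, h⟩ := Y_expansion c hx
  have hn : 0 < ‖nSlope c‖ := norm_pos_iff.2 (nSlope_ne hx)
  have hs : Tendsto (fun χ : ℂ => C * ‖χ‖) (𝓝 0) (𝓝 0) :=
    Continuous.tendsto' (by fun_prop) 0 0 (by simp)
  filter_upwards [h, hs.eventually (gt_mem_nhds (half_pos hn))] with χ h1 h2 h3
  have h4 := h1 h3
  have h5 : C * ‖χ‖ * χ.im ≤ ‖nSlope c‖ / 2 * χ.im := by gcongr
  have h6 : ‖(χ.im : ℂ) * nSlope c‖ = χ.im * ‖nSlope c‖ := by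
    rw [norm_mul, Complex.norm_real, Real.norm_of_nonneg h3.le]
  have h7 : ‖(χ.im : ℂ) * nSlope c‖ ≤ ‖D.Y (c.Z χ) - D.Y x₀‖ +
      ‖D.Y (c.Z χ) - D.Y x₀ - χ.im * nSlope c‖ := by
    have e : (χ.im : ℂ) * nSlope c = (D.Y (c.Z χ) - D.Y x₀) -
      (D.Y (c.Z χ) - D.Y x₀ - χ.im * nSlope c) := by ring
    conv_lhs => rw [e]
    exact norm_sub_le _ _
  linarith

/-- The image approaches the value at a gap along the direction of the slope. -/
theorem tendsto_direction (c : Chart D.S x₀ r₀) (hx : x₀ ∈ D.S.gaps) :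
    Tendsto (fun χ => (D.Y (c.Z χ) - D.Y x₀) / (‖D.Y (c.Z χ) - D.Y x₀‖ : ℂ))
      (𝓝[{χ : ℂ | 0 < χ.im}] 0) (𝓝 (nSlope c / ‖nSlope c‖)) := by
  obtain ⟨C, hC, h⟩ := Y_expansion c hx
  have hs : Tendsto (fun χ : ℂ => C * ‖χ‖) (𝓝[{χ : ℂ | 0 < χ.im}] 0) (𝓝 0) :=
    (Continuous.tendsto' (by fun_prop) 0 0 (by simp)).mono_left inf_le_left
  have h1 : Tendsto (fun χ : ℂ => (D.Y (c.Z χ) - D.Y x₀) / (χ.im : ℂ))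
      (𝓝[{χ : ℂ | 0 < χ.im}] 0) (𝓝 (nSlope c)) := by
    rw [tendsto_iff_norm_sub_tendsto_zero]
    refine squeeze_zero' (Eventually.of_forall fun _ => norm_nonneg _) ?_ hs
    filter_upwards [eventually_nhdsWithin_of_eventually_nhds h, self_mem_nhdsWithin] with χ h2 h3
    have h3' : 0 < χ.im := h3
    have h4 : (χ.im : ℂ) ≠ 0 := by exact_mod_cast h3'.ne'
    have e : (D.Y (c.Z χ) - D.Y x₀) / (χ.im : ℂ) - nSlope c =
      (D.Y (c.Z χ) - D.Y x₀ - χ.im * nSlope c) / (χ.im : ℂ) := by field_simp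
    rw [e, norm_div, Complex.norm_real, Real.norm_of_nonneg h3'.le, div_le_iff₀ h3']
    exact h2 h3'
  have hn : (‖nSlope c‖ : ℂ) ≠ 0 := by exact_mod_cast (norm_pos_iff.2 (nSlope_ne hx)).ne'
  have h2 := h1.div ((continuous_ofReal.tendsto _).comp h1.norm) hn
  refine h2.congr' ?_
  filter_upwards [self_mem_nhdsWithin] with χ h3
  have h3' : 0 < χ.im := h3
  have h4 : (χ.im : ℂ) ≠ 0 := by exact_mod_cast h3'.ne'
  show ((D.Y (c.Z χ) - D.Y x₀) / (χ.im : ℂ)) /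
    ((‖(D.Y (c.Z χ) - D.Y x₀) / (χ.im : ℂ)‖ : ℝ) : ℂ) = _
  rw [norm_div, Complex.norm_real, Real.norm_of_nonneg h3'.le, ofReal_div,
    div_div_div_cancel_right₀ h4]

section Theta

variable (tA tB : Potential D.S cutPlane)

/-- A second pair of potentials is isometric to the first along the gaps. -/
def IsIsometric (tA tB : Potential D.S cutPlane) : Prop :=
  ∀ x₀ r₀ : ℝ, x₀ ∈ D.S.gaps → ∀ c : Chart D.S x₀ r₀, ‖pairSlope c tA tB‖ = ‖nSlope c‖

variable {tA tB}

theorem lightlike_near_gap (h : IsIsometric tA tB) (hx : x₀ ∈ D.S.gaps) {η : ℝ} (hη : 0 < η) :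
    ∀ᶠ z in 𝓝 (x₀ : ℂ), z ∈ D.S.dom →
      |‖pair tA tB z - pair tA tB x₀‖ - ‖D.Y z - D.Y x₀‖| ≤ η * ‖D.Y z - D.Y x₀‖ := by
  refine eventually_of_charts hx.2 fun r₀ hr₀ => ?_
  obtain ⟨c⟩ := exists_chart D.S hr₀
  refine ⟨c, ?_⟩
  obtain ⟨C, hC, h1⟩ := Y_expansion c hx
  obtain ⟨C', hC', h2⟩ := pair_expansion c tA tB (gaps_mem_cutPlane hx)
  have hn : 0 < ‖nSlope c‖ := norm_pos_iff.2 (nSlope_ne hx)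
  have hs : Tendsto (fun χ : ℂ => (C + C') * ‖χ‖) (𝓝 0) (𝓝 0) :=
    Continuous.tendsto' (by fun_prop) 0 0 (by simp)
  filter_upwards [h1, h2, lower_bound c hx,
    hs.eventually (gt_mem_nhds (show 0 < η * (‖nSlope c‖ / 2) by positivity))]
    with χ k1 k2 k3 k4 k5
  have hi : 0 < χ.im := k5.1
  have e1 := abs_norm_sub_norm_le (D.Y (c.Z χ) - D.Y x₀) (χ.im * nSlope c)
  have e2 := abs_norm_sub_norm_le (pair tA tB (c.Z χ) - pair tA tB x₀)
    (χ.im * pairSlope c tA tB)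
  have e3 : ‖(χ.im : ℂ) * pairSlope c tA tB‖ = ‖(χ.im : ℂ) * nSlope c‖ := by
    rw [norm_mul, norm_mul, h x₀ r₀ hx c]
  rw [e3] at e2
  have e4 := e1.trans (k1 hi)
  have e5 := e2.trans (k2 hi)
  have e6 : (C + C') * ‖χ‖ * χ.im ≤ η * (‖nSlope c‖ / 2) * χ.im := by gcongr
  have e7 := mul_le_mul_of_nonneg_left (k3 hi) hη.le
  rw [abs_le] at e4 e5 ⊢
  constructor <;> nlinarith

/-- The second order estimate along the ray in the direction of the slope. -/
theorem ray_estimate (h : IsIsometric tA tB) (c : Chart D.S x₀ r₀) (hx : x₀ ∈ D.S.gaps) :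
    ∃ C, ∀ᶠ χ in 𝓝 (0 : ℂ), 0 < χ.im → ∀ t : ℝ, D.Y (c.Z χ) = D.Y x₀ + t * nSlope c →
      ‖pair tA tB (c.Z χ) - pair tA tB x₀ - pairSlope c tA tB / nSlope c *
        (D.Y (c.Z χ) - D.Y x₀)‖ ≤ C * t ^ 2 := by
  obtain ⟨C, hC, h1⟩ := Y_expansion c hx
  obtain ⟨C', hC', h2⟩ := pair_expansion c tA tB (gaps_mem_cutPlane hx)
  obtain ⟨E, hE, h3⟩ := transverse_expansion c hx
  have hn : 0 < ‖nSlope c‖ := norm_pos_iff.2 (nSlope_ne hx)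
  have hk : 0 < |transverse c| := abs_pos.2 (transverse_ne hx)
  refine ⟨(C + C') * 8, ?_⟩
  have hs : Tendsto (fun χ : ℂ => E * ‖χ‖) (𝓝 0) (𝓝 0) :=
    Continuous.tendsto' (by fun_prop) 0 0 (by simp)
  filter_upwards [h1, h2, h3, lower_bound c hx,
    hs.eventually (gt_mem_nhds (show 0 < |transverse c| / 3 by positivity))]
    with χ k1 k2 k3 k4 k5 hi t ht
  have hN : D.Y (c.Z χ) - D.Y x₀ = t * nSlope c := by rw [ht]; ring
  have e1 := k3 hi
  have e2 : ((D.Y (c.Z χ) - D.Y x₀) * (starRingEnd ℂ) (nSlope c)).im = 0 := by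
    rw [hN, mul_assoc, mul_conj, ← ofReal_mul, ofReal_im]
  rw [e2, zero_sub, abs_neg, abs_mul, abs_mul, abs_of_pos hi] at e1
  have e3 : |transverse c| * |χ.re| ≤ E * ‖χ‖ ^ 2 := le_of_mul_le_mul_right e1 hi
  have e4 : ‖χ‖ ≤ |χ.re| + χ.im := by
    have := norm_le_abs_re_add_abs_im χ
    rwa [abs_of_pos hi] at this
  have e5 : |χ.re| ≤ χ.im := by
    have : |transverse c| * |χ.re| ≤ |transverse c| / 3 * (|χ.re| + χ.im) := by
      calc |transverse c| * |χ.re| ≤ E * ‖χ‖ ^ 2 := e3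
        _ = (E * ‖χ‖) * ‖χ‖ := by ring
        _ ≤ |transverse c| / 3 * (|χ.re| + χ.im) := by
          have := norm_nonneg χ
          gcongr
    have h7 : |χ.re| ≤ (|χ.re| + χ.im) / 3 := by
      refine le_of_mul_le_mul_left ?_ hk
      linarith
    linarith
  have e6 : ‖χ‖ ≤ 2 * χ.im := by linarith
  have e7 : χ.im ≤ 2 * |t| := by
    have h8 := k4 hi
    rw [hN, norm_mul, Complex.norm_real, Real.norm_eq_abs] at h8
    have h9 : ‖nSlope c‖ * χ.im ≤ ‖nSlope c‖ * (2 * |t|) := by linarith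
    exact le_of_mul_le_mul_left h9 hn
  have hq : ‖pairSlope c tA tB / nSlope c‖ = 1 := by
    rw [norm_div, h x₀ r₀ hx c, div_self hn.ne']
  have e8 : pair tA tB (c.Z χ) - pair tA tB x₀ - pairSlope c tA tB / nSlope c *
        (D.Y (c.Z χ) - D.Y x₀) =
      (pair tA tB (c.Z χ) - pair tA tB x₀ - χ.im * pairSlope c tA tB) -
      pairSlope c tA tB / nSlope c * (D.Y (c.Z χ) - D.Y x₀ - χ.im * nSlope c) := by
    have := nSlope_ne (c := c) hx
    field_simp
    ring
  rw [e8]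
  refine (norm_sub_le _ _).trans ?_
  rw [norm_mul, hq, one_mul]
  have k6 := k1 hi
  have k7 := k2 hi
  have k8 : ‖χ‖ * χ.im ≤ 2 * χ.im * χ.im := by gcongr
  have k9 : χ.im * χ.im ≤ (2 * |t|) * (2 * |t|) := by gcongr
  have k10 : |t| * |t| = t ^ 2 := by rw [← pow_two, sq_abs]
  have k11 : (C + C') * (‖χ‖ * χ.im) ≤ (C + C') * (8 * t ^ 2) :=
    mul_le_mul_of_nonneg_left (by nlinarith) (by positivity)
  linarith

end Theta

theorem map_nhds_chart (c : Chart D.S x₀ r₀) {χ : ℂ} (hχ : χ ∈ halfDisc c.ε) :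
    map (fun χ => D.Y (c.Z χ)) (𝓝 χ) = 𝓝 (D.Y (c.Z χ)) := by
  obtain ⟨h1, h2⟩ := c.mem_dom χ hχ
  have hr : c.ρ χ ≠ 0 := h2 ▸ r_ne_zero h1
  have hZ : DifferentiableOn ℂ c.Z (Metric.ball 0 c.ε) := fun χ hχ =>
    (c.hasDerivAt χ hχ).differentiableAt.differentiableWithinAt
  have hs : HasStrictDerivAt c.Z (c.j χ * c.ρ χ) χ := by
    rw [← (c.hasDerivAt χ hχ.2).deriv]
    exact (hZ.analyticAt (Metric.isOpen_ball.mem_nhds hχ.2)).hasStrictDerivAt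
  have h3 := hs.map_nhds_eq (mul_ne_zero (c.j_ne χ hχ.2) hr)
  rw [← D.map_nhds_Y h1, ← h3, Filter.map_map]
  rfl

/-- Every point of the ray in the direction of the slope near its origin is attained in the
chart. -/
theorem ray_hit (c : Chart D.S x₀ r₀) (hx : x₀ ∈ D.S.gaps) {s : Set ℂ} (hs : s ∈ 𝓝 (0 : ℂ)) :
    ∀ᶠ t : ℝ in 𝓝[>] 0, ∃ χ ∈ halfDisc c.ε, χ ∈ s ∧ D.Y (c.Z χ) = D.Y x₀ + t * nSlope c := by
  obtain ⟨C, hC, h1⟩ := Y_expansion c hx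
  obtain ⟨E, hE, h2⟩ := transverse_expansion c hx
  have hn : 0 < ‖nSlope c‖ := norm_pos_iff.2 (nSlope_ne hx)
  have hk : 0 < |transverse c| := abs_pos.2 (transverse_ne hx)
  have hcy : ∀ᶠ χ in 𝓝 (0 : ℂ), c.Z χ ∈ cutPlane :=
    c.tendsto_Z.eventually (isOpen_cutPlane.mem_nhds (gaps_mem_cutPlane hx))
  obtain ⟨δ, hδ, hball⟩ := Metric.eventually_nhds_iff_ball.1 (h1.and (h2.and (hcy.and
    (show ∀ᶠ χ in 𝓝 (0 : ℂ), χ ∈ s from hs))))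
  set N : ℂ → ℂ := fun χ => (D.Y (c.Z χ) - D.Y x₀) * (starRingEnd ℂ) (nSlope c) with hN
  obtain ⟨η, hη, hη1, hη2, hη3⟩ : ∃ η > 0, 2 * η < min δ c.ε ∧ C * (2 * η) ≤ ‖nSlope c‖ / 2 ∧
      E * (4 * η) < |transverse c| := by
    have t1 : Tendsto (fun η : ℝ => 2 * η) (𝓝[>] 0) (𝓝 0) :=
      (Continuous.tendsto' (by fun_prop) 0 0 (by simp)).mono_left inf_le_left
    have t2 : Tendsto (fun η : ℝ => C * (2 * η)) (𝓝[>] 0) (𝓝 0) :=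
      (Continuous.tendsto' (by fun_prop) 0 0 (by simp)).mono_left inf_le_left
    have t3 : Tendsto (fun η : ℝ => E * (4 * η)) (𝓝[>] 0) (𝓝 0) :=
      (Continuous.tendsto' (by fun_prop) 0 0 (by simp)).mono_left inf_le_left
    obtain ⟨η, a1, a2, a3, a4⟩ := ((t1.eventually (gt_mem_nhds (lt_min hδ c.ε_pos))).and
      ((t2.eventually (gt_mem_nhds (half_pos hn))).and ((t3.eventually (gt_mem_nhds hk)).and
      (eventually_mem_nhdsWithin (s := Set.Ioi (0 : ℝ)))))).exists
    exact ⟨η, a4, a1, a2.le, a3⟩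
  have hnorm : ∀ χ : ℂ, |χ.re| ≤ χ.im → ‖χ‖ ≤ 2 * χ.im := fun χ hχ => by
    have := norm_le_abs_re_add_abs_im χ
    rw [abs_of_nonneg ((abs_nonneg _).trans hχ)] at this
    linarith
  have hin : ∀ χ : ℂ, |χ.re| ≤ χ.im → χ.im ≤ η → χ ∈ Metric.ball (0 : ℂ) (min δ c.ε) := by
    intro χ h3 h4
    rw [mem_ball_zero_iff]
    linarith [hnorm χ h3]
  have hinδ : ∀ χ : ℂ, |χ.re| ≤ χ.im → χ.im ≤ η → χ ∈ Metric.ball (0 : ℂ) δ := fun χ h3 h4 =>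
    Metric.ball_subset_ball (min_le_left _ _) (hin χ h3 h4)
  have hinε : ∀ χ : ℂ, |χ.re| ≤ χ.im → χ.im ≤ η → χ ∈ Metric.ball (0 : ℂ) c.ε := fun χ h3 h4 =>
    Metric.ball_subset_ball (min_le_right _ _) (hin χ h3 h4)
  have hre : ∀ χ : ℂ, 0 < χ.im → |χ.re| ≤ χ.im → χ.im ≤ η →
      |(N χ).re - ‖nSlope c‖ ^ 2 * χ.im| ≤ ‖nSlope c‖ ^ 2 / 2 * χ.im := by
    intro χ h0 h3 h4
    have h5 := (hball χ (hinδ χ h3 h4)).1 h0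
    have e : (N χ).re - ‖nSlope c‖ ^ 2 * χ.im =
        ((D.Y (c.Z χ) - D.Y x₀ - χ.im * nSlope c) * (starRingEnd ℂ) (nSlope c)).re := by
      rw [sub_mul (D.Y (c.Z χ) - D.Y x₀), sub_re, mul_assoc, mul_conj, normSq_eq_norm_sq,
        ← ofReal_mul, ofReal_re]
      ring
    rw [e]
    refine (abs_re_le_norm _).trans ?_
    rw [norm_mul, norm_conj]
    have h6 : C * ‖χ‖ ≤ ‖nSlope c‖ / 2 := by
      refine le_trans ?_ hη2
      have := hnorm χ h3
      gcongr
      linarith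
    calc _ ≤ (C * ‖χ‖ * χ.im) * ‖nSlope c‖ := by gcongr
      _ ≤ (‖nSlope c‖ / 2 * χ.im) * ‖nSlope c‖ := by gcongr
      _ = _ := by ring
  have him : ∀ χ : ℂ, 0 < χ.im → |χ.re| = χ.im → χ.im ≤ η →
      0 < (N χ).im * (transverse c * χ.re) := by
    intro χ h0 h3 h4
    have h5 := (hball χ (hinδ χ h3.le h4)).2.1 h0
    have h6 : E * ‖χ‖ ^ 2 * χ.im < |transverse c| * |χ.re| * χ.im := by
      have h7 : ‖χ‖ ^ 2 ≤ (2 * χ.im) ^ 2 := by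
        have := hnorm χ h3.le
        have := norm_nonneg χ
        gcongr
      have h8 : E * ‖χ‖ ^ 2 ≤ E * (4 * η) * χ.im := by
        calc E * ‖χ‖ ^ 2 ≤ E * (2 * χ.im) ^ 2 := by gcongr
          _ = E * (4 * χ.im) * χ.im := by ring
          _ ≤ _ := by gcongr
      rw [h3]
      have h9 : E * (4 * η) * χ.im < |transverse c| * χ.im := by gcongr
      have := h8.trans_lt h9
      gcongr
    have h7 := h5.trans_lt h6
    rw [← abs_of_pos h0, ← abs_mul, ← abs_mul, abs_of_pos h0] at h7
    have h8 : 0 < (N χ).im * (transverse c * χ.re * χ.im) := by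
      set A := (N χ).im
      set B := transverse c * χ.re * χ.im
      have h9 : |A - B| < |B| := h7
      rcases abs_cases B with ⟨hb1, hb2⟩ | ⟨hb1, hb2⟩
      · rw [hb1, abs_lt] at h9
        nlinarith [h9.1, h9.2]
      · rw [hb1, abs_lt] at h9
        nlinarith [h9.1, h9.2]
    have h9 : (N χ).im * (transverse c * χ.re * χ.im) =
      ((N χ).im * (transverse c * χ.re)) * χ.im := by ring
    rw [h9] at h8
    exact (pos_iff_pos_of_mul_pos h8).2 h0
  have hNc : ∀ χ : ℂ, |χ.re| ≤ χ.im → χ.im ≤ η → ContinuousAt (fun χ => D.Y (c.Z χ)) χ := by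
    intro χ h3 h4
    exact ContinuousAt.comp (D.continuousAt_Y (hball χ (hinδ χ h3 h4)).2.2.1)
      (c.hasDerivAt χ (hinε χ h3 h4)).continuousAt
  set V : Set ℂ := {χ | |χ.re| < χ.im ∧ χ.im < η} with hV
  have habs : Continuous fun χ : ℂ => |χ.re| := continuous_re.abs
  have hVo : IsOpen V := (isOpen_lt habs continuous_im).inter
    (isOpen_lt continuous_im continuous_const)
  have hVpos : ∀ χ ∈ V, 0 < χ.im := fun χ hχ => (abs_nonneg _).trans_lt hχ.1
  have hVd : ∀ χ ∈ V, χ ∈ halfDisc c.ε := fun χ hχ => ⟨hVpos χ hχ, hinε χ hχ.1.le hχ.2.le⟩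
  set line : ℝ → ℂ := fun t => D.Y x₀ + t * nSlope c with hline
  have hlc : Continuous line := by fun_prop
  set u : Set ℝ := line ⁻¹' ((fun χ => D.Y (c.Z χ)) '' V) with hu
  have huo : IsOpen u := by
    refine IsOpen.preimage hlc ?_
    rw [isOpen_iff_mem_nhds]
    rintro _ ⟨χ, hχ, rfl⟩
    show _ ∈ 𝓝 (D.Y (c.Z χ))
    rw [← map_nhds_chart c (hVd χ hχ)]
    exact image_mem_map (hVo.mem_nhds hχ)
  have hNline : ∀ χ t, D.Y (c.Z χ) = line t → N χ = (t * ‖nSlope c‖ ^ 2 : ℝ) := by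
    intro χ t h3
    rw [hN]
    simp only [h3, hline, add_sub_cancel_left]
    rw [mul_assoc, mul_conj, normSq_eq_norm_sq]
    push_cast; ring
  have hsub : Set.Ioo 0 (η / 2) ⊆ u := by
    refine isPreconnected_Ioo.subset_of_closure_inter_subset huo ?_ ?_
    · set b := η / 8 with hb
      have hb0 : 0 < b := by positivity
      have hpt : ∀ x ∈ Set.Icc (-b) b, |(⟨x, b⟩ : ℂ).re| ≤ (⟨x, b⟩ : ℂ).im ∧
          (⟨x, b⟩ : ℂ).im ≤ η := fun x hx => ⟨abs_le.2 hx, by simp only; linarith⟩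
      have hcont : ContinuousOn (fun x : ℝ => (N ⟨x, b⟩).im) (Set.Icc (-b) b) := by
        intro x hx
        have h3 := hNc ⟨x, b⟩ (hpt x hx).1 (hpt x hx).2
        have h4 : ContinuousAt (fun x : ℝ => (⟨x, b⟩ : ℂ)) x := by
          simp only [mk_eq_add_mul_I]; fun_prop
        have h5 : ContinuousAt (fun x : ℝ => D.Y (c.Z ⟨x, b⟩)) x :=
          ContinuousAt.comp (f := fun x : ℝ => (⟨x, b⟩ : ℂ)) h3 h4
        exact (continuous_im.continuousAt.comp
          ((h5.sub continuousAt_const).mul continuousAt_const)).continuousWithinAt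
      have s1 := him ⟨b, b⟩ hb0 (abs_of_pos hb0) (by simp only; linarith)
      have s2 := him ⟨-b, b⟩ hb0 (by simp only; rw [abs_neg, abs_of_pos hb0])
        (by simp only; linarith)
      simp only at s1 s2
      have hx' := hx
      obtain ⟨x, hx, hx0⟩ : ∃ x ∈ Set.Icc (-b) b, (N ⟨x, b⟩).im = 0 := by
        have hle : -b ≤ b := by linarith
        rcases (transverse_ne (c := c) hx).lt_or_gt with hneg | hpos
        · have p1 : (N ⟨b, b⟩).im < 0 := by
            have : transverse c * b < 0 := mul_neg_of_neg_of_pos hneg hb0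
            exact neg_of_mul_pos_left s1 this.le
          have p2 : 0 < (N ⟨-b, b⟩).im := by
            have : 0 < transverse c * -b := by nlinarith
            exact (pos_iff_pos_of_mul_pos s2).2 this
          exact intermediate_value_Icc' hle hcont ⟨p1.le, p2.le⟩
        · have p1 : 0 < (N ⟨b, b⟩).im :=
            (pos_iff_pos_of_mul_pos s1).2 (mul_pos hpos hb0)
          have p2 : (N ⟨-b, b⟩).im < 0 := by
            have : transverse c * -b < 0 := by nlinarith
            exact neg_of_mul_pos_left s2 this.le
          exact intermediate_value_Icc hle hcont ⟨p2.le, p1.le⟩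
      have hr := hre ⟨x, b⟩ hb0 (hpt x hx).1 (hpt x hx).2
      simp only at hr
      set t := (N ⟨x, b⟩).re / ‖nSlope c‖ ^ 2 with ht
      have hn2 : 0 < ‖nSlope c‖ ^ 2 := by positivity
      have htN : (N ⟨x, b⟩).re = t * ‖nSlope c‖ ^ 2 := by rw [ht]; field_simp
      have hxne : |x| < b := by
        rcases (abs_le.2 hx).lt_or_eq with h | h
        · exact h
        · have := him ⟨x, b⟩ hb0 h (by simp only; linarith)
          rw [hx0, zero_mul] at this
          exact absurd this (lt_irrefl _)
      rw [htN, abs_le] at hr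
      have ht1 : b / 2 ≤ t := by
        refine le_of_mul_le_mul_right ?_ hn2
        linarith [hr.1]
      have ht2 : t ≤ 3 / 2 * b := by
        refine le_of_mul_le_mul_right ?_ hn2
        linarith [hr.2]
      refine ⟨t, ⟨by linarith, by linarith⟩, ⟨x, b⟩, ⟨hxne, by simp only; linarith⟩, ?_⟩
      have hNe : N ⟨x, b⟩ = (t * ‖nSlope c‖ ^ 2 : ℝ) := Complex.ext (by rw [htN]; rfl)
        (by rw [hx0]; rfl)
      have hcn : (starRingEnd ℂ) (nSlope c) ≠ 0 := (_root_.map_ne_zero _).2 (nSlope_ne hx')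
      have h6 : D.Y (c.Z ⟨x, b⟩) - D.Y x₀ = t * nSlope c := by
        refine mul_right_cancel₀ hcn ?_
        have : N ⟨x, b⟩ = (D.Y (c.Z ⟨x, b⟩) - D.Y x₀) * (starRingEnd ℂ) (nSlope c) := rfl
        rw [← this, hNe, mul_assoc, mul_conj, normSq_eq_norm_sq]
        push_cast; rfl
      show D.Y (c.Z ⟨x, b⟩) = D.Y x₀ + t * nSlope c
      rw [← h6]; ring
    · rintro t ⟨ht, ht0, ht1⟩
      have htc : line t ∈ closure ((fun χ => D.Y (c.Z χ)) '' V) := by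
        have := hlc.closure_preimage_subset _ ht
        exact this
      obtain ⟨U, hU1, hU2⟩ := exists_ultrafilter_of_mem_closure_image htc
      have hVc : IsCompact {χ : ℂ | |χ.re| ≤ χ.im ∧ χ.im ≤ η} := by
        refine (isCompact_closedBall (0 : ℂ) (2 * η)).of_isClosed_subset
          ((isClosed_le habs continuous_im).inter
            (isClosed_le continuous_im continuous_const)) ?_
        rintro χ ⟨h3, h4⟩
        rw [mem_closedBall_zero_iff]
        linarith [hnorm χ h3]
      obtain ⟨χ, ⟨hχ1, hχ2⟩, hχU⟩ := isCompact_iff_ultrafilter_le_nhds.1 hVc U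
        (le_principal_iff.2 (mem_of_superset hU1 fun χ hχ => ⟨hχ.1.le, hχ.2.le⟩))
      have hYχ : D.Y (c.Z χ) = line t :=
        tendsto_nhds_unique ((hNc χ hχ1 hχ2).tendsto.mono_left hχU) hU2
      have hNχ := hNline χ t hYχ
      have hn2 : 0 < ‖nSlope c‖ ^ 2 := by positivity
      have hi0 : 0 < χ.im := by
        rcases ((abs_nonneg _).trans hχ1).lt_or_eq with h | h
        · exact h
        · exfalso
          have hre0 : χ.re = 0 := abs_eq_zero.1 (le_antisymm (h ▸ hχ1) (abs_nonneg _))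
          have hχ0 : χ = 0 := Complex.ext hre0 h.symm
          rw [hχ0, hN] at hNχ
          simp only [c.Z_zero, sub_self, zero_mul] at hNχ
          have h0 : t * ‖nSlope c‖ ^ 2 = 0 := by exact_mod_cast hNχ.symm
          exact (mul_pos ht0 hn2).ne' h0
      have hrr := hre χ hi0 hχ1 hχ2
      rw [hNχ, ofReal_re, abs_le] at hrr
      have htop : χ.im < η := by
        have : ‖nSlope c‖ ^ 2 * χ.im ≤ ‖nSlope c‖ ^ 2 * (2 * t) := by linarith [hrr.1]
        have := le_of_mul_le_mul_left this hn2
        linarith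
      have hside : |χ.re| < χ.im := by
        rcases hχ1.lt_or_eq with h | h
        · exact h
        · have := him χ hi0 h hχ2
          rw [hNχ, ofReal_im, zero_mul] at this
          exact absurd this (lt_irrefl _)
      exact ⟨χ, ⟨hside, htop⟩, hYχ⟩
  filter_upwards [Ioo_mem_nhdsGT (half_pos hη)] with t ht
  obtain ⟨χ, hχ, hχt⟩ := hsub ht
  exact ⟨χ, hVd χ hχ, (hball χ (hinδ χ hχ.1.le hχ.2.le)).2.2.2, hχt⟩

end CuspData

/-! ### The surface near the value at a gap -/

namespace CuspData

open SlitCurve Potential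

variable {D : CuspData}

theorem eventually_pair_eq (p q : Potential D.S cutPlane) {x₀ : ℝ} (hx : x₀ ∈ D.S.gaps) :
    ∀ᶠ x : ℝ in 𝓝 x₀, x ∈ D.S.gaps → pair p q x = pair p q x₀ := by
  filter_upwards [p.eventually_eq_of_nonneg (gaps_mem_cutPlane hx) hx.2,
    q.eventually_eq_of_nonneg (gaps_mem_cutPlane hx) hx.2] with x h1 h2 h3
  rw [pair, pair, h1 h3.2, h2 h3.2]

theorem continuousAt_pair (p q : Potential D.S cutPlane) {z : ℂ} (hz : z ∈ cutPlane) :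
    ContinuousAt (pair p q) z :=
  tendsto_mk (p.cont.continuousAt (isOpen_cutPlane.mem_nhds hz))
    (q.cont.continuousAt (isOpen_cutPlane.mem_nhds hz))

theorem isCompact_separated {P : ℝ → Prop}
    (hP : ∀ x ∈ D.S.gaps, ∀ᶠ x' in 𝓝 x, x' ∈ D.S.gaps → (P x' ↔ P x)) :
    IsCompact {x | x ∈ D.S.gaps ∧ P x} := by
  have hc : IsClosed {x | x ∈ D.S.gaps ∧ P x} := by
    rw [← isOpen_compl_iff, isOpen_iff_mem_nhds]
    intro x hx
    by_cases hg : x ∈ D.S.gaps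
    · filter_upwards [hP x hg] with x' h1 h2
      exact hx ⟨hg, (h1 h2.1).1 h2.2⟩
    · filter_upwards [D.S.isCompact_gaps.isClosed.isOpen_compl.mem_nhds hg] with x' h1 h2
      exact h1 h2.1
  exact D.S.isCompact_gaps.of_isClosed_subset hc fun x hx => hx.1

/-- The points of the gaps with the value `c` of `Y` and the value `θ` of a second pair. -/
def levelSet (D : CuspData) (tA tB : Potential D.S cutPlane) (c θ : ℂ) : Set ℝ :=
  {x | x ∈ D.S.gaps ∧ (D.Y x = c ∧ pair tA tB x = θ)}

variable {tA tB : Potential D.S cutPlane} {c θ : ℂ}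

theorem eventually_level_iff {x : ℝ} (hx : x ∈ D.S.gaps) :
    ∀ᶠ x' : ℝ in 𝓝 x, x' ∈ D.S.gaps →
      ((D.Y x' = c ∧ pair tA tB x' = θ) ↔ (D.Y x = c ∧ pair tA tB x = θ)) := by
  filter_upwards [eventually_pair_eq D.pA D.pB hx, eventually_pair_eq tA tB hx] with x' h1 h2 h3
  rw [Y_eq_pair, h1 h3, h2 h3]

/-- A neighbourhood of a level set is mapped onto a punctured neighbourhood of its value. -/
theorem image_mem_nhdsNE_level (hne : (D.levelSet tA tB c θ).Nonempty) {O : Set ℂ} (hO : IsOpen O)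
    (hGO : ∀ x ∈ D.levelSet tA tB c θ, (x : ℂ) ∈ O) : D.Y '' (D.S.dom ∩ O) ∈ 𝓝[≠] c := by
  have hK : IsCompact {x | x ∈ D.S.gaps ∧ ¬ (D.Y x = c ∧ pair tA tB x = θ)} :=
    isCompact_separated fun x hx => by
      filter_upwards [eventually_level_iff hx] with x' h1 h2
      exact not_congr (h1 h2)
  have hO' := hO.inter (hK.image continuous_ofReal).isClosed.isOpen_compl
  refine mem_of_superset (D.image_mem_nhdsNE
    (isCompact_separated fun x hx => eventually_level_iff hx) (fun x hx => hx.1) hne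
    (fun x hx => hx.2.1) hO' (fun x hx => ⟨hGO x hx, ?_⟩) fun x hx hxO => ⟨hx, ?_⟩)
    (Set.image_mono (Set.inter_subset_inter_right _ Set.inter_subset_left))
  · rintro ⟨y, hy, hyx⟩
    rw [ofReal_inj] at hyx
    exact hy.2 (hyx ▸ hx.2)
  · by_contra h
    exact hxO.2 ⟨x, ⟨hx, h⟩, rfl⟩

theorem Y_gap_not_mem {x : ℝ} (hx : x ∈ D.S.gaps) : D.Y x ∉ D.Y '' D.S.dom := by
  rintro ⟨z, hz, hzx⟩
  have hzg : z ∉ (fun x : ℝ => (x : ℂ)) '' D.S.gaps := by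
    rintro ⟨y, hy, rfl⟩
    exact not_mem_dom_of_gaps hy hz
  obtain ⟨U, V, hU, hV, hgU, hzV, hUV⟩ := SeparatedNhds.of_isCompact_isCompact
    (D.S.isCompact_gaps.image continuous_ofReal) isCompact_singleton
    (Set.disjoint_singleton_right.2 hzg)
  have h1 := D.image_mem_nhdsNE_level (tA := D.pA) (tB := D.pB) (c := D.Y x) (θ := D.Y x)
    ⟨x, hx, rfl, rfl⟩ hU fun y hy => hgU ⟨y, hy.1, rfl⟩
  have h2 : D.Y '' (D.S.dom ∩ V) ∈ 𝓝 (D.Y x) := by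
    rw [← hzx, ← D.map_nhds_Y hz]
    exact image_mem_map ((D.S.isOpen_dom.inter hV).mem_nhds ⟨hz, hzV rfl⟩)
  obtain ⟨_, ⟨a, ha, rfl⟩, b, hb, hab⟩ :=
    (NormedField.nhdsNE_neBot (D.Y x)).nonempty_of_mem (inter_mem h1 (mem_nhdsWithin_of_mem_nhds h2))
  have := D.injOn_Y hb.1 ha.1 hab
  exact Set.disjoint_left.1 hUV ha.2 (this ▸ hb.2)

theorem eventually_preimage_mem (hne : (D.levelSet tA tB c θ).Nonempty) {O : Set ℂ} (hO : IsOpen O)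
    (hGO : ∀ x ∈ D.levelSet tA tB c θ, (x : ℂ) ∈ O) :
    ∀ᶠ w in 𝓝 c, ∀ z ∈ D.S.dom, D.Y z = w → z ∈ O := by
  have h := image_mem_nhdsNE_level hne hO hGO
  rw [mem_nhdsWithin_iff_eventually] at h
  filter_upwards [h] with w hw z hz hzw
  have hne' : w ≠ c := by
    rintro rfl
    obtain ⟨x, hx⟩ := hne
    exact Y_gap_not_mem hx.1 ⟨z, hz, hzw.trans hx.2.1.symm⟩
  obtain ⟨z', hz', hzw'⟩ := hw hne'
  exact D.injOn_Y hz hz'.1 (hzw.trans hzw'.symm) ▸ hz'.2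

/-- The secants of the surface through the point of a gap are nearly light-like. -/
theorem eventually_lightlike (h : IsIsometric tA tB) (hne : (D.levelSet tA tB c θ).Nonempty) {η : ℝ}
    (hη : 0 < η) : ∀ᶠ w in 𝓝 c, ∀ z ∈ D.S.dom, D.Y z = w →
      |‖pair tA tB z - θ‖ - ‖w - c‖| ≤ η * ‖w - c‖ := by
  set P : Set ℂ := {z | z ∈ D.S.dom → |‖pair tA tB z - θ‖ - ‖D.Y z - c‖| ≤ η * ‖D.Y z - c‖} with hP
  have key := eventually_preimage_mem hne (O := interior P) isOpen_interior fun x hx => by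
    rw [mem_interior_iff_mem_nhds]
    have := lightlike_near_gap h hx.1 hη
    rw [hx.2.1, hx.2.2] at this
    exact this
  filter_upwards [key] with w hw z hz hzw
  have := interior_subset (hw z hz hzw) hz
  rwa [hzw] at this

end CuspData

end AztecGas

end

noncomputable section

namespace AztecGas

open Polynomial SlitCurve

/-! ### The differentials of the Aztec diamond -/

theorem Potential.slope_eq {S : SlitCurve} {D : Set ℂ} (p : Potential S D) {x₀ r₀ : ℝ}
    (c : Chart S x₀ r₀) (hx : (x₀ : ℂ) ∈ D) :
    (p.slope c : ℂ) = c.j 0 * (p.a x₀ * r₀ + aeval (x₀ : ℂ) p.q / (x₀ - 1)) := by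
  obtain ⟨ε, K, hK⟩ := p.exists_localPrimitive c hx
  rw [← hK.localForm_zero, Potential.localForm, c.Z_zero, c.ρ_zero]

/-- `r / 2 - z d`, the entry `μ - p₂₂` of the adjugate of `μ - (z - 1)^ℓ Φ`. -/
def diagEntry (L : List (ℝ × ℝ)) (z r : ℂ) : ℂ := r / 2 - z * aeval z (diagPoly L)

/-- The coefficients of `f Q g`. -/
def numA (L : List (ℝ × ℝ)) (z r : ℂ) : ℂ := adjEntry L z r - diagEntry L z r / z

/-- The second numerator of the differential of `𝒵`. -/
def numB (L : List (ℝ × ℝ)) (s : ℝ) (z : ℂ) : ℂ :=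
  s * aeval z (polySymbol L 0 1) + aeval z (lowPoly L) / s

/-- The coefficients of `f Q ḡ`. -/
def numA' (L : List (ℝ × ℝ)) (z r : ℂ) : ℂ := adjEntry L z r + diagEntry L z r / z

/-- The second numerator of the differential of `ϑ`. -/
def numB' (L : List (ℝ × ℝ)) (s : ℝ) (z : ℂ) : ℂ :=
  s * aeval z (polySymbol L 0 1) - aeval z (lowPoly L) / s

/-- The polynomials of the odd parts. -/
def polyA (L : List (ℝ × ℝ)) : ℝ[X] := diagPoly L * (X + 1)

/-- A polynomial of one of the odd parts. -/
def polyB (L : List (ℝ × ℝ)) (s : ℝ) : ℝ[X] := C s * polySymbol L 0 1 + C s⁻¹ * lowPoly L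

/-- A polynomial of one of the odd parts. -/
def polyA' (L : List (ℝ × ℝ)) : ℝ[X] := diagPoly L * (X - 1)

/-- A polynomial of one of the odd parts. -/
def polyB' (L : List (ℝ × ℝ)) (s : ℝ) : ℝ[X] := C s * polySymbol L 0 1 - C s⁻¹ * lowPoly L

section Forms

variable {L : List (ℝ × ℝ)} {s : ℝ} {z r : ℂ}

theorem numB_eq : numB L s z = aeval z (polyB L s) := by
  simp [numB, polyB]; ring

theorem numB'_eq : numB' L s z = aeval z (polyB' L s) := by
  simp [numB', polyB']; ring

theorem numA_eq (hz : z ≠ 0) (h1 : z - 1 ≠ 0) :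
    numA L z r = (z - 1) * (1 / (2 * z) * r + aeval z (polyA L) / (z - 1)) := by
  simp only [numA, adjEntry, diagEntry, polyA, map_mul, map_add, aeval_X, map_one]
  field_simp
  ring

theorem numA'_eq (hz : z ≠ 0) (h1 : z - 1 ≠ 0) :
    numA' L z r = (z - 1) * ((z + 1) / (2 * z * (z - 1)) * r + aeval z (polyA' L) / (z - 1)) := by
  simp only [numA', adjEntry, diagEntry, polyA', map_mul, map_sub, aeval_X, map_one]
  field_simp
  ring

end Forms

section

variable {n : ℕ} {α β : Fin (n + 1) → ℝ}

theorem natDegree_polyA : (polyA (weightList α β)).natDegree ≤ n ∧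
    (polyA' (weightList α β)).natDegree ≤ n := by
  obtain ⟨h1, h2, -⟩ := natDegree_symbolPolys (weightList α β) (length_weightList α β)
  rcases Nat.eq_zero_or_pos n with h0 | h0
  · rw [polyA, polyA', h2 h0]; simp
  · have e1 : ((X : ℝ[X]) + 1).natDegree ≤ 1 := by compute_degree
    have e2 : ((X : ℝ[X]) - 1).natDegree ≤ 1 := by compute_degree
    exact ⟨natDegree_mul_le.trans (by omega), natDegree_mul_le.trans (by omega)⟩

theorem natDegree_polyB (s : ℝ) : (polyB (weightList α β) s).natDegree ≤ n ∧
    (polyB' (weightList α β) s).natDegree ≤ n := by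
  obtain ⟨-, -, h3, h4⟩ := natDegree_symbolPolys (weightList α β) (length_weightList α β)
  have h5 := (natDegree_C_mul_le s (polySymbol (weightList α β) 0 1)).trans h4
  have h6 := (natDegree_C_mul_le s⁻¹ (lowPoly (weightList α β))).trans h3
  exact ⟨natDegree_add_le_of_degree_le h5 h6, natDegree_sub_le_of_le h5 h6 |>.trans (by simp)⟩

theorem diagEntry_mul (hβ : ∀ i, 0 < β i) (hprod : ∏ i, α i = ∏ i, β i) {z r : ℂ}
    (hr : r ^ 2 = aeval z (discPoly (weightList α β))) :
    diagEntry (weightList α β) z r * adjEntry (weightList α β) z r =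
      z * aeval z (lowPoly (weightList α β)) * aeval z (polySymbol (weightList α β) 0 1) :=
  entries_rel hβ hprod hr

theorem im_numA_mul_conj_neg (hα : ∀ i, 0 < α i) (hβ : ∀ i, 0 < β i)
    (hprod : ∏ i, α i = ∏ i, β i) {s : ℝ} (hs : 0 < s) {z : ℂ} (hz0 : z ≠ 0)
    (hz : z ∈ slitDomain (discPoly (weightList α β))) :
    (numA (weightList α β) z (sheet (weightList α β) z) *
      (starRingEnd ℂ) (numB (weightList α β) s z)).im < 0 := by
  have h1 := sheet_pos hα hβ hprod hz
  have h2 := (signForm_dichotomy hα hβ hprod hz (sheet_sq (weightList α β) z)).2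
  have h3 := diagEntry_mul hβ hprod (sheet_sq (weightList α β) z)
  rw [signForm] at h1
  rw [signForm] at h2
  have h4 := (pos_iff_pos_of_mul_pos h2).1 h1
  rw [numA, numB]
  set a := adjEntry (weightList α β) z (sheet (weightList α β) z)
  set b := diagEntry (weightList α β) z (sheet (weightList α β) z)
  set p := aeval z (polySymbol (weightList α β) 0 1)
  set c := aeval z (lowPoly (weightList α β))
  have ha : a ≠ 0 := by
    rintro h
    rw [h] at h1
    simp at h1
  have hN : 0 < normSq a := normSq_pos.2 ha
  have hb : b / z = c * p * (starRingEnd ℂ) a / normSq a := by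
    have hN' : (normSq a : ℂ) ≠ 0 := by exact_mod_cast hN.ne'
    rw [div_eq_div_iff hz0 hN', ← mul_conj]
    linear_combination (starRingEnd ℂ) a * h3
  rw [hb]
  have e : ((a - c * p * (starRingEnd ℂ) a / normSq a) * (starRingEnd ℂ) (s * p + c / s)).im =
      -(s * (p * (starRingEnd ℂ) a).im) - (c * (starRingEnd ℂ) a).im / s -
      s * normSq p * (c * (starRingEnd ℂ) a).im / normSq a -
      normSq c * (p * (starRingEnd ℂ) a).im / normSq a / s := by
    have e1 : (a - c * p * (starRingEnd ℂ) a / normSq a) * (starRingEnd ℂ) (s * p + c / s) =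
      (s : ℝ) * (starRingEnd ℂ) (p * (starRingEnd ℂ) a) +
      ((1 / s : ℝ) : ℂ) * (starRingEnd ℂ) (c * (starRingEnd ℂ) a) -
      ((s * normSq p / normSq a : ℝ) : ℂ) * (c * (starRingEnd ℂ) a) -
      ((normSq c / normSq a / s : ℝ) : ℂ) * (p * (starRingEnd ℂ) a) := by
      push_cast
      rw [← mul_conj p, ← mul_conj c]
      simp only [map_add, map_mul, map_div₀, conj_ofReal, conj_conj]
      ring
    rw [e1]
    simp only [sub_im, add_im, im_ofReal_mul, conj_im]
    ring
  rw [e]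
  have t1 : 0 < s * (p * (starRingEnd ℂ) a).im := mul_pos hs h1
  have t2 : 0 < (c * (starRingEnd ℂ) a).im / s := div_pos h4 hs
  have t3 : 0 ≤ s * normSq p * (c * (starRingEnd ℂ) a).im / normSq a := by
    have := normSq_nonneg p
    positivity
  have t4 : 0 ≤ normSq c * (p * (starRingEnd ℂ) a).im / normSq a / s := by
    have := normSq_nonneg c
    positivity
  linarith

theorem not_num_eq_zero (hβ : ∀ i, 0 < β i) (hprod : ∏ i, α i = ∏ i, β i)
    (hsimple : ∀ x : ℝ, (discPoly (weightList α β)).eval x = 0 →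
      (derivative (discPoly (weightList α β))).eval x ≠ 0) {s : ℝ} (hs : 0 < s) {x r : ℝ}
    (hx : x < 0) (hr : r ^ 2 = (discPoly (weightList α β)).eval x) :
    ¬ (r / (2 * x) + (polyA (weightList α β)).eval x / (x - 1) = 0 ∧
      (polyB (weightList α β) s).eval x = 0) := by
  rintro ⟨h1, h2⟩
  have hf := discPoly_factor hβ hprod
  rw [polyA, eval_mul, eval_add, eval_X, eval_one] at h1
  rw [polyB, eval_add, eval_mul, eval_mul, eval_C, eval_C] at h2
  have hd := congrArg (fun q : ℝ[X] => (derivative q).eval x) hf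
  simp only [derivative_mul, derivative_add, derivative_pow, derivative_X, eval_mul, eval_add,
    eval_pow, eval_X, eval_ofNat, derivative_ofNat, eval_zero, Nat.cast_ofNat, map_ofNat,
    mul_one, eval_one] at hd
  have hr2 := hr
  rw [hf] at hr
  simp only [eval_mul, eval_add, eval_pow, eval_X, eval_ofNat] at hr
  set d := (diagPoly (weightList α β)).eval x
  set p := (polySymbol (weightList α β) 0 1).eval x
  set c := (lowPoly (weightList α β)).eval x
  have hx1 : x - 1 ≠ 0 := by linarith
  have hc : c = -s ^ 2 * p := by
    field_simp at h2
    linear_combination h2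
  have ha : r / 2 - x * d = x * (r / 2 + x * d) := by
    have hx0 := hx.ne
    field_simp at h1
    linear_combination -h1 / 2
  have hsum : (r / 2 + x * d) ^ 2 + s ^ 2 * p ^ 2 = 0 := by
    have h5 : x * ((r / 2 + x * d) ^ 2 + s ^ 2 * p ^ 2) = 0 := by
      have : (r / 2 - x * d) * (r / 2 + x * d) = x * c * p := by linear_combination hr / 4
      rw [ha, hc] at this
      linear_combination this
    exact (mul_eq_zero.1 h5).resolve_left hx.ne
  have hp : s ^ 2 * p ^ 2 = 0 := by
    have := sq_nonneg (r / 2 + x * d)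
    have : 0 ≤ s ^ 2 * p ^ 2 := by positivity
    linarith
  have hp0 : p = 0 := by
    have := (mul_eq_zero.1 hp).resolve_left (by positivity)
    exact pow_eq_zero_iff two_ne_zero |>.1 this
  have ha0 : r / 2 + x * d = 0 := by
    rw [hp, add_zero] at hsum
    exact pow_eq_zero_iff two_ne_zero |>.1 hsum
  rw [ha0, mul_zero] at ha
  have hr0 : r = 0 := by linarith
  have hd0 : d = 0 := by
    have : x * d = 0 := by linarith
    exact (mul_eq_zero.1 this).resolve_left hx.ne
  have hc0 : c = 0 := by rw [hc, hp0, mul_zero]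
  refine hsimple x (by rw [← hr2, hr0]; ring) ?_
  rw [hd, hd0, hc0, hp0]
  ring

theorem sPar_pos (hα : ∀ i, 0 < α i) (hβ : ∀ i, 0 < β i) : 0 < sPar α β :=
  Real.sqrt_pos.2 (mul_pos (hα _) (hβ _))

/-- The cusp data of the Aztec diamond. -/
def aztecCusp (hα : ∀ i, 0 < α i) (hβ : ∀ i, 0 < β i) (hprod : ∏ i, α i = ∏ i, β i)
    (hgenus : spectralGenus α β = n) : CuspData where
  S := spectralSlitCurve hα hβ hprod hgenus
  qA := polyA (weightList α β)
  qB := polyB (weightList α β) (sPar α β)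
  degA := natDegree_polyA.1
  degB := (natDegree_polyB _).1
  jac := fun z hz => by
    have hz0 : z ≠ 0 := SlitCurve.ne_zero_of_mem hz
    have hz1 : z - 1 ≠ 0 := sub_ne_zero.2 (SlitCurve.ne_one_of_mem hz)
    have hr : sheet (weightList α β) z ≠ 0 :=
      SlitCurve.r_ne_zero (S := spectralSlitCurve hα hβ hprod hgenus) hz
    have h := im_numA_mul_conj_neg hα hβ hprod (sPar_pos hα hβ) hz0 hz
    set r := sheet (weightList α β) z with hrdef
    have hN : 0 < normSq ((z - 1) * r) := normSq_pos.2 (mul_ne_zero hz1 hr)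
    have hN' : (normSq ((z - 1) * r) : ℂ) ≠ 0 := by exact_mod_cast hN.ne'
    have hc : (starRingEnd ℂ) ((z - 1) * r) ≠ 0 :=
      (_root_.map_ne_zero _).2 (mul_ne_zero hz1 hr)
    have e1 : 1 / (2 * z) + (spectralSlitCurve hα hβ hprod hgenus).form
        (polyA (weightList α β)) z = numA (weightList α β) z r / ((z - 1) * r) := by
      rw [numA_eq hz0 hz1]
      simp only [SlitCurve.form, spectralSlitCurve]
      rw [← hrdef]
      field_simp
    have e2 : (spectralSlitCurve hα hβ hprod hgenus).form
        (polyB (weightList α β) (sPar α β)) z =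
        numB (weightList α β) (sPar α β) z / ((z - 1) * r) := by
      rw [numB_eq]; rfl
    rw [e1, e2, map_div₀, div_mul_div_comm, mul_conj, div_ofReal_im]
    exact div_neg_of_neg_of_pos h hN
  bdry := fun x r hx hr => not_num_eq_zero hβ hprod
    (spectralSlitCurve hα hβ hprod hgenus).simple (sPar_pos hα hβ) hx hr
  qB_one := by
    obtain ⟨-, -, -, -, h5⟩ :=
      eval_polySymbol_pos _ (weightList_pos hα hβ) (x := 1) one_pos
    obtain ⟨h6, h7⟩ := h5 (weightList_ne_nil α β)
    have h8 := congrArg (eval 1) (lowPoly_mul_X (weightList α β))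
    rw [eval_mul, eval_X, one_mul] at h8
    have := sPar_pos hα hβ
    rw [polyB, eval_add, eval_mul, eval_mul, eval_C, eval_C, h8]
    positivity

/-! #### The second pair of potentials -/

open SlitCurve in
/-- Adding the imaginary part of `log (1 - z) - log (-z) / 2` to a potential. -/
def argPotential' {S : SlitCurve} (p : Potential S {1}ᶜ) (ha : ∀ z, p.a z = 0) :
    Potential S cutPlane where
  y := fun z => (1 - z).arg - ((-z).arg + Real.pi) / 2 + p.y z
  a := fun z => (z + 1) / (2 * z * (z - 1))
  q := p.q
  isOpen_D := isOpen_cutPlane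
  ne_one := (argPotential p ha).ne_one
  a_diff := fun z hz => by
    have hz0 : z ≠ 0 := fun h => by rw [h, mem_cutPlane] at hz; norm_num at hz
    have hz1 : z ≠ 1 := (argPotential p ha).ne_one z hz
    have : DifferentiableAt ℂ (fun z : ℂ => (z + 1) / (2 * z * (z - 1))) z := by
      refine (differentiableAt_id.add_const _).div ((differentiableAt_id.const_mul _).mul
        (differentiableAt_id.sub_const _)) ?_
      simp [hz0, sub_ne_zero.2 hz1]
    exact this.differentiableWithinAt
  a_conj := fun z => by simp [map_ofNat]
  cont := by
    have h1 : ∀ z ∈ cutPlane, 1 - z ∈ slitPlane := fun z hz => by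
      rw [mem_cutPlane] at hz
      rcases hz with h | h
      · exact Or.inr (by simpa using h)
      · exact Or.inl (by simp; linarith)
    refine ContinuousOn.add (ContinuousOn.sub (fun z hz => ?_) (ContinuousOn.div_const
      (ContinuousOn.add (fun z hz => ?_) continuousOn_const) 2))
      (p.cont.mono fun z hz => (argPotential p ha).ne_one z hz)
    · exact (ContinuousAt.comp (g := arg) (f := fun z => 1 - z) (continuousAt_arg (h1 z hz))
        (by fun_prop)).continuousWithinAt
    · exact (ContinuousAt.comp (continuousAt_arg hz)
        continuous_neg.continuousAt).continuousWithinAt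
  deriv := fun z hz => by
    have hc := dom_subset_cutPlane hz
    have hc1 : 1 - z ∈ slitPlane := by
      rw [mem_cutPlane] at hc
      rcases hc with h | h
      · exact Or.inr (by simpa using h)
      · exact Or.inl (by simp; linarith)
    have hz0 := ne_zero_of_mem hz
    have hz1 := sub_ne_zero.2 (ne_one_of_mem hz)
    have hz1' : 1 - z ≠ 0 := fun h => hz1 (by linear_combination -h)
    have h1 : HasDerivAt (fun z : ℂ => log (1 - z) - (log (-z) + Real.pi * I) / 2)
        ((z + 1) / (2 * z * (z - 1))) z := by
      have := (((hasDerivAt_id' z).const_sub 1).clog hc1).fun_sub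
        (((((hasDerivAt_id' z).fun_neg).clog hc).add_const (Real.pi * I : ℂ)).div_const 2)
      refine this.congr_deriv ?_
      field_simp
      ring
    have h2 := (hasFDerivAt_im h1).add (p.deriv z hz)
    have h3 : imForm ((z + 1) / (2 * z * (z - 1))) + imForm (p.a z + S.form p.q z) =
        imForm ((z + 1) / (2 * z * (z - 1)) + S.form p.q z) := by
      ext v; simp only [ha, zero_add, add_apply, imForm_apply, add_mul, add_im]
    rw [h3] at h2
    refine h2.congr_of_eventuallyEq (Eventually.of_forall fun w => ?_)
    have : (log (1 - w) - (log (-w) + Real.pi * I) / 2).im =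
        (1 - w).arg - ((-w).arg + Real.pi) / 2 := by
      have e : log (1 - w) - (log (-w) + Real.pi * I) / 2 =
        log (1 - w) - ((1 / 2 : ℝ) : ℂ) * (log (-w) + Real.pi * I) := by
        push_cast; ring
      rw [e, sub_im, im_ofReal_mul, add_im, log_im, log_im]
      simp; ring
    simp only [Pi.add_apply]
    rw [this]

section Pair

variable (hα : ∀ i, 0 < α i) (hβ : ∀ i, 0 < β i) (hprod : ∏ i, α i = ∏ i, β i)
  (hgenus : spectralGenus α β = n)

theorem exists_thetaA : ∃ p : Potential (spectralSlitCurve hα hβ hprod hgenus) {1}ᶜ,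
    p.q = polyA' (weightList α β) ∧ (∀ z, p.a z = 0) ∧
      (∀ z, p.y ((starRingEnd ℂ) z) = p.y z) ∧ Tendsto p.y (Bornology.cobounded ℂ) (𝓝 0) :=
  exists_potential natDegree_polyA.2

theorem exists_thetaB : ∃ p : Potential (spectralSlitCurve hα hβ hprod hgenus) {1}ᶜ,
    p.q = polyB' (weightList α β) (sPar α β) ∧ (∀ z, p.a z = 0) ∧
      (∀ z, p.y ((starRingEnd ℂ) z) = p.y z) ∧ Tendsto p.y (Bornology.cobounded ℂ) (𝓝 0) :=
  exists_potential (natDegree_polyB _).2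

/-- The first coordinate of the origami map. -/
def thetaA : Potential (aztecCusp hα hβ hprod hgenus).S cutPlane :=
  argPotential' (exists_thetaA hα hβ hprod hgenus).choose
    (exists_thetaA hα hβ hprod hgenus).choose_spec.2.1

/-- The second coordinate of the origami map. -/
def thetaB : Potential (aztecCusp hα hβ hprod hgenus).S cutPlane :=
  (exists_thetaB hα hβ hprod hgenus).choose.restrict isOpen_cutPlane
    (thetaA hα hβ hprod hgenus).ne_one

open CuspData in
theorem nSlope_eq {x₀ r₀ : ℝ} (c : Chart (aztecCusp hα hβ hprod hgenus).S x₀ r₀) (hx : x₀ < 0) :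
    nSlope c * (x₀ - 1) = c.j 0 * (numA (weightList α β) x₀ r₀ +
      I * numB (weightList α β) (sPar α β) x₀) := by
  have hx' : (x₀ : ℂ) ∈ cutPlane := mem_cutPlane.2 (Or.inr (by simpa using hx))
  have hx0 : (x₀ : ℂ) ≠ 0 := by exact_mod_cast hx.ne
  have hx1 : (x₀ : ℂ) - 1 ≠ 0 := by
    have : x₀ - 1 ≠ 0 := by linarith
    exact_mod_cast this
  have e1 := (aztecCusp hα hβ hprod hgenus).pA.slope_eq c hx'
  have e2 := (aztecCusp hα hβ hprod hgenus).pB.slope_eq c hx'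
  have q1 : (aztecCusp hα hβ hprod hgenus).pA.q = polyA (weightList α β) :=
    (aztecCusp hα hβ hprod hgenus).yA_spec.1
  have q2 : (aztecCusp hα hβ hprod hgenus).pB.q = polyB (weightList α β) (sPar α β) :=
    (aztecCusp hα hβ hprod hgenus).yB_spec.1
  have a1 : (aztecCusp hα hβ hprod hgenus).pA.a x₀ = 1 / (2 * x₀) := rfl
  have a2 : (aztecCusp hα hβ hprod hgenus).pB.a x₀ = 0 :=
    (aztecCusp hα hβ hprod hgenus).yB_spec.2.1 _
  rw [q1, a1] at e1
  rw [q2, a2] at e2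
  rw [nSlope, Potential.pairSlope, mk_eq_add_mul_I, e1, e2, numA_eq hx0 hx1, numB_eq]
  field_simp
  ring

theorem pairSlope_theta_eq {x₀ r₀ : ℝ} (c : Chart (aztecCusp hα hβ hprod hgenus).S x₀ r₀)
    (hx : x₀ < 0) :
    Potential.pairSlope c (thetaA hα hβ hprod hgenus) (thetaB hα hβ hprod hgenus) * (x₀ - 1) =
      c.j 0 * (numA' (weightList α β) x₀ r₀ + I * numB' (weightList α β) (sPar α β) x₀) := by
  have hx' : (x₀ : ℂ) ∈ cutPlane := mem_cutPlane.2 (Or.inr (by simpa using hx))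
  have hx0 : (x₀ : ℂ) ≠ 0 := by exact_mod_cast hx.ne
  have hx1 : (x₀ : ℂ) - 1 ≠ 0 := by
    have : x₀ - 1 ≠ 0 := by linarith
    exact_mod_cast this
  have e1 := (thetaA hα hβ hprod hgenus).slope_eq c hx'
  have e2 := (thetaB hα hβ hprod hgenus).slope_eq c hx'
  have q1 : (thetaA hα hβ hprod hgenus).q = polyA' (weightList α β) :=
    (exists_thetaA hα hβ hprod hgenus).choose_spec.1
  have q2 : (thetaB hα hβ hprod hgenus).q = polyB' (weightList α β) (sPar α β) :=
    (exists_thetaB hα hβ hprod hgenus).choose_spec.1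
  have a1 : (thetaA hα hβ hprod hgenus).a x₀ = (x₀ + 1) / (2 * x₀ * (x₀ - 1)) := rfl
  have a2 : (thetaB hα hβ hprod hgenus).a x₀ = 0 :=
    (exists_thetaB hα hβ hprod hgenus).choose_spec.2.1 _
  rw [q1, a1] at e1
  rw [q2, a2] at e2
  rw [Potential.pairSlope, mk_eq_add_mul_I, e1, e2, numA'_eq hx0 hx1, numB'_eq]
  field_simp
  ring

theorem normSq_num_eq (hα : ∀ i, 0 < α i) (hβ : ∀ i, 0 < β i) (hprod : ∏ i, α i = ∏ i, β i)
    {x₀ r₀ : ℝ} (hx : x₀ ≠ 0) (hr : r₀ ^ 2 = (discPoly (weightList α β)).eval x₀) :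
    ‖numA' (weightList α β) x₀ r₀ + I * numB' (weightList α β) (sPar α β) x₀‖ =
      ‖numA (weightList α β) x₀ r₀ + I * numB (weightList α β) (sPar α β) x₀‖ := by
  have hs := (sPar_pos hα hβ).ne'
  have h := diagEntry_mul hβ hprod (z := x₀) (r := r₀)
    (by rw [aeval_ofReal_eq]; exact_mod_cast hr)
  simp only [diagEntry, adjEntry, aeval_ofReal_eq] at h
  simp only [numA, numA', numB, numB', diagEntry, adjEntry, aeval_ofReal_eq]
  set p := (polySymbol (weightList α β) 0 1).eval x₀
  set c := (lowPoly (weightList α β)).eval x₀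
  set d := (diagPoly (weightList α β)).eval x₀
  set s := sPar α β
  have h' : (r₀ / 2 - x₀ * d) * (r₀ / 2 + x₀ * d) = x₀ * c * p := by exact_mod_cast h
  have n1 : ∀ u v : ℝ, ‖(u : ℂ) + I * v‖ ^ 2 = u ^ 2 + v ^ 2 := fun u v => by
    rw [← normSq_eq_norm_sq, mul_comm, normSq_add_mul_I]
  rw [← sq_eq_sq₀ (norm_nonneg _) (norm_nonneg _)]
  have k1 := n1 (r₀ / 2 + x₀ * d + (r₀ / 2 - x₀ * d) / x₀) (s * p - c / s)
  have k2 := n1 (r₀ / 2 + x₀ * d - (r₀ / 2 - x₀ * d) / x₀) (s * p + c / s)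
  push_cast at k1 k2
  rw [k1, k2]
  field_simp
  linear_combination 16 * s ^ 2 * x₀ * h'

theorem isIsometric_theta : CuspData.IsIsometric (D := aztecCusp hα hβ hprod hgenus)
    (thetaA hα hβ hprod hgenus) (thetaB hα hβ hprod hgenus) := by
  intro x₀ r₀ hx c
  have h1 := congrArg norm (nSlope_eq hα hβ hprod hgenus c hx.1)
  have h2 := congrArg norm (pairSlope_theta_eq hα hβ hprod hgenus c hx.1)
  have hr : r₀ ^ 2 = (discPoly (weightList α β)).eval x₀ := by
    have := c.ρ_sq 0 (Metric.mem_ball_self c.ε_pos)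
    rw [c.Z_zero, c.ρ_zero, aeval_ofReal_eq] at this
    exact_mod_cast this
  have hx1 : (x₀ : ℂ) - 1 ≠ 0 := by
    have : x₀ - 1 ≠ 0 := by have := hx.1; linarith
    exact_mod_cast this
  rw [norm_mul, norm_mul] at h1 h2
  rw [normSq_num_eq hα hβ hprod hx.1.ne hr, ← h1] at h2
  exact mul_right_cancel₀ (norm_ne_zero_iff.2 hx1) h2

end Pair

end

/-! ### The spectral curve in terms of the square root of the discriminant -/

section

variable {n : ℕ} {α β : Fin (n + 1) → ℝ}

variable (α β) in
/-- The square root `2 (z - 1)^ℓ w - τ` of the discriminant. -/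
def discRoot (q : ℂ × ℂ) : ℂ :=
  2 * (q.1 - 1) ^ (n + 1) * q.2 -
    aeval q.1 (polySymbol (weightList α β) 0 0 + polySymbol (weightList α β) 1 1)

variable (α β) in
/-- The point with a given value of `z` and of the square root of the discriminant. -/
def liftPt (z r : ℂ) : ℂ × ℂ :=
  (z, (aeval z (polySymbol (weightList α β) 0 0 + polySymbol (weightList α β) 1 1) + r) /
    (2 * (z - 1) ^ (n + 1)))

theorem discRoot_liftPt {z r : ℂ} (hz : z ≠ 1) : discRoot α β (liftPt α β z r) = r := by
  have : z - 1 ≠ 0 := sub_ne_zero.2 hz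
  simp only [discRoot, liftPt]
  field_simp
  ring

theorem liftPt_discRoot {q : ℂ × ℂ} (hz : q.1 ≠ 1) : liftPt α β q.1 (discRoot α β q) = q := by
  have : q.1 - 1 ≠ 0 := sub_ne_zero.2 hz
  refine Prod.ext rfl ?_
  simp only [discRoot, liftPt]
  field_simp
  ring

theorem continuous_discRoot : Continuous (discRoot α β) := by
  have := (aeval_continuous (polySymbol (weightList α β) 0 0 +
    polySymbol (weightList α β) 1 1)).comp (continuous_fst (X := ℂ) (Y := ℂ))
  exact ((continuous_const.mul ((continuous_fst.sub continuous_const).pow _)).mul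
    continuous_snd).sub this

theorem discRoot_conj (q : ℂ × ℂ) :
    discRoot α β (conjPt q) = (starRingEnd ℂ) (discRoot α β q) := by
  simp only [discRoot, conjPt, aeval_conj_eq, map_sub, map_mul, map_pow, map_ofNat, map_one]

theorem eigenMu_discRoot (q : ℂ × ℂ) :
    eigenMu (weightList α β) q.1 (discRoot α β q) = (q.1 - 1) ^ (n + 1) * q.2 := by
  simp only [eigenMu, discRoot]; ring

section

variable (hα : ∀ i, 0 < α i) (hβ : ∀ i, 0 < β i)
include hα hβ

theorem charDet_eq {z : ℂ} (hz : z ≠ 0) (hz1 : z ≠ 1) (w : ℂ) :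
    charDet α β z w = w ^ 2 - ((z - 1) ^ (n + 1))⁻¹ *
      aeval z (polySymbol (weightList α β) 0 0 + polySymbol (weightList α β) 1 1) * w + 1 := by
  have h1 : z - 1 ≠ 0 := sub_ne_zero.2 hz1
  have hd := congrArg (aeval z) (det_polySymbol _ (weightList_pos hα hβ))
  rw [length_weightList, Matrix.det_fin_two] at hd
  simp only [map_sub, map_mul, map_pow, aeval_X, map_one] at hd
  rw [charDet, Phi_eq_polySymbol hα hβ hz, Matrix.det_fin_two]
  simp only [Matrix.sub_apply, Matrix.smul_apply, Matrix.map_apply, Matrix.one_apply, smul_eq_mul,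
    map_add, if_true, Fin.zero_eq_one_iff, Fin.one_eq_zero_iff, OfNat.ofNat_ne_one, if_false]
  field_simp
  linear_combination hd

theorem mem_curve_iff {q : ℂ × ℂ} : q ∈ curve α β ↔
    q.1 ≠ 0 ∧ q.1 ≠ 1 ∧ discRoot α β q ^ 2 = aeval q.1 (discPoly (weightList α β)) := by
  have key : ∀ {q : ℂ × ℂ}, q.1 ≠ 0 → q.1 ≠ 1 → (charDet α β q.1 q.2 = 0 ↔
      discRoot α β q ^ 2 = aeval q.1 (discPoly (weightList α β))) := by
    intro q h0 h1
    have h2 : q.1 - 1 ≠ 0 := sub_ne_zero.2 h1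
    rw [charDet_eq hα hβ h0 h1, discPoly_eq _ (weightList_pos hα hβ), length_weightList]
    have e : discRoot α β q ^ 2 - aeval q.1 ((polySymbol (weightList α β) 0 0 +
        polySymbol (weightList α β) 1 1) ^ 2 - 4 * (X - 1) ^ (2 * (n + 1))) =
        4 * (q.1 - 1) ^ (2 * (n + 1)) * (q.2 ^ 2 - ((q.1 - 1) ^ (n + 1))⁻¹ *
      aeval q.1 (polySymbol (weightList α β) 0 0 + polySymbol (weightList α β) 1 1) * q.2 + 1) := by
      simp only [discRoot, map_sub, map_mul, map_pow, aeval_X, map_one, map_ofNat]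
      field_simp
      ring
    rw [← sub_eq_zero (a := discRoot α β q ^ 2), e, mul_eq_zero, or_iff_right]
    exact mul_ne_zero (by norm_num) (pow_ne_zero _ h2)
  constructor
  · rintro ⟨h0, -, h1, h2⟩
    exact ⟨h0, h1, (key h0 h1).1 h2⟩
  · rintro ⟨h0, h1, h2⟩
    have h3 := (key h0 h1).2 h2
    refine ⟨h0, ?_, h1, h3⟩
    intro hw
    rw [charDet_eq hα hβ h0 h1, hw] at h3
    simp at h3

theorem conjPt_mem_curve {q : ℂ × ℂ} (hq : q ∈ curve α β) : conjPt q ∈ curve α β := by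
  rw [mem_curve_iff hα hβ] at hq ⊢
  obtain ⟨h0, h1, h2⟩ := hq
  refine ⟨(_root_.map_ne_zero _).2 h0, fun h => h1 ?_, ?_⟩
  · have := congrArg (starRingEnd ℂ) h
    simpa [conjPt] using this
  · rw [discRoot_conj, ← map_pow, h2]
    exact (aeval_conj_eq _ _).symm

theorem liftPt_mem_curve {z r : ℂ} (h0 : z ≠ 0) (h1 : z ≠ 1)
    (hr : r ^ 2 = aeval z (discPoly (weightList α β))) : liftPt α β z r ∈ curve α β :=
  (mem_curve_iff hα hβ).2 ⟨h0, h1, by rw [discRoot_liftPt h1]; exact hr⟩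

theorem Qmat_eq (hprod : ∏ i, α i = ∏ i, β i) {q : ℂ × ℂ} (h0 : q.1 ≠ 0) (h1 : q.1 ≠ 1) :
    Qmat α β q =
    (discRoot α β q)⁻¹ • !![diagEntry (weightList α β) q.1 (discRoot α β q),
      aeval q.1 (polySymbol (weightList α β) 0 1); q.1 * aeval q.1 (lowPoly (weightList α β)),
      adjEntry (weightList α β) q.1 (discRoot α β q)] := by
  have h2 : q.1 - 1 ≠ 0 := sub_ne_zero.2 h1
  have e1 : adjEntry (weightList α β) q.1 (discRoot α β q) = (q.1 - 1) ^ (n + 1) * q.2 -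
      aeval q.1 (polySymbol (weightList α β) 0 0) := by
    rw [adjEntry_eq hβ hprod, eigenMu_discRoot]
  have e2 : diagEntry (weightList α β) q.1 (discRoot α β q) = (q.1 - 1) ^ (n + 1) * q.2 -
      aeval q.1 (polySymbol (weightList α β) 1 1) := by
    have e3 : diagEntry (weightList α β) q.1 (discRoot α β q) = discRoot α β q -
      adjEntry (weightList α β) q.1 (discRoot α β q) := by rw [diagEntry, adjEntry]; ring
    rw [e3, e1, discRoot, map_add]
    ring
  have e4 := congrArg (aeval q.1) (lowPoly_mul_X (weightList α β))
  rw [map_mul, aeval_X] at e4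
  have hd : deriv (fun w => charDet α β q.1 w) q.2 =
      ((q.1 - 1) ^ (n + 1))⁻¹ * discRoot α β q := by
    have hf : (fun w => charDet α β q.1 w) = fun w => w ^ 2 - ((q.1 - 1) ^ (n + 1))⁻¹ *
      aeval q.1 (polySymbol (weightList α β) 0 0 + polySymbol (weightList α β) 1 1) * w + 1 :=
      funext fun w => charDet_eq hα hβ h0 h1 w
    rw [hf]
    have := (((hasDerivAt_pow 2 q.2).fun_sub ((hasDerivAt_id' q.2).const_mul
      (((q.1 - 1) ^ (n + 1))⁻¹ * aeval q.1 (polySymbol (weightList α β) 0 0 +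
        polySymbol (weightList α β) 1 1)))).add_const 1).deriv
    rw [this, discRoot]
    field_simp
    push_cast
    ring
  rw [Qmat, hd, Phi_eq_polySymbol hα hβ h0, Matrix.adjugate_fin_two, e1, e2, e4, mul_inv, inv_inv,
    mul_comm, ← smul_smul]
  congr 1
  ext i j
  fin_cases i <;> fin_cases j <;> simp <;> field_simp

/-- The integrand of `𝒵`. -/
theorem integrand_Z (hprod : ∏ i, α i = ∏ i, β i) {q : ℂ × ℂ} (h0 : q.1 ≠ 0) (h1 : q.1 ≠ 1) :
    fVec α β q.1 ⬝ᵥ (Qmat α β q).mulVec (gVec α β q.1) =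
      ((aPar α β : ℂ) + I) ^ (1 / 2 : ℂ) * (I - (aPar α β : ℂ)) *
        ((aPar α β : ℂ) - I) ^ (1 / 2 : ℂ) *
      ((numA (weightList α β) q.1 (discRoot α β q) +
        I * numB (weightList α β) (sPar α β) q.1) / ((q.1 - 1) * discRoot α β q)) := by
  have hs : (sPar α β : ℂ) ≠ 0 := by exact_mod_cast (sPar_pos hα hβ).ne'
  have h2 : q.1 - 1 ≠ 0 := sub_ne_zero.2 h1
  rw [Qmat_eq hα hβ hprod h0 h1, fVec, gVec, Matrix.smul_mulVec, Matrix.mulVec_smul,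
    smul_dotProduct, dotProduct_smul, dotProduct_smul]
  simp only [Matrix.mulVec, dotProduct, Fin.sum_univ_two, Matrix.of_apply, Matrix.cons_val',
    Matrix.cons_val_zero, Matrix.cons_val_one, Matrix.cons_val_fin_one, smul_eq_mul, numA, numB]
  set D := discRoot α β q
  set F := ((aPar α β : ℂ) + I) ^ (1 / 2 : ℂ)
  set G := ((aPar α β : ℂ) - I) ^ (1 / 2 : ℂ)
  set a := adjEntry (weightList α β) q.1 D
  set b := diagEntry (weightList α β) q.1 D
  set p := aeval q.1 (polySymbol (weightList α β) 0 1)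
  set c := aeval q.1 (lowPoly (weightList α β))
  set s := (sPar α β : ℂ)
  have e : I * s * (b * (I / s * (1 / q.1)) + p * 1) + 1 * (q.1 * c * (I / s * (1 / q.1)) + a * 1) =
      a - b / q.1 + I * (s * p + c / s) := by
    field_simp
    linear_combination s * b * I_sq
  rw [e]
  simp only [div_eq_mul_inv, mul_inv]
  ring

/-- The integrand of `ϑ`. -/
theorem integrand_theta (hprod : ∏ i, α i = ∏ i, β i) {q : ℂ × ℂ} (h0 : q.1 ≠ 0)
    (h1 : q.1 ≠ 1) :
    fVec α β q.1 ⬝ᵥ (Qmat α β q).mulVec (gBarVec α β q.1) =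
      ((aPar α β : ℂ) + I) ^ (1 / 2 : ℂ) * (I - (aPar α β : ℂ)) *
        (starRingEnd ℂ) (((aPar α β : ℂ) - I) ^ (1 / 2 : ℂ)) *
      ((numA' (weightList α β) q.1 (discRoot α β q) +
        I * numB' (weightList α β) (sPar α β) q.1) / ((q.1 - 1) * discRoot α β q)) := by
  have hs : (sPar α β : ℂ) ≠ 0 := by exact_mod_cast (sPar_pos hα hβ).ne'
  have h2 : q.1 - 1 ≠ 0 := sub_ne_zero.2 h1
  have hg : gBarVec α β q.1 = (starRingEnd ℂ) (((aPar α β : ℂ) - I) ^ (1 / 2 : ℂ)) •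
      ![-I / (sPar α β : ℂ) * (1 / q.1), 1] := by
    ext j
    fin_cases j <;> simp [gBarVec, gVec]
  rw [Qmat_eq hα hβ hprod h0 h1, fVec, hg, Matrix.smul_mulVec, Matrix.mulVec_smul,
    smul_dotProduct, dotProduct_smul, dotProduct_smul]
  simp only [Matrix.mulVec, dotProduct, Fin.sum_univ_two, Matrix.of_apply, Matrix.cons_val',
    Matrix.cons_val_zero, Matrix.cons_val_one, Matrix.cons_val_fin_one, smul_eq_mul, numA', numB']
  set D := discRoot α β q
  set F := ((aPar α β : ℂ) + I) ^ (1 / 2 : ℂ)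
  set G := (starRingEnd ℂ) (((aPar α β : ℂ) - I) ^ (1 / 2 : ℂ))
  set a := adjEntry (weightList α β) q.1 D
  set b := diagEntry (weightList α β) q.1 D
  set p := aeval q.1 (polySymbol (weightList α β) 0 1)
  set c := aeval q.1 (lowPoly (weightList α β))
  set s := (sPar α β : ℂ)
  have e : I * s * (b * (-I / s * (1 / q.1)) + p * 1) +
      1 * (q.1 * c * (-I / s * (1 / q.1)) + a * 1) =
      a + b / q.1 + I * (s * p - c / s) := by
    field_simp
    linear_combination -s * b * I_sq
  rw [e]
  simp only [div_eq_mul_inv, mul_inv]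
  ring

end

/-! #### The region `R₀` as a sheet over the slit domain -/

section

variable (hα : ∀ i, 0 < α i) (hβ : ∀ i, 0 < β i) (hprod : ∏ i, α i = ∏ i, β i)
include hα hβ hprod

omit hα hβ hprod in
theorem conjPt_eq_iff {q : ℂ × ℂ} : conjPt q = q ↔ q.1.im = 0 ∧ q.2.im = 0 := by
  rw [conjPt, Prod.ext_iff]
  simp only [conj_eq_iff_im]

omit hα hβ hprod in
theorem discRoot_im {q : ℂ × ℂ} (h : q.1.im = 0) (h1 : q.1 ≠ 1) :
    (discRoot α β q).im = 0 ↔ q.2.im = 0 := by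
  have hx : q.1 = (q.1.re : ℂ) := Complex.ext rfl (by simp [h])
  have h2 : q.1.re - 1 ≠ 0 := by
    intro h3
    apply h1
    rw [hx, show q.1.re = 1 by linarith]; simp
  rw [discRoot, aeval_of_im_eq_zero _ h, sub_im, ofReal_im, sub_zero]
  have e : 2 * (q.1 - 1) ^ (n + 1) * q.2 = ((2 * (q.1.re - 1) ^ (n + 1) : ℝ) : ℂ) * q.2 := by
    conv_lhs => rw [hx]
    push_cast; ring
  rw [e, im_ofReal_mul, mul_eq_zero, or_iff_right]
  exact mul_ne_zero two_ne_zero (pow_ne_zero _ h2)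

omit hprod in
theorem fst_mem_slitDomain {q : ℂ × ℂ} (hq : q ∈ nonrealLocus α β) :
    q.1 ∈ slitDomain (discPoly (weightList α β)) := by
  obtain ⟨h1, h2⟩ := hq
  rw [mem_curve_iff hα hβ] at h1
  by_cases him : q.1.im = 0
  · right
    by_contra hR
    push Not at hR
    apply h2
    rw [conjPt_eq_iff]
    refine ⟨him, ?_⟩
    rw [← discRoot_im him h1.2.1]
    have h3 := h1.2.2
    rw [aeval_of_im_eq_zero _ him] at h3
    have h4 : (discRoot α β q) ^ 2 = ((√((discPoly (weightList α β)).eval q.1.re) : ℝ) : ℂ) ^ 2 := by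
      rw [h3, ← ofReal_pow, Real.sq_sqrt hR]
    rcases sq_eq_sq_iff_eq_or_eq_neg.1 h4 with h | h <;> rw [h] <;> simp
  · exact Or.inl him

theorem signForm_ne_zero {q : ℂ × ℂ} (hq : q ∈ nonrealLocus α β) :
    signForm (weightList α β) q.1 (discRoot α β q) ≠ 0 := by
  intro h
  have := (signForm_dichotomy hα hβ hprod (fst_mem_slitDomain hα hβ hq)
    ((mem_curve_iff hα hβ).1 hq.1).2.2).1
  rw [h, zero_mul] at this
  exact lt_irrefl _ this

end

section

variable (hα : ∀ i, 0 < α i) (hβ : ∀ i, 0 < β i) (hprod : ∏ i, α i = ∏ i, β i)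
  (hgenus : spectralGenus α β = n)
include hα hβ hprod hgenus

theorem liftPt_mem_nonrealLocus {z : ℂ} (hz : z ∈ slitDomain (discPoly (weightList α β))) :
    liftPt α β z (sheet (weightList α β) z) ∈ nonrealLocus α β := by
  have hz' : z ∈ (spectralSlitCurve hα hβ hprod hgenus).dom := hz
  have h0 := ne_zero_of_mem hz'
  have h1 := ne_one_of_mem hz'
  refine ⟨liftPt_mem_curve hα hβ h0 h1 (sheet_sq _ _), fun h => ?_⟩
  have h2 := discRoot_conj (α := α) (β := β) (liftPt α β z (sheet (weightList α β) z))
  rw [h, discRoot_liftPt h1] at h2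
  have h3 : (starRingEnd ℂ) z = z := congrArg Prod.fst h
  have h4 := sheet_conj hα hβ hprod hz
  rw [h3, ← h2] at h4
  have h5 : sheet (weightList α β) z = 0 := by
    have : (2 : ℂ) * sheet (weightList α β) z = 0 := by linear_combination h4
    exact (mul_eq_zero.1 this).resolve_left two_ne_zero
  exact r_ne_zero hz' h5

theorem continuousOn_lift : ContinuousOn (fun z => liftPt α β z (sheet (weightList α β) z))
    (slitDomain (discPoly (weightList α β))) := by
  intro z hz
  have hz' : z ∈ (spectralSlitCurve hα hβ hprod hgenus).dom := hz
  have h1 := sub_ne_zero.2 (ne_one_of_mem hz')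
  have h2 := (sheet_differentiableAt hα hβ hprod hz).continuousAt
  refine ContinuousAt.continuousWithinAt (continuousAt_id.prodMk ?_)
  refine (((aeval_continuous _).continuousAt).add h2).div (by fun_prop) ?_
  exact mul_ne_zero two_ne_zero (pow_ne_zero _ h1)

omit hα hβ hprod hgenus in
theorem isPreconnected_dom (S : SlitCurve) : IsPreconnected S.dom := by
  obtain ⟨M, hM, hneg⟩ := S.exists_neg_bound
  set x : ℂ := ((-M - 1 : ℝ) : ℂ) with hx
  have hxd : x ∈ S.dom := Or.inr (by rw [hx, ofReal_re]; exact hneg _ (by linarith))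
  set N : Set ℂ := {z ∈ S.dom | z.im ≤ 0}
  set P : Set ℂ := {z ∈ S.dom | 0 ≤ z.im}
  have hN : IsPreconnected N := by
    refine (convex_lower.isPreconnected).subset_closure (fun z hz => ⟨lower_mem_dom hz, hz.le⟩) ?_
    rintro z ⟨-, hz⟩
    rw [Complex.closure_setOfPred_im_lt]; exact hz
  have hP : IsPreconnected P := by
    refine ((convex_halfSpace_im_gt 0).isPreconnected).subset_closure
      (fun z hz => ⟨Or.inl (ne_of_gt hz), le_of_lt hz⟩) ?_
    rintro z ⟨-, hz⟩
    rw [Complex.closure_setOfPred_lt_im]; exact hz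
  have : S.dom = N ∪ P := by
    ext z
    constructor
    · intro hz
      rcases le_total z.im 0 with h | h
      · exact Or.inl ⟨hz, h⟩
      · exact Or.inr ⟨hz, h⟩
    · rintro (h | h) <;> exact h.1
  rw [this]
  exact hN.union x ⟨hxd, by simp [hx]⟩ ⟨hxd, by simp [hx]⟩ hP

/-- The region `R₀` is the sheet over the slit domain. -/
theorem mem_regionZero_iff {q : ℂ × ℂ} : q ∈ regionZero α β ↔
    q.1 ∈ slitDomain (discPoly (weightList α β)) ∧
      discRoot α β q = sheet (weightList α β) q.1 := by
  constructor
  · rintro ⟨p, hp, hpi, hpn, hq⟩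
    have hp' := (mem_curve_iff hα hβ).1 hp.1
    have hps : 0 < signForm (weightList α β) p.1 (discRoot α β p) := by
      have h1 : discRoot α β p = sheet (weightList α β) p.1 := by
        rw [sheet_lower hα hβ hprod hpi hp'.2.2, eigenMu_discRoot, norm_mul, norm_pow]
        have : 0 < ‖p.1 - 1‖ := norm_pos_iff.2 (sub_ne_zero.2 hp'.2.1)
        exact lt_mul_of_one_lt_right (by positivity) hpn
      rw [h1]
      exact sheet_pos hα hβ hprod (Or.inl hpi.ne)
    have hsub := connectedComponentIn_subset (nonrealLocus α β) p
    have hcont : ContinuousOn (fun q => signForm (weightList α β) q.1 (discRoot α β q))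
        (connectedComponentIn (nonrealLocus α β) p) := by
      have h1 := (aeval_continuous (polySymbol (weightList α β) 0 1)).comp
        (continuous_fst (X := ℂ) (Y := ℂ))
      have h2 := (aeval_continuous (diagPoly (weightList α β))).comp
        (continuous_fst (X := ℂ) (Y := ℂ))
      refine Continuous.continuousOn (continuous_im.comp (h1.mul (continuous_conj.comp ?_)))
      exact (continuous_discRoot.div_const 2).add (continuous_fst.mul h2)
    have hqs : 0 < signForm (weightList α β) q.1 (discRoot α β q) := by
      by_contra hneg
      obtain ⟨y, hy, hy0⟩ := isPreconnected_connectedComponentIn.intermediate_value hq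
        (mem_connectedComponentIn hp) hcont ⟨not_lt.1 hneg, hps.le⟩
      exact signForm_ne_zero hα hβ hprod (hsub hy) hy0
    have hqd := fst_mem_slitDomain hα hβ (hsub hq)
    exact ⟨hqd, (eq_sheet hα hβ hprod hqd ((mem_curve_iff hα hβ).1 (hsub hq).1).2.2 hqs).symm⟩
  · rintro ⟨hq, hr⟩
    set F := fun z => liftPt α β z (sheet (weightList α β) z) with hF
    have him : (-I).im < 0 := by simp
    have hI : -I ∈ slitDomain (discPoly (weightList α β)) := Or.inl him.ne
    have hI1 : -I ≠ 1 := fun h => by simpa using congrArg Complex.re h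
    refine ⟨F (-I), liftPt_mem_nonrealLocus hα hβ hprod hgenus hI, him, ?_, ?_⟩
    · have h1 := (sheet_lower hα hβ hprod him (sheet_sq (weightList α β) (-I))).1 rfl
      have h2 := eigenMu_discRoot (α := α) (β := β) (F (-I))
      rw [hF] at h2
      simp only at h2
      rw [discRoot_liftPt hI1] at h2
      have h3 : (liftPt α β (-I) (sheet (weightList α β) (-I))).1 = -I := rfl
      rw [h3] at h2
      rw [h2, norm_mul, norm_pow] at h1
      have : 0 < ‖-I - 1‖ := norm_pos_iff.2 (sub_ne_zero.2 hI1)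
      exact (lt_mul_iff_one_lt_right (by positivity)).1 h1
    · have h1 : IsPreconnected (F '' slitDomain (discPoly (weightList α β))) :=
        (isPreconnected_dom (spectralSlitCurve hα hβ hprod hgenus)).image _
          (continuousOn_lift hα hβ hprod hgenus)
      have h2 := h1.subset_connectedComponentIn (F := nonrealLocus α β) ⟨-I, hI, rfl⟩ (by
        rintro _ ⟨z, hz, rfl⟩
        exact liftPt_mem_nonrealLocus hα hβ hprod hgenus hz)
      refine h2 ⟨q.1, hq, ?_⟩
      show liftPt α β q.1 (sheet (weightList α β) q.1) = q
      rw [← hr]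
      exact liftPt_discRoot (ne_one_of_mem
        (S := spectralSlitCurve hα hβ hprod hgenus) hq)

end

end

end AztecGas

end

noncomputable section

namespace AztecGas

open Polynomial SlitCurve MeasureTheory

/-! ### The value of a contour integral -/

section

variable {n : ℕ} {α β : Fin (n + 1) → ℝ}

theorem continuous_conjPt : Continuous conjPt :=
  (continuous_conj.comp continuous_fst).prodMk (continuous_conj.comp continuous_snd)

theorem conjPt_conjPt (q : ℂ × ℂ) : conjPt (conjPt q) = q := by simp [conjPt]

theorem IsContour.extend_symm {q : ℂ × ℂ} {γ : Path q (conjPt q)} (h : IsContour α β γ) {t : ℝ}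
    (ht : t ∈ Set.Icc (0 : ℝ) 1) : γ.extend (1 - t) = conjPt (γ.extend t) := by
  have ht' : 1 - t ∈ Set.Icc (0 : ℝ) 1 := ⟨by linarith [ht.2], by linarith [ht.1]⟩
  rw [Path.extend_apply _ ht, Path.extend_apply _ ht', ← h.symmetric]
  rfl

/-- The curve integral along a contour, on its first half. -/
theorem IsContour.curveIntegral_eq {q : ℂ × ℂ} {γ : Path q (conjPt q)} (h : IsContour α β γ)
    {ω : ℂ × ℂ → ℂ} {d : ℝ → ℂ}
    (hd : ContinuousOn d (Set.Icc 0 (1 / 2)))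
    (hγ : ∀ t ∈ Set.Ioo (0 : ℝ) (1 / 2), ∃ D : ℂ × ℂ, D.1 = d t ∧ HasDerivAt γ.extend D t)
    (hω : ContinuousOn (fun t => ω (γ.extend t)) (Set.Icc 0 (1 / 2)))
    (hω' : ContinuousOn (fun t => ω (conjPt (γ.extend t))) (Set.Icc 0 (1 / 2))) :
    curveIntegral (fun p => ω p • ContinuousLinearMap.fst ℂ ℂ ℂ) γ =
      ∫ t in (0 : ℝ)..(1 / 2), (ω (γ.extend t) * d t -
        ω (conjPt (γ.extend t)) * (starRingEnd ℂ) (d t)) := by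
  have hle : (0 : ℝ) ≤ 1 / 2 := by norm_num
  rw [curveIntegral_eq_intervalIntegral_deriv]
  simp only [smul_apply, ContinuousLinearMap.coe_fst', smul_eq_mul]
  set G : ℝ → ℂ := fun t => ω (γ.extend t) * (deriv γ.extend t).1 with hG
  have e1 : Set.EqOn (fun t => ω (γ.extend t) * d t) G (Set.Ioo 0 (1 / 2)) := by
    intro t ht
    obtain ⟨D, hD, hD'⟩ := hγ t ht
    simp only [hG]
    rw [hD'.deriv, hD]
  have e2 : Set.EqOn (fun t => -(ω (conjPt (γ.extend t)) * (starRingEnd ℂ) (d t)))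
      (fun t => G (1 - t)) (Set.Ioo 0 (1 / 2)) := by
    intro t ht
    obtain ⟨D, hD, hD'⟩ := hγ t ht
    have ht1 : t ∈ Set.Icc (0 : ℝ) 1 := ⟨ht.1.le, by linarith [ht.2]⟩
    simp only [hG]
    rw [h.extend_symm ht1]
    have h1 : HasDerivAt (fun s : ℝ => γ.extend (1 - s)) ((-1 : ℝ) • D) (1 - t) := by
      have h2 : HasDerivAt (fun s : ℝ => 1 - s) (-1 : ℝ) (1 - t) :=
        (hasDerivAt_id' _).const_sub 1
      have h3 : HasDerivAt γ.extend D (1 - (1 - t)) := by rwa [sub_sub_cancel]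
      exact h3.scomp (1 - t) h2
    have h4 : HasDerivAt γ.extend (conjPt (-D)) (1 - t) := by
      have h5 := (conjCLE.toContinuousLinearMap.prodMap
        conjCLE.toContinuousLinearMap).hasFDerivAt.comp_hasDerivAt (1 - t) h1
      refine (h5.congr_deriv (Prod.ext (by simp [conjPt]) (by simp [conjPt]))).congr_of_eventuallyEq ?_
      filter_upwards [Ioo_mem_nhds (show 1 / 2 < 1 - t by linarith [ht.2])
        (show 1 - t < 1 by linarith [ht.1])] with s hs
      have h6 := h.extend_symm (t := 1 - s) ⟨by linarith [hs.2], by linarith [hs.1]⟩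
      rw [sub_sub_cancel] at h6
      rw [h6]
      rfl
    have h9 : (_root_.deriv γ.extend (1 - t)).1 = -(starRingEnd ℂ) D.1 := by
      rw [h4.deriv]
      simp [conjPt]
    rw [h9, hD, mul_neg]
  have u1 : ∀ {f g : ℝ → ℂ}, Set.EqOn f g (Set.Ioo 0 (1 / 2)) →
      Set.EqOn f g (Set.uIoo 0 (1 / 2)) := fun h => by rwa [Set.uIoo_of_le hle]
  have i1 : IntervalIntegrable (fun t => ω (γ.extend t) * d t) volume 0 (1 / 2) :=
    ContinuousOn.intervalIntegrable (by rw [Set.uIcc_of_le hle]; exact hω.mul hd)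
  have i2 : IntervalIntegrable (fun t => -(ω (conjPt (γ.extend t)) * (starRingEnd ℂ) (d t))) volume
      0 (1 / 2) := by
    refine ContinuousOn.intervalIntegrable ?_
    rw [Set.uIcc_of_le hle]
    exact (hω'.mul (continuous_conj.comp_continuousOn hd)).neg
  have i3 : IntervalIntegrable G volume 0 (1 / 2) := i1.congr_uIoo (u1 e1)
  have i4 : IntervalIntegrable G volume (1 / 2) 1 := by
    have := (i2.congr_uIoo (u1 e2)).comp_sub_left 1
    simp only [sub_sub_cancel, sub_zero] at this
    convert this.symm using 1
    norm_num
  rw [← intervalIntegral.integral_add_adjacent_intervals i3 i4,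
    ← intervalIntegral.integral_congr_Ioo_of_le hle e1]
  have e3 : ∫ t in (1 / 2 : ℝ)..1, G t = ∫ t in (0 : ℝ)..(1 / 2), G (1 - t) := by
    rw [intervalIntegral.integral_comp_sub_left]
    norm_num
  rw [e3, ← intervalIntegral.integral_congr_Ioo_of_le hle e2,
    ← intervalIntegral.integral_add i1 i2]
  simp only [sub_eq_add_neg]

section

variable (hα : ∀ i, 0 < α i) (hβ : ∀ i, 0 < β i) (hprod : ∏ i, α i = ∏ i, β i)
  (hgenus : spectralGenus α β = n)
include hα hβ

/-- On the arc between `p_∞` and `q_∞` the root of the discriminant is positive. -/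
theorem discRoot_of_arc {p : ℂ × ℂ} (hp : p ∈ arcZeroOne α β) :
    ∃ x r : ℝ, 1 < x ∧ 0 < r ∧ p.1 = x ∧ discRoot α β p = r := by
  obtain ⟨⟨hc, hreal⟩, hx, hw⟩ := hp
  rw [conjPt_eq_iff] at hreal
  have hc' := (mem_curve_iff hα hβ).1 hc
  have hr : discRoot α β p = ((discRoot α β p).re : ℂ) :=
    Complex.ext rfl (by simp [(discRoot_im hreal.1 hc'.2.1).2 hreal.2])
  refine ⟨p.1.re, (discRoot α β p).re, hx, ?_, Complex.ext rfl (by simp [hreal.1]), hr⟩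
  have h1 := eigenMu_mul hα hβ hc'.2.2
  have h2 := eigenMu_discRoot (α := α) (β := β) p
  have hx' : p.1 = (p.1.re : ℂ) := Complex.ext rfl (by simp [hreal.1])
  have hw' : p.2 = (p.2.re : ℂ) := Complex.ext rfl (by simp [hreal.2])
  set x := p.1.re
  set w := p.2.re
  set r := (discRoot α β p).re
  have h3 : eigenMu (weightList α β) p.1 (-discRoot α β p) =
      (x - 1) ^ (n + 1) * w - r := by
    have : eigenMu (weightList α β) p.1 (-discRoot α β p) =
      eigenMu (weightList α β) p.1 (discRoot α β p) - discRoot α β p := by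
      simp only [eigenMu]; ring
    rw [this, h2, hr, hx', hw']
  rw [h3, h2, hx', hw'] at h1
  have h4 : ((x - 1) ^ (n + 1) * w) * ((x - 1) ^ (n + 1) * w - r) = (x - 1) ^ (2 * (n + 1)) := by
    exact_mod_cast h1
  have h5 : 0 < (x - 1) ^ (n + 1) := pow_pos (by linarith) _
  rw [mul_comm 2, pow_mul] at h4
  set m := (x - 1) ^ (n + 1)
  have h6 : w * (m * w - r) = m := by
    have : m * (w * (m * w - r)) = m * m := by rw [← pow_two, ← h4]; ring
    exact mul_left_cancel₀ h5.ne' this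
  by_contra hneg
  push Not at hneg
  nlinarith [mul_pos h5 (show 0 < w - 1 by linarith), mul_nonneg (show 0 ≤ w by linarith)
    (neg_nonneg.2 hneg)]

include hprod hgenus

omit hα hβ hprod hgenus in
theorem IsContour.mem_regionZero {q : ℂ × ℂ} (hq : q ∈ regionZero α β) {γ : Path q (conjPt q)}
    (h : IsContour α β γ) {t : ℝ} (ht : t ∈ Set.Ico (0 : ℝ) (1 / 2)) :
    γ.extend t ∈ regionZero α β := by
  have hsub : γ.extend '' Set.Ico (0 : ℝ) (1 / 2) ⊆ nonrealLocus α β := by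
    rintro _ ⟨s, hs, rfl⟩
    have hs1 : s ∈ Set.Icc (0 : ℝ) 1 := ⟨hs.1, by linarith [hs.2]⟩
    rw [Path.extend_apply _ hs1]
    refine ⟨h.mem_curve _, fun hc => ?_⟩
    rw [← h.symmetric] at hc
    have := congrArg Subtype.val (h.simple hc)
    simp only [unitInterval.coe_symm_eq] at this
    linarith [hs.2]
  have hpre : IsPreconnected (γ.extend '' Set.Ico (0 : ℝ) (1 / 2)) :=
    isPreconnected_Ico.image _ γ.continuous_extend.continuousOn
  obtain ⟨p, hp, h1, h2, h3⟩ := hq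
  refine ⟨p, hp, h1, h2, ?_⟩
  rw [connectedComponentIn_eq h3]
  exact hpre.subset_connectedComponentIn ⟨0, ⟨le_rfl, by norm_num⟩, γ.extend_zero⟩ hsub ⟨t, ht, rfl⟩

omit hα hβ hprod hgenus in
theorem IsContour.half_mem {q : ℂ × ℂ} {γ : Path q (conjPt q)}
    (h : IsContour α β γ) : γ.extend (1 / 2) ∈ arcZeroOne α β := by
  have h1 : (1 / 2 : ℝ) ∈ Set.Icc (0 : ℝ) 1 := by constructor <;> norm_num
  have h2 := h.extend_symm h1
  rw [show (1 - 1 / 2 : ℝ) = 1 / 2 by norm_num] at h2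
  rw [Path.extend_apply _ h1] at h2 ⊢
  exact h.meets_real _ ⟨h.mem_curve _, h2.symm⟩

end

variable {S : SlitCurve}

/-- The differential of a potential on the spectral curve. -/
def Potential.onCurve (α β : Fin (n + 1) → ℝ) (p : Potential S cutPlane) (v : ℂ × ℂ) : ℂ :=
  p.a v.1 + aeval v.1 p.q / ((v.1 - 1) * discRoot α β v)

theorem Potential.onCurve_conj (p : Potential S cutPlane) (v : ℂ × ℂ) :
    p.onCurve α β (conjPt v) = (starRingEnd ℂ) (p.onCurve α β v) := by
  simp only [onCurve, discRoot_conj, map_add, map_div₀, map_mul, map_sub, map_one]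
  rw [show (conjPt v).1 = (starRingEnd ℂ) v.1 from rfl, p.a_conj, aeval_conj_eq]

/-- The potential vanishes on the ray `z > 1` of the boundary of the lower half-plane. -/
structure Potential.VanishesAtArc (p : Potential S cutPlane) : Prop where
  a_cont : ∀ x : ℝ, 1 < x → ContinuousAt p.a x
  lim : ∀ x : ℝ, 1 < x → Tendsto p.y (𝓝[{z : ℂ | z.im < 0}] (x : ℂ)) (𝓝 0)

section

variable (hα : ∀ i, 0 < α i) (hβ : ∀ i, 0 < β i) (hprod : ∏ i, α i = ∏ i, β i)
  (hgenus : spectralGenus α β = n)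
include hα hβ hprod hgenus

theorem IsContour.discRoot_ne_zero {q : ℂ × ℂ} (hq : q ∈ regionZero α β)
    {γ : Path q (conjPt q)} (h : IsContour α β γ) {t : ℝ} (ht : t ∈ Set.Icc (0 : ℝ) (1 / 2)) :
    discRoot α β (γ.extend t) ≠ 0 := by
  rcases ht.2.lt_or_eq with h1 | rfl
  · obtain ⟨h2, h3⟩ := (mem_regionZero_iff hα hβ hprod hgenus).1
      (h.mem_regionZero hq ⟨ht.1, h1⟩)
    rw [h3]
    exact r_ne_zero (S := spectralSlitCurve hα hβ hprod hgenus) h2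
  · obtain ⟨x, r, hx, hr, h2, h3⟩ := discRoot_of_arc hα hβ h.half_mem
    rw [h3]; exact_mod_cast hr.ne'

theorem IsContour.continuousOn_onCurve {q : ℂ × ℂ} (hq : q ∈ regionZero α β)
    {γ : Path q (conjPt q)} (h : IsContour α β γ)
    {p : Potential (spectralSlitCurve hα hβ hprod hgenus) cutPlane} (hp : p.VanishesAtArc) :
    ContinuousOn (fun t => p.onCurve α β (γ.extend t)) (Set.Icc 0 (1 / 2)) := by
  intro t ht
  have hfst : ContinuousAt (fun t => (γ.extend t).1) t :=
    continuous_fst.continuousAt.comp γ.continuous_extend.continuousAt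
  have hdr : ContinuousAt (fun t => discRoot α β (γ.extend t)) t :=
    continuous_discRoot.continuousAt.comp γ.continuous_extend.continuousAt
  have key : ContinuousAt p.a (γ.extend t).1 ∧ (γ.extend t).1 ≠ 1 := by
    rcases ht.2.lt_or_eq with h1 | rfl
    · obtain ⟨h2, h3⟩ := (mem_regionZero_iff hα hβ hprod hgenus).1
        (h.mem_regionZero hq ⟨ht.1, h1⟩)
      have h2' : (γ.extend t).1 ∈ (spectralSlitCurve hα hβ hprod hgenus).dom := h2
      refine ⟨p.a_diff.continuousOn.continuousAt
        (isOpen_cutPlane.mem_nhds (dom_subset_cutPlane h2')), ne_one_of_mem h2'⟩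
    · obtain ⟨x, r, hx, hr, h2, h3⟩ := discRoot_of_arc hα hβ h.half_mem
      refine ⟨h2 ▸ hp.a_cont x hx, ?_⟩
      rw [h2]; exact_mod_cast hx.ne'
  refine ContinuousAt.continuousWithinAt (ContinuousAt.add ?_ (ContinuousAt.div ?_ ?_ ?_))
  · exact ContinuousAt.comp (f := fun t => (γ.extend t).1) key.1 hfst
  · exact ContinuousAt.comp (f := fun t => (γ.extend t).1) (aeval_continuous _).continuousAt hfst
  · exact (hfst.sub continuousAt_const).mul hdr
  · exact mul_ne_zero (sub_ne_zero.2 key.2)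
      (h.discRoot_ne_zero hα hβ hprod hgenus hq ht)

/-- The imaginary part of the integral of the differential of a potential. -/
theorem IsContour.integral_onCurve {q : ℂ × ℂ} (hq : q ∈ regionZero α β)
    {γ : Path q (conjPt q)} (h : IsContour α β γ)
    {p : Potential (spectralSlitCurve hα hβ hprod hgenus) cutPlane} (hp : p.VanishesAtArc)
    {d : ℝ → ℂ} (hd : ContinuousOn d (Set.Icc 0 (1 / 2)))
    (hγ : ∀ t ∈ Set.Ioo (0 : ℝ) (1 / 2), HasDerivAt (fun t => (γ.extend t).1) (d t) t) :
    ∫ t in (0 : ℝ)..(1 / 2), (p.onCurve α β (γ.extend t) * d t).im = -p.y q.1 := by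
  have hle : (0 : ℝ) ≤ 1 / 2 := by norm_num
  have hdom : ∀ t ∈ Set.Ico (0 : ℝ) (1 / 2),
      (γ.extend t).1 ∈ (spectralSlitCurve hα hβ hprod hgenus).dom ∧
        discRoot α β (γ.extend t) = sheet (weightList α β) (γ.extend t).1 := fun t ht =>
    (mem_regionZero_iff hα hβ hprod hgenus).1 (h.mem_regionZero hq ht)
  have hfst : Continuous (fun t => (γ.extend t).1) := continuous_fst.comp γ.continuous_extend
  set f : ℝ → ℝ := fun t => if t < 1 / 2 then p.y (γ.extend t).1 else 0 with hf
  have hfe : ∀ t : ℝ, t < 1 / 2 → f =ᶠ[𝓝 t] fun t => p.y (γ.extend t).1 := fun t ht => by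
    filter_upwards [gt_mem_nhds ht] with s hs
    simp only [hf]
    rw [if_pos hs]
  have hder : ∀ t ∈ Set.Ico (0 : ℝ) (1 / 2), ContinuousAt f t := fun t ht => by
    refine ContinuousAt.congr ?_ (hfe t ht.2).symm
    exact ContinuousAt.comp (f := fun t => (γ.extend t).1)
      (p.deriv _ (hdom t ht).1).continuousAt hfst.continuousAt
  have := intervalIntegral.integral_eq_sub_of_hasDerivAt_of_le (f := f)
    (f' := fun t => (p.onCurve α β (γ.extend t) * d t).im) hle ?_ ?_ ?_
  · rw [this]
    simp only [hf]
    rw [if_neg (lt_irrefl _), if_pos (by norm_num), γ.extend_zero, zero_sub]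
  · intro t ht
    rcases ht.2.lt_or_eq with h1 | rfl
    · exact (hder t ⟨ht.1, h1⟩).continuousWithinAt
    · obtain ⟨x, r, hx, hr, h2, h3⟩ := discRoot_of_arc hα hβ h.half_mem
      have hlow : ∀ᶠ t in 𝓝[<] (1 / 2 : ℝ), (γ.extend t).1.im < 0 := by
        have k1 : ∀ᶠ t in 𝓝[<] (1 / 2 : ℝ), 0 < (discRoot α β (γ.extend t)).re := by
          have : Continuous (fun t => (discRoot α β (γ.extend t)).re) :=
            continuous_re.comp (continuous_discRoot.comp γ.continuous_extend)
          exact (this.continuousAt.eventually (lt_mem_nhds (by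
            show 0 < (discRoot α β (γ.extend (1 / 2))).re
            rw [h3, ofReal_re]; exact hr))).filter_mono inf_le_left
        have k2 : ∀ᶠ t in 𝓝[<] (1 / 2 : ℝ), 0 < (γ.extend t).1.re :=
          ((continuous_re.comp hfst).continuousAt.eventually (lt_mem_nhds (by
            show 0 < (γ.extend (1 / 2)).1.re
            rw [h2, ofReal_re]; linarith))).filter_mono inf_le_left
        have k3 : Tendsto (fun t => (starRingEnd ℂ) (γ.extend t).1) (𝓝[<] (1 / 2 : ℝ))
            (𝓝 (x : ℂ)) := by
          have := (continuous_conj.comp hfst).tendsto (1 / 2 : ℝ)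
          simp only [Function.comp, h2, conj_ofReal] at this
          exact this.mono_left inf_le_left
        have k4 := k3.eventually (eventually_nhdsWithin_iff.1
          ((spectralSlitCurve hα hβ hprod hgenus).r_re_pos x (by linarith)))
        filter_upwards [k1, k2, k4, Ico_mem_nhdsLT (show (0 : ℝ) < 1 / 2 by norm_num)]
          with t m1 m2 m3 m4
        obtain ⟨m5, m6⟩ := hdom t m4
        by_contra hneg
        rcases (not_lt.1 hneg).lt_or_eq with m7 | m7
        · have m8 := m3 (by simpa using m7)
          rw [(spectralSlitCurve hα hβ hprod hgenus).r_conj _ m5] at m8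
          have m9 : (spectralSlitCurve hα hβ hprod hgenus).r (γ.extend t).1 =
            discRoot α β (γ.extend t) := m6.symm
          rw [m9, neg_re, conj_re] at m8
          linarith
        · rcases mem_dom_imp m5 with m8 | m8
          · exact m8 m7.symm
          · linarith
      have hlim : Tendsto (fun t => p.y (γ.extend t).1) (𝓝[<] (1 / 2 : ℝ)) (𝓝 0) := by
        refine (hp.lim x hx).comp (tendsto_nhdsWithin_iff.2 ⟨?_, hlow⟩)
        rw [← h2]
        exact hfst.continuousAt.tendsto.mono_left inf_le_left
      have hc : ContinuousWithinAt f (Set.Iic (1 / 2)) (1 / 2) := by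
        rw [← continuousWithinAt_Iio_iff_Iic, ContinuousWithinAt]
        have e0 : f (1 / 2) = 0 := by simp [hf]
        rw [e0]
        refine hlim.congr' ?_
        filter_upwards [self_mem_nhdsWithin] with t ht
        simp only [hf]
        rw [if_pos (show t < 1 / 2 from ht)]
      exact hc.mono Set.Icc_subset_Iic_self
  · intro t ht
    have h0 : t ∈ Set.Ico (0 : ℝ) (1 / 2) := ⟨ht.1.le, ht.2⟩
    obtain ⟨h1, h2⟩ := hdom t h0
    have h3 := (p.deriv _ h1).comp_hasDerivAt t (hγ t ht)
    refine (h3.congr_deriv ?_).congr_of_eventuallyEq (hfe t ht.2)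
    rw [imForm_apply, Potential.onCurve, h2]
    rfl
  · refine ContinuousOn.intervalIntegrable ?_
    rw [Set.uIcc_of_le hle]
    exact continuous_im.comp_continuousOn
      ((h.continuousOn_onCurve hα hβ hprod hgenus hq hp).mul hd)

/-- The integral of a combination of the differentials of two potentials along a contour. -/
theorem IsContour.curveIntegral_pair {q : ℂ × ℂ} (hq : q ∈ regionZero α β)
    {γ : Path q (conjPt q)} (h : IsContour α β γ)
    {pA pB : Potential (spectralSlitCurve hα hβ hprod hgenus) cutPlane} (hA : pA.VanishesAtArc)
    (hB : pB.VanishesAtArc) {C : ℂ} {ω : ℂ × ℂ → ℂ}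
    (hω : ∀ v ∈ curve α β, discRoot α β v ≠ 0 → ω v = C * (pA.onCurve α β v + I * pB.onCurve α β v)) :
    curveIntegral (fun p => ω p • ContinuousLinearMap.fst ℂ ℂ ℂ) γ =
      -2 * I * C * Potential.pair pA pB q.1 := by
  have hle : (0 : ℝ) ≤ 1 / 2 := by norm_num
  set d : ℝ → ℂ := fun t => (derivWithin γ.extend (Set.Icc 0 (1 / 2)) t).1 with hd
  have hdc : ContinuousOn d (Set.Icc 0 (1 / 2)) :=
    continuous_fst.comp_continuousOn (h.contDiffOn.continuousOn_derivWithin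
      (uniqueDiffOn_Icc (by norm_num)) le_rfl)
  have hder : ∀ t ∈ Set.Ioo (0 : ℝ) (1 / 2), HasDerivAt γ.extend
      (derivWithin γ.extend (Set.Icc 0 (1 / 2)) t) t := fun t ht =>
    ((h.contDiffOn.differentiableOn (by simp)) t
      (Set.Ioo_subset_Icc_self ht)).hasDerivWithinAt.hasDerivAt (Icc_mem_nhds ht.1 ht.2)
  have hder1 : ∀ t ∈ Set.Ioo (0 : ℝ) (1 / 2), HasDerivAt (fun t => (γ.extend t).1) (d t) t :=
    fun t ht => (ContinuousLinearMap.fst ℝ ℂ ℂ).hasFDerivAt.comp_hasDerivAt t (hder t ht)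
  have hcv : ∀ t, γ.extend t ∈ curve α β := fun t => h.mem_curve _
  have cA := h.continuousOn_onCurve hα hβ hprod hgenus hq hA
  have cB := h.continuousOn_onCurve hα hβ hprod hgenus hq hB
  have hdr : ∀ t ∈ Set.Icc (0 : ℝ) (1 / 2), discRoot α β (γ.extend t) ≠ 0 := fun t ht =>
    h.discRoot_ne_zero hα hβ hprod hgenus hq ht
  have e1 : ∀ t ∈ Set.Icc (0 : ℝ) (1 / 2), ω (γ.extend t) = C * (pA.onCurve α β (γ.extend t) +
      I * pB.onCurve α β (γ.extend t)) := fun t ht => hω _ (hcv t) (hdr t ht)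
  have e2 : ∀ t ∈ Set.Icc (0 : ℝ) (1 / 2), ω (conjPt (γ.extend t)) =
      C * ((starRingEnd ℂ) (pA.onCurve α β (γ.extend t)) +
      I * (starRingEnd ℂ) (pB.onCurve α β (γ.extend t))) := fun t ht => by
    rw [hω _ (conjPt_mem_curve hα hβ (hcv t)) (by
      rw [discRoot_conj]; exact (_root_.map_ne_zero _).2 (hdr t ht)),
      Potential.onCurve_conj, Potential.onCurve_conj]
  rw [h.curveIntegral_eq hdc (fun t ht => ⟨_, rfl, hder t ht⟩)
    ((continuousOn_const.mul (cA.add (continuousOn_const.mul cB))).congr e1)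
    ((continuousOn_const.mul ((continuous_conj.comp_continuousOn cA).add
        (continuousOn_const.mul (continuous_conj.comp_continuousOn cB)))).congr e2)]
  have e3 : ∀ t ∈ Set.Icc (0 : ℝ) (1 / 2), ω (γ.extend t) * d t - ω (conjPt (γ.extend t)) * (starRingEnd ℂ) (d t) =
      2 * I * C * (((pA.onCurve α β (γ.extend t) * d t).im : ℂ) +
        I * ((pB.onCurve α β (γ.extend t) * d t).im : ℂ)) := fun t ht => by
    have k1 := e1 t ht
    have k2 := e2 t ht
    have k3 : ∀ u : ℂ, u - (starRingEnd ℂ) u = 2 * I * (u.im : ℂ) := fun u => by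
      rw [sub_conj]; push_cast; ring
    rw [k1, k2]
    have k4 := k3 (pA.onCurve α β (γ.extend t) * d t)
    have k5 := k3 (pB.onCurve α β (γ.extend t) * d t)
    rw [map_mul] at k4 k5
    linear_combination C * k4 + C * I * k5
  rw [intervalIntegral.integral_congr fun t ht => e3 t (by
    rwa [Set.uIcc_of_le hle] at ht)]
  have i1 : ∀ {p : Potential (spectralSlitCurve hα hβ hprod hgenus) cutPlane},
      ContinuousOn (fun t => p.onCurve α β (γ.extend t)) (Set.Icc 0 (1 / 2)) →
      IntervalIntegrable (fun t => (((p.onCurve α β (γ.extend t) * d t).im : ℝ) : ℂ)) volume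
        0 (1 / 2) := fun hc => by
    refine ContinuousOn.intervalIntegrable ?_
    rw [Set.uIcc_of_le hle]
    exact continuous_ofReal.comp_continuousOn (continuous_im.comp_continuousOn (hc.mul hdc))
  rw [intervalIntegral.integral_const_mul, intervalIntegral.integral_add (i1 cA)
    ((i1 cB).const_mul I), intervalIntegral.integral_const_mul, intervalIntegral.integral_ofReal,
    intervalIntegral.integral_ofReal, h.integral_onCurve hα hβ hprod hgenus hq hA hdc hder1,
    h.integral_onCurve hα hβ hprod hgenus hq hB hdc hder1, Potential.pair, mk_eq_add_mul_I]
  push_cast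
  ring

end

end

end AztecGas

end

noncomputable section

namespace AztecGas

open Polynomial SlitCurve

/-! ### Existence of contours -/

theorem im_exp_ne_zero {ζ : ℂ} (h1 : -Real.pi < ζ.im) (h2 : ζ.im < Real.pi) (h0 : ζ.im ≠ 0) :
    (exp ζ).im ≠ 0 := by
  rw [exp_im]
  refine mul_ne_zero (Real.exp_pos _).ne' fun h => h0 ?_
  exact (Real.sin_eq_zero_iff_of_lt_of_lt h1 h2).1 h

/-- A path in the slit domain to the positive axis. -/
theorem SlitCurve.exists_path (S : SlitCurve) {z₀ : ℂ} (hz₀ : z₀ ∈ S.dom) :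
    ∃ (Z : ℝ → ℂ) (x : ℝ), ContDiff ℝ 1 Z ∧ Z 0 = z₀ ∧ 1 < x ∧ Z (1 / 2) = x ∧
      (∀ t ∈ Set.Ico (0 : ℝ) (1 / 2), Z t ∈ S.dom) ∧ Set.InjOn Z (Set.Icc 0 (1 / 2)) ∧
      ∀ᶠ t in 𝓝[<] (1 / 2 : ℝ), (Z t).im < 0 := by
  obtain ⟨M, hM, hneg⟩ := S.exists_neg_bound
  set ζ₀ : ℂ := log (-z₀) with hζ₀
  have hsl : -z₀ ∈ slitPlane := dom_subset_cutPlane hz₀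
  have hne : -z₀ ≠ 0 := slitPlane_ne_zero hsl
  have harg : ζ₀.im ≠ Real.pi := by rw [log_im]; exact slitPlane_arg_ne_pi hsl
  have hlt : ζ₀.im < Real.pi := lt_of_le_of_ne (log_im_le_pi _) harg
  have hgt : -Real.pi < ζ₀.im := neg_pi_lt_log_im _
  obtain ⟨ξ, hξ, hcross⟩ : ∃ ξ : ℝ, 0 < ξ ∧ ∀ u : ℝ, 0 < u → (1 - u) * ζ₀.im + u * Real.pi = 0 →
      Real.log M < (1 - u) * ζ₀.re + u * ξ := by
    have hpos : 0 < Real.pi - ζ₀.im := by linarith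
    set v : ℝ := -ζ₀.im / (Real.pi - ζ₀.im) with hv
    refine ⟨max 1 ((Real.log M - (1 - v) * ζ₀.re) / v + 1), by positivity, fun u hu h => ?_⟩
    have huv : u = v := by
      rw [hv, eq_div_iff hpos.ne']
      linarith
    rw [← huv]
    have h1 : (Real.log M - (1 - u) * ζ₀.re) / u <
        max 1 ((Real.log M - (1 - u) * ζ₀.re) / u + 1) :=
      (lt_add_one _).trans_le (le_max_right _ _)
    rw [div_lt_iff₀ hu] at h1
    linarith
  set ζ : ℝ → ℂ := fun t => (1 - 2 * t) * ζ₀ + 2 * t * (ξ + Real.pi * I) with hζ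
  have hre : ∀ t, (ζ t).re = (1 - 2 * t) * ζ₀.re + 2 * t * ξ := fun t => by
    have : ζ t = ((1 - 2 * t : ℝ) : ℂ) * ζ₀ + ((2 * t : ℝ) : ℂ) * (ξ + Real.pi * I) := by
      simp only [hζ]; push_cast; ring
    rw [this, add_re, re_ofReal_mul, re_ofReal_mul]
    simp
  have him : ∀ t, (ζ t).im = (1 - 2 * t) * ζ₀.im + 2 * t * Real.pi := fun t => by
    have : ζ t = ((1 - 2 * t : ℝ) : ℂ) * ζ₀ + ((2 * t : ℝ) : ℂ) * (ξ + Real.pi * I) := by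
      simp only [hζ]; push_cast; ring
    rw [this, add_im, im_ofReal_mul, im_ofReal_mul]
    simp
  have himlt : ∀ t ∈ Set.Ico (0 : ℝ) (1 / 2), -Real.pi < (ζ t).im ∧ (ζ t).im < Real.pi := by
    intro t ht
    rw [him]
    have h1 : 0 < 1 - 2 * t := by linarith [ht.2]
    have h2 : 0 ≤ t := ht.1
    have h3 := Real.pi_pos
    have h4 := mul_pos h1 (show 0 < Real.pi - ζ₀.im by linarith)
    have h5 := mul_pos h1 (show 0 < Real.pi + ζ₀.im by linarith)
    have h6 := mul_nonneg h2 h3.le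
    constructor <;> nlinarith
  have himle : ∀ t ∈ Set.Icc (0 : ℝ) (1 / 2), -Real.pi < (ζ t).im ∧ (ζ t).im ≤ Real.pi := by
    intro t ht
    rcases ht.2.lt_or_eq with h | rfl
    · exact ⟨(himlt t ⟨ht.1, h⟩).1, (himlt t ⟨ht.1, h⟩).2.le⟩
    · rw [him]
      have := Real.pi_pos
      constructor <;> nlinarith
  have hζc : ContDiff ℝ 1 ζ := by
    have : ContDiff ℝ 1 (fun t : ℝ => (t : ℂ)) := ofRealCLM.contDiff
    simp only [hζ]
    fun_prop
  have hZc : ContDiff ℝ 1 (fun t => -exp (ζ t)) := hζc.cexp.neg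
  have hend : -exp (ζ (1 / 2)) = (Real.exp ξ : ℝ) := by
    have : ζ (1 / 2) = ξ + Real.pi * I := by simp [hζ]
    rw [this, exp_add, exp_pi_mul_I]
    simp
  refine ⟨fun t => -exp (ζ t), Real.exp ξ, hZc, ?_, Real.one_lt_exp_iff.2 hξ, hend, ?_, ?_, ?_⟩
  · simp only [hζ]
    rw [ofReal_zero, mul_zero, sub_zero, one_mul, zero_mul, add_zero, hζ₀, exp_log hne, neg_neg]
  · intro t ht
    obtain ⟨h1, h2⟩ := himlt t ht
    show -exp (ζ t) ∈ S.dom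
    by_cases h0 : (ζ t).im = 0
    · rcases ht.1.lt_or_eq with h3 | rfl
      · have h4 := hcross (2 * t) (by linarith) (by rw [← him, h0])
        rw [← hre, Real.log_lt_iff_lt_exp hM] at h4
        have h5 : ζ t = ((ζ t).re : ℂ) := Complex.ext rfl (by simp [h0])
        refine Or.inr ?_
        rw [h5, ← ofReal_exp, neg_re, ofReal_re]
        exact hneg _ (by linarith)
      · have : -exp (ζ 0) = z₀ := by
          simp only [hζ]
          rw [ofReal_zero, mul_zero, sub_zero, one_mul, zero_mul, add_zero, hζ₀, exp_log hne,
            neg_neg]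
        rwa [this]
    · refine Or.inl ?_
      rw [neg_im, neg_ne_zero]
      exact im_exp_ne_zero h1 h2 h0
  · intro s hs t ht hst
    have h1 : exp (ζ s) = exp (ζ t) := neg_injective hst
    have h2 := exp_inj_of_neg_pi_lt_of_le_pi (himle s hs).1 (himle s hs).2 (himle t ht).1
      (himle t ht).2 h1
    have h3 := congrArg Complex.im h2
    rw [him, him] at h3
    have h4 : (s - t) * (Real.pi - ζ₀.im) = 0 := by linear_combination h3 / 2
    exact sub_eq_zero.1 ((mul_eq_zero.1 h4).resolve_right (by linarith))
  · have hc : Tendsto (fun t => (ζ t).im) (𝓝[<] (1 / 2 : ℝ)) (𝓝 ((ζ (1 / 2)).im)) :=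
      ((continuous_im.comp hζc.continuous).tendsto _).mono_left inf_le_left
    have h1 : 0 < (ζ (1 / 2)).im := by
      rw [him]; have := Real.pi_pos; linarith
    filter_upwards [hc.eventually (lt_mem_nhds h1),
      Ico_mem_nhdsLT (show (0 : ℝ) < 1 / 2 by norm_num)] with t h2 h3
    rw [neg_im, exp_im, neg_lt_zero]
    exact mul_pos (Real.exp_pos _) (Real.sin_pos_of_pos_of_lt_pi h2 (himlt t h3).2)

/-- The root along a path to the positive axis. -/
theorem SlitCurve.exists_root_along (S : SlitCurve) {Z : ℝ → ℂ} {x : ℝ} (hZ : ContDiff ℝ 1 Z)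
    (hx : 0 < x) (hZx : Z (1 / 2) = x) (hdom : ∀ t ∈ Set.Ico (0 : ℝ) (1 / 2), Z t ∈ S.dom)
    (hlow : ∀ᶠ t in 𝓝[<] (1 / 2 : ℝ), (Z t).im < 0) :
    ∃ ρ : ℝ → ℂ, ContDiffOn ℝ 1 ρ (Set.Icc 0 (1 / 2)) ∧
      (∀ t ∈ Set.Ico (0 : ℝ) (1 / 2), ρ t = S.r (Z t)) ∧ ρ (1 / 2) = (√(S.R.eval x) : ℝ) := by
  have hR := S.R_pos x hx
  have hs := Real.sqrt_pos.2 hR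
  obtain ⟨f, hfa, hf0, hfs⟩ := local_sqrt (R := S.R) (z₀ := x) (r₀ := (√(S.R.eval x) : ℝ))
    (by rw [aeval_ofReal_eq, ← ofReal_pow, Real.sq_sqrt hR.le]) (by exact_mod_cast hs.ne')
  set ρ : ℝ → ℂ := fun t => if t < 1 / 2 then S.r (Z t) else (√(S.R.eval x) : ℝ) with hρ
  have hρ1 : ∀ t, t < 1 / 2 → ρ t = S.r (Z t) := fun t ht => if_pos ht
  have hρ2 : ρ (1 / 2) = (√(S.R.eval x) : ℝ) := if_neg (lt_irrefl _)
  refine ⟨ρ, ?_, fun t ht => hρ1 t ht.2, hρ2⟩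
  intro t ht
  rcases ht.2.lt_or_eq with h | rfl
  · have h1 : ContDiffAt ℝ 1 S.r (Z t) :=
      ((show DifferentiableOn ℂ S.r S.dom from fun z hz =>
        (S.r_diff z hz).differentiableWithinAt).analyticAt
          (S.isOpen_dom.mem_nhds (hdom t ⟨ht.1, h⟩))).contDiffAt.restrict_scalars ℝ
    refine ((h1.comp t hZ.contDiffAt).congr_of_eventuallyEq ?_).contDiffWithinAt
    filter_upwards [gt_mem_nhds h] with s hs
    exact hρ1 s hs
  · have h1 : ContDiffAt ℝ 1 f (Z (1 / 2)) := by
      rw [hZx]; exact hfa.contDiffAt.restrict_scalars ℝ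
    have hZt : Tendsto Z (𝓝[<] (1 / 2 : ℝ)) (𝓝 (x : ℂ)) := by
      rw [← hZx]; exact (hZ.continuous.tendsto _).mono_left inf_le_left
    have k1 := (tendsto_nhdsWithin_iff.2 ⟨hZt, hlow⟩).eventually (S.r_re_pos x hx)
    have k2 : ∀ᶠ t in 𝓝[<] (1 / 2 : ℝ), 0 < (f (Z t)).re := by
      refine hZt.eventually ((continuous_re.continuousAt.comp hfa.continuousAt).eventually
        (lt_mem_nhds ?_))
      show 0 < (f x).re
      rw [hf0, ofReal_re]; exact hs
    have k3 : ρ =ᶠ[𝓝[<] (1 / 2 : ℝ)] f ∘ Z := by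
      filter_upwards [k1, k2, self_mem_nhdsWithin] with t m1 m2 m3
      rw [hρ1 t m3]
      rcases sq_eq_sq_iff_eq_or_eq_neg.1 ((S.r_sq (Z t)).trans (hfs (Z t)).symm) with h | h
      · exact h
      · rw [h, neg_re] at m1
        linarith
    have k4 : ρ (1 / 2) = (f ∘ Z) (1 / 2) := by
      rw [hρ2, Function.comp, hZx, hf0]
    refine (h1.comp (1 / 2 : ℝ) hZ.contDiffAt).contDiffWithinAt.congr_of_eventuallyEq ?_ k4
    rw [EventuallyEq, eventually_nhdsWithin_iff] at k3 ⊢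
    filter_upwards [k3] with t m1 m2
    rcases m2.2.lt_or_eq with h | h
    · exact m1 h
    · rw [h, k4]

section

variable {n : ℕ} {α β : Fin (n + 1) → ℝ}

theorem contDiffOn_liftPt {Z ρ : ℝ → ℂ} {s : Set ℝ} (hZ : ContDiffOn ℝ 1 Z s)
    (hρ : ContDiffOn ℝ 1 ρ s) (h1 : ∀ t ∈ s, Z t ≠ 1) :
    ContDiffOn ℝ 1 (fun t => liftPt α β (Z t) (ρ t)) s := by
  have hp : ContDiff ℝ 1 (fun z : ℂ => aeval z (polySymbol (weightList α β) 0 0 +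
      polySymbol (weightList α β) 1 1)) :=
    (aeval_differentiable _).contDiff.restrict_scalars ℝ
  simp only [liftPt, div_eq_mul_inv]
  refine hZ.prodMk (((hp.comp_contDiffOn hZ).add hρ).mul (ContDiffOn.fun_inv
    (contDiffOn_const.mul ((hZ.sub contDiffOn_const).pow _)) ?_))
  intro t ht
  exact mul_ne_zero two_ne_zero (pow_ne_zero _ (sub_ne_zero.2 (h1 t ht)))

section

variable (hα : ∀ i, 0 < α i) (hβ : ∀ i, 0 < β i)
include hα hβ

theorem liftPt_mem_arc {x : ℝ} (hx : 1 < x) :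
    liftPt α β x (√((discPoly (weightList α β)).eval x) : ℝ) ∈ arcZeroOne α β := by
  have hR := discPoly_pos _ (weightList_pos hα hβ) (weightList_ne_nil α β) (one_pos.trans hx)
  have hs := Real.sqrt_pos.2 hR
  have hsq := Real.sq_sqrt hR.le
  set r := √((discPoly (weightList α β)).eval x)
  have hr : (r : ℂ) ^ 2 = aeval (x : ℂ) (discPoly (weightList α β)) := by
    rw [aeval_ofReal_eq, ← ofReal_pow, hsq]
  have hx0 : (x : ℂ) ≠ 0 := by exact_mod_cast (one_pos.trans hx).ne'
  have hx1 : (x : ℂ) ≠ 1 := by exact_mod_cast hx.ne'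
  set T := (polySymbol (weightList α β) 0 0 + polySymbol (weightList α β) 1 1).eval x with hT
  have hTpos : 0 < T := by
    obtain ⟨h1, -, -, h2, -⟩ := eval_polySymbol_pos _ (weightList_pos hα hβ) (one_pos.trans hx)
    rw [hT, eval_add]
    exact add_pos h1 h2
  have hm : 0 < (x - 1) ^ (n + 1) := pow_pos (by linarith) _
  have hw : liftPt α β x r = ((x : ℂ), (((T + r) / (2 * (x - 1) ^ (n + 1)) : ℝ) : ℂ)) := by
    refine Prod.ext rfl ?_
    simp only [liftPt, aeval_ofReal_eq]
    push_cast
    rfl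
  have hmu := eigenMu_mul hα hβ hr
  simp only [eigenMu, aeval_ofReal_eq] at hmu
  have hmu' : (T + r) / 2 * ((T + -r) / 2) = (x - 1) ^ (2 * (n + 1)) := by exact_mod_cast hmu
  rw [mul_comm 2, pow_mul] at hmu'
  have hbig : (x - 1) ^ (n + 1) < (T + r) / 2 := by
    by_contra hcon
    push Not at hcon
    have h1 : (T + -r) / 2 < (x - 1) ^ (n + 1) := by linarith
    have h2 : 0 < (T + r) / 2 := by linarith
    nlinarith
  refine ⟨⟨liftPt_mem_curve hα hβ hx0 hx1 hr, ?_⟩, ?_, ?_⟩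
  · rw [hw, conjPt_eq_iff]; exact ⟨ofReal_im _, ofReal_im _⟩
  · rw [hw]; simpa using hx
  · rw [hw]
    simp only [ofReal_re]
    rw [lt_div_iff₀ (by positivity)]
    linarith

end

variable (hα : ∀ i, 0 < α i) (hβ : ∀ i, 0 < β i) (hprod : ∏ i, α i = ∏ i, β i)
  (hgenus : spectralGenus α β = n)
include hα hβ hprod hgenus

theorem exists_contour {q : ℂ × ℂ} (hq : q ∈ regionZero α β) :
    ∃ γ : Path q (conjPt q), IsContour α β γ := by
  set S := spectralSlitCurve hα hβ hprod hgenus with hS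
  obtain ⟨hqd, hqr⟩ := (mem_regionZero_iff hα hβ hprod hgenus).1 hq
  obtain ⟨Z, x, hZ, hZ0, hx, hZx, hdom, hinj, hlow⟩ := S.exists_path hqd
  obtain ⟨ρ, hρ, hρr, hρx⟩ := S.exists_root_along hZ (one_pos.trans hx) hZx hdom hlow
  have hle : (0 : ℝ) ≤ 1 / 2 := by norm_num
  set P : ℝ → ℂ × ℂ := fun t => liftPt α β (Z t) (ρ t) with hP
  have hZ1 : ∀ t ∈ Set.Icc (0 : ℝ) (1 / 2), Z t ≠ 1 := by
    intro t ht
    rcases ht.2.lt_or_eq with h | rfl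
    · exact ne_one_of_mem (hdom t ⟨ht.1, h⟩)
    · rw [hZx]; exact_mod_cast hx.ne'
  have hPc : ContDiffOn ℝ 1 P (Set.Icc 0 (1 / 2)) :=
    contDiffOn_liftPt hZ.contDiffOn hρ hZ1
  have hPd : ∀ t ∈ Set.Ico (0 : ℝ) (1 / 2), P t ∈ nonrealLocus α β := by
    intro t ht
    simp only [hP]
    rw [hρr t ht]
    exact liftPt_mem_nonrealLocus hα hβ hprod hgenus (hdom t ht)
  have hPh : P (1 / 2) ∈ arcZeroOne α β := by
    simp only [hP]
    rw [hZx, hρx]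
    exact liftPt_mem_arc hα hβ hx
  have hP0 : P 0 = q := by
    simp only [hP]
    rw [hρr 0 ⟨le_rfl, by norm_num⟩, hZ0]
    have : S.r q.1 = discRoot α β q := hqr.symm
    rw [this]
    exact liftPt_discRoot (ne_one_of_mem (S := S) hqd)
  have hPcurve : ∀ t ∈ Set.Icc (0 : ℝ) (1 / 2), P t ∈ curve α β := by
    intro t ht
    rcases ht.2.lt_or_eq with h | rfl
    · exact (hPd t ⟨ht.1, h⟩).1
    · exact hPh.1.1
  set E : ℝ → ℂ × ℂ := Set.IccExtend hle ((Set.Icc (0 : ℝ) (1 / 2)).domRestrict P) with hE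
  have hEc : Continuous E := hPc.continuousOn.domRestrict.Icc_extend'
  have hEP : ∀ t ∈ Set.Icc (0 : ℝ) (1 / 2), E t = P t := fun t ht => by
    rw [hE, Set.IccExtend_of_mem _ _ ht]; rfl
  have hhalf : (1 / 2 : ℝ) ∈ Set.Icc (0 : ℝ) (1 / 2) := ⟨hle, le_rfl⟩
  set F : ℝ → ℂ × ℂ := fun t => if t ≤ 1 / 2 then E t else conjPt (E (1 - t)) with hF
  have hFc : Continuous F := by
    refine Continuous.if_le hEc (continuous_conjPt.comp (hEc.comp (by fun_prop))) continuous_id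
      continuous_const ?_
    rintro t rfl
    rw [show (1 - 1 / 2 : ℝ) = 1 / 2 by norm_num, hEP _ hhalf]
    exact hPh.1.2.symm
  have hF1 : ∀ t ∈ Set.Icc (0 : ℝ) (1 / 2), F t = P t := fun t ht => by
    simp only [hF]; rw [if_pos ht.2, hEP t ht]
  have hF2 : ∀ t, 1 / 2 < t → t ≤ 1 → F t = conjPt (P (1 - t)) := fun t ht ht' => by
    simp only [hF]; rw [if_neg (not_le.2 ht), hEP _ ⟨by linarith, by linarith⟩]
  let γ : Path q (conjPt q) :=
    { toFun := fun t => F t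
      continuous_toFun := hFc.comp continuous_subtype_val
      source' := by
        show F 0 = q
        rw [hF1 0 ⟨le_rfl, hle⟩, hP0]
      target' := by
        show F 1 = conjPt q
        rw [hF2 1 (by norm_num) le_rfl, sub_self, hP0] }
  have hγ : ∀ t, γ t = F t := fun t => rfl
  have hmix : ∀ s ∈ Set.Icc (0 : ℝ) (1 / 2), ∀ t ∈ Set.Ico (0 : ℝ) (1 / 2),
      P s ≠ conjPt (P t) := by
    intro s hs t ht hst
    have hz : Z s = (starRingEnd ℂ) (Z t) := congrArg Prod.fst hst
    rcases hs.2.lt_or_eq with h | rfl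
    · have h1 := congrArg (discRoot α β) hst
      rw [discRoot_conj] at h1
      simp only [hP] at h1
      rw [discRoot_liftPt (hZ1 s hs), discRoot_liftPt (hZ1 t ⟨ht.1, ht.2.le⟩), hρr s ⟨hs.1, h⟩,
        hρr t ht, hz, S.r_conj _ (hdom t ht)] at h1
      have h2 : (starRingEnd ℂ) (S.r (Z t)) = 0 := by
        have : (2 : ℂ) * (starRingEnd ℂ) (S.r (Z t)) = 0 := by linear_combination -h1
        exact (mul_eq_zero.1 this).resolve_left two_ne_zero
      exact r_ne_zero (hdom t ht) ((_root_.map_eq_zero _).1 h2)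
    · rw [hZx] at hz
      have h1 : Z t = x := by rw [← conj_conj (Z t), ← hz, conj_ofReal]
      have h2 := mem_dom_imp (hdom t ht)
      rw [h1] at h2
      simp at h2
      linarith
  refine ⟨γ, ⟨?_, ?_, ?_, ?_, ?_⟩⟩
  · intro t
    rw [hγ]
    rcases le_or_gt (t : ℝ) (1 / 2) with h | h
    · rw [hF1 _ ⟨t.2.1, h⟩]; exact hPcurve _ ⟨t.2.1, h⟩
    · rw [hF2 _ h t.2.2]
      exact conjPt_mem_curve hα hβ (hPcurve _ ⟨by linarith [t.2.2], by linarith⟩)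
  · intro s t hst
    rw [hγ, hγ] at hst
    have hPinj : ∀ s ∈ Set.Icc (0 : ℝ) (1 / 2), ∀ t ∈ Set.Icc (0 : ℝ) (1 / 2), P s = P t → s = t :=
      fun s hs t ht h => hinj hs ht (congrArg Prod.fst h)
    rcases le_or_gt (s : ℝ) (1 / 2) with h | h <;> rcases le_or_gt (t : ℝ) (1 / 2) with h' | h'
    · rw [hF1 _ ⟨s.2.1, h⟩, hF1 _ ⟨t.2.1, h'⟩] at hst
      exact Subtype.ext (hPinj _ ⟨s.2.1, h⟩ _ ⟨t.2.1, h'⟩ hst)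
    · rw [hF1 _ ⟨s.2.1, h⟩, hF2 _ h' t.2.2] at hst
      exact absurd hst (hmix _ ⟨s.2.1, h⟩ _ ⟨by linarith [t.2.2], by linarith⟩)
    · rw [hF1 _ ⟨t.2.1, h'⟩, hF2 _ h s.2.2] at hst
      exact absurd hst.symm (hmix _ ⟨t.2.1, h'⟩ _ ⟨by linarith [s.2.2], by linarith⟩)
    · rw [hF2 _ h s.2.2, hF2 _ h' t.2.2] at hst
      have h1 := congrArg conjPt hst
      rw [conjPt_conjPt, conjPt_conjPt] at h1
      have := hPinj _ ⟨by linarith [s.2.2], by linarith⟩ _ ⟨by linarith [t.2.2], by linarith⟩ h1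
      exact Subtype.ext (by linarith)
  · intro t
    rw [hγ, hγ, unitInterval.coe_symm_eq]
    rcases lt_trichotomy (t : ℝ) (1 / 2) with h | h | h
    · rw [hF2 _ (by linarith) (by linarith [t.2.1]), hF1 _ ⟨t.2.1, h.le⟩, sub_sub_cancel]
    · rw [h, show (1 - 1 / 2 : ℝ) = 1 / 2 by norm_num, hF1 _ hhalf]
      exact hPh.1.2.symm
    · rw [hF2 _ h t.2.2, hF1 _ ⟨by linarith [t.2.2], by linarith⟩, conjPt_conjPt]
  · intro t ht
    rw [hγ] at ht ⊢
    rcases lt_trichotomy (t : ℝ) (1 / 2) with h | h | h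
    · rw [hF1 _ ⟨t.2.1, h.le⟩] at ht
      exact absurd ht.2 (hPd _ ⟨t.2.1, h⟩).2
    · rw [h, hF1 _ hhalf]; exact hPh
    · rw [hF2 _ h t.2.2] at ht
      have h1 := congrArg conjPt ht.2
      rw [conjPt_conjPt, conjPt_conjPt] at h1
      exact absurd h1 (hPd (1 - (t : ℝ)) ⟨by linarith [t.2.2], by linarith⟩).2
  · refine hPc.congr fun t ht => ?_
    have ht1 : t ∈ Set.Icc (0 : ℝ) 1 := ⟨ht.1, by linarith [ht.2]⟩
    rw [Path.extend_apply _ ht1, hγ]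
    exact hF1 t ht

end

/-! ### The surface in terms of the potentials -/

theorem tendsto_arg_ofReal_sub {c x : ℝ} (h : c < x) :
    Tendsto (fun z : ℂ => ((c : ℂ) - z).arg) (𝓝[{z : ℂ | z.im < 0}] (x : ℂ)) (𝓝 Real.pi) := by
  refine (tendsto_arg_nhdsWithin_im_nonneg_of_re_neg_of_im_zero (z := (c : ℂ) - x)
    (by simpa using h) (by simp)).comp (tendsto_nhdsWithin_iff.2 ⟨?_, ?_⟩)
  · exact (continuous_const.sub continuous_id).continuousAt.tendsto.mono_left inf_le_left
  · filter_upwards [self_mem_nhdsWithin] with z hz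
    have : z.im < 0 := hz
    simpa using this.le

theorem Potential.tendsto_zero_of_cobounded {S : SlitCurve} (p : Potential S {1}ᶜ)
    (h : Tendsto p.y (Bornology.cobounded ℂ) (𝓝 0)) {x : ℝ} (hx : 1 < x) :
    Tendsto p.y (𝓝[{z : ℂ | z.im < 0}] (x : ℂ)) (𝓝 0) := by
  have h1 : ContinuousAt p.y x := p.cont.continuousAt (p.isOpen_D.mem_nhds (by
    have := hx.ne'
    simpa using this))
  have h2 := h1.tendsto
  rw [potential_eq_zero p h hx] at h2
  exact h2.mono_left inf_le_left

section

variable {n : ℕ} {α β : Fin (n + 1) → ℝ}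

section

variable {S : SlitCurve} {p : Potential S {1}ᶜ} (ha : ∀ z, p.a z = 0)
  (hy : Tendsto p.y (Bornology.cobounded ℂ) (𝓝 0))
include hy

theorem vanishesAtArc_restrict (ha : ∀ z, p.a z = 0) (h : cutPlane ⊆ {1}ᶜ) :
    (p.restrict isOpen_cutPlane h).VanishesAtArc where
  a_cont := fun x hx => by
    have : p.a = fun _ => 0 := funext ha
    show ContinuousAt p.a x
    rw [this]
    exact continuousAt_const
  lim := fun x hx => p.tendsto_zero_of_cobounded hy hx

theorem vanishesAtArc_argPotential : (argPotential p ha).VanishesAtArc where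
  a_cont := fun x hx => by
    have h0 : (x : ℂ) ≠ 0 := by exact_mod_cast (one_pos.trans hx).ne'
    exact continuousAt_const.div (continuousAt_const.mul continuousAt_id)
      (mul_ne_zero two_ne_zero h0)
  lim := fun x hx => by
    have h1 := tendsto_arg_ofReal_sub (one_pos.trans hx)
    have h2 := ((h1.sub_const Real.pi).div_const 2).add (p.tendsto_zero_of_cobounded hy hx)
    simp only [ofReal_zero, zero_sub, sub_self, zero_div, add_zero] at h2
    exact h2

theorem vanishesAtArc_argPotential' : (argPotential' p ha).VanishesAtArc where
  a_cont := fun x hx => by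
    have h0 : (x : ℂ) ≠ 0 := by exact_mod_cast (one_pos.trans hx).ne'
    have h1 : (x : ℂ) - 1 ≠ 0 := sub_ne_zero.2 (by exact_mod_cast hx.ne')
    exact (continuousAt_id.add continuousAt_const).div
      ((continuousAt_const.mul continuousAt_id).mul (continuousAt_id.sub continuousAt_const))
      (mul_ne_zero (mul_ne_zero two_ne_zero h0) h1)
  lim := fun x hx => by
    have h1 := tendsto_arg_ofReal_sub (one_pos.trans hx)
    have h2 := ((tendsto_arg_ofReal_sub hx).sub ((h1.add_const Real.pi).div_const 2)).add
      (p.tendsto_zero_of_cobounded hy hx)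
    simp only [ofReal_zero, ofReal_one, zero_sub, add_self_div_two, sub_self, add_zero] at h2
    exact h2

end

variable (α β) in
/-- The constant factor of the integrand of `𝒵`. -/
def coefZ : ℂ := ((aPar α β : ℂ) + I) ^ (1 / 2 : ℂ) * (I - (aPar α β : ℂ)) *
  ((aPar α β : ℂ) - I) ^ (1 / 2 : ℂ)

variable (α β) in
/-- The constant factor of the integrand of `ϑ`. -/
def coefTheta : ℂ := ((aPar α β : ℂ) + I) ^ (1 / 2 : ℂ) * (I - (aPar α β : ℂ)) *
  (starRingEnd ℂ) (((aPar α β : ℂ) - I) ^ (1 / 2 : ℂ))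

theorem gFactor_ne_zero : ((aPar α β : ℂ) - I) ^ (1 / 2 : ℂ) ≠ 0 := by
  rw [Ne, cpow_eq_zero_iff, not_and_or]
  left
  intro h
  have := congrArg im h
  simp at this

theorem coefZ_ne_zero : coefZ α β ≠ 0 := by
  refine mul_ne_zero (mul_ne_zero ?_ ?_) gFactor_ne_zero
  · rw [Ne, cpow_eq_zero_iff, not_and_or]
    left
    intro h
    have := congrArg im h
    simp at this
  · intro h
    have := congrArg im h
    simp at this

theorem norm_coefTheta : ‖coefTheta α β‖ = ‖coefZ α β‖ := by
  rw [coefTheta, coefZ, norm_mul, norm_mul _ (_ ^ _), norm_conj]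

theorem coefTheta_div : coefTheta α β / coefZ α β =
    (starRingEnd ℂ) (((aPar α β : ℂ) - I) ^ (1 / 2 : ℂ)) /
      ((aPar α β : ℂ) - I) ^ (1 / 2 : ℂ) := by
  have h := coefZ_ne_zero (α := α) (β := β)
  rw [coefZ] at h
  rw [coefTheta, coefZ, mul_div_mul_left _ _ (left_ne_zero_of_mul h)]

section

variable (hα : ∀ i, 0 < α i) (hβ : ∀ i, 0 < β i) (hprod : ∏ i, α i = ∏ i, β i)
  (hgenus : spectralGenus α β = n)
include hα hβ hprod hgenus

theorem contourIntegral_pair {q : ℂ × ℂ} (hq : q ∈ regionZero α β)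
    {pA pB : Potential (spectralSlitCurve hα hβ hprod hgenus) cutPlane} (hA : pA.VanishesAtArc)
    (hB : pB.VanishesAtArc) {C : ℂ} {ω : ℂ × ℂ → ℂ}
    (hω : ∀ v ∈ curve α β, discRoot α β v ≠ 0 →
      ω v = C * (pA.onCurve α β v + I * pB.onCurve α β v)) :
    (2 * (Real.pi : ℂ) * I)⁻¹ * contourIntegral α β ω q = -(C / Real.pi * pA.pair pB q.1) := by
  have hex := exists_contour hα hβ hprod hgenus hq
  rw [contourIntegral, dif_pos hex,
    hex.choose_spec.curveIntegral_pair hα hβ hprod hgenus hq hA hB hω]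
  have : (Real.pi : ℂ) ≠ 0 := by exact_mod_cast Real.pi_ne_zero
  field_simp

theorem Zmap_eq {q : ℂ × ℂ} (hq : q ∈ regionZero α β) :
    Zmap α β q = ((2 * aPar α β * √(aPar α β ^ 2 + 1) : ℝ) : ℂ) -
      coefZ α β / Real.pi * (aztecCusp hα hβ hprod hgenus).Y q.1 := by
  obtain ⟨q1, -, -, y1⟩ := (aztecCusp hα hβ hprod hgenus).yA_spec
  obtain ⟨q2, a2, -, y2⟩ := (aztecCusp hα hβ hprod hgenus).yB_spec
  rw [Zmap, sub_eq_add_neg, contourIntegral_pair hα hβ hprod hgenus hq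
    (vanishesAtArc_argPotential _ y1) (vanishesAtArc_restrict y2 a2
      (aztecCusp hα hβ hprod hgenus).pA.ne_one) (C := coefZ α β)]
  · rfl
  · intro v hv hr
    rw [mem_curve_iff hα hβ] at hv
    have h1 := sub_ne_zero.2 hv.2.1
    have hz := hv.1
    rw [integrand_Z hα hβ hprod hv.1 hv.2.1, numA_eq hv.1 h1, numB_eq]
    simp only [Potential.onCurve, argPotential, Potential.restrict, q1, q2, a2]
    rw [coefZ]
    simp only [aztecCusp]
    field_simp
    ring

theorem thetaMap_eq {q : ℂ × ℂ} (hq : q ∈ regionZero α β) :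
    thetaMap α β q = -(coefTheta α β / Real.pi * Potential.pair (thetaA hα hβ hprod hgenus)
      (thetaB hα hβ hprod hgenus) q.1) := by
  obtain ⟨q1, -, -, y1⟩ := (exists_thetaA hα hβ hprod hgenus).choose_spec
  obtain ⟨q2, a2, -, y2⟩ := (exists_thetaB hα hβ hprod hgenus).choose_spec
  rw [thetaMap, contourIntegral_pair hα hβ hprod hgenus hq (vanishesAtArc_argPotential' _ y1)
    (vanishesAtArc_restrict y2 a2 (thetaA hα hβ hprod hgenus).ne_one) (C := coefTheta α β)]
  · rfl
  · intro v hv hr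
    rw [mem_curve_iff hα hβ] at hv
    have h1 := sub_ne_zero.2 hv.2.1
    have hz := hv.1
    rw [integrand_theta hα hβ hprod hv.1 hv.2.1, numA'_eq hv.1 h1, numB'_eq]
    simp only [Potential.onCurve, argPotential', Potential.restrict, q1, q2, a2]
    rw [coefTheta]
    field_simp
    ring

theorem injOn_Zmap : Set.InjOn (Zmap α β) (regionZero α β) := by
  intro q hq q' hq' h
  rw [Zmap_eq hα hβ hprod hgenus hq, Zmap_eq hα hβ hprod hgenus hq', sub_right_inj,
    mul_right_inj' (div_ne_zero coefZ_ne_zero (by exact_mod_cast Real.pi_ne_zero))] at h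
  rw [mem_regionZero_iff hα hβ hprod hgenus] at hq hq'
  have h1 := (aztecCusp hα hβ hprod hgenus).injOn_Y hq.1 hq'.1 h
  have n1 : ∀ {q : ℂ × ℂ}, q.1 ∈ slitDomain (discPoly (weightList α β)) → q.1 ≠ 1 := fun hq =>
    ne_one_of_mem (S := spectralSlitCurve hα hβ hprod hgenus) hq
  rw [← liftPt_discRoot (α := α) (β := β) (n1 hq.1), ← liftPt_discRoot (α := α) (β := β) (n1 hq'.1), hq.2, hq'.2, h1]

/-- A compact oval lies over a gap. -/
theorem IsCompactOval.mem_gaps {A : Set (ℂ × ℂ)} (hA : IsCompactOval α β A) {q : ℂ × ℂ}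
    (hq : q ∈ A) : ∃ x₀ r₀ : ℝ, x₀ ∈ (spectralSlitCurve hα hβ hprod hgenus).gaps ∧
      r₀ ^ 2 = (discPoly (weightList α β)).eval x₀ ∧ q.1 = x₀ ∧ discRoot α β q = r₀ := by
  obtain ⟨hAc, p, hp, rfl⟩ := hA
  have hsub := connectedComponentIn_subset (realLocus α β) p
  obtain ⟨hc, hreal⟩ := hsub hq
  rw [mem_curve_iff hα hβ] at hc
  rw [conjPt_eq_iff] at hreal
  have hx : q.1 = (q.1.re : ℂ) := Complex.ext rfl (by simp [hreal.1])
  have hr : discRoot α β q = ((discRoot α β q).re : ℂ) :=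
    Complex.ext rfl (by simp [(discRoot_im hreal.1 hc.2.1).2 hreal.2])
  obtain ⟨hc0, hc1, hc2⟩ := hc
  have hR : (discRoot α β q).re ^ 2 = (discPoly (weightList α β)).eval q.1.re := by
    rw [hr, hx, aeval_ofReal_eq] at hc2
    exact_mod_cast hc2
  refine ⟨q.1.re, (discRoot α β q).re, ⟨?_, hR ▸ sq_nonneg _⟩, hR, hx, hr⟩
  by_contra hneg
  have hpos : 0 < q.1.re := (not_lt.1 hneg).lt_of_ne fun h => hc0 (by rw [hx, ← h]; simp)
  have hne : q.1.re ≠ 1 := fun h => hc1 (by rw [hx, h]; simp)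
  obtain ⟨J, hJ, hxJ, hJp, hJ1⟩ : ∃ J : Set ℝ, IsPreconnected J ∧ q.1.re ∈ J ∧
      (∀ x ∈ J, 0 < x ∧ x ≠ 1) ∧ (1 : ℝ) ∈ closure J := by
    rcases hne.lt_or_gt with h | h
    · exact ⟨Set.Ioo 0 1, isPreconnected_Ioo, ⟨hpos, h⟩, fun x hx => ⟨hx.1, hx.2.ne⟩, by
        rw [closure_Ioo zero_ne_one]; simp⟩
    · exact ⟨Set.Ioi 1, isPreconnected_Ioi, h, fun x hx => ⟨one_pos.trans hx, ne_of_gt hx⟩, by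
        rw [closure_Ioi]; simp⟩
  obtain ⟨s, hs, hsr⟩ : ∃ s : ℝ, s ^ 2 = 1 ∧
      s * √((discPoly (weightList α β)).eval q.1.re) = (discRoot α β q).re := by
    rw [← hR, Real.sqrt_sq_eq_abs]
    rcases abs_cases (discRoot α β q).re with ⟨h1, -⟩ | ⟨h1, -⟩
    · exact ⟨1, by norm_num, by rw [h1, one_mul]⟩
    · exact ⟨-1, by norm_num, by rw [h1]; ring⟩
  set F : ℝ → ℂ × ℂ := fun x =>
    liftPt α β x ((s * √((discPoly (weightList α β)).eval x) : ℝ) : ℂ) with hF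
  have hFq : F q.1.re = q := by
    simp only [hF]
    rw [hsr, ← hx, ← hr, liftPt_discRoot hc1]
  have hF1 : ∀ x ∈ J, (x : ℂ) ≠ 1 := fun x hx => by exact_mod_cast (hJp x hx).2
  have hFc : ContinuousOn F J := by
    intro x hx
    have h1 := sub_ne_zero.2 (hF1 x hx)
    refine ContinuousAt.continuousWithinAt (continuous_ofReal.continuousAt.prodMk ?_)
    refine ContinuousAt.div (((aeval_continuous _).comp continuous_ofReal).continuousAt.add
      (continuous_ofReal.comp (continuous_const.mul
        (Polynomial.continuous _).sqrt)).continuousAt) (by fun_prop) ?_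
    exact mul_ne_zero two_ne_zero (pow_ne_zero _ h1)
  have hFr : F '' J ⊆ realLocus α β := by
    rintro _ ⟨x, hx, rfl⟩
    have h0 : (x : ℂ) ≠ 0 := by exact_mod_cast (hJp x hx).1.ne'
    refine ⟨liftPt_mem_curve hα hβ h0 (hF1 x hx) ?_, ?_⟩
    · rw [aeval_ofReal_eq, ← ofReal_pow, mul_pow, hs, one_mul, Real.sq_sqrt]
      exact (discPoly_pos _ (weightList_pos hα hβ) (weightList_ne_nil α β) (hJp x hx).1).le
    · rw [conjPt_eq_iff]
      refine ⟨ofReal_im _, ?_⟩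
      rw [← discRoot_im (q := F x) (ofReal_im _) (hF1 x hx), hF]
      simp only
      rw [discRoot_liftPt (hF1 x hx), ofReal_im]
  have hFA : F '' J ⊆ connectedComponentIn (realLocus α β) p := by
    rw [connectedComponentIn_eq hq]
    exact (hJ.image F hFc).subset_connectedComponentIn ⟨_, hxJ, hFq⟩ hFr
  have hcl : IsClosed ((fun q : ℂ × ℂ => q.1.re) '' connectedComponentIn (realLocus α β) p) :=
    (hAc.image (continuous_re.comp continuous_fst)).isClosed
  obtain ⟨v, hv, hv1⟩ := hcl.closure_subset_iff.2
    (fun x hx => (⟨F x, hFA ⟨x, hx, rfl⟩, rfl⟩ : x ∈ (fun q : ℂ × ℂ => q.1.re) ''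
      connectedComponentIn (realLocus α β) p)) hJ1
  obtain ⟨hvc, hvr⟩ := hsub hv
  exact ((mem_curve_iff hα hβ).1 hvc).2.1
    (Complex.ext (by simpa using hv1) (by simpa using (conjPt_eq_iff.1 hvr).1))

/-- Potentials are constant on compact ovals. -/
theorem IsCompactOval.potential_eq {A : Set (ℂ × ℂ)} (hA : IsCompactOval α β A)
    (p : Potential (spectralSlitCurve hα hβ hprod hgenus) cutPlane) {q q' : ℂ × ℂ}
    (hq : q ∈ A) (hq' : q' ∈ A) : p.y q.1 = p.y q'.1 := by
  have hpre : IsPreconnected ((fun q : ℂ × ℂ => q.1.re) '' A) := by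
    obtain ⟨-, p, -, rfl⟩ := hA
    exact isPreconnected_connectedComponentIn.image _
      (continuous_re.comp continuous_fst).continuousOn
  have key : ∀ v ∈ A, v.1.re ∈ (spectralSlitCurve hα hβ hprod hgenus).gaps ∧
      v.1 = (v.1.re : ℂ) := fun v hv => by
    obtain ⟨x, r, hx, -, h1, -⟩ := hA.mem_gaps hα hβ hprod hgenus hv
    rw [h1]; exact ⟨hx, rfl⟩
  rw [(key q hq).2, (key q' hq').2]
  refine p.eq_on_preconnected hpre ?_ ⟨q, hq, rfl⟩ ⟨q', hq', rfl⟩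
  rintro _ ⟨v, hv, rfl⟩
  exact ⟨gaps_mem_cutPlane (key v hv).1, (key v hv).1.2⟩

end

end

/-! ### The cusps of the surface -/

section

variable {n : ℕ} {α β : Fin (n + 1) → ℝ}
  (hα : ∀ i, 0 < α i) (hβ : ∀ i, 0 < β i) (hprod : ∏ i, α i = ∏ i, β i)
  (hgenus : spectralGenus α β = n)

/-- The coordinate `𝒵` as a function of `z`. -/
def surfZ (z : ℂ) : ℂ := ((2 * aPar α β * √(aPar α β ^ 2 + 1) : ℝ) : ℂ) -
  coefZ α β / Real.pi * (aztecCusp hα hβ hprod hgenus).Y z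

/-- The pair of potentials of the coordinate `ϑ`. -/
def thetaPair (z : ℂ) : ℂ :=
  Potential.pair (thetaA hα hβ hprod hgenus) (thetaB hα hβ hprod hgenus) z

/-- The point of the surface as a function of `z`. -/
def surfPt (z : ℂ) : ℂ × ℂ :=
  (surfZ hα hβ hprod hgenus z, -(coefTheta α β / Real.pi * thetaPair hα hβ hprod hgenus z))

theorem surfPt_eq {q : ℂ × ℂ} (hq : q ∈ regionZero α β) :
    (Zmap α β q, thetaMap α β q) = surfPt hα hβ hprod hgenus q.1 :=
  Prod.ext (Zmap_eq hα hβ hprod hgenus hq) (thetaMap_eq hα hβ hprod hgenus hq)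

theorem liftPt_mem_regionZero {z : ℂ} (hz : z ∈ (aztecCusp hα hβ hprod hgenus).S.dom) :
    liftPt α β z (sheet (weightList α β) z) ∈ regionZero α β :=
  (mem_regionZero_iff hα hβ hprod hgenus).2 ⟨hz, discRoot_liftPt (ne_one_of_mem hz)⟩

theorem surface_eq : surface α β =
    surfPt hα hβ hprod hgenus '' (aztecCusp hα hβ hprod hgenus).S.dom := by
  ext P
  constructor
  · rintro ⟨q, hq, rfl⟩
    exact ⟨q.1, ((mem_regionZero_iff hα hβ hprod hgenus).1 hq).1,
      (surfPt_eq hα hβ hprod hgenus hq).symm⟩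
  · rintro ⟨z, hz, rfl⟩
    exact ⟨_, liftPt_mem_regionZero hα hβ hprod hgenus hz, surfPt_eq hα hβ hprod hgenus
      (liftPt_mem_regionZero hα hβ hprod hgenus hz)⟩

theorem continuousAt_surfPt {z : ℂ} (hz : z ∈ cutPlane) :
    ContinuousAt (surfPt hα hβ hprod hgenus) z :=
  (continuousAt_const.sub (continuousAt_const.mul (CuspData.continuousAt_Y hz))).prodMk
    (continuousAt_const.mul (CuspData.continuousAt_pair _ _ hz)).neg

theorem IsCompactOval.surfPt_eq {A : Set (ℂ × ℂ)} (hA : IsCompactOval α β A) {q q' : ℂ × ℂ}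
    (hq : q ∈ A) (hq' : q' ∈ A) :
    surfPt hα hβ hprod hgenus q.1 = surfPt hα hβ hprod hgenus q'.1 := by
  have h := fun p => hA.potential_eq hα hβ hprod hgenus p hq hq'
  have h1 : (aztecCusp hα hβ hprod hgenus).Y q.1 = (aztecCusp hα hβ hprod hgenus).Y q'.1 :=
    Complex.ext (h (aztecCusp hα hβ hprod hgenus).pA) (h (aztecCusp hα hβ hprod hgenus).pB)
  have h2 : thetaPair hα hβ hprod hgenus q.1 = thetaPair hα hβ hprod hgenus q'.1 :=
    Complex.ext (h (thetaA hα hβ hprod hgenus)) (h (thetaB hα hβ hprod hgenus))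
  rw [surfPt, surfPt, surfZ, surfZ, h1, h2]

theorem IsCompactOval.tendsto {A : Set (ℂ × ℂ)} (hA : IsCompactOval α β A) {q : ℂ × ℂ}
    (hq : q ∈ A) : Tendsto (fun q => (Zmap α β q, thetaMap α β q))
      (𝓝ˢ A ⊓ 𝓟 (regionZero α β)) (𝓝 (surfPt hα hβ hprod hgenus q.1)) := by
  have h : Tendsto (fun q : ℂ × ℂ => surfPt hα hβ hprod hgenus q.1) (𝓝ˢ A)
      (𝓝 (surfPt hα hβ hprod hgenus q.1)) := by
    intro U hU
    refine mem_nhdsSet_iff_forall.2 fun q' hq' => ?_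
    obtain ⟨x, r, hx, -, h1, -⟩ := hA.mem_gaps hα hβ hprod hgenus hq'
    have h2 : ContinuousAt (fun q : ℂ × ℂ => surfPt hα hβ hprod hgenus q.1) q' :=
      ContinuousAt.comp (continuousAt_surfPt hα hβ hprod hgenus
        (by rw [h1]; exact gaps_mem_cutPlane hx)) continuousAt_fst
    refine h2 ?_
    show U ∈ 𝓝 (surfPt hα hβ hprod hgenus q'.1)
    rwa [hA.surfPt_eq hα hβ hprod hgenus hq' hq]
  refine (h.mono_left inf_le_left).congr' ?_
  filter_upwards [mem_inf_of_right (mem_principal_self _)] with q hq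
  exact (AztecGas.surfPt_eq hα hβ hprod hgenus hq).symm

theorem surfZ_scale_ne : coefZ α β / Real.pi ≠ 0 :=
  div_ne_zero coefZ_ne_zero (by exact_mod_cast Real.pi_ne_zero)

theorem surfZ_symm (K z y : ℂ) :
    (K - z) / (coefZ α β / Real.pi) = y ↔ z = K - coefZ α β / Real.pi * y := by
  rw [div_eq_iff surfZ_scale_ne]
  constructor <;> intro h <;> linear_combination -h

variable {x₀ : ℝ} (hx : x₀ ∈ (aztecCusp hα hβ hprod hgenus).S.gaps)
include hx

theorem eventually_mem_image_Zmap : ∀ᶠ z in 𝓝[≠] (surfZ hα hβ hprod hgenus x₀),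
    z ∈ Zmap α β '' regionZero α β := by
  set D := aztecCusp hα hβ hprod hgenus with hD
  have h1 := CuspData.image_mem_nhdsNE_level (tA := D.pA) (tB := D.pB) (c := D.Y x₀) (θ := D.Y x₀)
    ⟨x₀, hx, rfl, rfl⟩ isOpen_univ fun _ _ => trivial
  set K : ℂ := ((2 * aPar α β * √(aPar α β ^ 2 + 1) : ℝ) : ℂ) with hK
  have h2 : surfZ hα hβ hprod hgenus x₀ = K - coefZ α β / Real.pi * D.Y x₀ := rfl
  have h3 : Tendsto (fun z => (K - z) / (coefZ α β / Real.pi))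
      (𝓝[≠] (surfZ hα hβ hprod hgenus x₀)) (𝓝[≠] (D.Y x₀)) := by
    refine tendsto_nhdsWithin_iff.2 ⟨?_, ?_⟩
    · refine (Continuous.tendsto' (by fun_prop) _ _ ?_).mono_left inf_le_left
      exact (surfZ_symm _ _ _).2 h2
    · filter_upwards [self_mem_nhdsWithin] with z hz hzz
      apply hz
      exact ((surfZ_symm _ _ _).1 hzz).trans h2.symm
  filter_upwards [h3 h1] with z hz
  obtain ⟨w, hw, hwz⟩ := hz
  refine ⟨_, liftPt_mem_regionZero hα hβ hprod hgenus hw.1, ?_⟩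
  rw [Zmap_eq hα hβ hprod hgenus (liftPt_mem_regionZero hα hβ hprod hgenus hw.1)]
  show K - coefZ α β / Real.pi * D.Y w = z
  exact ((surfZ_symm _ _ _).1 hwz.symm).symm

theorem eventually_surface_lightlike {η : ℝ} (hη : 0 < η) :
    ∀ᶠ P in 𝓝 (surfPt hα hβ hprod hgenus x₀), P ∈ surface α β →
      |‖P.2 - (surfPt hα hβ hprod hgenus x₀).2‖ - ‖P.1 - (surfPt hα hβ hprod hgenus x₀).1‖| ≤
        η * ‖P.1 - (surfPt hα hβ hprod hgenus x₀).1‖ := by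
  set D := aztecCusp hα hβ hprod hgenus with hD
  have h1 := CuspData.eventually_lightlike (isIsometric_theta hα hβ hprod hgenus)
    (c := D.Y x₀) (θ := thetaPair hα hβ hprod hgenus x₀) ⟨x₀, hx, rfl, rfl⟩ hη
  set K : ℂ := ((2 * aPar α β * √(aPar α β ^ 2 + 1) : ℝ) : ℂ) with hK
  have h3 : Tendsto (fun P : ℂ × ℂ => (K - P.1) / (coefZ α β / Real.pi))
      (𝓝 (surfPt hα hβ hprod hgenus x₀)) (𝓝 (D.Y x₀)) := by
    exact Continuous.tendsto' (by fun_prop) _ _ ((surfZ_symm _ _ _).2 rfl)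
  filter_upwards [h3.eventually h1] with P hP hPS
  rw [surface_eq hα hβ hprod hgenus] at hPS
  obtain ⟨z, hz, rfl⟩ := hPS
  have h4 := hP z hz ((surfZ_symm _ _ _).2 rfl).symm
  have e1 : (surfPt hα hβ hprod hgenus z).1 - (surfPt hα hβ hprod hgenus x₀).1 =
      -(coefZ α β / Real.pi * (D.Y z - D.Y x₀)) := by
    show K - coefZ α β / Real.pi * D.Y z - (K - coefZ α β / Real.pi * D.Y x₀) = _
    ring
  have e2 : (surfPt hα hβ hprod hgenus z).2 - (surfPt hα hβ hprod hgenus x₀).2 =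
      -(coefTheta α β / Real.pi * (thetaPair hα hβ hprod hgenus z -
        thetaPair hα hβ hprod hgenus x₀)) := by
    show -(coefTheta α β / Real.pi * _) - -(coefTheta α β / Real.pi * _) = _
    ring
  have e3 : (K - (surfPt hα hβ hprod hgenus z).1) / (coefZ α β / Real.pi) = D.Y z :=
    (surfZ_symm _ _ _).2 rfl
  rw [e3] at h4
  have h4 : |‖thetaPair hα hβ hprod hgenus z - thetaPair hα hβ hprod hgenus x₀‖ -
    ‖D.Y z - D.Y x₀‖| ≤ η * ‖D.Y z - D.Y x₀‖ := h4
  rw [e1, e2, norm_neg, norm_neg, norm_mul, norm_mul, norm_div, norm_coefTheta, ← norm_div,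
    ← mul_sub, abs_mul, abs_of_nonneg (norm_nonneg _)]
  calc _ ≤ ‖coefZ α β / Real.pi‖ * (η * ‖D.Y z - D.Y x₀‖) := by gcongr
    _ = _ := by ring

theorem isLightlikeCusp_surface : IsLightlikeCusp (surface α β) (surfPt hα hβ hprod hgenus x₀) := by
  refine ⟨?_, ?_, ?_⟩
  · rw [surface_eq hα hβ hprod hgenus]
    exact mem_closure_image (continuousAt_surfPt hα hβ hprod hgenus
      (gaps_mem_cutPlane hx)) (lower_mem_closure_dom (ofReal_im _))
  · rw [surface_eq hα hβ hprod hgenus]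
    rintro ⟨z, hz, h⟩
    have h1 := congrArg Prod.fst h
    simp only [surfPt, surfZ, sub_right_inj] at h1
    exact CuspData.Y_gap_not_mem hx ⟨z, hz, mul_left_cancel₀ surfZ_scale_ne h1⟩
  · intro v hv
    obtain ⟨ι, l, hl, c, d, hd, hdS, hcd⟩ := exists_fun_of_mem_tangentConeAt hv
    have key : ∀ η > 0, |‖v.2‖ - ‖v.1‖| ≤ η * ‖v.1‖ := by
      intro η hη
      have h1 : Tendsto (fun i => surfPt hα hβ hprod hgenus x₀ + d i) l
          (𝓝 (surfPt hα hβ hprod hgenus x₀)) := by simpa using hd.const_add _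
      have c1 : Continuous (fun p : ℂ × ℂ => |‖p.2‖ - ‖p.1‖|) := by fun_prop
      have c2 : Continuous (fun p : ℂ × ℂ => η * ‖p.1‖) := by fun_prop
      refine le_of_tendsto_of_tendsto ((c1.tendsto v).comp hcd) ((c2.tendsto v).comp hcd) ?_
      filter_upwards [h1.eventually (eventually_surface_lightlike hα hβ hprod hgenus hx hη), hdS]
        with i h2 h3
      have h4 := h2 h3
      rw [Prod.fst_add, Prod.snd_add, add_sub_cancel_left, add_sub_cancel_left] at h4
      simp only [Function.comp, Prod.smul_fst, Prod.smul_snd, norm_smul, ← mul_sub, abs_mul,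
        abs_norm]
      calc _ ≤ ‖c i‖ * (η * ‖(d i).1‖) := by gcongr
        _ = _ := by ring
    have h0 : |‖v.2‖ - ‖v.1‖| = 0 := by
      refine le_antisymm (le_of_forall_pos_le_add fun δ hδ => ?_) (abs_nonneg _)
      refine (key (δ / (‖v.1‖ + 1)) (by positivity)).trans ?_
      rw [zero_add, div_mul_eq_mul_div, div_le_iff₀ (by positivity)]
      nlinarith [norm_nonneg v.1]
    rw [minkowskiSq, sub_eq_zero.1 (abs_eq_zero.1 h0), sub_self]

end

/-! ### The direction of a cusp and the slope along a ray -/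

section

variable {n : ℕ} {α β : Fin (n + 1) → ℝ}

variable (α β) in
/-- The numerator of the differential of `𝒵` on the spectral curve. -/
def numZ (q : ℂ × ℂ) : ℂ :=
  numA (weightList α β) q.1 (discRoot α β q) + I * numB (weightList α β) (sPar α β) q.1

variable (α β) in
/-- The numerator of the differential of `ϑ` on the spectral curve. -/
def numTheta (q : ℂ × ℂ) : ℂ :=
  numA' (weightList α β) q.1 (discRoot α β q) + I * numB' (weightList α β) (sPar α β) q.1

theorem continuousAt_num {q : ℂ × ℂ} (h0 : q.1 ≠ 0) :
    ContinuousAt (numZ α β) q ∧ ContinuousAt (numTheta α β) q := by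
  have h1 : ContinuousAt (discRoot α β) q := continuous_discRoot.continuousAt
  have h2 : ∀ p : ℝ[X], ContinuousAt (fun q : ℂ × ℂ => aeval q.1 p) q := fun p =>
    ((aeval_continuous p).comp continuous_fst).continuousAt
  have h3 : ContinuousAt (fun q : ℂ × ℂ => q.1) q := continuousAt_fst
  have ha : ContinuousAt (fun q => adjEntry (weightList α β) q.1 (discRoot α β q)) q :=
    (h1.div_const 2).add (h3.mul (h2 _))
  have hb : ContinuousAt (fun q => diagEntry (weightList α β) q.1 (discRoot α β q) / q.1) q :=
    ((h1.div_const 2).sub (h3.mul (h2 _))).div h3 h0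
  exact ⟨(ha.sub hb).add (continuousAt_const.mul ((continuousAt_const.mul (h2 _)).add
      ((h2 _).div_const _))),
    (ha.add hb).add (continuousAt_const.mul ((continuousAt_const.mul (h2 _)).sub
      ((h2 _).div_const _)))⟩

theorem diagEntry_conjPt (q : ℂ × ℂ) :
    diagEntry (weightList α β) (conjPt q).1 (discRoot α β (conjPt q)) =
      (starRingEnd ℂ) (diagEntry (weightList α β) q.1 (discRoot α β q)) := by
  rw [discRoot_conj, diagEntry, diagEntry, show (conjPt q).1 = (starRingEnd ℂ) q.1 from rfl,
    aeval_conj_eq]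
  simp only [map_sub, map_mul, map_div₀, map_ofNat]

section

variable (hα : ∀ i, 0 < α i) (hβ : ∀ i, 0 < β i) (hprod : ∏ i, α i = ∏ i, β i)
include hα hβ hprod

theorem Gfun_eq {q : ℂ × ℂ} (hq : q ∈ curve α β) (hr : discRoot α β q ≠ 0)
    (hb : diagEntry (weightList α β) q.1 (discRoot α β q) ≠ 0) :
    Gfun α β q = ((aPar α β : ℂ) - I) ^ (1 / 2 : ℂ) *
      (aeval q.1 (polySymbol (weightList α β) 0 1) /
        diagEntry (weightList α β) q.1 (discRoot α β q) + I / (sPar α β * q.1)) := by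
  have hq' := (mem_curve_iff hα hβ).1 hq
  have hs : (sPar α β : ℂ) ≠ 0 := by exact_mod_cast (sPar_pos hα hβ).ne'
  have hz := hq'.1
  have h1 := diagEntry_mul hβ hprod hq'.2.2
  have h2 : adjEntry (weightList α β) q.1 (discRoot α β q) +
      diagEntry (weightList α β) q.1 (discRoot α β q) = discRoot α β q := by
    rw [adjEntry, diagEntry]; ring
  simp only [Gfun, vVec, uVec, gVec, Qmat_eq hα hβ hprod hq'.1 hq'.2.1, dotProduct,
    Fin.sum_univ_two, Matrix.smul_apply, Pi.smul_apply, Matrix.of_apply, Matrix.cons_val',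
    Matrix.cons_val_zero, Matrix.cons_val_one, Matrix.cons_val_fin_one, smul_eq_mul]
  set D := discRoot α β q
  set b := diagEntry (weightList α β) q.1 D
  set p := aeval q.1 (polySymbol (weightList α β) 0 1)
  set l := aeval q.1 (lowPoly (weightList α β))
  have e : D⁻¹ * b * (D⁻¹ * b) + D⁻¹ * p * (D⁻¹ * (q.1 * l)) = b / D := by
    field_simp
    linear_combination b * h2 - h1
  rw [e]
  field_simp
  ring

theorem gRatio_eq {q : ℂ × ℂ} (hq : q ∈ curve α β) (hr : discRoot α β q ≠ 0)
    (hb : diagEntry (weightList α β) q.1 (discRoot α β q) ≠ 0) (hN : numZ α β q ≠ 0) :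
    GBar α β q / Gfun α β q =
      coefTheta α β / coefZ α β * (numTheta α β q / numZ α β q) := by
  have hq' := (mem_curve_iff hα hβ).1 hq
  have hs : (sPar α β : ℂ) ≠ 0 := by exact_mod_cast (sPar_pos hα hβ).ne'
  have hz := hq'.1
  have h1 := diagEntry_mul hβ hprod hq'.2.2
  have hG := Gfun_eq hα hβ hprod hq hr hb
  have hG' := Gfun_eq hα hβ hprod (conjPt_mem_curve hα hβ hq)
    (by rw [discRoot_conj]; exact (_root_.map_ne_zero _).2 hr)
    (by rw [diagEntry_conjPt]; exact (_root_.map_ne_zero _).2 hb)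
  rw [diagEntry_conjPt, show (conjPt q).1 = (starRingEnd ℂ) q.1 from rfl, aeval_conj_eq] at hG'
  rw [GBar, hG', hG, coefTheta_div]
  simp only [map_mul, map_add, map_div₀, conj_conj, conj_I, conj_ofReal]
  rw [mul_div_mul_comm]
  congr 1
  rw [numZ] at hN ⊢
  rw [numTheta]
  simp only [numA, numB, numA', numB'] at hN ⊢
  set D := discRoot α β q
  set a := adjEntry (weightList α β) q.1 D
  set b := diagEntry (weightList α β) q.1 D
  set p := aeval q.1 (polySymbol (weightList α β) 0 1)
  set l := aeval q.1 (lowPoly (weightList α β))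
  set s := (sPar α β : ℂ)
  have key : (a + b / q.1 + I * (s * p - l / s)) * (p / b + I / (s * q.1)) =
      (p / b + -I / (s * q.1)) * (a - b / q.1 + I * (s * p + l / s)) := by
    field_simp
    linear_combination q.1 * (2 * I * s * h1 + 2 * s ^ 2 * b * p * I_sq)
  have hne : p / b + I / (s * q.1) ≠ 0 := by
    intro h
    rw [h, mul_zero, eq_comm, mul_eq_zero, or_iff_left hN] at key
    have h2 : 2 * (I / (s * q.1)) = 0 := by linear_combination h - key
    exact div_ne_zero I_ne_zero (mul_ne_zero hs hz) ((mul_eq_zero.1 h2).resolve_left two_ne_zero)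
  rw [div_eq_div_iff hne hN, key]

theorem isGRatioAt {q' : ℂ × ℂ} (hq' : q' ∈ curve α β) (hN : numZ α β q' ≠ 0) :
    IsGRatioAt α β q' (coefTheta α β / coefZ α β * (numTheta α β q' / numZ α β q')) := by
  have hc := (mem_curve_iff hα hβ).1 hq'
  obtain ⟨c1, c2⟩ := continuousAt_num (α := α) (β := β) hc.1
  have hlim : Tendsto (fun q => coefTheta α β / coefZ α β * (numTheta α β q / numZ α β q))
      (𝓝[curve α β \ {q'}] q')
      (𝓝 (coefTheta α β / coefZ α β * (numTheta α β q' / numZ α β q'))) :=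
    ((c2.tendsto.div c1.tendsto hN).const_mul _).mono_left inf_le_left
  refine hlim.congr' ?_
  obtain ⟨h5, -, -, -, h6⟩ :=
    eval_polySymbol_pos _ (weightList_pos hα hβ) (x := 1) one_pos
  have p1 : polySymbol (weightList α β) 0 1 ≠ 0 := fun h => by
    have := (h6 (weightList_ne_nil α β)).1
    rw [h] at this; simp at this
  have p2 : lowPoly (weightList α β) ≠ 0 := fun h => by
    have h7 := lowPoly_mul_X (weightList α β)
    have := (h6 (weightList_ne_nil α β)).2
    rw [← h7, h] at this; simp at this
  have p3 : discPoly (weightList α β) ≠ 0 := fun h => by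
    have := discPoly_pos _ (weightList_pos hα hβ) (weightList_ne_nil α β) one_pos
    rw [h] at this; simp at this
  set W := discPoly (weightList α β) * (lowPoly (weightList α β) * polySymbol (weightList α β) 0 1)
    with hW
  have hW0 : W.map (algebraMap ℝ ℂ) ≠ 0 := (Polynomial.map_ne_zero_iff
    (algebraMap ℝ ℂ).injective).2 (mul_ne_zero p3 (mul_ne_zero p2 p1))
  have hroots : ∀ᶠ z in 𝓝[≠] q'.1, aeval z W ≠ 0 := by
    have h := (W.map (algebraMap ℝ ℂ)).roots.toFinset.finite_toSet.sdiff (t := {q'.1})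
    filter_upwards [mem_nhdsWithin_of_mem_nhds (h.isClosed.isOpen_compl.mem_nhds
      (show q'.1 ∈ (_ \ {q'.1})ᶜ from fun hx => hx.2 rfl)), self_mem_nhdsWithin] with z hz hz' h0
    refine hz ⟨?_, hz'⟩
    simp only [Finset.mem_coe, Multiset.mem_toFinset]
    rw [mem_roots hW0, IsRoot, eval_map_algebraMap, h0]
  rw [eventually_nhdsWithin_iff] at hroots
  have e1 : ∀ᶠ q in 𝓝[curve α β \ {q'}] q', numZ α β q ≠ 0 :=
    eventually_nhdsWithin_of_eventually_nhds (c1.eventually_ne hN)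
  have e2 : ∀ᶠ q : ℂ × ℂ in 𝓝[curve α β \ {q'}] q', q.1 ∈ ({q'.1}ᶜ : Set ℂ) → aeval q.1 W ≠ 0 :=
    eventually_nhdsWithin_of_eventually_nhds (continuousAt_fst.eventually hroots)
  have e3 : ∀ᶠ q : ℂ × ℂ in 𝓝[curve α β \ {q'}] q',
      discRoot α β q = -discRoot α β q' → discRoot α β q = discRoot α β q' := by
    by_cases h0 : discRoot α β q' = 0
    · exact Eventually.of_forall fun q hq => by rw [hq, h0, neg_zero]
    · have : discRoot α β q' ≠ -discRoot α β q' := fun h => h0 (by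
        have : (2 : ℂ) * discRoot α β q' = 0 := by linear_combination h
        exact (mul_eq_zero.1 this).resolve_left two_ne_zero)
      filter_upwards [eventually_nhdsWithin_of_eventually_nhds
        (continuous_discRoot.continuousAt.eventually_ne this)] with q hq h
      exact absurd h hq
  filter_upwards [e1, e2, e3, self_mem_nhdsWithin] with q k1 k2 k3 hq
  have hqc := (mem_curve_iff hα hβ).1 hq.1
  have hne : q.1 ∈ ({q'.1}ᶜ : Set ℂ) := by
    intro h
    have h : q.1 = q'.1 := h
    have h7 : discRoot α β q = discRoot α β q' := by
      have : discRoot α β q ^ 2 = discRoot α β q' ^ 2 := by rw [hqc.2.2, hc.2.2, h]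
      exact (sq_eq_sq_iff_eq_or_eq_neg.1 this).elim id k3
    apply hq.2
    rw [Set.mem_singleton_iff, ← liftPt_discRoot hqc.2.1, ← liftPt_discRoot hc.2.1, h, h7]
  have h8 := k2 hne
  rw [hW, map_mul, map_mul, mul_ne_zero_iff, mul_ne_zero_iff] at h8
  have hr : discRoot α β q ≠ 0 := fun h => h8.1 (by rw [← hqc.2.2, h]; norm_num)
  have hb : diagEntry (weightList α β) q.1 (discRoot α β q) ≠ 0 := fun h => by
    have := diagEntry_mul hβ hprod hqc.2.2
    rw [h, zero_mul, eq_comm, mul_eq_zero, mul_eq_zero, or_iff_right hqc.1] at this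
    exact this.elim h8.2.1 h8.2.2
  exact (gRatio_eq hα hβ hprod hq.1 hr hb k1).symm

end

section

variable (hα : ∀ i, 0 < α i) (hβ : ∀ i, 0 < β i) (hprod : ∏ i, α i = ∏ i, β i)
  (hgenus : spectralGenus α β = n) {x₀ r₀ : ℝ}
  (hx : x₀ ∈ (aztecCusp hα hβ hprod hgenus).S.gaps)
  (c : Chart (aztecCusp hα hβ hprod hgenus).S x₀ r₀)

/-- The direction of the ray at a point of a compact oval. -/
def rayDir : ℂ := -(coefZ α β / ‖coefZ α β‖ * (CuspData.nSlope c / ‖CuspData.nSlope c‖))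

/-- The slope of the pair of potentials of `ϑ` at a point of a compact oval. -/
def thetaSlope : ℂ :=
  Potential.pairSlope c (thetaA hα hβ hprod hgenus) (thetaB hα hβ hprod hgenus)

include hx

theorem norm_rayDir : ‖rayDir hα hβ hprod hgenus c‖ = 1 := by
  have h1 := norm_ne_zero_iff.2 (coefZ_ne_zero (α := α) (β := β))
  have h2 := norm_ne_zero_iff.2 (CuspData.nSlope_ne (c := c) hx)
  rw [rayDir, norm_neg, norm_mul, norm_div, norm_div, norm_real, norm_real, norm_norm, norm_norm,
    div_self h1, div_self h2, one_mul]

theorem isRayDirection {q' : ℂ × ℂ} (h1 : q'.1 = x₀) (h2 : discRoot α β q' = r₀) :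
    IsRayDirection α β q' (surfZ hα hβ hprod hgenus x₀) (rayDir hα hβ hprod hgenus c) := by
  refine ⟨norm_rayDir hα hβ hprod hgenus hx c, ?_⟩
  have hcont : Tendsto (fun q : ℂ × ℂ => (q.1, discRoot α β q)) (𝓝[regionZero α β] q')
      (𝓝 ((x₀ : ℂ), (r₀ : ℂ))) := by
    rw [← h1, ← h2]
    exact ((continuous_fst.prodMk continuous_discRoot).tendsto q').mono_left inf_le_left
  have hinv : ∀ᶠ q in 𝓝[regionZero α β] q', c.inv (q.1, discRoot α β q) ∈ halfDisc c.ε ∧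
      c.Z (c.inv (q.1, discRoot α β q)) = q.1 := by
    filter_upwards [hcont.eventually c.inv_im_pos, self_mem_nhdsWithin] with q h3 hq
    obtain ⟨h4, h5⟩ := (mem_regionZero_iff hα hβ hprod hgenus).1 hq
    exact h3 h4 h5
  have hχ : Tendsto (fun q : ℂ × ℂ => c.inv (q.1, discRoot α β q)) (𝓝[regionZero α β] q')
      (𝓝[{χ : ℂ | 0 < χ.im}] 0) :=
    tendsto_nhdsWithin_iff.2 ⟨c.tendsto_inv.comp hcont, hinv.mono fun q hq => hq.1.1⟩
  have hlim := (((CuspData.tendsto_direction c hx).comp hχ).const_mul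
    (coefZ α β / ‖coefZ α β‖)).neg
  refine hlim.congr' ?_
  filter_upwards [hinv, self_mem_nhdsWithin] with q h3 hq
  have e : Zmap α β q - surfZ hα hβ hprod hgenus x₀ =
      -(coefZ α β / Real.pi * ((aztecCusp hα hβ hprod hgenus).Y q.1 - (aztecCusp hα hβ hprod hgenus).Y x₀)) := by
    rw [Zmap_eq hα hβ hprod hgenus hq, surfZ]
    ring
  have hπ : (Real.pi : ℂ) ≠ 0 := by exact_mod_cast Real.pi_ne_zero
  rw [e, norm_neg, norm_mul, norm_div, norm_real, Real.norm_of_nonneg Real.pi_pos.le]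
  simp only [Function.comp]
  rw [h3.2, ofReal_mul, ofReal_div, neg_div, mul_div_mul_comm, div_div_div_cancel_right₀ hπ]

theorem isBigO_ray {k : ℂ} (hk : k = coefTheta α β / coefZ α β *
      (thetaSlope hα hβ hprod hgenus c /
        CuspData.nSlope c)) :
    (fun z => thetaMap α β (Zinv α β z) - (surfPt hα hβ hprod hgenus x₀).2 -
      k * (z - surfZ hα hβ hprod hgenus x₀))
      =O[𝓝[openRay (surfZ hα hβ hprod hgenus x₀) (rayDir hα hβ hprod hgenus c)]
        (surfZ hα hβ hprod hgenus x₀)] (fun z => (z - surfZ hα hβ hprod hgenus x₀) ^ 2) := by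
  have hC := coefZ_ne_zero (α := α) (β := β)
  have hn := CuspData.nSlope_ne (c := c) hx
  have hCn := norm_pos_iff.2 hC
  have hnn := norm_pos_iff.2 hn
  have hC' : (‖coefZ α β‖ : ℂ) ≠ 0 := by exact_mod_cast hCn.ne'
  have hn' : (‖CuspData.nSlope c‖ : ℂ) ≠ 0 := by exact_mod_cast hnn.ne'
  have hπ : (Real.pi : ℂ) ≠ 0 := by exact_mod_cast Real.pi_ne_zero
  have he := norm_rayDir hα hβ hprod hgenus hx c
  obtain ⟨M, hM⟩ := CuspData.ray_estimate (isIsometric_theta hα hβ hprod hgenus) c hx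
  have hhit := CuspData.ray_hit c hx hM
  set Z₀ := surfZ hα hβ hprod hgenus x₀ with hZ₀
  set m : ℝ := Real.pi / (‖coefZ α β‖ * ‖CuspData.nSlope c‖) with hm
  have hmpos : 0 < m := by have := Real.pi_pos; positivity
  have hray : ∀ z ∈ openRay Z₀ (rayDir hα hβ hprod hgenus c),
      0 < ‖z - Z₀‖ ∧ z = Z₀ + ‖z - Z₀‖ * rayDir hα hβ hprod hgenus c := by
    rintro _ ⟨t, ht, rfl⟩
    have : ‖Z₀ + t * rayDir hα hβ hprod hgenus c - Z₀‖ = t := by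
      rw [add_sub_cancel_left, norm_mul, he, mul_one, norm_real, Real.norm_of_nonneg ht.le]
    rw [this]
    exact ⟨ht, rfl⟩
  have hT : Tendsto (fun z => ‖z - Z₀‖ * m)
      (𝓝[openRay Z₀ (rayDir hα hβ hprod hgenus c)] Z₀) (𝓝[>] 0) := by
    refine tendsto_nhdsWithin_iff.2 ⟨?_, ?_⟩
    · exact (Continuous.tendsto' (by fun_prop) _ _ (by simp)).mono_left inf_le_left
    · filter_upwards [self_mem_nhdsWithin] with z hz
      exact mul_pos (hray z hz).1 hmpos
  refine Asymptotics.IsBigO.of_bound (‖coefTheta α β‖ / Real.pi * (M * m ^ 2)) ?_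
  filter_upwards [hT.eventually hhit, self_mem_nhdsWithin] with z hz hzr
  obtain ⟨χ, hχ, hest, hY⟩ := hz
  obtain ⟨hdom, -⟩ := c.mem_dom χ hχ
  have hq := liftPt_mem_regionZero hα hβ hprod hgenus hdom
  set q := liftPt α β (c.Z χ) (sheet (weightList α β) (c.Z χ)) with hqd
  have hZq : Zmap α β q = z := by
    rw [Zmap_eq hα hβ hprod hgenus hq]
    show _ - _ * (aztecCusp hα hβ hprod hgenus).Y (c.Z χ) = z
    have e1 : coefZ α β / Real.pi * ((‖z - Z₀‖ * m : ℝ) * CuspData.nSlope c) =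
        -(‖z - Z₀‖ * rayDir hα hβ hprod hgenus c) := by
      rw [rayDir, hm]
      push_cast
      field_simp
    have e2 := (hray z hzr).2
    have e3 : Z₀ = ((2 * aPar α β * √(aPar α β ^ 2 + 1) : ℝ) : ℂ) -
      coefZ α β / Real.pi * (aztecCusp hα hβ hprod hgenus).Y x₀ := rfl
    rw [hY]
    linear_combination -e1 - e2 - e3
  have hinv : Zinv α β z = q := by
    rw [← hZq]
    exact (injOn_Zmap hα hβ hprod hgenus).leftInvOn_invFunOn hq
  have h3 := hest hχ.1 _ hY
  have e : thetaMap α β q - (surfPt hα hβ hprod hgenus x₀).2 - k * (z - Z₀) =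
      -(coefTheta α β / Real.pi * (thetaPair hα hβ hprod hgenus (c.Z χ) -
        thetaPair hα hβ hprod hgenus x₀ - thetaSlope hα hβ hprod hgenus c / CuspData.nSlope c * ((aztecCusp hα hβ hprod hgenus).Y (c.Z χ) - (aztecCusp hα hβ hprod hgenus).Y x₀))) := by
    rw [← hZq, thetaMap_eq hα hβ hprod hgenus hq, Zmap_eq hα hβ hprod hgenus hq, hk, hZ₀]
    show -(_ * thetaPair hα hβ hprod hgenus (c.Z χ)) - -(_ * _) -
      _ * (_ - _ * (aztecCusp hα hβ hprod hgenus).Y (c.Z χ) - (_ - _ * (aztecCusp hα hβ hprod hgenus).Y x₀)) = _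
    field_simp
    ring
  rw [hinv, e, norm_neg, norm_mul, norm_div, norm_real, Real.norm_of_nonneg Real.pi_pos.le,
    norm_pow]
  have := Real.pi_pos
  calc _ ≤ ‖coefTheta α β‖ / Real.pi * (M * (‖z - Z₀‖ * m) ^ 2) := by gcongr; exact h3
    _ = _ := by ring

/-- The value of the slope of the surface at a point of a compact oval. -/
theorem slope_eq {q' : ℂ × ℂ} (h1 : q'.1 = x₀) (h2 : discRoot α β q' = r₀) : numZ α β q' ≠ 0 ∧
    coefTheta α β / coefZ α β * (numTheta α β q' / numZ α β q') = coefTheta α β / coefZ α β *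
      (thetaSlope hα hβ hprod hgenus c /
        CuspData.nSlope c) ∧
    ‖coefTheta α β / coefZ α β * (numTheta α β q' / numZ α β q')‖ = 1 := by
  have hx1 : (x₀ : ℂ) - 1 ≠ 0 := by
    have : x₀ - 1 ≠ 0 := by linarith [hx.1]
    exact_mod_cast this
  have hn := CuspData.nSlope_ne (c := c) hx
  have e1 := nSlope_eq hα hβ hprod hgenus c hx.1
  have e2 := pairSlope_theta_eq hα hβ hprod hgenus c hx.1
  have e3 : numZ α β q' = numA (weightList α β) x₀ r₀ +
      I * numB (weightList α β) (sPar α β) x₀ := by rw [numZ, h1, h2]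
  have e4 : numTheta α β q' = numA' (weightList α β) x₀ r₀ +
      I * numB' (weightList α β) (sPar α β) x₀ := by rw [numTheta, h1, h2]
  rw [← e3] at e1
  rw [← e4, ← thetaSlope] at e2
  have h3 : c.j 0 * numZ α β q' ≠ 0 := e1 ▸ mul_ne_zero hn hx1
  have hj := left_ne_zero_of_mul h3
  have hN := right_ne_zero_of_mul h3
  have h4 : numTheta α β q' / numZ α β q' = thetaSlope hα hβ hprod hgenus c / CuspData.nSlope c := by
    rw [← mul_div_mul_left _ _ hj, ← e1, ← e2, mul_div_mul_right _ _ hx1]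
  refine ⟨hN, by rw [h4], ?_⟩
  rw [h4, norm_mul, norm_div, norm_coefTheta, norm_div, thetaSlope, isIsometric_theta hα hβ hprod hgenus x₀ r₀ hx c,
    div_self (norm_ne_zero_iff.2 coefZ_ne_zero), div_self (norm_ne_zero_iff.2 hn), one_mul]

end

end

end AztecGas

end

theorem mainTheorem5 (n : ℕ) (α β : Fin (n + 1) → ℝ)
    (hα : ∀ i, 0 < α i) (hβ : ∀ i, 0 < β i)
    (hprod : ∏ i, α i = ∏ i, β i)
    (hgenus : spectralGenus α β = n) :
    Set.InjOn (Zmap α β) (regionZero α β) ∧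
    ∀ A : Set (ℂ × ℂ), IsCompactOval α β A →
      ∃ Z₀ θ₀ : ℂ,
        Tendsto (fun q => (Zmap α β q, thetaMap α β q))
          (𝓝ˢ A ⊓ 𝓟 (regionZero α β)) (𝓝 (Z₀, θ₀)) ∧
        (∀ᶠ z in 𝓝[≠] Z₀, z ∈ Zmap α β '' regionZero α β) ∧
        IsLightlikeCusp (surface α β) (Z₀, θ₀) ∧
        ∀ q' ∈ A, ∃ e c : ℂ,
          IsRayDirection α β q' Z₀ e ∧
          IsGRatioAt α β q' c ∧
          ‖c‖ = 1 ∧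
          (fun z => thetaMap α β (Zinv α β z) - θ₀ - c * (z - Z₀))
            =O[𝓝[openRay Z₀ e] Z₀] (fun z => (z - Z₀) ^ 2) := by
  refine ⟨injOn_Zmap hα hβ hprod hgenus, fun A hA => ?_⟩
  obtain ⟨p, hpA⟩ : A.Nonempty := by
    obtain ⟨-, p, hp, rfl⟩ := hA
    exact ⟨p, mem_connectedComponentIn hp⟩
  obtain ⟨x, r, hx, -, hpx, -⟩ := hA.mem_gaps hα hβ hprod hgenus hpA
  have hsurf : ∀ q ∈ A, surfPt hα hβ hprod hgenus q.1 = surfPt hα hβ hprod hgenus x :=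
    fun q hq => hpx ▸ hA.surfPt_eq hα hβ hprod hgenus hq hpA
  refine ⟨(surfPt hα hβ hprod hgenus x).1, (surfPt hα hβ hprod hgenus x).2, ?_,
    eventually_mem_image_Zmap hα hβ hprod hgenus hx,
    isLightlikeCusp_surface hα hβ hprod hgenus hx, fun q' hq' => ?_⟩
  · have h := hA.tendsto hα hβ hprod hgenus hpA
    rwa [hpx] at h
  · obtain ⟨x₀, r₀, hx₀, hr, h1, h2⟩ := hA.mem_gaps hα hβ hprod hgenus hq'
    obtain ⟨c⟩ := exists_chart (aztecCusp hα hβ hprod hgenus).S (x₀ := x₀) hr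
    have hq'c : q' ∈ curve α β := by
      obtain ⟨-, p, -, rfl⟩ := hA
      exact (connectedComponentIn_subset _ _ hq').1
    obtain ⟨hN, hk, hk1⟩ := slope_eq hα hβ hprod hgenus hx₀ c h1 h2
    rw [← hsurf q' hq', h1]
    exact ⟨_, _, isRayDirection hα hβ hprod hgenus hx₀ c h1 h2,
      isGRatioAt hα hβ hprod hq'c hN, hk1, isBigO_ray hα hβ hprod hgenus hx₀ c hk⟩
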